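/- Let $\mathbb{E}$ be a monoidal bicategory (a tricategory with one object), with tensor product $\otimes$, unit object $I$, associativity equivalences $\alpha_{X,Y,Z}\colon (X\otimes Y)\otimes Z\to X\otimes(Y\otimes Z)$ and invertible pentagon 2-cells satisfying the associahedron axiom $K_5$. Assume that the monoid $G=\pi_0(\mathbb{E})$ of equivalence classes of objects under $\otimes$ is a group. Let $\mathcal{A}=\mathcal{A}\mathrm{ut}_{\mathbb{E}}(I)$ be the groupoid of self-equivalences $I\to I$ and invertible 2-cells between them, with composition of 1-cells (written $+$) as monoidal structure. For an object $X$ and $f\in\mathcal{A}$ let $\eta_X(f)\colon X\to X$ be the automorphism corresponding to $X\otimes f$ under $X\otimes I\simeq X$, and let $\varepsilon_X(f)\colon X\to X$ be the one corresponding to $f\otimes X$ under $I\otimes X\simeq X$. Assume that the canonical action of $G$ on $\mathcal{A}$ is trivial, and fix a trivialization: invertible 2-cells $\varepsilon_X(f)\cong\eta_X(f)$ that are natural and monoidal in $f$, natural with respect to equivalences $X\simeq Y$, and compatible with $\otimes$. Then: 1. $\mathcal{A}$ is a Picard groupoid (a symmetric monoidal groupoid in which every object is invertible), with the canonical symmetry: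 for every $X$, $\eta_X$ carries the symmetry $f+g\cong g+f$ to the 2-cell given by the naturality of $\eta_{(-)}(g)$ along $\eta_X(f)$. 2. Let $s\colon G\to\mathrm{Ob}\,\mathbb{E}$ be any section of the projection $\mathbb{E}\to\pi_0(\mathbb{E})$. There are equivalences $c_{x,y}\colon s(x)\otimes s(y)\to s(xy)$, objects $f_{x,y,z}$ of $\mathcal{A}$, and invertible 2-cells $$\varphi_{x,y,z}\colon\ \eta_{s(xyz)}(f_{x,y,z})\circ c_{xy,z}\circ(c_{x,y}\otimes \mathrm{id}_{s(z)})\ \cong\ c_{x,yz}\circ(\mathrm{id}_{s(x)}\otimes c_{y,z})\circ\alpha_{s(x),s(y),s(z)}\qquad(x,y,z\in G).$$ 3. For every such choice of $(c,f,\varphi)$ there is exactly one family of morphisms of $\mathcal{A}$ $$\theta_{x,y,z,t}\colon\ f_{xy,z,t}+f_{x,y,zt}\ \longrightarrow\ f_{x,y,z}+f_{x,yz,t}+f_{y,z,t}\qquad(x,y,z,t\in G)$$ filling the pentagons: for all $x,y,z,t$, the pasting of the 2-cells $\varphi_{xy,z,t}$, $\varphi_{x,y,zt}$ and naturality 2-cells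 of $\alpha$ equals the pasting of $\theta_{x,y,z,t}$, $\varphi_{x,y,z}\otimes s(t)$, $\varphi_{x,yz,t}$, $s(x)\otimes\varphi_{y,z,t}$, a naturality 2-cell of $\alpha$ and the pentagon 2-cell of $s(x),s(y),s(z),s(t)$, where $f_{x,y,z}\otimes s(t)$ and $s(x)\otimes f_{y,z,t}$ are moved to $s(xyzt)$ by the unit constraints and the trivialization. 4. For every such choice, the pair $(f,\theta)$ is a 3-cocycle of $G$ with coefficients in the Picard groupoid $\mathcal{A}$: for all $x,y,z,t,w\in G$, $$\theta_{xy,z,t,w}\cdot\theta_{x,y,zt,w}\cdot\theta_{x,y,z,t}\ =\ \theta_{x,y,z,tw}\cdot\theta_{x,yz,t,w}\cdot\theta_{y,z,t,w}$$ as morphisms $$f_{xyz,t,w}+f_{xy,z,tw}+f_{x,y,ztw}\ \longrightarrow\ f_{x,y,z}+f_{x,yz,t}+f_{y,z,t}+f_{x,yzt,w}+f_{y,zt,w}+f_{z,t,w},$$ where each $\theta$ is extended by the identity of the remaining summands and the summands are permuted by the symmetry of $\mathcal{A}$. (A 3-cochain is a map $f\colon G^3\to\mathrm{Ob}\,\mathcal{A}$;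 $\theta$ is the transpose of a morphism from $\delta f=f_{y,z,t}-f_{xy,z,t}+f_{x,yz,t}-f_{x,y,zt}+f_{x,y,z}$ to $0$.) Hence $(f,\theta)$ determines a unique class $[f,\theta]\in H^3(\pi_0(\mathbb{E}),\mathcal{A}\mathrm{ut}_{\mathbb{E}}(I))$. Here $H^3(G,\mathcal{A})$ is the set of 3-cocycles modulo coboundaries: $(f,\theta)\sim(f',\theta')$ when there are $Q\colon G^2\to\mathrm{Ob}\,\mathcal{A}$ and isomorphisms $f'\cong f+\delta Q$ compatible with $\theta$ and $\theta'$. -/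

import Mathlib

open CategoryTheory

universe w v u w₁ v₁ u₁ w₂ v₂ u₂ w₃ v₃ u₃ w₄ v₄ u₄

namespace MonBicat

section General
open Bicategory
open scoped CategoryTheory.Prod

variable {B : Type u₁} [Bicategory.{w₁, v₁} B] {C : Type u₂} [Bicategory.{w₂, v₂} C]
  {B' : Type u₃} [Bicategory.{w₃, v₃} B'] {C' : Type u₄} [Bicategory.{w₄, v₄} C']

/-- The product of two pseudofunctors. -/
def prodMap (F : B ⥤ᵖ B') (G : C ⥤ᵖ C') : (B × C) ⥤ᵖ (B' × C') where
  obj X := (F.obj X.1, G.obj X.2)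
  map f := F.map f.1 ×ₘ G.map f.2
  map₂ η := F.map₂ η.1 ×ₘ G.map₂ η.2
  mapId X := Iso.prod (F.mapId X.1) (G.mapId X.2)
  mapComp f g := Iso.prod (F.mapComp f.1 g.1) (G.mapComp f.2 g.2)

/-- The reassociation pseudofunctor. -/
def reassoc (B : Type u₁) [Bicategory.{w₁, v₁} B] : ((B × B) × B) ⥤ᵖ (B × (B × B)) where
  obj X := (X.1.1, (X.1.2, X.2))
  map f := f.1.1 ×ₘ (f.1.2 ×ₘ f.2)
  map₂ η := η.1.1 ×ₘ (η.1.2 ×ₘ η.2)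
  mapId X := Iso.refl _
  mapComp f g := Iso.refl _
/-- Pseudonatural equivalence: a pseudonatural transformation together with a choice of adjoint
equivalences having its components as underlying 1-cells. -/
structure PseudonatEquiv (F G : B ⥤ᵖ C) extends Pseudofunctor.StrongTrans F G where
  inv (a : B) : G.obj a ⟶ F.obj a
  unit (a : B) : 𝟙 (F.obj a) ≅ app a ≫ inv a
  counit (a : B) : inv a ≫ app a ≅ 𝟙 (G.obj a)
  left_triangle (a : B) :
    leftZigzagIso (unit a) (counit a) = λ_ (app a) ≪≫ (ρ_ (app a)).symm

/-- The component at `a` of a pseudonatural equivalence. -/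
def PseudonatEquiv.equiv {F G : B ⥤ᵖ C} (t : PseudonatEquiv F G) (a : B) : F.obj a ≌ G.obj a where
  hom := t.app a
  inv := t.inv a
  unit := t.unit a
  counit := t.counit a
  left_triangle := t.left_triangle a

/-- A 1-cell is an equivalence. -/
def IsEquiv {a b : B} (f : a ⟶ b) : Prop :=
  ∃ g : b ⟶ a, Nonempty (f ≫ g ≅ 𝟙 a) ∧ Nonempty (g ≫ f ≅ 𝟙 b)

/-- Cancel on the left a 1-cell `p` with a left quasi-inverse `q`. -/
def cancelLeft {a b c : B} {p : a ⟶ b} {q : b ⟶ a} (e : q ≫ p ≅ 𝟙 b) {m m' : b ⟶ c}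
    (σ : p ≫ m ≅ p ≫ m') : m ≅ m' :=
  (λ_ m).symm ≪≫ whiskerRightIso e.symm m ≪≫ α_ q p m ≪≫ whiskerLeftIso q σ ≪≫
    (α_ q p m').symm ≪≫ whiskerRightIso e m' ≪≫ λ_ m'

/-- A square filled with an invertible 2-cell, pasted next to another one. -/
def hPaste {a₀ a₁ a₂ b₀ b₁ b₂ : B} {f₀ : a₀ ⟶ b₀} {f₁ : a₁ ⟶ b₁} {f₂ : a₂ ⟶ b₂}
    {p : a₀ ⟶ a₁} {q : b₀ ⟶ b₁} {p' : a₁ ⟶ a₂} {q' : b₁ ⟶ b₂}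
    (σ : f₀ ≫ q ≅ p ≫ f₁) (τ : f₁ ≫ q' ≅ p' ≫ f₂) : f₀ ≫ (q ≫ q') ≅ (p ≫ p') ≫ f₂ :=
  (α_ f₀ q q').symm ≪≫ whiskerRightIso σ q' ≪≫ α_ p f₁ q' ≪≫ whiskerLeftIso p τ ≪≫
    (α_ p p' f₂).symm

/-- The trivial square on a 1-cell. -/
def idSq {a b : B} (f : a ⟶ b) : f ≫ 𝟙 b ≅ 𝟙 a ≫ f := ρ_ f ≪≫ (λ_ f).symm

/-- A pseudofunctor applied to a composite of three 1-cells. -/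
def mapComp₃ (F : B ⥤ᵖ C) {a b c d : B} (f : a ⟶ b) (g : b ⟶ c) (h : c ⟶ d) :
    F.map (f ≫ g ≫ h) ≅ F.map f ≫ F.map g ≫ F.map h :=
  F.mapComp f (g ≫ h) ≪≫ whiskerLeftIso (F.map f) (F.mapComp g h)

end General

section MonoidalBicategory
open Bicategory
open scoped CategoryTheory.Prod

/-- A bicategory with a tensor product and a unit object. -/
class TensorBicategory (E : Type u) [Bicategory.{w, v} E] where
  tensor : (E × E) ⥤ᵖ E
  unit : E

variable {E : Type u} [Bicategory.{w, v} E]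

section Tensor
variable [TensorBicategory E]

variable (E) in
/-- The unit object. -/
abbrev I : E := TensorBicategory.unit

/-- Tensor product of objects. -/
abbrev tObj (X Y : E) : E := TensorBicategory.tensor.obj (X, Y)

infixr:70 " ⊠ " => tObj

/-- Tensor product of 1-cells. -/
abbrev tHom {X X' Y Y' : E} (f : X ⟶ X') (g : Y ⟶ Y') : X ⊠ Y ⟶ X' ⊠ Y' :=
  TensorBicategory.tensor.map (f ×ₘ g)

infixr:70 " ⊠₁ " => tHom

/-- Tensor product of invertible 2-cells. -/
abbrev tIso {X X' Y Y' : E} {f f' : X ⟶ X'} {g g' : Y ⟶ Y'} (η : f ≅ f') (θ : g ≅ g') :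
    f ⊠₁ g ≅ f' ⊠₁ g' :=
  TensorBicategory.tensor.map₂Iso (Iso.prod η θ)

abbrev tComp {X X' X'' Y Y' Y'' : E} (f : X ⟶ X') (f' : X' ⟶ X'') (g : Y ⟶ Y') (g' : Y' ⟶ Y'') :
    (f ≫ f') ⊠₁ (g ≫ g') ≅ (f ⊠₁ g) ≫ (f' ⊠₁ g') :=
  TensorBicategory.tensor.mapComp (f ×ₘ g) (f' ×ₘ g')

abbrev tId (X Y : E) : 𝟙 X ⊠₁ 𝟙 Y ≅ 𝟙 (X ⊠ Y) :=
  TensorBicategory.tensor.mapId (X, Y)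

/-- The pseudofunctor `X ⊠ -`. -/
abbrev tensorLeft (X : E) : E ⥤ᵖ E :=
  (Bicategory.Prod.sectR X E).toPseudofunctor.comp TensorBicategory.tensor

/-- The pseudofunctor `- ⊠ Y`. -/
abbrev tensorRight (Y : E) : E ⥤ᵖ E :=
  (Bicategory.Prod.sectL E Y).toPseudofunctor.comp TensorBicategory.tensor

variable (E) in
/-- The pseudofunctor `((X, Y), Z) ↦ (X ⊠ Y) ⊠ Z`. -/
abbrev tensor₃Left : ((E × E) × E) ⥤ᵖ E :=
  (prodMap TensorBicategory.tensor (Pseudofunctor.id E)).comp TensorBicategory.tensor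
variable (E) in
/-- The pseudofunctor `((X, Y), Z) ↦ X ⊠ (Y ⊠ Z)`. -/
abbrev tensor₃Right : ((E × E) × E) ⥤ᵖ E :=
  (reassoc E).comp ((prodMap (Pseudofunctor.id E) TensorBicategory.tensor).comp
    TensorBicategory.tensor)

end Tensor

/-- A tensor product with pseudonatural adjoint equivalences `(XY)Z ≌ X(YZ)`, `IX ≌ X` and
`XI ≌ X`. -/
class PreMonoidalBicategory (E : Type u) [Bicategory.{w, v} E] extends TensorBicategory E where
  assoc : PseudonatEquiv (tensor₃Left E) (tensor₃Right E)
  leftUnit : PseudonatEquiv (tensorLeft (I E)) (Pseudofunctor.id E)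
  rightUnit : PseudonatEquiv (tensorRight (I E)) (Pseudofunctor.id E)

section Pre
variable [PreMonoidalBicategory E]
open PreMonoidalBicategory

abbrev as (X Y Z : E) : (X ⊠ Y) ⊠ Z ≌ X ⊠ (Y ⊠ Z) := assoc.equiv ((X, Y), Z)
abbrev lu (X : E) : I E ⊠ X ≌ X := leftUnit.equiv X
abbrev ru (X : E) : X ⊠ I E ≌ X := rightUnit.equiv X

abbrev asNat {X X' Y Y' Z Z' : E} (f : X ⟶ X') (g : Y ⟶ Y') (h : Z ⟶ Z') :
    ((f ⊠₁ g) ⊠₁ h) ≫ (as X' Y' Z').hom ≅ (as X Y Z).hom ≫ (f ⊠₁ (g ⊠₁ h)) :=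
  assoc.naturality ((f ×ₘ g) ×ₘ h)
abbrev luNat {X X' : E} (f : X ⟶ X') : (𝟙 (I E) ⊠₁ f) ≫ (lu X').hom ≅ (lu X).hom ≫ f :=
  leftUnit.naturality f
abbrev ruNat {X X' : E} (f : X ⟶ X') : (f ⊠₁ 𝟙 (I E)) ≫ (ru X').hom ≅ (ru X).hom ≫ f :=
  rightUnit.naturality f

/-- The left whiskering of a 1-cell by an object. -/
abbrev wl (X : E) {Y Y' : E} (f : Y ⟶ Y') : X ⊠ Y ⟶ X ⊠ Y' := 𝟙 X ⊠₁ f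
/-- The right whiskering of a 1-cell by an object. -/
abbrev wr {X X' : E} (f : X ⟶ X') (Y : E) : X ⊠ Y ⟶ X' ⊠ Y := f ⊠₁ 𝟙 Y

infixr:83 " ◁ₜ " => wl
infixl:83 " ▷ₜ " => wr

abbrev wlIso (X : E) {Y Y' : E} {f f' : Y ⟶ Y'} (σ : f ≅ f') : X ◁ₜ f ≅ X ◁ₜ f' :=
  tIso (Iso.refl (𝟙 X)) σ
abbrev wrIso {X X' : E} {f f' : X ⟶ X'} (σ : f ≅ f') (Y : E) : f ▷ₜ Y ≅ f' ▷ₜ Y :=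
  tIso σ (Iso.refl (𝟙 Y))
abbrev wlComp (X : E) {Y Y' Y'' : E} (f : Y ⟶ Y') (g : Y' ⟶ Y'') :
    X ◁ₜ (f ≫ g) ≅ X ◁ₜ f ≫ X ◁ₜ g := (tensorLeft X).mapComp f g
abbrev wrComp {X X' X'' : E} (f : X ⟶ X') (g : X' ⟶ X'') (Y : E) :
    (f ≫ g) ▷ₜ Y ≅ f ▷ₜ Y ≫ g ▷ₜ Y := (tensorRight Y).mapComp f g
abbrev wlComp₃ (X : E) {Y₀ Y₁ Y₂ Y₃ : E} (f : Y₀ ⟶ Y₁) (g : Y₁ ⟶ Y₂) (h : Y₂ ⟶ Y₃) :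
    X ◁ₜ (f ≫ g ≫ h) ≅ X ◁ₜ f ≫ X ◁ₜ g ≫ X ◁ₜ h := mapComp₃ (tensorLeft X) f g h
abbrev wrComp₃ {X₀ X₁ X₂ X₃ : E} (f : X₀ ⟶ X₁) (g : X₁ ⟶ X₂) (h : X₂ ⟶ X₃) (Y : E) :
    (f ≫ g ≫ h) ▷ₜ Y ≅ f ▷ₜ Y ≫ g ▷ₜ Y ≫ h ▷ₜ Y := mapComp₃ (tensorRight Y) f g h

/-- The interchange 2-cell of the tensor product. -/
def interchange {X X' Y Y' : E} (f : X ⟶ X') (g : Y ⟶ Y') :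
    f ▷ₜ Y ≫ X' ◁ₜ g ≅ X ◁ₜ g ≫ f ▷ₜ Y' :=
  (tComp f (𝟙 X') (𝟙 Y) g).symm ≪≫ tIso (ρ_ f ≪≫ (λ_ f).symm) (λ_ g ≪≫ (ρ_ g).symm) ≪≫
    tComp (𝟙 X) f g (𝟙 Y')

/-- The tensor product of two squares filled with invertible 2-cells. -/
def tSq {X₀ X₁ X₀' X₁' Y₀ Y₁ Y₀' Y₁' : E}
    {f : X₀ ⟶ X₀'} {f' : X₁ ⟶ X₁'} {p : X₀ ⟶ X₁} {q : X₀' ⟶ X₁'}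
    {g : Y₀ ⟶ Y₀'} {g' : Y₁ ⟶ Y₁'} {r : Y₀ ⟶ Y₁} {s : Y₀' ⟶ Y₁'}
    (σ : f ≫ q ≅ p ≫ f') (τ : g ≫ s ≅ r ≫ g') :
    (f ⊠₁ g) ≫ (q ⊠₁ s) ≅ (p ⊠₁ r) ≫ (f' ⊠₁ g') :=
  (tComp f q g s).symm ≪≫ tIso σ τ ≪≫ tComp p f' r g'

/-- The associator 1-cell. -/
abbrev a (X Y Z : E) : (X ⊠ Y) ⊠ Z ⟶ X ⊠ (Y ⊠ Z) := (as X Y Z).hom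
/-- The left unitor 1-cell. -/
abbrev l (X : E) : I E ⊠ X ⟶ X := (lu X).hom
/-- The right unitor 1-cell. -/
abbrev r (X : E) : X ⊠ I E ⟶ X := (ru X).hom

/-- Naturality of the associator in the first variable. -/
def as₁ {X X' : E} (f : X ⟶ X') (Y Z : E) :
    (f ▷ₜ Y) ▷ₜ Z ≫ a X' Y Z ≅ a X Y Z ≫ f ▷ₜ (Y ⊠ Z) :=
  asNat f (𝟙 Y) (𝟙 Z) ≪≫ a X Y Z ◁ᵢ tIso (Iso.refl f) (tId Y Z)
/-- Naturality of the associator in the second variable. -/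
def as₂ (X : E) {Y Y' : E} (g : Y ⟶ Y') (Z : E) :
    (X ◁ₜ g) ▷ₜ Z ≫ a X Y' Z ≅ a X Y Z ≫ X ◁ₜ (g ▷ₜ Z) :=
  asNat (𝟙 X) g (𝟙 Z)
/-- Naturality of the associator in the third variable. -/
def as₃ (X Y : E) {Z Z' : E} (h : Z ⟶ Z') :
    (X ⊠ Y) ◁ₜ h ≫ a X Y Z' ≅ a X Y Z ≫ X ◁ₜ (Y ◁ₜ h) :=
  tIso (tId X Y).symm (Iso.refl h) ▷ᵢ a X Y Z' ≪≫ asNat (𝟙 X) (𝟙 Y) h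

end Pre

/-- A monoidal bicategory, that is, a tricategory with one object: besides the tensor product,
the unit object and the pseudonatural adjoint equivalences `a`, `l`, `r`, there are invertible
modifications `pent`, `mid`, `lam`, `rho`, subject to the associahedron axiom `K₅` and the two
unit (normalization) axioms. -/
class MonoidalBicategory (E : Type u) [Bicategory.{w, v} E] extends PreMonoidalBicategory E where
  /-- The pentagonator. -/
  pent (X Y Z W : E) :
    a X Y Z ▷ₜ W ≫ a X (Y ⊠ Z) W ≫ X ◁ₜ a Y Z W ≅ a (X ⊠ Y) Z W ≫ a X Y (Z ⊠ W)
  /-- The middle 2-unitor. -/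
  mid (X Y : E) : a X (I E) Y ≫ X ◁ₜ l Y ≅ r X ▷ₜ Y
  /-- The left 2-unitor. -/
  lam (X Y : E) : a (I E) X Y ≫ l (X ⊠ Y) ≅ l X ▷ₜ Y
  /-- The right 2-unitor. -/
  rho (X Y : E) : a X Y (I E) ≫ X ◁ₜ r Y ≅ r (X ⊠ Y)
  /-- `pent` is a modification. -/
  pent_natural {X X' Y Y' Z Z' W W' : E}
    (f : X ⟶ X') (g : Y ⟶ Y') (h : Z ⟶ Z') (k : W ⟶ W') :
    (((f ⊠₁ g) ⊠₁ h) ⊠₁ k) ◁ᵢ pent X' Y' Z' W' ≪≫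
        hPaste (asNat (f ⊠₁ g) h k) (asNat f g (h ⊠₁ k)) =
      hPaste (tSq (asNat f g h) (idSq k))
          (hPaste (asNat f (g ⊠₁ h) k) (tSq (idSq f) (asNat g h k))) ≪≫
        pent X Y Z W ▷ᵢ (f ⊠₁ (g ⊠₁ (h ⊠₁ k)))
  /-- `mid` is a modification. -/
  mid_natural {X X' Y Y' : E} (f : X ⟶ X') (g : Y ⟶ Y') :
    ((f ⊠₁ 𝟙 (I E)) ⊠₁ g) ◁ᵢ mid X' Y' ≪≫ tSq (ruNat f) (idSq g) =
      hPaste (asNat f (𝟙 (I E)) g) (tSq (idSq f) (luNat g)) ≪≫ mid X Y ▷ᵢ (f ⊠₁ g)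
  /-- `lam` is a modification. -/
  lam_natural {X X' Y Y' : E} (f : X ⟶ X') (g : Y ⟶ Y') :
    ((𝟙 (I E) ⊠₁ f) ⊠₁ g) ◁ᵢ lam X' Y' ≪≫ tSq (luNat f) (idSq g) =
      hPaste (asNat (𝟙 (I E)) f g) (luNat (f ⊠₁ g)) ≪≫ lam X Y ▷ᵢ (f ⊠₁ g)
  /-- `rho` is a modification. -/
  rho_natural {X X' Y Y' : E} (f : X ⟶ X') (g : Y ⟶ Y') :
    ((f ⊠₁ g) ⊠₁ 𝟙 (I E)) ◁ᵢ rho X' Y' ≪≫ ruNat (f ⊠₁ g) =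
      hPaste (asNat f g (𝟙 (I E))) (tSq (idSq f) (ruNat g)) ≪≫ rho X Y ▷ᵢ (f ⊠₁ g)
  /-- The associahedron `K₅`: the two ways to sweep across its 2-dimensional faces, six pentagons
  and three naturality squares, from the longest to the shortest path from
  `(((XY)Z)T)W` to `X(Y(Z(TW)))`, agree. -/
  associahedron (X Y Z T W : E) :
    Iso.refl ((a X Y Z ▷ₜ T) ▷ₜ W ≫ a X (Y ⊠ Z) T ▷ₜ W ≫ (X ◁ₜ a Y Z T) ▷ₜ W ≫
        a X (Y ⊠ (Z ⊠ T)) W ≫ X ◁ₜ a Y (Z ⊠ T) W ≫ X ◁ₜ (Y ◁ₜ a Z T W)) ≪⊗≫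
      ((wrComp₃ (a X Y Z ▷ₜ T) (a X (Y ⊠ Z) T) (X ◁ₜ a Y Z T) W).symm ≪≫
          wrIso (pent X Y Z T) W ≪≫ wrComp (a (X ⊠ Y) Z T) (a X Y (Z ⊠ T)) W) ▷ᵢ
        (a X (Y ⊠ (Z ⊠ T)) W ≫ X ◁ₜ a Y (Z ⊠ T) W ≫ X ◁ₜ (Y ◁ₜ a Z T W)) ≪⊗≫
      a (X ⊠ Y) Z T ▷ₜ W ◁ᵢ (pent X Y (Z ⊠ T) W ▷ᵢ (X ◁ₜ (Y ◁ₜ a Z T W))) ≪⊗≫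
      (a (X ⊠ Y) Z T ▷ₜ W ≫ a (X ⊠ Y) (Z ⊠ T) W) ◁ᵢ (as₃ X Y (a Z T W)).symm ≪⊗≫
      pent (X ⊠ Y) Z T W ▷ᵢ a X Y (Z ⊠ (T ⊠ W)) ≪⊗≫
      Iso.refl (a ((X ⊠ Y) ⊠ Z) T W ≫ a (X ⊠ Y) Z (T ⊠ W) ≫ a X Y (Z ⊠ (T ⊠ W))) =
    Iso.refl ((a X Y Z ▷ₜ T) ▷ₜ W ≫ a X (Y ⊠ Z) T ▷ₜ W ≫ (X ◁ₜ a Y Z T) ▷ₜ W ≫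
        a X (Y ⊠ (Z ⊠ T)) W ≫ X ◁ₜ a Y (Z ⊠ T) W ≫ X ◁ₜ (Y ◁ₜ a Z T W)) ≪⊗≫
      ((a X Y Z ▷ₜ T) ▷ₜ W ≫ a X (Y ⊠ Z) T ▷ₜ W) ◁ᵢ
        (as₂ X (a Y Z T) W ▷ᵢ (X ◁ₜ a Y (Z ⊠ T) W ≫ X ◁ₜ (Y ◁ₜ a Z T W))) ≪⊗≫
      ((a X Y Z ▷ₜ T) ▷ₜ W ≫ a X (Y ⊠ Z) T ▷ₜ W ≫ a X ((Y ⊠ Z) ⊠ T) W) ◁ᵢ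
        ((wlComp₃ X (a Y Z T ▷ₜ W) (a Y (Z ⊠ T) W) (Y ◁ₜ a Z T W)).symm ≪≫
          wlIso X (pent Y Z T W) ≪≫ wlComp X (a (Y ⊠ Z) T W) (a Y Z (T ⊠ W))) ≪⊗≫
      (a X Y Z ▷ₜ T) ▷ₜ W ◁ᵢ (pent X (Y ⊠ Z) T W ▷ᵢ (X ◁ₜ a Y Z (T ⊠ W))) ≪⊗≫
      as₁ (a X Y Z) T W ▷ᵢ (a X (Y ⊠ Z) (T ⊠ W) ≫ X ◁ₜ a Y Z (T ⊠ W)) ≪⊗≫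
      a ((X ⊠ Y) ⊠ Z) T W ◁ᵢ pent X Y Z (T ⊠ W) ≪⊗≫
      Iso.refl (a ((X ⊠ Y) ⊠ Z) T W ≫ a (X ⊠ Y) Z (T ⊠ W) ≫ a X Y (Z ⊠ (T ⊠ W)))
  /-- The left normalization axiom. -/
  left_normalization (X Y Z : E) :
    Iso.refl (a X (I E) Y ▷ₜ Z ≫ a X (I E ⊠ Y) Z ≫ X ◁ₜ a (I E) Y Z ≫ X ◁ₜ l (Y ⊠ Z)) ≪⊗≫
      pent X (I E) Y Z ▷ᵢ (X ◁ₜ l (Y ⊠ Z)) ≪⊗≫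
      a (X ⊠ I E) Y Z ◁ᵢ mid X (Y ⊠ Z) ≪⊗≫
      Iso.refl (a (X ⊠ I E) Y Z ≫ r X ▷ₜ (Y ⊠ Z)) =
    Iso.refl (a X (I E) Y ▷ₜ Z ≫ a X (I E ⊠ Y) Z ≫ X ◁ₜ a (I E) Y Z ≫ X ◁ₜ l (Y ⊠ Z)) ≪⊗≫
      (a X (I E) Y ▷ₜ Z ≫ a X (I E ⊠ Y) Z) ◁ᵢ
        ((wlComp X (a (I E) Y Z) (l (Y ⊠ Z))).symm ≪≫ wlIso X (lam Y Z)) ≪⊗≫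
      a X (I E) Y ▷ₜ Z ◁ᵢ (as₂ X (l Y) Z).symm ≪⊗≫
      ((wrComp (a X (I E) Y) (X ◁ₜ l Y) Z).symm ≪≫ wrIso (mid X Y) Z) ▷ᵢ a X Y Z ≪⊗≫
      as₁ (r X) Y Z ≪⊗≫
      Iso.refl (a (X ⊠ I E) Y Z ≫ r X ▷ₜ (Y ⊠ Z))
  /-- The right normalization axiom. -/
  right_normalization (X Y Z : E) :
    Iso.refl (a X Y (I E) ▷ₜ Z ≫ a X (Y ⊠ I E) Z ≫ X ◁ₜ a Y (I E) Z ≫ X ◁ₜ (Y ◁ₜ l Z)) ≪⊗≫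
      pent X Y (I E) Z ▷ᵢ (X ◁ₜ (Y ◁ₜ l Z)) ≪⊗≫
      a (X ⊠ Y) (I E) Z ◁ᵢ (as₃ X Y (l Z)).symm ≪⊗≫
      mid (X ⊠ Y) Z ▷ᵢ a X Y Z ≪⊗≫
      Iso.refl (r (X ⊠ Y) ▷ₜ Z ≫ a X Y Z) =
    Iso.refl (a X Y (I E) ▷ₜ Z ≫ a X (Y ⊠ I E) Z ≫ X ◁ₜ a Y (I E) Z ≫ X ◁ₜ (Y ◁ₜ l Z)) ≪⊗≫
      (a X Y (I E) ▷ₜ Z ≫ a X (Y ⊠ I E) Z) ◁ᵢ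
        ((wlComp X (a Y (I E) Z) (Y ◁ₜ l Z)).symm ≪≫ wlIso X (mid Y Z)) ≪⊗≫
      a X Y (I E) ▷ₜ Z ◁ᵢ (as₂ X (r Y) Z).symm ≪⊗≫
      ((wrComp (a X Y (I E)) (X ◁ₜ r Y) Z).symm ≪≫ wrIso (rho X Y) Z) ▷ᵢ a X Y Z ≪⊗≫
      Iso.refl (r (X ⊠ Y) ▷ₜ Z ≫ a X Y Z)

end MonoidalBicategory

section FundamentalGroupoid
open Bicategory
variable {E : Type u} [Bicategory.{w, v} E]

lemma IsEquiv.id (X : E) : IsEquiv (𝟙 X) := ⟨𝟙 X, ⟨λ_ _⟩, ⟨λ_ _⟩⟩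

lemma IsEquiv.comp {X Y Z : E} {f : X ⟶ Y} {g : Y ⟶ Z} (hf : IsEquiv f) (hg : IsEquiv g) :
    IsEquiv (f ≫ g) := by
  obtain ⟨f', ⟨u⟩, ⟨c⟩⟩ := hf
  obtain ⟨g', ⟨u'⟩, ⟨c'⟩⟩ := hg
  exact ⟨g' ≫ f',
    ⟨α_ f g (g' ≫ f') ≪≫ f ◁ᵢ ((α_ g g' f').symm ≪≫ u' ▷ᵢ f' ≪≫ λ_ f') ≪≫ u⟩,
    ⟨α_ g' f' (f ≫ g) ≪≫ g' ◁ᵢ ((α_ f' f g).symm ≪≫ c ▷ᵢ g ≪≫ λ_ g) ≪≫ c'⟩⟩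

variable (E) in
/-- Objects of the groupoid `Aut_E(I)`: self-equivalences of the unit object. -/
structure AutI [TensorBicategory E] where
  hom : I E ⟶ I E
  isEquiv : IsEquiv hom

namespace AutI
variable [TensorBicategory E]

/-- Morphisms of `Aut_E(I)` are the invertible 2-cells. -/
instance : Category (AutI E) where
  Hom f g := f.hom ≅ g.hom
  id f := Iso.refl f.hom
  comp σ τ := σ ≪≫ τ

/-- The monoidal structure of `Aut_E(I)` is the composition of 1-cells. -/
instance : MonoidalCategory (AutI E) where
  tensorObj f g := ⟨f.hom ≫ g.hom, f.isEquiv.comp g.isEquiv⟩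
  tensorUnit := ⟨𝟙 (I E), IsEquiv.id _⟩
  whiskerLeft f _ _ σ := f.hom ◁ᵢ σ
  whiskerRight σ g := σ ▷ᵢ g.hom
  tensorHom {f _ _ g'} σ τ := σ ▷ᵢ _ ≪≫ _ ◁ᵢ τ
  associator f g h :=
    { hom := α_ f.hom g.hom h.hom
      inv := (α_ f.hom g.hom h.hom).symm
      hom_inv_id := Iso.self_symm_id _
      inv_hom_id := Iso.symm_self_id _ }
  leftUnitor f :=
    { hom := λ_ f.hom
      inv := (λ_ f.hom).symm
      hom_inv_id := Iso.self_symm_id _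
      inv_hom_id := Iso.symm_self_id _ }
  rightUnitor f :=
    { hom := ρ_ f.hom
      inv := (ρ_ f.hom).symm
      hom_inv_id := Iso.self_symm_id _
      inv_hom_id := Iso.symm_self_id _ }
  tensorHom_def _ _ := rfl
  id_tensorHom_id _ _ := by apply Iso.ext; simp [CategoryStruct.id]
  tensorHom_comp_tensorHom _ _ _ _ := by
    apply Iso.ext; simp [CategoryStruct.comp, whisker_exchange_assoc]
  whiskerLeft_id _ _ := by apply Iso.ext; simp [CategoryStruct.id]
  id_whiskerRight _ _ := by apply Iso.ext; simp [CategoryStruct.id]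
  associator_naturality _ _ _ := by apply Iso.ext; simp [CategoryStruct.comp]
  leftUnitor_naturality _ := by apply Iso.ext; simp [CategoryStruct.comp]
  rightUnitor_naturality _ := by apply Iso.ext; simp [CategoryStruct.comp]
  pentagon _ _ _ _ := by apply Iso.ext; simp [CategoryStruct.comp]
  triangle _ _ := by apply Iso.ext; simp [CategoryStruct.comp]

end AutI

end FundamentalGroupoid

section PiZero
open Bicategory
open scoped CategoryTheory.Prod

lemma equivalence_symm {B : Type u} [Bicategory.{w, v} B] {X Y : B}
    (h : Nonempty (X ≌ Y)) : Nonempty (Y ≌ X) :=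
  h.map fun e => Equivalence.mkOfAdjointifyCounit e.counit.symm e.unit.symm

lemma equivalence_of_isEquiv {B : Type u} [Bicategory.{w, v} B] {X Y : B} {f : X ⟶ Y}
    (hf : IsEquiv f) : Nonempty (X ≌ Y) := by
  obtain ⟨g, ⟨s⟩, ⟨t⟩⟩ := hf
  exact ⟨Equivalence.mkOfAdjointifyCounit s.symm t⟩

lemma isEquiv_hom {B : Type u} [Bicategory.{w, v} B] {X Y : B} (e : X ≌ Y) : IsEquiv e.hom :=
  ⟨e.inv, ⟨e.unit.symm⟩, ⟨e.counit⟩⟩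

/-- Equivalence of objects of a bicategory. -/
def equivalenceSetoid (B : Type u) [Bicategory.{w, v} B] : Setoid B where
  r X Y := Nonempty (X ≌ Y)
  iseqv :=
    { refl := fun X => ⟨Equivalence.id X⟩
      symm := equivalence_symm
      trans := fun ⟨e⟩ ⟨e'⟩ => equivalence_of_isEquiv ((isEquiv_hom e).comp (isEquiv_hom e')) }

/-- `π₀` of a bicategory: the set of equivalence classes of objects. -/
def PiZero (B : Type u) [Bicategory.{w, v} B] : Type u := Quotient (equivalenceSetoid B)

/-- The projection onto `π₀`. -/
def PiZero.mk {B : Type u} [Bicategory.{w, v} B] (X : B) : PiZero B :=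
  Quotient.mk (equivalenceSetoid B) X

variable {E : Type u} [Bicategory.{w, v} E]

lemma tensor_equivalence [TensorBicategory E] {X X' Y Y' : E} (e : X ≌ X') (e' : Y ≌ Y') :
    Nonempty (X ⊠ Y ≌ X' ⊠ Y') :=
  equivalence_of_isEquiv (f := e.hom ⊠₁ e'.hom) ⟨e.inv ⊠₁ e'.inv,
    ⟨(tComp e.hom e.inv e'.hom e'.inv).symm ≪≫ tIso e.unit.symm e'.unit.symm ≪≫ tId X Y⟩,
    ⟨(tComp e.inv e.hom e'.inv e'.hom).symm ≪≫ tIso e.counit e'.counit ≪≫ tId X' Y'⟩⟩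

/-- The multiplication of `π₀` induced by the tensor product. -/
instance [PreMonoidalBicategory E] : Monoid (PiZero E) where
  mul := Quotient.map₂ (fun X Y : E => X ⊠ Y)
    fun _ _ ⟨e⟩ _ _ ⟨e'⟩ => tensor_equivalence e e'
  one := PiZero.mk (I E)
  mul_assoc := by
    rintro ⟨X⟩ ⟨Y⟩ ⟨Z⟩
    exact Quotient.sound ⟨as X Y Z⟩
  one_mul := by
    rintro ⟨X⟩
    exact Quotient.sound ⟨lu X⟩
  mul_one := by
    rintro ⟨X⟩
    exact Quotient.sound ⟨ru X⟩

/-- A monoidal bicategory is group-like if every object has an inverse, up to equivalence,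
for the tensor product; in other words, if `π₀` is a group. -/
class IsGroupLike (E : Type u) [Bicategory.{w, v} E] [TensorBicategory E] : Prop where
  exists_inverse (X : E) : ∃ Y : E, Nonempty (Y ⊠ X ≌ I E) ∧ Nonempty (X ⊠ Y ≌ I E)

lemma PiZero.exists_left_inverse [PreMonoidalBicategory E] [IsGroupLike E] (x : PiZero E) :
    ∃ y : PiZero E, y * x = 1 := by
  induction x using Quotient.inductionOn with
  | h X =>
    obtain ⟨Y, h, -⟩ := IsGroupLike.exists_inverse X
    exact ⟨PiZero.mk Y, Quotient.sound h⟩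

noncomputable instance [PreMonoidalBicategory E] [IsGroupLike E] : Group (PiZero E) where
  inv x := (PiZero.exists_left_inverse x).choose
  inv_mul_cancel x := (PiZero.exists_left_inverse x).choose_spec

end PiZero

section RightAction
open Bicategory
variable {E : Type u} [Bicategory.{w, v} E]

section
variable [PreMonoidalBicategory E]

/-- The functor `η_X : End(I) ⟶ End(X)` given by the right unitor. -/
def eta (X : E) (f : I E ⟶ I E) : X ⟶ X := (ru X).inv ≫ X ◁ₜ f ≫ r X

/-- The 2-cell `ζ_f` filling the square that defines `η_X(f)`. -/
def zeta (X : E) (f : I E ⟶ I E) : r X ≫ eta X f ≅ X ◁ₜ f ≫ r X :=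
  (α_ _ _ _).symm ≪≫ (ru X).unit.symm ▷ᵢ (X ◁ₜ f ≫ r X) ≪≫ λ_ _

/-- The functor `η_X` on invertible 2-cells. -/
def etaIso (X : E) {f g : I E ⟶ I E} (σ : f ≅ g) : eta X f ≅ eta X g :=
  (ru X).inv ◁ᵢ (wlIso X σ ▷ᵢ r X)

/-- `η_X` is monoidal. -/
def etaComp (X : E) (f g : I E ⟶ I E) : eta X (f ≫ g) ≅ eta X f ≫ eta X g :=
  cancelLeft (ru X).counit
    (zeta X (f ≫ g) ≪≫ wlComp X f g ▷ᵢ r X ≪⊗≫ X ◁ₜ f ◁ᵢ (zeta X g).symm ≪⊗≫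
      (zeta X f).symm ▷ᵢ eta X g ≪⊗≫ Iso.refl (r X ≫ eta X f ≫ eta X g))

/-- `η_X(f)` is natural in `X`. -/
def etaNat {X Y : E} (h : X ⟶ Y) (f : I E ⟶ I E) : h ≫ eta Y f ≅ eta X f ≫ h :=
  cancelLeft (ru X).counit
    (Iso.refl (r X ≫ h ≫ eta Y f) ≪⊗≫ (ruNat h).symm ▷ᵢ eta Y f ≪⊗≫
      h ▷ₜ I E ◁ᵢ zeta Y f ≪⊗≫ interchange h f ▷ᵢ r Y ≪⊗≫ X ◁ₜ f ◁ᵢ ruNat h ≪⊗≫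
      (zeta X f).symm ▷ᵢ h ≪⊗≫ Iso.refl (r X ≫ eta X f ≫ h))

/-- The functor `End(I) ⟶ End(X)` given by the left unitor. -/
def eps (X : E) (f : I E ⟶ I E) : X ⟶ X := (lu X).inv ≫ f ▷ₜ X ≫ l X

/-- The 2-cell filling the square that defines `eps X f`. -/
def xi (X : E) (f : I E ⟶ I E) : l X ≫ eps X f ≅ f ▷ₜ X ≫ l X :=
  (α_ _ _ _).symm ≪≫ (lu X).unit.symm ▷ᵢ (f ▷ₜ X ≫ l X) ≪≫ λ_ _

/-- The functor `eps X` on invertible 2-cells. -/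
def epsIso (X : E) {f g : I E ⟶ I E} (σ : f ≅ g) : eps X f ≅ eps X g :=
  (lu X).inv ◁ᵢ (wrIso σ X ▷ᵢ l X)

/-- `eps X` is monoidal. -/
def epsComp (X : E) (f g : I E ⟶ I E) : eps X (f ≫ g) ≅ eps X f ≫ eps X g :=
  cancelLeft (lu X).counit
    (xi X (f ≫ g) ≪≫ wrComp f g X ▷ᵢ l X ≪⊗≫ f ▷ₜ X ◁ᵢ (xi X g).symm ≪⊗≫
      (xi X f).symm ▷ᵢ eps X g ≪⊗≫ Iso.refl (l X ≫ eps X f ≫ eps X g))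

/-- `eps X f` is natural in `X`. -/
def epsNat {X Y : E} (h : X ⟶ Y) (f : I E ⟶ I E) : h ≫ eps Y f ≅ eps X f ≫ h :=
  cancelLeft (lu X).counit
    (Iso.refl (l X ≫ h ≫ eps Y f) ≪⊗≫ (luNat h).symm ▷ᵢ eps Y f ≪⊗≫
      I E ◁ₜ h ◁ᵢ xi Y f ≪⊗≫ (interchange f h).symm ▷ᵢ l Y ≪⊗≫ f ▷ₜ X ◁ᵢ luNat h ≪⊗≫
      (xi X f).symm ▷ᵢ h ≪⊗≫ Iso.refl (l X ≫ eps X f ≫ h))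

end

variable [MonoidalBicategory E]
open MonoidalBicategory

/-- `X η_Y = η_{XY}`. -/
def etaTensor (X Y : E) (f : I E ⟶ I E) : X ◁ₜ eta Y f ≅ eta (X ⊠ Y) f :=
  cancelLeft (ru (X ⊠ Y)).counit
    ((rho X Y).symm ▷ᵢ (X ◁ₜ eta Y f) ≪⊗≫
      a X Y (I E) ◁ᵢ ((wlComp X (r Y) (eta Y f)).symm ≪≫ wlIso X (zeta Y f) ≪≫
        wlComp X (Y ◁ₜ f) (r Y)) ≪⊗≫
      (as₃ X Y f).symm ▷ᵢ (X ◁ₜ r Y) ≪⊗≫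
      (X ⊠ Y) ◁ₜ f ◁ᵢ rho X Y ≪⊗≫
      (zeta (X ⊠ Y) f).symm)

/-- `eps X (f) Y = eps (XY) (f)`. -/
def epsTensor (X Y : E) (f : I E ⟶ I E) : eps X f ▷ₜ Y ≅ eps (X ⊠ Y) f :=
  cancelLeft (lu (X ⊠ Y)).counit <| cancelLeft (as (I E) X Y).counit
    (Iso.refl (a (I E) X Y ≫ l (X ⊠ Y) ≫ eps X f ▷ₜ Y) ≪⊗≫
      lam X Y ▷ᵢ (eps X f ▷ₜ Y) ≪⊗≫
      ((wrComp (l X) (eps X f) Y).symm ≪≫ wrIso (xi X f) Y ≪≫ wrComp (f ▷ₜ X) (l X) Y) ≪⊗≫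
      (f ▷ₜ X) ▷ₜ Y ◁ᵢ (lam X Y).symm ≪⊗≫
      as₁ f X Y ▷ᵢ l (X ⊠ Y) ≪⊗≫
      a (I E) X Y ◁ᵢ (xi (X ⊠ Y) f).symm)

/-- The middle comparison: `η_X(f) Y = X (eps Y f)`. -/
def etaEps (X Y : E) (f : I E ⟶ I E) : eta X f ▷ₜ Y ≅ X ◁ₜ eps Y f :=
  cancelLeft ((wlComp X (lu Y).inv (l Y)).symm ≪≫ wlIso X (lu Y).counit ≪≫ tId X Y) <|
    cancelLeft (as X (I E) Y).counit
    (Iso.refl (a X (I E) Y ≫ X ◁ₜ l Y ≫ eta X f ▷ₜ Y) ≪⊗≫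
      mid X Y ▷ᵢ (eta X f ▷ₜ Y) ≪⊗≫
      ((wrComp (r X) (eta X f) Y).symm ≪≫ wrIso (zeta X f) Y ≪≫ wrComp (X ◁ₜ f) (r X) Y) ≪⊗≫
      (X ◁ₜ f) ▷ₜ Y ◁ᵢ (mid X Y).symm ≪⊗≫
      as₂ X f Y ▷ᵢ (X ◁ₜ l Y) ≪⊗≫
      a X (I E) Y ◁ᵢ ((wlComp X (f ▷ₜ Y) (l Y)).symm ≪≫ wlIso X (xi Y f).symm ≪≫
        wlComp X (l Y) (eps Y f)))

variable (E) in
/-- A trivialization of the canonical action of `π₀(E)` on `Aut_E(I)`.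

An object `X` acts on `f` by sending it to the (unique up to isomorphism) `ᵡf` with
`f ⊠ X ≅ X ⊠ ᵡf`, i.e. `eps X f ≅ η_X(ᵡf)`. The action is trivial when there are isomorphisms
`eps X f ≅ η_X(f)`, natural and monoidal in `f`, natural with respect to equivalences in `X` (so
that they only depend on the class of `X` in `π₀`), and compatible with the tensor product. -/
structure TrivialAction where
  iso (X : E) (f : AutI E) : eps X f.hom ≅ eta X f.hom
  natural (X : E) {f g : AutI E} (σ : f ⟶ g) :
    epsIso X σ ≪≫ iso X g = iso X f ≪≫ etaIso X σ
  monoidal (X : E) (f g : AutI E) :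
    iso X ⟨f.hom ≫ g.hom, f.isEquiv.comp g.isEquiv⟩ ≪≫ etaComp X f.hom g.hom =
      epsComp X f.hom g.hom ≪≫ iso X f ▷ᵢ eps X g.hom ≪≫ eta X f.hom ◁ᵢ iso X g
  natural_obj {X Y : E} (h : X ≌ Y) (f : AutI E) :
    h.hom ◁ᵢ iso Y f ≪≫ etaNat h.hom f.hom = epsNat h.hom f.hom ≪≫ iso X f ▷ᵢ h.hom
  tensor (X Y : E) (f : AutI E) :
    epsTensor X Y f.hom ≪≫ iso (X ⊠ Y) f =
      wrIso (iso X f) Y ≪≫ etaEps X Y f.hom ≪≫ wlIso X (iso Y f) ≪≫ etaTensor X Y f.hom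

/-- Moving an automorphism of the unit through a 1-cell out of a tensor product, to the
right-hand factor. -/
def enterRight {X Y N : E} (k : X ⊠ Y ⟶ N) (f : AutI E) :
    k ≫ eta N f.hom ≅ X ◁ₜ eta Y f.hom ≫ k :=
  etaNat k f.hom ≪≫ (etaTensor X Y f.hom).symm ▷ᵢ k

/-- Moving an automorphism of the unit through a 1-cell out of a tensor product, to the
left-hand factor. -/
def enterLeft (z : TrivialAction E) {X Y N : E} (k : X ⊠ Y ⟶ N) (f : AutI E) :
    k ≫ eta N f.hom ≅ eta X f.hom ▷ₜ Y ≫ k :=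
  enterRight k f ≪≫ (wlIso X (z.iso Y f).symm ≪≫ (etaEps X Y f.hom).symm) ▷ᵢ k

end RightAction

section Cohomology
open MonoidalCategory

/-- A Picard groupoid: a symmetric monoidal groupoid in which every object is invertible. -/
class PicardGroupoid (A : Type u₁) [Category.{v₁} A] [MonoidalCategory A] extends
    SymmetricCategory A where
  isIso {X Y : A} (f : X ⟶ Y) : IsIso f
  exists_inverse (X : A) : ∃ Y : A, Nonempty (X ⊗ Y ≅ 𝟙_ A)

variable {G : Type u} [Group G] {A : Type u₁} [Category.{v₁} A] [MonoidalCategory A]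

/-- The sum of the faces with negative sign in `δf`, for a 3-cochain `f` of the bar construction. -/
def dNeg (f : G → G → G → A) (x y z t : G) : A := f (x * y) z t ⊗ f x y (z * t)

/-- The sum of the faces with positive sign in `δf`, for a 3-cochain `f` of the bar
construction. -/
def dPos (f : G → G → G → A) (x y z t : G) : A := f x y z ⊗ f x (y * z) t ⊗ f y z t

variable (G A) in
/-- A 3-pseudococycle of the complex of Picard groupoids `A^{G^•}`: a 3-cochain `f` with a
morphism from `δf` to the unit object in `A^{G⁴}`. As
`δf = f(y,z,t) - f(xy,z,t) + f(x,yz,t) - f(x,y,zt) + f(x,y,z)`, the latter is given by its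
transpose `θ` from the negative part of `δf` to the positive part. -/
structure PseudoCocycle₃ where
  f : G → G → G → A
  θ (x y z t : G) : dNeg f x y z t ⟶ dPos f x y z t

namespace PseudoCocycle₃

section
variable [PicardGroupoid A] (P : PseudoCocycle₃ G A)

/-- `θ` with its type written out. -/
abbrev th (x y z t : G) : P.f (x * y) z t ⊗ P.f x y (z * t) ⟶
    P.f x y z ⊗ P.f x (y * z) t ⊗ P.f y z t := P.θ x y z t

/-- The composite `θ_{x,y,z,tw} · θ_{x,yz,t,w} · θ_{y,z,t,w}`. -/
def evenFaces (x y z t w : G) :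
    P.f (x * y * z) t w ⊗ P.f (x * y) z (t * w) ⊗ P.f x y (z * (t * w)) ⟶
      P.f x y z ⊗ P.f x (y * z) t ⊗ P.f y z t ⊗ P.f x (y * (z * t)) w ⊗
        P.f y (z * t) w ⊗ P.f z t w :=
  P.f (x * y * z) t w ◁ P.th x y z (t * w) ⊗≫
    (β_ (P.f (x * y * z) t w) (P.f x y z)).hom ▷ (P.f x (y * z) (t * w) ⊗ P.f y z (t * w)) ⊗≫
    P.f x y z ◁ eqToHom (congrArg (P.f · t w) (mul_assoc x y z)) ▷
      (P.f x (y * z) (t * w) ⊗ P.f y z (t * w)) ⊗≫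
    P.f x y z ◁ P.th x (y * z) t w ▷ P.f y z (t * w) ⊗≫
    (P.f x y z ⊗ P.f x (y * z) t ⊗ P.f x (y * z * t) w) ◁ P.th y z t w ⊗≫
    (P.f x y z ⊗ P.f x (y * z) t) ◁ (β_ (P.f x (y * z * t) w) (P.f y z t)).hom ▷
      (P.f y (z * t) w ⊗ P.f z t w) ⊗≫
    (P.f x y z ⊗ P.f x (y * z) t ⊗ P.f y z t) ◁
      eqToHom (congrArg (P.f x · w) (mul_assoc y z t)) ▷ (P.f y (z * t) w ⊗ P.f z t w) ⊗≫
    𝟙 (P.f x y z ⊗ P.f x (y * z) t ⊗ P.f y z t ⊗ P.f x (y * (z * t)) w ⊗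
        P.f y (z * t) w ⊗ P.f z t w)

/-- The composite `θ_{xy,z,t,w} · θ_{x,y,zt,w} · θ_{x,y,z,t}`. -/
def oddFaces (x y z t w : G) :
    P.f (x * y * z) t w ⊗ P.f (x * y) z (t * w) ⊗ P.f x y (z * (t * w)) ⟶
      P.f x y z ⊗ P.f x (y * z) t ⊗ P.f y z t ⊗ P.f x (y * (z * t)) w ⊗
        P.f y (z * t) w ⊗ P.f z t w :=
  𝟙 (P.f (x * y * z) t w ⊗ P.f (x * y) z (t * w) ⊗ P.f x y (z * (t * w))) ⊗≫
    P.th (x * y) z t w ▷ P.f x y (z * (t * w)) ⊗≫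
    (P.f (x * y) z t ⊗ P.f (x * y) (z * t) w) ◁ (β_ (P.f z t w) (P.f x y (z * (t * w)))).hom ⊗≫
    (P.f (x * y) z t ⊗ P.f (x * y) (z * t) w) ◁
      eqToHom (congrArg (P.f x y ·) (mul_assoc z t w).symm) ▷ P.f z t w ⊗≫
    P.f (x * y) z t ◁ P.th x y (z * t) w ▷ P.f z t w ⊗≫
    P.th x y z t ▷ (P.f x (y * (z * t)) w ⊗ P.f y (z * t) w ⊗ P.f z t w) ⊗≫
    𝟙 (P.f x y z ⊗ P.f x (y * z) t ⊗ P.f y z t ⊗ P.f x (y * (z * t)) w ⊗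
        P.f y (z * t) w ⊗ P.f z t w)

/-- The 3-cocycle condition
`θ_{xy,z,t,w} · θ_{x,y,zt,w} · θ_{x,y,z,t} = θ_{x,y,z,tw} · θ_{x,yz,t,w} · θ_{y,z,t,w}`,
where the symmetry of `A` is used to permute the summands. -/
def IsCocycle : Prop := ∀ x y z t w : G, P.oddFaces x y z t w = P.evenFaces x y z t w

end
end PseudoCocycle₃

variable (G A) in
/-- The 3-cocycles of `G` with values in the Picard groupoid `A`. -/
structure Cocycle₃ [PicardGroupoid A] extends PseudoCocycle₃ G A where
  isCocycle : toPseudoCocycle₃.IsCocycle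

section
variable [PicardGroupoid A]

/-- Two 3-cocycles are cohomologous if the second one is isomorphic, as a 3-cocycle, to the sum of
the first one and of the coboundary of a 2-cochain `Q`, where
`δQ = Q(y,z) - Q(xy,z) + Q(x,yz) - Q(x,y)`. In the isomorphism `f' ≅ f + δQ`, the negative terms
of `δQ` have been moved to the other side, where they give `β`. -/
def Cohomologous (P P' : Cocycle₃ G A) : Prop :=
  ∃ (Q : G → G → A)
    (β : ∀ x y z : G, Q x y ⊗ Q (x * y) z ⊗ P'.f x y z ⟶ P.f x y z ⊗ Q y z ⊗ Q x (y * z)),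
    ∀ x y z t : G,
      𝟙 (Q x y ⊗ Q (x * y) z ⊗ Q (x * y * z) t ⊗ P'.f (x * y) z t ⊗ P'.f x y (z * t)) ⊗≫
        Q x y ◁ β (x * y) z t ▷ P'.f x y (z * t) ⊗≫
        (β_ (Q x y) (P.f (x * y) z t ⊗ Q z t)).hom ▷ (Q (x * y) (z * t) ⊗ P'.f x y (z * t)) ⊗≫
        (P.f (x * y) z t ⊗ Q z t) ◁ β x y (z * t) ⊗≫
        P.f (x * y) z t ◁ (β_ (Q z t) (P.f x y (z * t))).hom ▷
          (Q y (z * t) ⊗ Q x (y * (z * t))) ⊗≫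
        P.th x y z t ▷ (Q z t ⊗ Q y (z * t) ⊗ Q x (y * (z * t))) ⊗≫
        𝟙 (P.f x y z ⊗ P.f x (y * z) t ⊗ P.f y z t ⊗ Q z t ⊗ Q y (z * t) ⊗ Q x (y * (z * t))) =
      𝟙 (Q x y ⊗ Q (x * y) z ⊗ Q (x * y * z) t ⊗ P'.f (x * y) z t ⊗ P'.f x y (z * t)) ⊗≫
        (Q x y ⊗ Q (x * y) z ⊗ Q (x * y * z) t) ◁ P'.th x y z t ⊗≫
        (Q x y ⊗ Q (x * y) z) ◁ (β_ (Q (x * y * z) t) (P'.f x y z)).hom ▷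
          (P'.f x (y * z) t ⊗ P'.f y z t) ⊗≫
        β x y z ▷ (Q (x * y * z) t ⊗ P'.f x (y * z) t ⊗ P'.f y z t) ⊗≫
        (P.f x y z ⊗ Q y z ⊗ Q x (y * z)) ◁ eqToHom (congrArg (Q · t) (mul_assoc x y z)) ▷
          (P'.f x (y * z) t ⊗ P'.f y z t) ⊗≫
        (P.f x y z ⊗ Q y z) ◁ β x (y * z) t ▷ P'.f y z t ⊗≫
        P.f x y z ◁ (β_ (Q y z) (P.f x (y * z) t)).hom ▷
          (Q (y * z) t ⊗ Q x (y * z * t) ⊗ P'.f y z t) ⊗≫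
        (P.f x y z ⊗ P.f x (y * z) t ⊗ Q y z ⊗ Q (y * z) t) ◁
          (β_ (Q x (y * z * t)) (P'.f y z t)).hom ⊗≫
        (P.f x y z ⊗ P.f x (y * z) t) ◁ β y z t ▷ Q x (y * z * t) ⊗≫
        (P.f x y z ⊗ P.f x (y * z) t ⊗ P.f y z t ⊗ Q z t ⊗ Q y (z * t)) ◁
          eqToHom (congrArg (Q x ·) (mul_assoc y z t)) ⊗≫
        𝟙 (P.f x y z ⊗ P.f x (y * z) t ⊗ P.f y z t ⊗ Q z t ⊗ Q y (z * t) ⊗ Q x (y * (z * t)))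

variable (G A) in
/-- The third cohomology `H³(G, A)` of `G` with coefficients in the Picard groupoid `A`: the
isomorphism classes of objects of the quotient of 3-cocycles by 3-coboundaries. -/
def H3 : Type _ := Quot (Cohomologous (G := G) (A := A))

/-- The class of a 3-cocycle. -/
def H3.mk (P : Cocycle₃ G A) : H3 G A := Quot.mk _ P

/-- A cohomology class is the class of a pair `(f, θ)`; this includes that `(f, θ)` is a
3-cocycle. -/
def H3.IsClassOf (k : H3 G A) (P : PseudoCocycle₃ G A) : Prop :=
  ∃ h : P.IsCocycle, k = H3.mk ⟨P, h⟩

end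
end Cohomology

section Extension
open Bicategory
variable {E : Type u} [Bicategory.{w, v} E] [MonoidalBicategory E]
open MonoidalBicategory

variable (E) in
/-- A (set-theoretic) section of the projection `E ⟶ π₀(E)`. -/
structure PiZeroSection where
  obj : PiZero E → E
  mk_obj (x : PiZero E) : PiZero.mk (obj x) = x

/-- The choices made for a section `s`: equivalences `c_{x,y} : s(x) ⊠ s(y) ≌ s(xy)` and
associativity 1-cells `f_{x,y,z}`, which are regarded as automorphisms of the unit through
`η_{s(xyz)}`, with the invertible 2-cells filling the squares that define them.

To avoid transports along equalities such as `(xy)z = x(yz)`, the families are indexed by the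
products together with a proof that they are the products: `c h` with `h : x * y = p`
is `c_{x,y}`. -/
structure AssociativityData (s : PiZeroSection E) where
  c {x y p : PiZero E} (h : x * y = p) : s.obj x ⊠ s.obj y ≌ s.obj p
  f (x y z : PiZero E) : AutI E
  φ {x y z p q n : PiZero E} (hp : x * y = p) (hq : y * z = q) (hn : p * z = n)
    (hn' : x * q = n) :
    (c hp).hom ▷ₜ s.obj z ≫ (c hn).hom ≫ eta (s.obj n) (f x y z).hom ≅
      a (s.obj x) (s.obj y) (s.obj z) ≫ s.obj x ◁ₜ (c hq).hom ≫ (c hn').hom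

namespace AssociativityData
variable {s : PiZeroSection E} (D : AssociativityData s) (τ : TrivialAction E)

section
variable {x y z t p q r' u' v' n : PiZero E} (hp : x * y = p) (hq : y * z = q) (hr : z * t = r')
  (hu : p * z = u') (hu' : x * q = u') (hv : y * r' = v') (hv' : q * t = v') (hn : u' * t = n)
  (hn₁ : p * r' = n) (hn₂ : x * v' = n)

/-- The side of the pentagon with two edges, `f_{xy,z,t}` and `f_{x,y,zt}`. -/
def upperSide :
    (D.c hp).hom ▷ₜ s.obj z ▷ₜ s.obj t ≫ (D.c hu).hom ▷ₜ s.obj t ≫ (D.c hn).hom ≫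
        eta (s.obj n) (D.f p z t).hom ≫ eta (s.obj n) (D.f x y r').hom ≅
      a (s.obj x ⊠ s.obj y) (s.obj z) (s.obj t) ≫ a (s.obj x) (s.obj y) (s.obj z ⊠ s.obj t) ≫
        s.obj x ◁ₜ (s.obj y ◁ₜ (D.c hr).hom) ≫ s.obj x ◁ₜ (D.c hv).hom ≫ (D.c hn₂).hom :=
  Iso.refl ((D.c hp).hom ▷ₜ s.obj z ▷ₜ s.obj t ≫ (D.c hu).hom ▷ₜ s.obj t ≫ (D.c hn).hom ≫
        eta (s.obj n) (D.f p z t).hom ≫ eta (s.obj n) (D.f x y r').hom) ≪⊗≫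
    (D.c hp).hom ▷ₜ s.obj z ▷ₜ s.obj t ◁ᵢ
      (D.φ hu hr hn hn₁ ▷ᵢ eta (s.obj n) (D.f x y r').hom) ≪⊗≫
    as₁ (D.c hp).hom (s.obj z) (s.obj t) ▷ᵢ
      (s.obj p ◁ₜ (D.c hr).hom ≫ (D.c hn₁).hom ≫ eta (s.obj n) (D.f x y r').hom) ≪⊗≫
    a (s.obj x ⊠ s.obj y) (s.obj z) (s.obj t) ◁ᵢ
      (interchange (D.c hp).hom (D.c hr).hom ▷ᵢ
        ((D.c hn₁).hom ≫ eta (s.obj n) (D.f x y r').hom)) ≪⊗≫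
    (a (s.obj x ⊠ s.obj y) (s.obj z) (s.obj t) ≫ (s.obj x ⊠ s.obj y) ◁ₜ (D.c hr).hom) ◁ᵢ
      D.φ hp hv hn₁ hn₂ ≪⊗≫
    a (s.obj x ⊠ s.obj y) (s.obj z) (s.obj t) ◁ᵢ
      (as₃ (s.obj x) (s.obj y) (D.c hr).hom ▷ᵢ (s.obj x ◁ₜ (D.c hv).hom ≫ (D.c hn₂).hom)) ≪⊗≫
    Iso.refl (a (s.obj x ⊠ s.obj y) (s.obj z) (s.obj t) ≫
      a (s.obj x) (s.obj y) (s.obj z ⊠ s.obj t) ≫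
        s.obj x ◁ₜ (s.obj y ◁ₜ (D.c hr).hom) ≫ s.obj x ◁ₜ (D.c hv).hom ≫ (D.c hn₂).hom)

/-- The side of the pentagon with three edges, `f_{x,y,z} ⊗ t`, `f_{x,yz,t}` and
`x ⊗ f_{y,z,t}`, followed by the pentagonator. -/
def lowerSide :
    (D.c hp).hom ▷ₜ s.obj z ▷ₜ s.obj t ≫ (D.c hu).hom ▷ₜ s.obj t ≫ (D.c hn).hom ≫
        eta (s.obj n) (D.f x y z).hom ≫ eta (s.obj n) (D.f x q t).hom ≫
          eta (s.obj n) (D.f y z t).hom ≅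
      a (s.obj x ⊠ s.obj y) (s.obj z) (s.obj t) ≫ a (s.obj x) (s.obj y) (s.obj z ⊠ s.obj t) ≫
        s.obj x ◁ₜ (s.obj y ◁ₜ (D.c hr).hom) ≫ s.obj x ◁ₜ (D.c hv).hom ≫ (D.c hn₂).hom :=
  Iso.refl ((D.c hp).hom ▷ₜ s.obj z ▷ₜ s.obj t ≫ (D.c hu).hom ▷ₜ s.obj t ≫ (D.c hn).hom ≫
        eta (s.obj n) (D.f x y z).hom ≫ eta (s.obj n) (D.f x q t).hom ≫
          eta (s.obj n) (D.f y z t).hom) ≪⊗≫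
    ((D.c hp).hom ▷ₜ s.obj z ▷ₜ s.obj t ≫ (D.c hu).hom ▷ₜ s.obj t) ◁ᵢ
      (enterLeft τ (D.c hn).hom (D.f x y z) ▷ᵢ
        (eta (s.obj n) (D.f x q t).hom ≫ eta (s.obj n) (D.f y z t).hom)) ≪⊗≫
    ((wrComp₃ ((D.c hp).hom ▷ₜ s.obj z) (D.c hu).hom (eta (s.obj u') (D.f x y z).hom)
          (s.obj t)).symm ≪≫
        wrIso (D.φ hp hq hu hu') (s.obj t) ≪≫
        wrComp₃ (a (s.obj x) (s.obj y) (s.obj z)) (s.obj x ◁ₜ (D.c hq).hom) (D.c hu').hom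
          (s.obj t)) ▷ᵢ
      ((D.c hn).hom ≫ eta (s.obj n) (D.f x q t).hom ≫ eta (s.obj n) (D.f y z t).hom) ≪⊗≫
    (a (s.obj x) (s.obj y) (s.obj z) ▷ₜ s.obj t ≫ (s.obj x ◁ₜ (D.c hq).hom) ▷ₜ s.obj t) ◁ᵢ
      (D.φ hu' hv' hn hn₂ ▷ᵢ eta (s.obj n) (D.f y z t).hom) ≪⊗≫
    (a (s.obj x) (s.obj y) (s.obj z) ▷ₜ s.obj t ≫ (s.obj x ◁ₜ (D.c hq).hom) ▷ₜ s.obj t ≫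
        a (s.obj x) (s.obj q) (s.obj t) ≫ s.obj x ◁ₜ (D.c hv').hom) ◁ᵢ
      enterRight (D.c hn₂).hom (D.f y z t) ≪⊗≫
    a (s.obj x) (s.obj y) (s.obj z) ▷ₜ s.obj t ◁ᵢ
      (as₂ (s.obj x) (D.c hq).hom (s.obj t) ▷ᵢ
        (s.obj x ◁ₜ (D.c hv').hom ≫ s.obj x ◁ₜ eta (s.obj v') (D.f y z t).hom ≫
          (D.c hn₂).hom)) ≪⊗≫
    (a (s.obj x) (s.obj y) (s.obj z) ▷ₜ s.obj t ≫ a (s.obj x) (s.obj y ⊠ s.obj z) (s.obj t)) ◁ᵢ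
      (((wlComp₃ (s.obj x) ((D.c hq).hom ▷ₜ s.obj t) (D.c hv').hom
            (eta (s.obj v') (D.f y z t).hom)).symm ≪≫
          wlIso (s.obj x) (D.φ hq hr hv' hv) ≪≫
          wlComp₃ (s.obj x) (a (s.obj y) (s.obj z) (s.obj t)) (s.obj y ◁ₜ (D.c hr).hom)
            (D.c hv).hom) ▷ᵢ (D.c hn₂).hom) ≪⊗≫
    pent (s.obj x) (s.obj y) (s.obj z) (s.obj t) ▷ᵢ
      (s.obj x ◁ₜ (s.obj y ◁ₜ (D.c hr).hom) ≫ s.obj x ◁ₜ (D.c hv).hom ≫ (D.c hn₂).hom) ≪⊗≫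
    Iso.refl (a (s.obj x ⊠ s.obj y) (s.obj z) (s.obj t) ≫
      a (s.obj x) (s.obj y) (s.obj z ⊠ s.obj t) ≫
        s.obj x ◁ₜ (s.obj y ◁ₜ (D.c hr).hom) ≫ s.obj x ◁ₜ (D.c hv).hom ≫ (D.c hn₂).hom)

end

/-- The 2-cells `θ_{x,y,z,t}` of the pentagons whose edges are the 1-cells `f`, seen as morphisms of
`Aut_E(I)`. -/
abbrev PentagonCells [IsGroupLike E] : Type _ :=
  ∀ x y z t : PiZero E, dNeg D.f x y z t ⟶ dPos D.f x y z t

/-- The 2-cell `θ_{x,y,z,t}` as a 2-cell between composites of endomorphisms of `N`. -/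
def pentagonCell (N : E) {f₁ f₂ g₁ g₂ g₃ : AutI E}
    (θ : f₁.hom ≫ f₂.hom ≅ g₁.hom ≫ g₂.hom ≫ g₃.hom) :
    eta N f₁.hom ≫ eta N f₂.hom ≅ eta N g₁.hom ≫ eta N g₂.hom ≫ eta N g₃.hom :=
  (etaComp N f₁.hom f₂.hom).symm ≪≫ etaIso N θ ≪≫ etaComp N g₁.hom (g₂.hom ≫ g₃.hom) ≪≫
    eta N g₁.hom ◁ᵢ etaComp N g₂.hom g₃.hom

/-- The defining property of the pentagon 2-cells `θ`: they fill the pentagons, that is, the two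
sides of each pentagon agree up to `θ`. -/
def IsPentagon [IsGroupLike E] (θ : D.PentagonCells) : Prop :=
  ∀ x y z t : PiZero E,
    D.upperSide (p := x * y) (r' := z * t) (u' := x * y * z) (v' := y * (z * t))
        (n := x * y * z * t) rfl rfl rfl rfl rfl (mul_assoc (x * y) z t).symm
        (by simp only [mul_assoc]) =
      Iso.refl _ ≪⊗≫
        ((D.c (p := x * y) rfl).hom ▷ₜ s.obj z ▷ₜ s.obj t ≫
          (D.c (p := x * y * z) rfl).hom ▷ₜ s.obj t ≫ (D.c (p := x * y * z * t) rfl).hom) ◁ᵢ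
          pentagonCell (s.obj (x * y * z * t)) (θ x y z t) ≪⊗≫
        D.lowerSide τ (p := x * y) (q := y * z) (r' := z * t) (u' := x * y * z)
          (v' := y * (z * t)) (n := x * y * z * t) rfl rfl rfl rfl (mul_assoc x y z).symm rfl
          (mul_assoc y z t) rfl (by simp only [mul_assoc])

end AssociativityData

/-- The Picard structure on `Aut_E(I)` is the canonical one: the symmetry is the one obtained by
moving one automorphism of the unit through another one. -/
def IsCanonicalSymmetry (P : PicardGroupoid (AutI E)) : Prop :=
  ∀ (X : E) (f g : AutI E),
    etaIso X (P.braiding f g).hom =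
      etaComp X f.hom g.hom ≪≫ etaNat (eta X f.hom) g.hom ≪≫ (etaComp X g.hom f.hom).symm

end Extension
end MonBicat

/-! Everything is transported to automorphisms of the objects `s(n)`. Since every object `X` has an
inverse `Z`, and `Z ⊗ (X ⊗ f) ≃ I ⊗ f ≃ f`, the functor `η_X` from `Aut(I)` to the self-equivalences
of `X` is an equivalence: it is bijective on 2-cells (`etaIso_injective`, `etaIso_surjective`) and
essentially surjective (`exists_eta`). This gives the objects `f`, because the two bracketed
equivalences `(s(x) ⊗ s(y)) ⊗ s(z) → s(xyz)` differ by a self-equivalence of `s(xyz)`. It also gives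
`θ` and its uniqueness: both sides of a pentagon are invertible squares on the same equivalence, so
a unique 2-cell of automorphisms of `s(xyzt)` compares them.

The symmetry is the naturality of `η(g)` along `η(f)`. It does not depend on the object, since `η`
is compatible with `⊗` and with equivalences. On `A ⊗ B` the trivialization lets `f` act on `A`
while `g` acts on `B`; the naturality 2-cells of `g` along `f` and of `f` along `g` are then the
interchange 2-cell and its inverse (`etaNat_eta_symm`). So the braiding is a symmetry.

For the cocycle identity, consider squares `u ≫ η_N(f) ≅ p ≫ u'`, where `u` and `u'` are iterated
products into `N = s(xyztw)` and `p` is a path of associators. They compose (`gradedComp`): the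
paths compose and the `f` add up. `GradedRel π θ` says that two of them agree up to a 2-cell `π` of
paths and a morphism `θ` of `Aut(I)`; when `u` is an equivalence, `π` determines `θ`
(`GradedRel.unique`). An edge of the associahedron carries a square made from one of the `φ`
(`assocCell`, `leftMul`, `rightMul`). A pentagonal face gives a relation over a pentagonator and one
of the `θ` (`pentagon_transport`); a naturality face gives a relation over a naturality 2-cell and
the symmetry (`assocCell_as₁`, `assocCell_as₂`, `assocCell_as₃`). The two halves of `K₅` thus relate
the same two squares. The associahedron axiom says that their `π` agree, hence so do the two
composites of `θ` (`IsPentagon.oddGrade_eq_evenGrade`).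

The naturality faces need the following coherence: moving `f` through an associator does not depend
on which of the three factors it enters. This is `etaTensor_as₃`, `TrivialAction.etaTensor_as₂` and
`TrivialAction.etaTensorLeft_as₁`; it rests on the modification axioms, on the two normalization
axioms and on the compatibility of the trivialization with `⊗`.

Throughout, a 2-cell defined by cancelling an equivalence is handled through the commutative cube
(`SqRel`) that characterizes it. -/

namespace MonBicat

/-! ### Calculus of squares filled with invertible 2-cells, and of cubes between them. -/

section Squares
open Bicategory

variable {B : Type u₁} [Bicategory.{w₁, v₁} B] {C : Type u₂} [Bicategory.{w₂, v₂} C]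

/-- The horizontal composite of two invertible 2-cells. -/
def hc {a b c : B} {f f' : a ⟶ b} {g g' : b ⟶ c} (π : f ≅ f') (ρ : g ≅ g') : f ≫ g ≅ f' ≫ g' :=
  π ▷ᵢ g ≪≫ f' ◁ᵢ ρ

section hc
variable {a b c : B} {f f' f'' : a ⟶ b} {g g' g'' : b ⟶ c}

@[simp] lemma hc_hom (π : f ≅ f') (ρ : g ≅ g') : (hc π ρ).hom = π.hom ▷ g ≫ f' ◁ ρ.hom := rfl
lemma hc_inv (π : f ≅ f') (ρ : g ≅ g') : (hc π ρ).inv = f' ◁ ρ.inv ≫ π.inv ▷ g := rfl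
@[simp] lemma hc_refl : hc (Iso.refl f) (Iso.refl g) = Iso.refl (f ≫ g) := by
  ext; simp
lemma hc_refl_right (π : f ≅ f') : hc π (Iso.refl g) = π ▷ᵢ g := by ext; simp
lemma hc_refl_left (ρ : g ≅ g') : hc (Iso.refl f) ρ = f ◁ᵢ ρ := by ext; simp
lemma hc_trans (π : f ≅ f') (π' : f' ≅ f'') (ρ : g ≅ g') (ρ' : g' ≅ g'') :
    hc (π ≪≫ π') (ρ ≪≫ ρ') = hc π ρ ≪≫ hc π' ρ' := by
  ext; simp [whisker_exchange_assoc]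
@[simp] lemma hc_symm (π : f ≅ f') (ρ : g ≅ g') : (hc π ρ).symm = hc π.symm ρ.symm := by
  ext; simp [hc_inv, whisker_exchange]
end hc

/-- A morphism of squares: a commutative cube two opposite faces of which are squares filled with
invertible 2-cells and whose other faces are bigons. -/
def SqRel {a₀ a₁ b₀ b₁ : B} {f₀ f₀' : a₀ ⟶ b₀} {f₁ f₁' : a₁ ⟶ b₁} {p p' : a₀ ⟶ a₁}
    {q q' : b₀ ⟶ b₁} (i : f₀ ≅ f₀') (j : f₁ ≅ f₁') (π : p ≅ p') (ρ : q ≅ q')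
    (σ : f₀ ≫ q ≅ p ≫ f₁) (σ' : f₀' ≫ q' ≅ p' ≫ f₁') : Prop :=
  σ ≪≫ hc π j = hc i ρ ≪≫ σ'

/-- A square filled with an invertible 2-cell, pasted on top of another one. -/
def vPaste {a₀ a₁ b₀ b₁ c₀ c₁ : B} {f₀ : a₀ ⟶ b₀} {f₁ : a₁ ⟶ b₁} {g₀ : b₀ ⟶ c₀} {g₁ : b₁ ⟶ c₁}
    {p : a₀ ⟶ a₁} {q : b₀ ⟶ b₁} {r : c₀ ⟶ c₁}
    (σ : f₀ ≫ q ≅ p ≫ f₁) (τ : g₀ ≫ r ≅ q ≫ g₁) : (f₀ ≫ g₀) ≫ r ≅ p ≫ (f₁ ≫ g₁) :=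
  (hPaste σ.symm τ.symm).symm

lemma vPaste_eq {a₀ a₁ b₀ b₁ c₀ c₁ : B} {f₀ : a₀ ⟶ b₀} {f₁ : a₁ ⟶ b₁} {g₀ : b₀ ⟶ c₀}
    {g₁ : b₁ ⟶ c₁} {p : a₀ ⟶ a₁} {q : b₀ ⟶ b₁} {r : c₀ ⟶ c₁}
    (σ : f₀ ≫ q ≅ p ≫ f₁) (τ : g₀ ≫ r ≅ q ≫ g₁) :
    vPaste σ τ = α_ f₀ g₀ r ≪≫ f₀ ◁ᵢ τ ≪≫ (α_ f₀ q g₁).symm ≪≫ σ ▷ᵢ g₁ ≪≫ α_ p f₁ g₁ := by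
  ext; simp [vPaste, hPaste]

lemma hPaste_hom {a₀ a₁ a₂ b₀ b₁ b₂ : B} {f₀ : a₀ ⟶ b₀} {f₁ : a₁ ⟶ b₁} {f₂ : a₂ ⟶ b₂}
    {p : a₀ ⟶ a₁} {q : b₀ ⟶ b₁} {p' : a₁ ⟶ a₂} {q' : b₁ ⟶ b₂}
    (σ : f₀ ≫ q ≅ p ≫ f₁) (τ : f₁ ≫ q' ≅ p' ≫ f₂) :
    (hPaste σ τ).hom = (α_ f₀ q q').inv ≫ σ.hom ▷ q' ≫ (α_ p f₁ q').hom ≫ p ◁ τ.hom ≫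
      (α_ p p' f₂).inv := by simp [hPaste]

lemma vPaste_hom {a₀ a₁ b₀ b₁ c₀ c₁ : B} {f₀ : a₀ ⟶ b₀} {f₁ : a₁ ⟶ b₁} {g₀ : b₀ ⟶ c₀}
    {g₁ : b₁ ⟶ c₁} {p : a₀ ⟶ a₁} {q : b₀ ⟶ b₁} {r : c₀ ⟶ c₁}
    (σ : f₀ ≫ q ≅ p ≫ f₁) (τ : g₀ ≫ r ≅ q ≫ g₁) :
    (vPaste σ τ).hom = (α_ f₀ g₀ r).hom ≫ f₀ ◁ τ.hom ≫ (α_ f₀ q g₁).inv ≫ σ.hom ▷ g₁ ≫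
      (α_ p f₁ g₁).hom := by simp [vPaste_eq]

lemma hc_assoc {a b c d : B} {f f' : a ⟶ b} {g g' : b ⟶ c} {h h' : c ⟶ d} (x : f ≅ f')
    (y : g ≅ g') (z : h ≅ h') :
    hc (hc x y) z ≪≫ α_ f' g' h' = α_ f g h ≪≫ hc x (hc y z) := by
  ext; simp

lemma hc_assoc_symm {a b c d : B} {f f' : a ⟶ b} {g g' : b ⟶ c} {h h' : c ⟶ d} (x : f ≅ f')
    (y : g ≅ g') (z : h ≅ h') :
    (α_ f g h).symm ≪≫ hc (hc x y) z = hc x (hc y z) ≪≫ (α_ f' g' h').symm := by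
  ext; simp

lemma hPaste_eq {a₀ a₁ a₂ b₀ b₁ b₂ : B} {f₀ : a₀ ⟶ b₀} {f₁ : a₁ ⟶ b₁} {f₂ : a₂ ⟶ b₂}
    {p : a₀ ⟶ a₁} {q : b₀ ⟶ b₁} {p' : a₁ ⟶ a₂} {q' : b₁ ⟶ b₂}
    (σ : f₀ ≫ q ≅ p ≫ f₁) (τ : f₁ ≫ q' ≅ p' ≫ f₂) :
    hPaste σ τ = (α_ f₀ q q').symm ≪≫ hc σ (Iso.refl q') ≪≫ α_ p f₁ q' ≪≫ hc (Iso.refl p) τ ≪≫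
      (α_ p p' f₂).symm := by
  rw [hc_refl_left, hc_refl_right]; rfl

namespace SqRel

section basic
variable {a₀ a₁ b₀ b₁ : B} {f₀ f₀' f₀'' : a₀ ⟶ b₀} {f₁ f₁' f₁'' : a₁ ⟶ b₁} {p p' p'' : a₀ ⟶ a₁}
  {q q' q'' : b₀ ⟶ b₁} {i : f₀ ≅ f₀'} {j : f₁ ≅ f₁'} {π : p ≅ p'} {ρ : q ≅ q'}
  {σ : f₀ ≫ q ≅ p ≫ f₁} {σ' : f₀' ≫ q' ≅ p' ≫ f₁'}
  {i' : f₀' ≅ f₀''} {j' : f₁' ≅ f₁''} {π' : p' ≅ p''} {ρ' : q' ≅ q''}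
  {σ'' : f₀'' ≫ q'' ≅ p'' ≫ f₁''}

lemma iff_hom : SqRel i j π ρ σ σ' ↔
    σ.hom ≫ π.hom ▷ f₁ ≫ p' ◁ j.hom = i.hom ▷ q ≫ f₀' ◁ ρ.hom ≫ σ'.hom := by
  rw [SqRel, Iso.ext_iff]; simp

lemma refl (σ : f₀ ≫ q ≅ p ≫ f₁) :
    SqRel (Iso.refl _) (Iso.refl _) (Iso.refl _) (Iso.refl _) σ σ := by
  simp [SqRel]

lemma of_eq {τ : f₀ ≫ q ≅ p ≫ f₁} (h : σ = τ) :
    SqRel (Iso.refl _) (Iso.refl _) (Iso.refl _) (Iso.refl _) σ τ := h ▸ refl σ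

lemma eq {τ : f₀ ≫ q ≅ p ≫ f₁}
    (h : SqRel (Iso.refl _) (Iso.refl _) (Iso.refl _) (Iso.refl _) σ τ) : σ = τ := by
  simpa [SqRel] using h

/-- Most coherence proofs below stack cubes with `trans`, `symm`, `hPaste` and `vPaste`; what
remains for `congr` is to identify the four composite bigons. -/
lemma trans (h : SqRel i j π ρ σ σ') (h' : SqRel i' j' π' ρ' σ' σ'') :
    SqRel (i ≪≫ i') (j ≪≫ j') (π ≪≫ π') (ρ ≪≫ ρ') σ σ'' := by
  rw [SqRel, hc_trans, hc_trans, Iso.trans_assoc, ← h', ← Iso.trans_assoc, h, Iso.trans_assoc]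

lemma symm (h : SqRel i j π ρ σ σ') : SqRel i.symm j.symm π.symm ρ.symm σ' σ := by
  rw [SqRel, ← hc_symm, ← hc_symm]
  have h' := congrArg (fun τ => (hc i ρ).symm ≪≫ τ ≪≫ (hc π j).symm) h
  simp only [Iso.trans_assoc, Iso.symm_self_id_assoc, Iso.self_symm_id, Iso.trans_refl] at h'
  exact h'.symm

lemma transpose (h : SqRel i j π ρ σ σ') : SqRel π ρ i j σ.symm σ'.symm := by
  have h' := congrArg (fun τ => σ.symm ≪≫ τ ≪≫ σ'.symm) h
  simp only [Iso.trans_assoc, Iso.symm_self_id_assoc, Iso.self_symm_id, Iso.trans_refl] at h'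
  exact h'.symm

lemma congr (h : SqRel i j π ρ σ σ') {i₁ : f₀ ≅ f₀'} {j₁ : f₁ ≅ f₁'} {π₁ : p ≅ p'} {ρ₁ : q ≅ q'}
    (hi : i = i₁) (hj : j = j₁) (hπ : π = π₁) (hρ : ρ = ρ₁) : SqRel i₁ j₁ π₁ ρ₁ σ σ' := by
  subst hi hj hπ hρ; exact h

end basic

lemma hPaste {a₀ a₁ a₂ b₀ b₁ b₂ : B} {f₀ f₀' : a₀ ⟶ b₀} {f₁ f₁' : a₁ ⟶ b₁} {f₂ f₂' : a₂ ⟶ b₂}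
    {p p' : a₀ ⟶ a₁} {q q' : b₀ ⟶ b₁} {r r' : a₁ ⟶ a₂} {s s' : b₁ ⟶ b₂}
    {i : f₀ ≅ f₀'} {j : f₁ ≅ f₁'} {k : f₂ ≅ f₂'} {π : p ≅ p'} {ρ : q ≅ q'} {π' : r ≅ r'}
    {ρ' : s ≅ s'} {σ : f₀ ≫ q ≅ p ≫ f₁} {σ' : f₀' ≫ q' ≅ p' ≫ f₁'}
    {τ : f₁ ≫ s ≅ r ≫ f₂} {τ' : f₁' ≫ s' ≅ r' ≫ f₂'}
    (h : SqRel i j π ρ σ σ') (h' : SqRel j k π' ρ' τ τ') :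
    SqRel i k (hc π π') (hc ρ ρ') (MonBicat.hPaste σ τ) (MonBicat.hPaste σ' τ') := by
  rw [SqRel, hPaste_eq, hPaste_eq]
  simp only [Iso.trans_assoc]
  rw [hc_assoc_symm, ← Iso.trans_assoc (hc (Iso.refl p) τ), ← hc_trans, h', Iso.refl_trans]
  nth_rw 1 [← Iso.trans_refl π]
  rw [hc_trans, Iso.trans_assoc, ← Iso.trans_assoc (α_ _ _ _), ← hc_assoc, Iso.trans_assoc,
    ← Iso.trans_assoc (hc σ _), ← hc_trans, h, Iso.refl_trans]
  nth_rw 1 [← Iso.trans_refl ρ']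
  rw [hc_trans, Iso.trans_assoc, ← Iso.trans_assoc (α_ _ _ _).symm, hc_assoc_symm, Iso.trans_assoc]

lemma vPaste {a₀ a₁ b₀ b₁ c₀ c₁ : B} {f₀ f₀' : a₀ ⟶ b₀} {f₁ f₁' : a₁ ⟶ b₁} {g₀ g₀' : b₀ ⟶ c₀}
    {g₁ g₁' : b₁ ⟶ c₁} {p p' : a₀ ⟶ a₁} {q q' : b₀ ⟶ b₁} {r r' : c₀ ⟶ c₁}
    {i : f₀ ≅ f₀'} {j : f₁ ≅ f₁'} {i' : g₀ ≅ g₀'} {j' : g₁ ≅ g₁'} {π : p ≅ p'} {ρ : q ≅ q'}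
    {κ : r ≅ r'} {σ : f₀ ≫ q ≅ p ≫ f₁} {σ' : f₀' ≫ q' ≅ p' ≫ f₁'}
    {τ : g₀ ≫ r ≅ q ≫ g₁} {τ' : g₀' ≫ r' ≅ q' ≫ g₁'}
    (h : SqRel i j π ρ σ σ') (h' : SqRel i' j' ρ κ τ τ') :
    SqRel (hc i i') (hc j j') π κ (MonBicat.vPaste σ τ) (MonBicat.vPaste σ' τ') :=
  (h.transpose.hPaste h'.transpose).transpose

section assoc

lemma hPaste_assoc {a₀ a₁ a₂ a₃ b₀ b₁ b₂ b₃ : B} {f₀ : a₀ ⟶ b₀} {f₁ : a₁ ⟶ b₁} {f₂ : a₂ ⟶ b₂}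
    {f₃ : a₃ ⟶ b₃} {p : a₀ ⟶ a₁} {q : b₀ ⟶ b₁} {p' : a₁ ⟶ a₂} {q' : b₁ ⟶ b₂} {p'' : a₂ ⟶ a₃}
    {q'' : b₂ ⟶ b₃} (σ : f₀ ≫ q ≅ p ≫ f₁) (τ : f₁ ≫ q' ≅ p' ≫ f₂) (κ : f₂ ≫ q'' ≅ p'' ≫ f₃) :
    SqRel (Iso.refl _) (Iso.refl _) (α_ p p' p'') (α_ q q' q'')
      (MonBicat.hPaste (MonBicat.hPaste σ τ) κ) (MonBicat.hPaste σ (MonBicat.hPaste τ κ)) := by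
  rw [iff_hom]
  simp only [hPaste_hom, Iso.refl_hom]
  bicategory

lemma vPaste_assoc {a₀ a₁ b₀ b₁ c₀ c₁ d₀ d₁ : B} {f₀ : a₀ ⟶ b₀} {f₁ : a₁ ⟶ b₁} {g₀ : b₀ ⟶ c₀}
    {g₁ : b₁ ⟶ c₁} {h₀ : c₀ ⟶ d₀} {h₁ : c₁ ⟶ d₁} {p : a₀ ⟶ a₁} {q : b₀ ⟶ b₁} {r : c₀ ⟶ c₁}
    {s : d₀ ⟶ d₁} (σ : f₀ ≫ q ≅ p ≫ f₁) (τ : g₀ ≫ r ≅ q ≫ g₁) (κ : h₀ ≫ s ≅ r ≫ h₁) :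
    SqRel (α_ f₀ g₀ h₀) (α_ f₁ g₁ h₁) (Iso.refl _) (Iso.refl _)
      (MonBicat.vPaste (MonBicat.vPaste σ τ) κ) (MonBicat.vPaste σ (MonBicat.vPaste τ κ)) :=
  (hPaste_assoc σ.symm τ.symm κ.symm).transpose

lemma hPaste_idSq {a₀ a₁ b₀ b₁ : B} {f₀ : a₀ ⟶ b₀} {f₁ : a₁ ⟶ b₁} {p : a₀ ⟶ a₁} {q : b₀ ⟶ b₁}
    (σ : f₀ ≫ q ≅ p ≫ f₁) :
    SqRel (Iso.refl _) (Iso.refl _) (ρ_ p) (ρ_ q) (MonBicat.hPaste σ (idSq f₁)) σ := by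
  rw [iff_hom]
  simp only [hPaste_hom, Iso.refl_hom, idSq, Iso.trans_hom, Iso.symm_hom]
  bicategory

lemma idSq_hPaste {a₀ a₁ b₀ b₁ : B} {f₀ : a₀ ⟶ b₀} {f₁ : a₁ ⟶ b₁} {p : a₀ ⟶ a₁} {q : b₀ ⟶ b₁}
    (σ : f₀ ≫ q ≅ p ≫ f₁) :
    SqRel (Iso.refl _) (Iso.refl _) (λ_ p) (λ_ q) (MonBicat.hPaste (idSq f₀) σ) σ := by
  rw [iff_hom]
  simp only [hPaste_hom, Iso.refl_hom, idSq, Iso.trans_hom, Iso.symm_hom]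
  bicategory

lemma idSq {a b : B} {f f' : a ⟶ b} (i : f ≅ f') :
    SqRel i i (Iso.refl _) (Iso.refl _) (MonBicat.idSq f) (MonBicat.idSq f') := by
  rw [iff_hom]; simp [MonBicat.idSq]

end assoc

end SqRel

lemma vPaste_idSq {a b c : B} (f : a ⟶ b) (g : b ⟶ c) :
    vPaste (idSq f) (idSq g) = idSq (f ≫ g) := by
  ext
  simp only [vPaste_hom, idSq, Iso.trans_hom, Iso.symm_hom]
  bicategory

/-- Up to coherence, the two orders of pasting a 2×2 grid differ only by sliding `σ` past `τ'`, the
two squares that sit at opposite corners. -/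
lemma hPaste_vPaste {a₀ a₁ a₂ b₀ b₁ b₂ c₀ c₁ c₂ : B} {f₀ : a₀ ⟶ b₀} {f₁ : a₁ ⟶ b₁} {f₂ : a₂ ⟶ b₂}
    {g₀ : b₀ ⟶ c₀} {g₁ : b₁ ⟶ c₁} {g₂ : b₂ ⟶ c₂} {p : a₀ ⟶ a₁} {q : b₀ ⟶ b₁} {r : c₀ ⟶ c₁}
    {p' : a₁ ⟶ a₂} {q' : b₁ ⟶ b₂} {r' : c₁ ⟶ c₂}
    (σ : f₀ ≫ q ≅ p ≫ f₁) (σ' : f₁ ≫ q' ≅ p' ≫ f₂) (τ : g₀ ≫ r ≅ q ≫ g₁)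
    (τ' : g₁ ≫ r' ≅ q' ≫ g₂) :
    hPaste (vPaste σ τ) (vPaste σ' τ') = vPaste (hPaste σ σ') (hPaste τ τ') := by
  ext
  simp only [hPaste_hom, vPaste_hom]
  calc _ = 𝟙 _ ⊗≫ f₀ ◁ τ.hom ▷ r' ⊗≫ (σ.hom ▷ (g₁ ≫ r') ≫ (p ≫ f₁) ◁ τ'.hom) ⊗≫
        p ◁ σ'.hom ▷ g₂ ⊗≫ 𝟙 _ := by bicategory
    _ = 𝟙 _ ⊗≫ f₀ ◁ τ.hom ▷ r' ⊗≫ ((f₀ ≫ q) ◁ τ'.hom ≫ σ.hom ▷ (q' ≫ g₂)) ⊗≫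
        p ◁ σ'.hom ▷ g₂ ⊗≫ 𝟙 _ := by rw [whisker_exchange]
    _ = _ := by bicategory

end Squares
-- Cancelling equivalences in 2-cells, squares and cubes.
section Cancellation
open Bicategory

variable {B : Type u₁} [Bicategory.{w₁, v₁} B]

lemma IsEquiv.of_iso {a b : B} {f f' : a ⟶ b} (hf : IsEquiv f) (i : f ≅ f') : IsEquiv f' := by
  obtain ⟨g, ⟨s⟩, ⟨t⟩⟩ := hf
  exact ⟨g, ⟨i.symm ▷ᵢ g ≪≫ s⟩, ⟨g ◁ᵢ i.symm ≪≫ t⟩⟩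

/-- A 2-cell `γ` is recovered from `p ◁ γ` by whiskering with `q` and conjugating with `e`; only one
half of an equivalence is needed. -/
lemma whiskerLeft_injective_of_comp {a b c : B} {p : a ⟶ b} {q : b ⟶ a} (e : q ≫ p ≅ 𝟙 b)
    {m m' : b ⟶ c} {α β : m ⟶ m'} (h : p ◁ α = p ◁ β) : α = β := by
  have key (γ : m ⟶ m') : γ = (λ_ m).inv ≫ e.inv ▷ m ≫ (α_ q p m).hom ≫ q ◁ (p ◁ γ) ≫
      (α_ q p m').inv ≫ e.hom ▷ m' ≫ (λ_ m').hom := by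
    have h : q ◁ (p ◁ γ) = (α_ q p m).inv ≫ (q ≫ p) ◁ γ ≫ (α_ q p m').hom := by simp
    simp only [h, Category.assoc, Iso.hom_inv_id_assoc]
    rw [← whisker_exchange_assoc, ← comp_whiskerRight_assoc]
    simp
  rw [key α, key β, h]

lemma whiskerRight_injective_of_comp {a b c : B} {p : b ⟶ c} {q : c ⟶ b} (e : p ≫ q ≅ 𝟙 b)
    {m m' : a ⟶ b} {α β : m ⟶ m'} (h : α ▷ p = β ▷ p) : α = β := by
  have key (γ : m ⟶ m') : γ = (ρ_ m).inv ≫ m ◁ e.inv ≫ (α_ m p q).inv ≫ (γ ▷ p) ▷ q ≫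
      (α_ m' p q).hom ≫ m' ◁ e.hom ≫ (ρ_ m').hom := by
    have h : (γ ▷ p) ▷ q = (α_ m p q).hom ≫ γ ▷ (p ≫ q) ≫ (α_ m' p q).inv := by simp
    simp only [h, Category.assoc, Iso.inv_hom_id_assoc]
    rw [whisker_exchange_assoc, ← whiskerLeft_comp_assoc]
    simp
  rw [key α, key β, h]

lemma IsEquiv.whiskerLeft_injective {a b c : B} {p : a ⟶ b} (hp : IsEquiv p) {m m' : b ⟶ c}
    {α β : m ≅ m'} (h : p ◁ᵢ α = p ◁ᵢ β) : α = β := by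
  obtain ⟨q, -, ⟨e⟩⟩ := hp
  exact Iso.ext (whiskerLeft_injective_of_comp e (congrArg Iso.hom h))

lemma IsEquiv.whiskerRight_injective {a b c : B} {p : b ⟶ c} (hp : IsEquiv p) {m m' : a ⟶ b}
    {α β : m ≅ m'} (h : α ▷ᵢ p = β ▷ᵢ p) : α = β := by
  obtain ⟨q, ⟨e⟩, -⟩ := hp
  exact Iso.ext (whiskerRight_injective_of_comp e (congrArg Iso.hom h))

/-- No triangle identity relates `e` to the rest. Instead both sides are whiskered with `q`:
conjugation by `e` turns `q ◁ (p ◁ γ)` into `γ`, which is how `cancelLeft` was defined, and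
whiskering with `q` is faithful since `q` is an equivalence too. -/
lemma whiskerLeft_cancelLeft {a b c : B} {p : a ⟶ b} {q : b ⟶ a} (e : q ≫ p ≅ 𝟙 b)
    (hp : IsEquiv p) {m m' : b ⟶ c} (σ : p ≫ m ≅ p ≫ m') : p ◁ᵢ cancelLeft e σ = σ := by
  -- The left quasi-inverse of `q` is `p`: with `q'` a quasi-inverse of `p`, one has `q ≅ q ≫ p ≫ q'
  -- ≅ q'`.
  have hq : ∃ r : a ⟶ b, Nonempty (r ≫ q ≅ 𝟙 a) := by
    obtain ⟨q', ⟨s⟩, ⟨t⟩⟩ := hp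
    exact ⟨p, ⟨p ◁ᵢ ((ρ_ q).symm ≪≫ q ◁ᵢ s.symm ≪≫ (α_ _ _ _).symm ≪≫ e ▷ᵢ q' ≪≫ λ_ q') ≪≫ s⟩⟩
  obtain ⟨r, ⟨e'⟩⟩ := hq
  ext
  apply whiskerLeft_injective_of_comp e'
  have key (γ : m ⟶ m') : q ◁ (p ◁ γ) = (α_ q p m).inv ≫ e.hom ▷ m ≫ (λ_ m).hom ≫ γ ≫ (λ_ m').inv ≫
      e.inv ▷ m' ≫ (α_ q p m').hom := by
    have h : q ◁ (p ◁ γ) = (α_ q p m).inv ≫ (q ≫ p) ◁ γ ≫ (α_ q p m').hom := by simp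
    have h' : (q ≫ p) ◁ γ = e.hom ▷ m ≫ 𝟙 b ◁ γ ≫ e.inv ▷ m' := by
      rw [whisker_exchange, ← comp_whiskerRight_assoc]; simp
    rw [h, h']; simp
  simp only [whiskerLeftIso_hom]
  rw [key]
  simp [cancelLeft, ← comp_whiskerRight_assoc]

lemma hc_left_injective {a b c : B} {f f' : a ⟶ b} {g g' : b ⟶ c} {π π' : f ≅ f'} {ρ : g ≅ g'}
    (hg : IsEquiv g) (h : hc π ρ = hc π' ρ) : π = π' := by
  apply hg.whiskerRight_injective
  ext
  simpa [hc, cancel_mono, cancel_epi] using congrArg Iso.hom h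

lemma hc_right_injective {a b c : B} {f f' : a ⟶ b} {g g' : b ⟶ c} {π : f ≅ f'} {ρ ρ' : g ≅ g'}
    (hf : IsEquiv f') (h : hc π ρ = hc π ρ') : ρ = ρ' := by
  apply hf.whiskerLeft_injective
  ext
  simpa [hc, cancel_mono, cancel_epi] using congrArg Iso.hom h

namespace SqRel

section
variable {a₀ a₁ b₀ b₁ : B} {f₀ f₀' : a₀ ⟶ b₀} {f₁ f₁' : a₁ ⟶ b₁} {p p' : a₀ ⟶ a₁}
  {q q' : b₀ ⟶ b₁} {i i' : f₀ ≅ f₀'} {j j' : f₁ ≅ f₁'} {π π' : p ≅ p'} {ρ ρ' : q ≅ q'}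
  {σ : f₀ ≫ q ≅ p ≫ f₁} {σ' : f₀' ≫ q' ≅ p' ≫ f₁'}

lemma right_unique (h : SqRel i j π ρ σ σ') {σ'' : f₀' ≫ q' ≅ p' ≫ f₁'}
    (h' : SqRel i j π ρ σ σ'') : σ' = σ'' := by
  rw [SqRel] at h h'
  rw [h] at h'
  simpa only [Iso.symm_self_id_assoc] using congrArg (fun x => (hc i ρ).symm ≪≫ x) h'

lemma ρ_unique (h : SqRel i j π ρ σ σ') (h' : SqRel i j π ρ' σ σ') (hf : IsEquiv f₀) : ρ = ρ' := by
  rw [SqRel] at h h'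
  rw [h] at h'
  refine hc_right_injective (hf.of_iso i) (π := i) ?_
  simpa using congrArg (fun x => x ≪≫ σ'.symm) h'

lemma i_unique (h : SqRel i j π ρ σ σ') (h' : SqRel i' j π ρ σ σ') (hq : IsEquiv q) : i = i' := by
  rw [SqRel] at h h'
  rw [h] at h'
  refine hc_left_injective hq (ρ := ρ) ?_
  simpa using congrArg (fun x => x ≪≫ σ'.symm) h'

lemma π_unique (h : SqRel i j π ρ σ σ') (h' : SqRel i j π' ρ σ σ') (hf : IsEquiv f₁) : π = π' :=
  i_unique h.transpose h'.transpose hf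

lemma j_unique (h : SqRel i j π ρ σ σ') (h' : SqRel i j' π ρ σ σ') (hp : IsEquiv p) : j = j' :=
  ρ_unique h.transpose h'.transpose hp

lemma exists_right (i : f₀ ≅ f₀') (j : f₁ ≅ f₁') (π : p ≅ p') (ρ : q ≅ q') (σ : f₀ ≫ q ≅ p ≫ f₁) :
    ∃ σ', SqRel i j π ρ σ σ' := ⟨(hc i ρ).symm ≪≫ σ ≪≫ hc π j, by rw [SqRel, Iso.self_symm_id_assoc]⟩
end

section
variable {a₀ a₁ b₀ b₁ c₀ c₁ : B} {f₀ f₀' : a₀ ⟶ b₀} {f₁ f₁' : a₁ ⟶ b₁} {g₀ g₀' : b₀ ⟶ c₀}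
    {g₁ g₁' : b₁ ⟶ c₁} {p p' : a₀ ⟶ a₁} {q q' : b₀ ⟶ b₁} {r r' : c₀ ⟶ c₁}
    {i : f₀ ≅ f₀'} {j : f₁ ≅ f₁'} {i' : g₀ ≅ g₀'} {j' : g₁ ≅ g₁'} {π : p ≅ p'} {ρ : q ≅ q'}
    {κ : r ≅ r'} {σ : f₀ ≫ q ≅ p ≫ f₁} {σ' : f₀' ≫ q' ≅ p' ≫ f₁'}
    {τ : g₀ ≫ r ≅ q ≫ g₁} {τ' : g₀' ≫ r' ≅ q' ≫ g₁'}

/-- There is exactly one square `τ''` completing the second cube, and pasting it below `σ'` gives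
the same result as `τ'`. Pasting below `σ'` is injective because `f₀`, hence `f₀'`, is an
equivalence. -/
lemma vPaste_cancel_left (h : SqRel (hc i i') (hc j j') π κ (MonBicat.vPaste σ τ)
    (MonBicat.vPaste σ' τ')) (h' : SqRel i j π ρ σ σ') (hf : IsEquiv f₀) :
    SqRel i' j' ρ κ τ τ' := by
  obtain ⟨τ'', h''⟩ := exists_right i' j' ρ κ τ
  have := (h'.vPaste h'').right_unique h
  suffices τ'' = τ' from this ▸ h''
  apply (hf.of_iso i).whiskerLeft_injective
  rw [vPaste_eq, vPaste_eq] at this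
  ext
  simpa [cancel_mono, cancel_epi] using congrArg Iso.hom this

lemma vPaste_cancel_right (h : SqRel (hc i i') (hc j j') π κ (MonBicat.vPaste σ τ)
    (MonBicat.vPaste σ' τ')) (h' : SqRel i' j' ρ κ τ τ') (hg : IsEquiv g₁) :
    SqRel i j π ρ σ σ' := by
  obtain ⟨σ'', h''⟩ := exists_right i j π ρ σ
  have := (h''.vPaste h').right_unique h
  suffices σ'' = σ' from this ▸ h''
  apply (hg.of_iso j').whiskerRight_injective
  rw [vPaste_eq, vPaste_eq] at this
  ext
  simpa [cancel_mono, cancel_epi] using congrArg Iso.hom this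

lemma hPaste_cancel_left {a₀ a₁ a₂ b₀ b₁ b₂ : B} {f₀ f₀' : a₀ ⟶ b₀} {f₁ f₁' : a₁ ⟶ b₁}
    {f₂ f₂' : a₂ ⟶ b₂} {p p' : a₀ ⟶ a₁} {q q' : b₀ ⟶ b₁} {r r' : a₁ ⟶ a₂} {s s' : b₁ ⟶ b₂}
    {i : f₀ ≅ f₀'} {j : f₁ ≅ f₁'} {k : f₂ ≅ f₂'} {π : p ≅ p'} {ρ : q ≅ q'} {π' : r ≅ r'}
    {ρ' : s ≅ s'} {σ : f₀ ≫ q ≅ p ≫ f₁} {σ' : f₀' ≫ q' ≅ p' ≫ f₁'}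
    {τ : f₁ ≫ s ≅ r ≫ f₂} {τ' : f₁' ≫ s' ≅ r' ≫ f₂'}
    (h : SqRel i k (hc π π') (hc ρ ρ') (MonBicat.hPaste σ τ) (MonBicat.hPaste σ' τ'))
    (h' : SqRel i j π ρ σ σ') (hp : IsEquiv p) : SqRel j k π' ρ' τ τ' :=
  (vPaste_cancel_left (σ := σ.symm) (σ' := σ'.symm) (τ := τ.symm) (τ' := τ'.symm)
    h.transpose h'.transpose hp).transpose

end
end SqRel

end Cancellation
-- Squares under pseudofunctors and pseudonatural transformations.
section Map
open Bicategory

/-- Two ways to express the commutativity of a cube. -/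
lemma SqRel.cube_iff {B : Type u₁} [Bicategory.{w₁, v₁} B] {a₀ a₁ b₀ b₁ a₀' a₁' b₀' b₁' : B}
    {f₀ : a₀ ⟶ b₀} {f₁ : a₁ ⟶ b₁} {p : a₀ ⟶ a₁} {q : b₀ ⟶ b₁}
    {f₀' : a₀' ⟶ b₀'} {f₁' : a₁' ⟶ b₁'} {p' : a₀' ⟶ a₁'} {q' : b₀' ⟶ b₁'}
    {x₀ : a₀ ⟶ a₀'} {x₁ : a₁ ⟶ a₁'} {y₀ : b₀ ⟶ b₀'} {y₁ : b₁ ⟶ b₁'}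
    {σ : f₀ ≫ q ≅ p ≫ f₁} {σ' : f₀' ≫ q' ≅ p' ≫ f₁'} {l₀ : f₀ ≫ y₀ ≅ x₀ ≫ f₀'}
    {l₁ : f₁ ≫ y₁ ≅ x₁ ≫ f₁'} {m : p ≫ x₁ ≅ x₀ ≫ p'} {n : q ≫ y₁ ≅ y₀ ≫ q'} :
    SqRel σ σ' (Iso.refl _) (Iso.refl _) (MonBicat.vPaste l₀ n) (MonBicat.vPaste m l₁) ↔
      SqRel (Iso.refl _) (Iso.refl _) m n (MonBicat.hPaste σ l₁) (MonBicat.hPaste l₀ σ') := by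
  rw [SqRel.iff_hom, SqRel.iff_hom]
  simp only [vPaste_hom, hPaste_hom, Iso.refl_hom, whiskerLeft_id, id_whiskerRight,
    Category.id_comp, Category.comp_id, Category.assoc]
  constructor
  · intro h
    have h' := congrArg (fun z => (α_ _ _ _).inv ≫ z ≫ (α_ _ _ _).inv) h
    simp only [Category.assoc, Iso.inv_hom_id_assoc, Iso.hom_inv_id, Category.comp_id] at h'
    exact h'.symm
  · intro h
    have h' := congrArg (fun z => (α_ _ _ _).hom ≫ z ≫ (α_ _ _ _).hom) h
    simp only [Category.assoc, Iso.hom_inv_id_assoc, Iso.inv_hom_id, Category.comp_id] at h'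
    exact h'.symm

variable {B : Type u₁} [Bicategory.{w₁, v₁} B] {C : Type u₂} [Bicategory.{w₂, v₂} C]

/-- The image under a pseudofunctor of a square filled with an invertible 2-cell. -/
def mapSq (F : B ⥤ᵖ C) {a₀ a₁ b₀ b₁ : B} {f₀ : a₀ ⟶ b₀} {f₁ : a₁ ⟶ b₁} {p : a₀ ⟶ a₁}
    {q : b₀ ⟶ b₁} (σ : f₀ ≫ q ≅ p ≫ f₁) : F.map f₀ ≫ F.map q ≅ F.map p ≫ F.map f₁ :=
  (F.mapComp f₀ q).symm ≪≫ F.map₂Iso σ ≪≫ F.mapComp p f₁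

lemma mapSq_symm (F : B ⥤ᵖ C) {a₀ a₁ b₀ b₁ : B} {f₀ : a₀ ⟶ b₀} {f₁ : a₁ ⟶ b₁} {p : a₀ ⟶ a₁}
    {q : b₀ ⟶ b₁} (σ : f₀ ≫ q ≅ p ≫ f₁) : mapSq F σ.symm = (mapSq F σ).symm := by
  rw [mapSq, mapSq, Iso.trans_symm, Iso.trans_symm, Iso.trans_assoc]; rfl

lemma mapSq_hom (F : B ⥤ᵖ C) {a₀ a₁ b₀ b₁ : B} {f₀ : a₀ ⟶ b₀} {f₁ : a₁ ⟶ b₁} {p : a₀ ⟶ a₁}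
    {q : b₀ ⟶ b₁} (σ : f₀ ≫ q ≅ p ≫ f₁) :
    (mapSq F σ).hom = (F.mapComp f₀ q).inv ≫ F.map₂ σ.hom ≫ (F.mapComp p f₁).hom := rfl

lemma map₂Iso_refl (F : B ⥤ᵖ C) {a b : B} (f : a ⟶ b) :
    F.map₂Iso (Iso.refl f) = Iso.refl (F.map f) := Iso.ext (F.map₂_id f)

lemma map₂Iso_trans (F : B ⥤ᵖ C) {a b : B} {f g h : a ⟶ b} (x : f ≅ g) (y : g ≅ h) :
    F.map₂Iso (x ≪≫ y) = F.map₂Iso x ≪≫ F.map₂Iso y := Iso.ext (F.map₂_comp _ _)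

lemma map₂Iso_symm (F : B ⥤ᵖ C) {a b : B} {f g : a ⟶ b} (x : f ≅ g) :
    F.map₂Iso x.symm = (F.map₂Iso x).symm := rfl

lemma map₂Iso_whiskerLeft (F : B ⥤ᵖ C) {a b c : B} (f : a ⟶ b) {g g' : b ⟶ c}
    (ρ : g ≅ g') :
    F.map₂Iso (f ◁ᵢ ρ) = F.mapComp f g ≪≫ (F.map f ◁ᵢ F.map₂Iso ρ) ≪≫
      (F.mapComp f g').symm := Iso.ext (F.map₂_whisker_left _ _)

lemma map₂Iso_whiskerRight (F : B ⥤ᵖ C) {a b c : B} {f f' : a ⟶ b} (π : f ≅ f') (g : b ⟶ c) :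
    F.map₂Iso (π ▷ᵢ g) = F.mapComp f g ≪≫ (F.map₂Iso π ▷ᵢ F.map g) ≪≫
      (F.mapComp f' g).symm := Iso.ext (F.map₂_whisker_right _ _)

lemma map₂Iso_associator (F : B ⥤ᵖ C) {a b c d : B} (f : a ⟶ b) (g : b ⟶ c) (h : c ⟶ d) :
    F.map₂Iso (α_ f g h) = F.mapComp (f ≫ g) h ≪≫ hc (F.mapComp f g) (Iso.refl _) ≪≫
      α_ (F.map f) (F.map g) (F.map h) ≪≫ hc (Iso.refl _) (F.mapComp g h).symm ≪≫
        (F.mapComp f (g ≫ h)).symm := by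
  rw [hc_refl_left, hc_refl_right]
  exact Iso.ext (F.map₂_associator _ _ _)

lemma map₂Iso_leftUnitor (F : B ⥤ᵖ C) {a b : B} (f : a ⟶ b) :
    F.map₂Iso (λ_ f) = F.mapComp (𝟙 a) f ≪≫ hc (F.mapId a) (Iso.refl _) ≪≫ λ_ (F.map f) := by
  rw [hc_refl_right]
  exact Iso.ext (F.map₂_left_unitor _)

lemma map₂Iso_rightUnitor (F : B ⥤ᵖ C) {a b : B} (f : a ⟶ b) :
    F.map₂Iso (ρ_ f) = F.mapComp f (𝟙 b) ≪≫ hc (Iso.refl _) (F.mapId b) ≪≫ ρ_ (F.map f) := by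
  rw [hc_refl_left]
  exact Iso.ext (F.map₂_right_unitor _)

lemma map₂Iso_hc (F : B ⥤ᵖ C) {a b c : B} {f f' : a ⟶ b} {g g' : b ⟶ c} (π : f ≅ f')
    (ρ : g ≅ g') :
    F.map₂Iso (hc π ρ) = F.mapComp f g ≪≫ hc (F.map₂Iso π) (F.map₂Iso ρ) ≪≫
      (F.mapComp f' g').symm := by
  rw [hc, map₂Iso_trans, map₂Iso_whiskerLeft, map₂Iso_whiskerRight]
  simp only [Iso.trans_assoc, Iso.symm_self_id_assoc, hc]

lemma SqRel.map (F : B ⥤ᵖ C) {a₀ a₁ b₀ b₁ : B} {f₀ f₀' : a₀ ⟶ b₀} {f₁ f₁' : a₁ ⟶ b₁}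
    {p p' : a₀ ⟶ a₁} {q q' : b₀ ⟶ b₁} {i : f₀ ≅ f₀'} {j : f₁ ≅ f₁'} {π : p ≅ p'} {ρ : q ≅ q'}
    {σ : f₀ ≫ q ≅ p ≫ f₁} {σ' : f₀' ≫ q' ≅ p' ≫ f₁'} (h : SqRel i j π ρ σ σ') :
    SqRel (F.map₂Iso i) (F.map₂Iso j) (F.map₂Iso π) (F.map₂Iso ρ) (mapSq F σ) (mapSq F σ') := by
  have h' := congrArg (fun x => (F.mapComp _ _).symm ≪≫ F.map₂Iso x ≪≫ F.mapComp _ _) h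
  simp only [map₂Iso_trans, map₂Iso_hc, Iso.trans_assoc, Iso.symm_self_id, Iso.trans_refl,
    Iso.symm_self_id_assoc] at h'
  simpa only [SqRel, mapSq, Iso.trans_assoc] using h'

lemma hc_trans_refl {a b c : B} {f f' f'' : a ⟶ b} (x : f ≅ f') (y : f' ≅ f'') (g : b ⟶ c) :
    hc (x ≪≫ y) (Iso.refl g) = hc x (Iso.refl g) ≪≫ hc y (Iso.refl g) := by
  rw [← hc_trans, Iso.trans_refl]

lemma hc_refl_trans {a b c : B} {g g' g'' : b ⟶ c} (f : a ⟶ b) (x : g ≅ g') (y : g' ≅ g'') :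
    hc (Iso.refl f) (x ≪≫ y) = hc (Iso.refl f) x ≪≫ hc (Iso.refl f) y := by
  rw [← hc_trans, Iso.trans_refl]

lemma hc_symm_self {a b c : B} {f f' : a ⟶ b} (x : f ≅ f') (g : b ⟶ c) :
    hc x.symm (Iso.refl g) ≪≫ hc x (Iso.refl g) = Iso.refl _ := by
  rw [← hc_trans]; simp

lemma mapSq_hPaste (F : B ⥤ᵖ C) {a₀ a₁ a₂ b₀ b₁ b₂ : B} {f₀ : a₀ ⟶ b₀} {f₁ : a₁ ⟶ b₁}
    {f₂ : a₂ ⟶ b₂} {p : a₀ ⟶ a₁} {q : b₀ ⟶ b₁} {p' : a₁ ⟶ a₂} {q' : b₁ ⟶ b₂}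
    (σ : f₀ ≫ q ≅ p ≫ f₁) (τ : f₁ ≫ q' ≅ p' ≫ f₂) :
    SqRel (Iso.refl _) (Iso.refl _) (F.mapComp p p') (F.mapComp q q')
      (mapSq F (hPaste σ τ)) (hPaste (mapSq F σ) (mapSq F τ)) := by
  simp only [SqRel, mapSq, hPaste_eq, map₂Iso_trans, map₂Iso_hc, map₂Iso_symm, map₂Iso_associator,
    map₂Iso_refl, Iso.trans_symm, Iso.symm_symm_eq, hc_symm, Iso.refl_symm, Iso.trans_assoc,
    Iso.symm_self_id_assoc, hc_trans_refl, hc_refl_trans, hc_symm_self,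
    Iso.trans_refl]

lemma mapSq_vPaste (F : B ⥤ᵖ C) {a₀ a₁ b₀ b₁ c₀ c₁ : B} {f₀ : a₀ ⟶ b₀} {f₁ : a₁ ⟶ b₁}
    {g₀ : b₀ ⟶ c₀} {g₁ : b₁ ⟶ c₁} {p : a₀ ⟶ a₁} {q : b₀ ⟶ b₁} {r : c₀ ⟶ c₁}
    (σ : f₀ ≫ q ≅ p ≫ f₁) (τ : g₀ ≫ r ≅ q ≫ g₁) :
    SqRel (F.mapComp f₀ g₀) (F.mapComp f₁ g₁) (Iso.refl _) (Iso.refl _)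
      (mapSq F (vPaste σ τ)) (vPaste (mapSq F σ) (mapSq F τ)) := by
  have h := (mapSq_hPaste F σ.symm τ.symm).transpose
  rw [← mapSq_symm, mapSq_symm F σ, mapSq_symm F τ] at h
  exact h

lemma mapSq_idSq (F : B ⥤ᵖ C) {a b : B} (f : a ⟶ b) :
    SqRel (Iso.refl _) (Iso.refl _) (F.mapId a) (F.mapId b) (mapSq F (idSq f))
      (idSq (F.map f)) := by
  simp only [SqRel, mapSq, idSq, map₂Iso_trans, map₂Iso_symm, map₂Iso_leftUnitor, Iso.trans_symm,
    map₂Iso_rightUnitor, Iso.trans_assoc, Iso.symm_self_id_assoc, hc_symm,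
    Iso.refl_symm, Iso.symm_self_id, Iso.trans_refl, hc_symm_self]

variable {F G : B ⥤ᵖ C} (t : Pseudofunctor.StrongTrans F G)

lemma strongTrans_comp {a b c : B} (f : a ⟶ b) (g : b ⟶ c) :
    SqRel (F.mapComp f g) (G.mapComp f g) (Iso.refl _) (Iso.refl _) (t.naturality (f ≫ g))
      (vPaste (t.naturality f) (t.naturality g)) := by
  rw [SqRel.iff_hom]
  simp only [vPaste_hom, Iso.refl_hom, whiskerLeft_id, id_whiskerRight, Category.id_comp]
  exact t.naturality_comp f g

lemma strongTrans_id (a : B) :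
    SqRel (F.mapId a) (G.mapId a) (Iso.refl _) (Iso.refl _) (t.naturality (𝟙 a))
      (idSq (t.app a)).symm := by
  rw [SqRel.iff_hom]
  simp only [idSq, Iso.refl_hom, whiskerLeft_id, id_whiskerRight, Category.id_comp]
  exact t.naturality_id a

lemma strongTrans_map₂ {a b : B} {f g : a ⟶ b} (i : f ≅ g) :
    SqRel (F.map₂Iso i) (G.map₂Iso i) (Iso.refl _) (Iso.refl _) (t.naturality f)
      (t.naturality g) := by
  rw [SqRel.iff_hom]
  simp only [Iso.refl_hom, whiskerLeft_id, id_whiskerRight, Category.id_comp]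
  exact (t.naturality_naturality i.hom).symm

/-- The axioms for composites and for 2-cells compare the naturality squares of `f₀ ≫ q` and `p ≫
f₁` through `σ`; `cube_iff` reads this comparison as an equality of horizontal pastings. -/
lemma strongTrans_hPaste {a₀ a₁ b₀ b₁ : B} {f₀ : a₀ ⟶ b₀} {f₁ : a₁ ⟶ b₁} {p : a₀ ⟶ a₁}
    {q : b₀ ⟶ b₁} (σ : f₀ ≫ q ≅ p ≫ f₁) :
    SqRel (Iso.refl _) (Iso.refl _) (t.naturality p) (t.naturality q)
      (hPaste (mapSq F σ) (t.naturality f₁)) (hPaste (t.naturality f₀) (mapSq G σ)) := by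
  have h := (strongTrans_comp t f₀ q).symm.trans
    ((strongTrans_map₂ t σ).trans (strongTrans_comp t p f₁))
  exact SqRel.cube_iff.1 (h.congr (by simp only [mapSq]) rfl (by simp) (by simp))

end Map

/-! ### Tensor products of squares. -/

section Tensor
open Bicategory
open scoped CategoryTheory.Prod
variable {E : Type u} [Bicategory.{w, v} E] [PreMonoidalBicategory E]

section
variable {X₀ X₁ X₀' X₁' Y₀ Y₁ Y₀' Y₁' : E}
    {f : X₀ ⟶ X₀'} {f' : X₁ ⟶ X₁'} {p : X₀ ⟶ X₁} {q : X₀' ⟶ X₁'}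
    {g : Y₀ ⟶ Y₀'} {g' : Y₁ ⟶ Y₁'} {r : Y₀ ⟶ Y₁} {s : Y₀' ⟶ Y₁'}

/-- The tensor product is a pseudofunctor on `E × E`, so the results on `mapSq` apply to pairs of
squares. -/
lemma tSq_eq_mapSq (σ : f ≫ q ≅ p ≫ f') (τ : g ≫ s ≅ r ≫ g') :
    tSq σ τ = mapSq TensorBicategory.tensor (f₀ := f ×ₘ g) (q := q ×ₘ s) (p := p ×ₘ r)
      (f₁ := f' ×ₘ g') (Iso.prod σ τ) := rfl

end
lemma tSq_symm {X₀ X₁ X₀' X₁' Y₀ Y₁ Y₀' Y₁' : E}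
    {f : X₀ ⟶ X₀'} {f' : X₁ ⟶ X₁'} {p : X₀ ⟶ X₁} {q : X₀' ⟶ X₁'}
    {g : Y₀ ⟶ Y₀'} {g' : Y₁ ⟶ Y₁'} {r : Y₀ ⟶ Y₁} {s : Y₀' ⟶ Y₁'}
    (σ : f ≫ q ≅ p ≫ f') (τ : g ≫ s ≅ r ≫ g') : tSq σ.symm τ.symm = (tSq σ τ).symm :=
  mapSq_symm TensorBicategory.tensor (f₀ := f ×ₘ g) (q := q ×ₘ s) (p := p ×ₘ r)
      (f₁ := f' ×ₘ g') (Iso.prod σ τ)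

lemma SqRel.tSq {X₀ X₁ X₀' X₁' Y₀ Y₁ Y₀' Y₁' : E}
    {f f₁ : X₀ ⟶ X₀'} {f' f₁' : X₁ ⟶ X₁'} {p p₁ : X₀ ⟶ X₁} {q q₁ : X₀' ⟶ X₁'}
    {g g₁ : Y₀ ⟶ Y₀'} {g' g₁' : Y₁ ⟶ Y₁'} {r r₁ : Y₀ ⟶ Y₁} {s s₁ : Y₀' ⟶ Y₁'}
    {σ : f ≫ q ≅ p ≫ f'} {τ : g ≫ s ≅ r ≫ g'} {σ₁ : f₁ ≫ q₁ ≅ p₁ ≫ f₁'}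
    {τ₁ : g₁ ≫ s₁ ≅ r₁ ≫ g₁'}
    {i : f ≅ f₁} {j : f' ≅ f₁'} {π : p ≅ p₁} {ρ : q ≅ q₁}
    {i' : g ≅ g₁} {j' : g' ≅ g₁'} {π' : r ≅ r₁} {ρ' : s ≅ s₁}
    (h : SqRel i j π ρ σ σ₁) (h' : SqRel i' j' π' ρ' τ τ₁) :
    SqRel (tIso i i') (tIso j j') (tIso π π') (tIso ρ ρ') (tSq σ τ) (tSq σ₁ τ₁) := by
  refine SqRel.map TensorBicategory.tensor (i := Iso.prod i i') (j := Iso.prod j j')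
    (π := Iso.prod π π') (ρ := Iso.prod ρ ρ')
    (f₀ := f ×ₘ g) (q := q ×ₘ s) (p := p ×ₘ r) (f₁ := f' ×ₘ g') (f₀' := f₁ ×ₘ g₁) (q' := q₁ ×ₘ s₁)
    (p' := p₁ ×ₘ r₁) (f₁' := f₁' ×ₘ g₁') (σ := Iso.prod σ τ) (σ' := Iso.prod σ₁ τ₁) ?_
  apply Iso.ext
  exact Prod.ext (congrArg Iso.hom h) (congrArg Iso.hom h')

lemma tSq_hPaste {X₀ X₁ X₂ X₀' X₁' X₂' Y₀ Y₁ Y₂ Y₀' Y₁' Y₂' : E}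
    {f₀ : X₀ ⟶ X₀'} {f₁ : X₁ ⟶ X₁'} {f₂ : X₂ ⟶ X₂'} {p : X₀ ⟶ X₁} {q : X₀' ⟶ X₁'}
    {p' : X₁ ⟶ X₂} {q' : X₁' ⟶ X₂'}
    {g₀ : Y₀ ⟶ Y₀'} {g₁ : Y₁ ⟶ Y₁'} {g₂ : Y₂ ⟶ Y₂'} {r : Y₀ ⟶ Y₁} {s : Y₀' ⟶ Y₁'}
    {r' : Y₁ ⟶ Y₂} {s' : Y₁' ⟶ Y₂'}
    (σ : f₀ ≫ q ≅ p ≫ f₁) (σ' : f₁ ≫ q' ≅ p' ≫ f₂)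
    (τ : g₀ ≫ s ≅ r ≫ g₁) (τ' : g₁ ≫ s' ≅ r' ≫ g₂) :
    SqRel (Iso.refl _) (Iso.refl _) (tComp p p' r r') (tComp q q' s s')
      (tSq (hPaste σ σ') (hPaste τ τ')) (hPaste (tSq σ τ) (tSq σ' τ')) :=
  mapSq_hPaste TensorBicategory.tensor (f₀ := f₀ ×ₘ g₀) (q := q ×ₘ s) (p := p ×ₘ r)
    (f₁ := f₁ ×ₘ g₁) (q' := q' ×ₘ s') (p' := p' ×ₘ r') (f₂ := f₂ ×ₘ g₂) (Iso.prod σ τ)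
    (Iso.prod σ' τ')

lemma tSq_vPaste {X₀ X₁ X₀' X₁' X₀'' X₁'' Y₀ Y₁ Y₀' Y₁' Y₀'' Y₁'' : E}
    {f₀ : X₀ ⟶ X₀'} {f₁ : X₁ ⟶ X₁'} {h₀ : X₀' ⟶ X₀''} {h₁ : X₁' ⟶ X₁''} {p : X₀ ⟶ X₁}
    {q : X₀' ⟶ X₁'} {p' : X₀'' ⟶ X₁''}
    {g₀ : Y₀ ⟶ Y₀'} {g₁ : Y₁ ⟶ Y₁'} {k₀ : Y₀' ⟶ Y₀''} {k₁ : Y₁' ⟶ Y₁''} {r : Y₀ ⟶ Y₁}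
    {s : Y₀' ⟶ Y₁'} {r' : Y₀'' ⟶ Y₁''}
    (σ : f₀ ≫ q ≅ p ≫ f₁) (σ' : h₀ ≫ p' ≅ q ≫ h₁)
    (τ : g₀ ≫ s ≅ r ≫ g₁) (τ' : k₀ ≫ r' ≅ s ≫ k₁) :
    SqRel (tComp f₀ h₀ g₀ k₀) (tComp f₁ h₁ g₁ k₁) (Iso.refl _) (Iso.refl _)
      (tSq (vPaste σ σ') (vPaste τ τ')) (vPaste (tSq σ τ) (tSq σ' τ')) :=
  mapSq_vPaste TensorBicategory.tensor (f₀ := f₀ ×ₘ g₀) (q := q ×ₘ s) (p := p ×ₘ r)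
    (f₁ := f₁ ×ₘ g₁) (g₀ := h₀ ×ₘ k₀) (g₁ := h₁ ×ₘ k₁) (r := p' ×ₘ r') (Iso.prod σ τ)
    (Iso.prod σ' τ')

lemma tSq_idSq {X X' Y Y' : E} (f : X ⟶ X') (g : Y ⟶ Y') :
    SqRel (Iso.refl _) (Iso.refl _) (tId X Y) (tId X' Y') (tSq (idSq f) (idSq g))
      (idSq (f ⊠₁ g)) :=
  mapSq_idSq TensorBicategory.tensor (f ×ₘ g)

@[simp] lemma tIso_refl {X X' Y Y' : E} (f : X ⟶ X') (g : Y ⟶ Y') :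
    tIso (Iso.refl f) (Iso.refl g) = Iso.refl (f ⊠₁ g) := by
  exact Iso.ext (TensorBicategory.tensor.map₂_id (f ×ₘ g))

lemma tIso_trans {X X' Y Y' : E} {f f' f'' : X ⟶ X'} {g g' g'' : Y ⟶ Y'} (x : f ≅ f')
    (x' : f' ≅ f'') (y : g ≅ g') (y' : g' ≅ g'') :
    tIso (x ≪≫ x') (y ≪≫ y') = tIso x y ≪≫ tIso x' y' := by
  exact Iso.ext (TensorBicategory.tensor.map₂_comp (f := f ×ₘ g) (g := f' ×ₘ g') (h := f'' ×ₘ g'')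
    (x.hom ×ₘ y.hom) (x'.hom ×ₘ y'.hom))

@[simp] lemma tIso_symm {X X' Y Y' : E} {f f' : X ⟶ X'} {g g' : Y ⟶ Y'} (x : f ≅ f')
    (y : g ≅ g') : (tIso x y).symm = tIso x.symm y.symm := rfl

end Tensor
-- Whiskering of squares by objects, and naturality of the associator and unitors on squares.
section
open Bicategory

variable {B : Type u₁} [Bicategory.{w₁, v₁} B] {C : Type u₂} [Bicategory.{w₂, v₂} C]
  {D : Type u₃} [Bicategory.{w₃, v₃} D]

lemma mapSq_comp (F : B ⥤ᵖ C) (G : C ⥤ᵖ D) {a₀ a₁ b₀ b₁ : B} {f₀ : a₀ ⟶ b₀} {f₁ : a₁ ⟶ b₁}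
    {p : a₀ ⟶ a₁} {q : b₀ ⟶ b₁} (σ : f₀ ≫ q ≅ p ≫ f₁) :
    mapSq (F.comp G) σ = mapSq G (mapSq F σ) := by
  apply Iso.ext
  change ((G.mapComp _ _).inv ≫ G.map₂ (F.mapComp f₀ q).inv) ≫ G.map₂ (F.map₂ σ.hom) ≫
    G.map₂ (F.mapComp p f₁).hom ≫ (G.mapComp _ _).hom = (G.mapComp _ _).inv ≫
      G.map₂ ((F.mapComp f₀ q).inv ≫ F.map₂ σ.hom ≫ (F.mapComp p f₁).hom) ≫ (G.mapComp _ _).hom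
  rw [G.map₂_comp, G.map₂_comp]
  simp only [Category.assoc]

lemma mapSq_id {a₀ a₁ b₀ b₁ : B} {f₀ : a₀ ⟶ b₀} {f₁ : a₁ ⟶ b₁}
    {p : a₀ ⟶ a₁} {q : b₀ ⟶ b₁} (σ : f₀ ≫ q ≅ p ≫ f₁) :
    mapSq (Pseudofunctor.id B) σ = σ := by
  apply Iso.ext
  change 𝟙 _ ≫ σ.hom ≫ 𝟙 _ = σ.hom
  simp

lemma idSq_id (X : B) : idSq (𝟙 X) = Iso.refl _ := by
  ext; simp [idSq]

end

section
open Bicategory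
open scoped CategoryTheory.Prod
variable {E : Type u} [Bicategory.{w, v} E] [PreMonoidalBicategory E]

lemma mapSq_tensorLeft (X : E) {a₀ a₁ b₀ b₁ : E} {f₀ : a₀ ⟶ b₀} {f₁ : a₁ ⟶ b₁} {p : a₀ ⟶ a₁}
    {q : b₀ ⟶ b₁} (σ : f₀ ≫ q ≅ p ≫ f₁) :
    mapSq (tensorLeft X) σ = tSq (idSq (𝟙 X)) σ := by
  rw [mapSq_comp, tSq_eq_mapSq]
  congr 1
  apply Iso.ext
  refine Prod.ext ?_ ?_
  · rw [idSq_id]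
    change (ρ_ (𝟙 X)).hom ≫ 𝟙 _ ≫ (ρ_ (𝟙 X)).inv = _
    simp
  · change 𝟙 _ ≫ σ.hom ≫ 𝟙 _ = σ.hom
    simp

lemma mapSq_tensorRight (X : E) {a₀ a₁ b₀ b₁ : E} {f₀ : a₀ ⟶ b₀} {f₁ : a₁ ⟶ b₁} {p : a₀ ⟶ a₁}
    {q : b₀ ⟶ b₁} (σ : f₀ ≫ q ≅ p ≫ f₁) :
    mapSq (tensorRight X) σ = tSq σ (idSq (𝟙 X)) := by
  rw [mapSq_comp, tSq_eq_mapSq]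
  congr 1
  apply Iso.ext
  refine Prod.ext ?_ ?_
  · change 𝟙 _ ≫ σ.hom ≫ 𝟙 _ = σ.hom
    simp
  · rw [idSq_id]
    change (λ_ (𝟙 X)).hom ≫ 𝟙 _ ≫ (λ_ (𝟙 X)).inv = _
    simp

lemma mapSq_tensor₃Left {X₀ X₁ X₀' X₁' Y₀ Y₁ Y₀' Y₁' Z₀ Z₁ Z₀' Z₁' : E}
    {f : X₀ ⟶ X₀'} {f' : X₁ ⟶ X₁'} {p : X₀ ⟶ X₁} {q : X₀' ⟶ X₁'}
    {g : Y₀ ⟶ Y₀'} {g' : Y₁ ⟶ Y₁'} {r : Y₀ ⟶ Y₁} {s : Y₀' ⟶ Y₁'}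
    {h : Z₀ ⟶ Z₀'} {h' : Z₁ ⟶ Z₁'} {t : Z₀ ⟶ Z₁} {u : Z₀' ⟶ Z₁'}
    (σ : f ≫ q ≅ p ≫ f') (τ : g ≫ s ≅ r ≫ g') (κ : h ≫ u ≅ t ≫ h') :
    mapSq (tensor₃Left E) (f₀ := (f ×ₘ g) ×ₘ h) (f₁ := (f' ×ₘ g') ×ₘ h') (p := (p ×ₘ r) ×ₘ t)
      (q := (q ×ₘ s) ×ₘ u) (Iso.prod (Iso.prod σ τ) κ) = tSq (tSq σ τ) κ := by
  rw [mapSq_comp, tSq_eq_mapSq]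
  congr 1
  apply Iso.ext
  refine Prod.ext ?_ ?_
  · rfl
  · change 𝟙 _ ≫ κ.hom ≫ 𝟙 _ = κ.hom
    simp

lemma mapSq_tensor₃Right {X₀ X₁ X₀' X₁' Y₀ Y₁ Y₀' Y₁' Z₀ Z₁ Z₀' Z₁' : E}
    {f : X₀ ⟶ X₀'} {f' : X₁ ⟶ X₁'} {p : X₀ ⟶ X₁} {q : X₀' ⟶ X₁'}
    {g : Y₀ ⟶ Y₀'} {g' : Y₁ ⟶ Y₁'} {r : Y₀ ⟶ Y₁} {s : Y₀' ⟶ Y₁'}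
    {h : Z₀ ⟶ Z₀'} {h' : Z₁ ⟶ Z₁'} {t : Z₀ ⟶ Z₁} {u : Z₀' ⟶ Z₁'}
    (σ : f ≫ q ≅ p ≫ f') (τ : g ≫ s ≅ r ≫ g') (κ : h ≫ u ≅ t ≫ h') :
    mapSq (tensor₃Right E) (f₀ := (f ×ₘ g) ×ₘ h) (f₁ := (f' ×ₘ g') ×ₘ h') (p := (p ×ₘ r) ×ₘ t)
      (q := (q ×ₘ s) ×ₘ u) (Iso.prod (Iso.prod σ τ) κ) = tSq σ (tSq τ κ) := by
  rw [mapSq_comp, mapSq_comp, tSq_eq_mapSq]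
  congr 1
  apply Iso.ext
  refine Prod.ext ?_ ?_
  · change 𝟙 _ ≫ (𝟙 _ ≫ σ.hom ≫ 𝟙 _) ≫ 𝟙 _ = σ.hom
    simp
  · rw [tSq_eq_mapSq, mapSq_hom]
    change (tComp _ _ _ _).inv ≫ (TensorBicategory.tensor.map₂ ((_ ×ₘ _) ≫ (_ ×ₘ _) ≫ (_ ×ₘ _))) ≫ (tComp _ _ _ _).hom = _
    congr 2
    refine congrArg _ (Prod.ext ?_ ?_)
    · change 𝟙 _ ≫ τ.hom ≫ 𝟙 _ = τ.hom
      simp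
    · change 𝟙 _ ≫ κ.hom ≫ 𝟙 _ = κ.hom
      simp

/-- Pseudonaturality of the associator on a triple of squares. With trivial squares in suitable
places it gives the naturality cubes for the whiskerings `as₁`, `as₂` and `as₃`. -/
lemma asNat_sq {X₀ X₁ X₀' X₁' Y₀ Y₁ Y₀' Y₁' Z₀ Z₁ Z₀' Z₁' : E}
    {f : X₀ ⟶ X₀'} {f' : X₁ ⟶ X₁'} {p : X₀ ⟶ X₁} {q : X₀' ⟶ X₁'}
    {g : Y₀ ⟶ Y₀'} {g' : Y₁ ⟶ Y₁'} {r : Y₀ ⟶ Y₁} {s : Y₀' ⟶ Y₁'}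
    {h : Z₀ ⟶ Z₀'} {h' : Z₁ ⟶ Z₁'} {t : Z₀ ⟶ Z₁} {u : Z₀' ⟶ Z₁'}
    (σ : f ≫ q ≅ p ≫ f') (τ : g ≫ s ≅ r ≫ g') (κ : h ≫ u ≅ t ≫ h') :
    SqRel (Iso.refl _) (Iso.refl _) (asNat p r t) (asNat q s u)
      (hPaste (tSq (tSq σ τ) κ) (asNat f' g' h')) (hPaste (asNat f g h) (tSq σ (tSq τ κ))) := by
  rw [← mapSq_tensor₃Left, ← mapSq_tensor₃Right]
  exact strongTrans_hPaste PreMonoidalBicategory.assoc.toStrongTrans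
    (f₀ := (f ×ₘ g) ×ₘ h) (f₁ := (f' ×ₘ g') ×ₘ h') (p := (p ×ₘ r) ×ₘ t)
      (q := (q ×ₘ s) ×ₘ u) (Iso.prod (Iso.prod σ τ) κ)

lemma asNat_comp {X X' X'' Y Y' Y'' Z Z' Z'' : E} (f : X ⟶ X') (f' : X' ⟶ X'') (g : Y ⟶ Y')
    (g' : Y' ⟶ Y'') (h : Z ⟶ Z') (h' : Z' ⟶ Z'') :
    SqRel (tIso (tComp f f' g g') (Iso.refl _) ≪≫ tComp (f ⊠₁ g) (f' ⊠₁ g') h h')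
      (tIso (Iso.refl _) (tComp g g' h h') ≪≫ tComp f f' (g ⊠₁ h) (g' ⊠₁ h'))
      (Iso.refl _) (Iso.refl _) (asNat (f ≫ f') (g ≫ g') (h ≫ h'))
      (vPaste (asNat f g h) (asNat f' g' h')) := by
  refine (strongTrans_comp PreMonoidalBicategory.assoc.toStrongTrans
    ((f ×ₘ g) ×ₘ h) ((f' ×ₘ g') ×ₘ h')).congr rfl ?_ rfl rfl
  exact (congrArg (fun x => x ≪≫ tIso (Iso.refl _) (tComp g g' h h') ≪≫
    tComp f f' (g ⊠₁ h) (g' ⊠₁ h')) (map₂Iso_refl ((prodMap (Pseudofunctor.id E)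
    TensorBicategory.tensor).comp TensorBicategory.tensor)
      ((f ≫ f') ×ₘ ((g ≫ g') ×ₘ (h ≫ h'))))).trans (Iso.refl_trans _)

lemma asNat_map₂ {X X' Y Y' Z Z' : E} {f f' : X ⟶ X'} {g g' : Y ⟶ Y'} {h h' : Z ⟶ Z'}
    (i : f ≅ f') (j : g ≅ g') (k : h ≅ h') :
    SqRel (tIso (tIso i j) k) (tIso i (tIso j k)) (Iso.refl _) (Iso.refl _) (asNat f g h)
      (asNat f' g' h') :=
  strongTrans_map₂ PreMonoidalBicategory.assoc.toStrongTrans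
    (f := (f ×ₘ g) ×ₘ h) (g := (f' ×ₘ g') ×ₘ h') (Iso.prod (Iso.prod i j) k)

lemma asNat_id (X Y Z : E) :
    SqRel (tIso (tId X Y) (Iso.refl _) ≪≫ tId _ _) (tIso (Iso.refl _) (tId Y Z) ≪≫ tId _ _)
      (Iso.refl _) (Iso.refl _) (asNat (𝟙 X) (𝟙 Y) (𝟙 Z)) (idSq (a X Y Z)).symm := by
  refine (strongTrans_id PreMonoidalBicategory.assoc.toStrongTrans ((X, Y), Z)).congr rfl ?_ rfl rfl
  exact (congrArg (fun x => x ≪≫ tIso (Iso.refl _) (tId Y Z) ≪≫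
    tId X (Y ⊠ Z)) (map₂Iso_refl ((prodMap (Pseudofunctor.id E)
    TensorBicategory.tensor).comp TensorBicategory.tensor)
      (𝟙 X ×ₘ (𝟙 Y ×ₘ 𝟙 Z)))).trans (Iso.refl_trans _)

lemma ruNat_sq {a₀ a₁ b₀ b₁ : E} {f₀ : a₀ ⟶ b₀} {f₁ : a₁ ⟶ b₁} {p : a₀ ⟶ a₁}
    {q : b₀ ⟶ b₁} (σ : f₀ ≫ q ≅ p ≫ f₁) :
    SqRel (Iso.refl _) (Iso.refl _) (ruNat p) (ruNat q)
      (hPaste (tSq σ (idSq (𝟙 (I E)))) (ruNat f₁)) (hPaste (ruNat f₀) σ) := by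
  have h := strongTrans_hPaste PreMonoidalBicategory.rightUnit.toStrongTrans σ
  rwa [mapSq_tensorRight, mapSq_id] at h

lemma ruNat_comp {X Y Z : E} (f : X ⟶ Y) (g : Y ⟶ Z) :
    SqRel (wrComp f g (I E)) (Iso.refl _) (Iso.refl _) (Iso.refl _) (ruNat (f ≫ g))
      (vPaste (ruNat f) (ruNat g)) :=
  strongTrans_comp PreMonoidalBicategory.rightUnit.toStrongTrans f g

lemma luNat_map₂ {X Y : E} {f g : X ⟶ Y} (i : f ≅ g) :
    SqRel (wlIso (I E) i) i (Iso.refl _) (Iso.refl _) (luNat f) (luNat g) :=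
  strongTrans_map₂ PreMonoidalBicategory.leftUnit.toStrongTrans i

lemma ruNat_map₂ {X Y : E} {f g : X ⟶ Y} (i : f ≅ g) :
    SqRel (wrIso i (I E)) i (Iso.refl _) (Iso.refl _) (ruNat f) (ruNat g) :=
  strongTrans_map₂ PreMonoidalBicategory.rightUnit.toStrongTrans i

lemma interchange_eq {X X' Y Y' : E} (f : X ⟶ X') (g : Y ⟶ Y') :
    interchange f g = tSq (idSq f) (idSq g).symm := rfl

lemma wlComp_eq (X : E) {Y Y' Y'' : E} (f : Y ⟶ Y') (g : Y' ⟶ Y'') :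
    wlComp X f g = tIso (ρ_ (𝟙 X)).symm (Iso.refl _) ≪≫ tComp (𝟙 X) (𝟙 X) f g := rfl

lemma wrComp_eq {X X' X'' : E} (f : X ⟶ X') (g : X' ⟶ X'') (Y : E) :
    wrComp f g Y = tIso (Iso.refl _) (λ_ (𝟙 Y)).symm ≪≫ tComp f g (𝟙 Y) (𝟙 Y) := rfl

lemma wlSq_eq (X : E) {a₀ a₁ b₀ b₁ : E} {f₀ : a₀ ⟶ b₀} {f₁ : a₁ ⟶ b₁} {p : a₀ ⟶ a₁}
    {q : b₀ ⟶ b₁} (σ : f₀ ≫ q ≅ p ≫ f₁) :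
    tSq (idSq (𝟙 X)) σ = (wlComp X f₀ q).symm ≪≫ wlIso X σ ≪≫ wlComp X p f₁ := by
  rw [← mapSq_tensorLeft]; rfl

lemma wrSq_eq {a₀ a₁ b₀ b₁ : E} {f₀ : a₀ ⟶ b₀} {f₁ : a₁ ⟶ b₁} {p : a₀ ⟶ a₁}
    {q : b₀ ⟶ b₁} (σ : f₀ ≫ q ≅ p ≫ f₁) (Y : E) :
    tSq σ (idSq (𝟙 Y)) = (wrComp f₀ q Y).symm ≪≫ wrIso σ Y ≪≫ wrComp p f₁ Y := by
  rw [← mapSq_tensorRight]; rfl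

lemma as₁_rel {X X' : E} (f : X ⟶ X') (Y Z : E) :
    SqRel (Iso.refl _) (tIso (Iso.refl f) (tId Y Z)) (Iso.refl _) (Iso.refl _)
      (asNat f (𝟙 Y) (𝟙 Z)) (as₁ f Y Z) := by
  rw [SqRel, hc_refl, Iso.refl_trans, as₁, hc_refl_left]

lemma as₃_rel (X Y : E) {Z Z' : E} (h : Z ⟶ Z') :
    SqRel (tIso (tId X Y) (Iso.refl h)) (Iso.refl _) (Iso.refl _) (Iso.refl _)
      (asNat (𝟙 X) (𝟙 Y) h) (as₃ X Y h) := by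
  rw [SqRel, hc_refl, Iso.trans_refl, as₃, hc_refl_right, ← Iso.trans_assoc]
  have : (tIso (tId X Y) (Iso.refl h) ▷ᵢ a X Y Z') ≪≫ (tIso (tId X Y).symm (Iso.refl h) ▷ᵢ
      a X Y Z') = Iso.refl _ := by
    have h' := hc_symm_self (tIso (tId X Y) (Iso.refl h)).symm (a X Y Z')
    rwa [hc_refl_right, hc_refl_right] at h'
  rw [this, Iso.refl_trans]

end
-- The cubes that characterize the structure 2-cells of `η` and `ε`.
section
open Bicategory
open scoped CategoryTheory.Prod
variable {E : Type u} [Bicategory.{w, v} E]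

/-- Both `η_X` and `ε_X` are conjugation by a unitor; their effect on 2-cells is compatible with the
defining square by the exchange law for `e`. -/
lemma conjugate_rel {B : Type u₁} [Bicategory.{w₁, v₁} B] {x y : B} {r : x ⟶ y} {r' : y ⟶ x}
    (e : r ≫ r' ≅ 𝟙 x) {m m' : x ⟶ x} (τ : m ≅ m') :
    SqRel (Iso.refl r) (Iso.refl r) τ (r' ◁ᵢ (τ ▷ᵢ r))
      ((α_ r r' (m ≫ r)).symm ≪≫ e ▷ᵢ (m ≫ r) ≪≫ λ_ (m ≫ r))
      ((α_ r r' (m' ≫ r)).symm ≪≫ e ▷ᵢ (m' ≫ r) ≪≫ λ_ (m' ≫ r)) := by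
  rw [SqRel.iff_hom]
  have h := whisker_exchange e.hom (τ.hom ▷ r)
  simp only [comp_whiskerLeft, id_whiskerLeft, Category.assoc] at h
  simp only [Iso.trans_hom, Iso.symm_hom, whiskerRightIso_hom, whiskerLeftIso_hom, Iso.refl_hom,
    whiskerLeft_id, id_whiskerRight, Category.id_comp, Category.comp_id, Category.assoc]
  rw [← cancel_epi (α_ r r' (m ≫ r)).hom, Iso.hom_inv_id_assoc]
  have h' := congrArg (fun z => z ≫ (λ_ (m' ≫ r)).hom) h
  simp only [Category.assoc, Iso.inv_hom_id, Category.comp_id] at h'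
  rw [h']

section
variable [PreMonoidalBicategory E]

lemma isEquiv_r (X : E) : IsEquiv (r X) := isEquiv_hom (ru X)
lemma isEquiv_l (X : E) : IsEquiv (l X) := isEquiv_hom (lu X)
lemma isEquiv_a (X Y Z : E) : IsEquiv (a X Y Z) := isEquiv_hom (as X Y Z)

lemma IsEquiv.tHom {X X' Y Y' : E} {f : X ⟶ X'} {g : Y ⟶ Y'} (hf : IsEquiv f) (hg : IsEquiv g) :
    IsEquiv (f ⊠₁ g) := by
  obtain ⟨f', ⟨u⟩, ⟨c⟩⟩ := hf
  obtain ⟨g', ⟨u'⟩, ⟨c'⟩⟩ := hg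
  exact ⟨f' ⊠₁ g', ⟨(tComp f f' g g').symm ≪≫ tIso u u' ≪≫ tId _ _⟩,
    ⟨(tComp f' f g' g).symm ≪≫ tIso c c' ≪≫ tId _ _⟩⟩

lemma IsEquiv.wl {Y Y' : E} {f : Y ⟶ Y'} (hf : IsEquiv f) (X : E) : IsEquiv (X ◁ₜ f) :=
  (IsEquiv.id X).tHom hf
lemma IsEquiv.wr {X X' : E} {f : X ⟶ X'} (hf : IsEquiv f) (Y : E) : IsEquiv (f ▷ₜ Y) :=
  hf.tHom (IsEquiv.id Y)

lemma etaIso_rel (X : E) {f g : I E ⟶ I E} (σ : f ≅ g) :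
    SqRel (Iso.refl _) (Iso.refl _) (wlIso X σ) (etaIso X σ) (zeta X f) (zeta X g) := by
  exact conjugate_rel _ _

lemma epsIso_rel (X : E) {f g : I E ⟶ I E} (σ : f ≅ g) :
    SqRel (Iso.refl _) (Iso.refl _) (wrIso σ X) (epsIso X σ) (xi X f) (xi X g) := by
  exact conjugate_rel _ _

/-- By `whiskerLeft_cancelLeft`, whiskering with the unitor gives back the composite under
`cancelLeft`, and the rest is coherence. The other lemmas of this part ending in `_rel` use the same
mechanism. -/
lemma etaComp_rel (X : E) (f g : I E ⟶ I E) :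
    SqRel (Iso.refl _) (Iso.refl _) (wlComp X f g) (etaComp X f g) (zeta X (f ≫ g))
      (hPaste (zeta X f) (zeta X g)) := by
  have h := congrArg Iso.hom (whiskerLeft_cancelLeft (ru X).counit (isEquiv_r X)
    (zeta X (f ≫ g) ≪≫ wlComp X f g ▷ᵢ r X ≪⊗≫ X ◁ₜ f ◁ᵢ (zeta X g).symm ≪⊗≫
      (zeta X f).symm ▷ᵢ eta X g ≪⊗≫ Iso.refl (r X ≫ eta X f ≫ eta X g)))
  rw [SqRel.iff_hom]
  simp only [whiskerLeftIso_hom] at h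
  rw [← etaComp] at h
  simp [h, hPaste_hom, bicategoricalIsoComp]
  rfl

lemma epsComp_rel (X : E) (f g : I E ⟶ I E) :
    SqRel (Iso.refl _) (Iso.refl _) (wrComp f g X) (epsComp X f g) (xi X (f ≫ g))
      (hPaste (xi X f) (xi X g)) := by
  have h := congrArg Iso.hom (whiskerLeft_cancelLeft (lu X).counit (isEquiv_l X)
    (xi X (f ≫ g) ≪≫ wrComp f g X ▷ᵢ l X ≪⊗≫ f ▷ₜ X ◁ᵢ (xi X g).symm ≪⊗≫
      (xi X f).symm ▷ᵢ eps X g ≪⊗≫ Iso.refl (l X ≫ eps X f ≫ eps X g)))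
  rw [SqRel.iff_hom]
  simp only [whiskerLeftIso_hom] at h
  rw [← epsComp] at h
  simp [h, hPaste_hom, bicategoricalIsoComp]
  rfl

lemma etaNat_rel {X Y : E} (h : X ⟶ Y) (f : I E ⟶ I E) :
    SqRel (ruNat h) (ruNat h) (Iso.refl _) (Iso.refl _) (vPaste (interchange h f) (zeta Y f))
      (vPaste (zeta X f) (etaNat h f)) := by
  have e := congrArg Iso.hom (whiskerLeft_cancelLeft (ru X).counit (isEquiv_r X)
    (Iso.refl (r X ≫ h ≫ eta Y f) ≪⊗≫ (ruNat h).symm ▷ᵢ eta Y f ≪⊗≫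
      h ▷ₜ I E ◁ᵢ zeta Y f ≪⊗≫ interchange h f ▷ᵢ r Y ≪⊗≫ X ◁ₜ f ◁ᵢ ruNat h ≪⊗≫
      (zeta X f).symm ▷ᵢ h ≪⊗≫ Iso.refl (r X ≫ eta X f ≫ h)))
  rw [SqRel.iff_hom]
  simp only [whiskerLeftIso_hom] at e
  rw [← etaNat] at e
  simp [e, vPaste_hom, bicategoricalIsoComp]

lemma epsNat_rel {X Y : E} (h : X ⟶ Y) (f : I E ⟶ I E) :
    SqRel (luNat h) (luNat h) (Iso.refl _) (Iso.refl _)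
      (vPaste (interchange f h).symm (xi Y f)) (vPaste (xi X f) (epsNat h f)) := by
  have e := congrArg Iso.hom (whiskerLeft_cancelLeft (lu X).counit (isEquiv_l X)
    (Iso.refl (l X ≫ h ≫ eps Y f) ≪⊗≫ (luNat h).symm ▷ᵢ eps Y f ≪⊗≫
      I E ◁ₜ h ◁ᵢ xi Y f ≪⊗≫ (interchange f h).symm ▷ᵢ l Y ≪⊗≫ f ▷ₜ X ◁ᵢ luNat h ≪⊗≫
      (xi X f).symm ▷ᵢ h ≪⊗≫ Iso.refl (l X ≫ eps X f ≫ h)))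
  rw [SqRel.iff_hom]
  simp only [whiskerLeftIso_hom] at e
  rw [← epsNat] at e
  simp [e, vPaste_hom, bicategoricalIsoComp]

end

variable [MonoidalBicategory E]
open MonoidalBicategory

lemma etaTensor_rel (X Y : E) (f : I E ⟶ I E) :
    SqRel (rho X Y) (rho X Y) (Iso.refl _) (etaTensor X Y f)
      (vPaste (as₃ X Y f).symm (tSq (idSq (𝟙 X)) (zeta Y f))) (zeta (X ⊠ Y) f) := by
  have e := congrArg Iso.hom (whiskerLeft_cancelLeft (ru (X ⊠ Y)).counit (isEquiv_r (X ⊠ Y))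
    ((rho X Y).symm ▷ᵢ (X ◁ₜ eta Y f) ≪⊗≫
      a X Y (I E) ◁ᵢ ((wlComp X (r Y) (eta Y f)).symm ≪≫ wlIso X (zeta Y f) ≪≫
        wlComp X (Y ◁ₜ f) (r Y)) ≪⊗≫
      (as₃ X Y f).symm ▷ᵢ (X ◁ₜ r Y) ≪⊗≫
      (X ⊠ Y) ◁ₜ f ◁ᵢ rho X Y ≪⊗≫
      (zeta (X ⊠ Y) f).symm))
  rw [SqRel.iff_hom]
  simp only [whiskerLeftIso_hom] at e
  rw [← etaTensor, ← wlSq_eq] at e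
  simp [e, vPaste_hom, bicategoricalIsoComp]

/-- The definition cancels both the left unitor and an associator, so `whiskerLeft_cancelLeft` is
needed twice. -/
lemma epsTensor_rel (X Y : E) (f : I E ⟶ I E) :
    SqRel (lam X Y).symm (lam X Y).symm (Iso.refl _) (epsTensor X Y f)
      (tSq (xi X f) (idSq (𝟙 Y))) (vPaste (as₁ f X Y).symm (xi (X ⊠ Y) f)) := by
  have e := congrArg Iso.hom (whiskerLeft_cancelLeft (lu (X ⊠ Y)).counit (isEquiv_l (X ⊠ Y)) <|
    cancelLeft (as (I E) X Y).counit
    (Iso.refl (a (I E) X Y ≫ l (X ⊠ Y) ≫ eps X f ▷ₜ Y) ≪⊗≫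
      lam X Y ▷ᵢ (eps X f ▷ₜ Y) ≪⊗≫
      ((wrComp (l X) (eps X f) Y).symm ≪≫ wrIso (xi X f) Y ≪≫ wrComp (f ▷ₜ X) (l X) Y) ≪⊗≫
      (f ▷ₜ X) ▷ₜ Y ◁ᵢ (lam X Y).symm ≪⊗≫
      as₁ f X Y ▷ᵢ l (X ⊠ Y) ≪⊗≫
      a (I E) X Y ◁ᵢ (xi (X ⊠ Y) f).symm))
  have e' := congrArg Iso.hom (whiskerLeft_cancelLeft (as (I E) X Y).counit (isEquiv_a (I E) X Y)
    (Iso.refl (a (I E) X Y ≫ l (X ⊠ Y) ≫ eps X f ▷ₜ Y) ≪⊗≫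
      lam X Y ▷ᵢ (eps X f ▷ₜ Y) ≪⊗≫
      ((wrComp (l X) (eps X f) Y).symm ≪≫ wrIso (xi X f) Y ≪≫ wrComp (f ▷ₜ X) (l X) Y) ≪⊗≫
      (f ▷ₜ X) ▷ₜ Y ◁ᵢ (lam X Y).symm ≪⊗≫
      as₁ f X Y ▷ᵢ l (X ⊠ Y) ≪⊗≫
      a (I E) X Y ◁ᵢ (xi (X ⊠ Y) f).symm))
  rw [SqRel.iff_hom]
  simp only [whiskerLeftIso_hom] at e e'
  rw [← epsTensor] at e
  rw [← e, ← wrSq_eq] at e'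
  simp [vPaste_hom, bicategoricalIsoComp] at e' ⊢
  rw [show a (I E) X Y ◁ l (X ⊠ Y) ◁ (epsTensor X Y f).hom = _ from e']
  simp

lemma etaEps_rel (X Y : E) (f : I E ⟶ I E) :
    SqRel (mid X Y).symm (mid X Y).symm (Iso.refl _) (etaEps X Y f)
      (tSq (zeta X f) (idSq (𝟙 Y)))
      (vPaste (as₂ X f Y).symm (tSq (idSq (𝟙 X)) (xi Y f))) := by
  have e := congrArg Iso.hom (whiskerLeft_cancelLeft
    ((wlComp X (lu Y).inv (l Y)).symm ≪≫ wlIso X (lu Y).counit ≪≫ tId X Y)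
    ((isEquiv_l Y).wl X) <|
    cancelLeft (as X (I E) Y).counit
    (Iso.refl (a X (I E) Y ≫ X ◁ₜ l Y ≫ eta X f ▷ₜ Y) ≪⊗≫
      mid X Y ▷ᵢ (eta X f ▷ₜ Y) ≪⊗≫
      ((wrComp (r X) (eta X f) Y).symm ≪≫ wrIso (zeta X f) Y ≪≫ wrComp (X ◁ₜ f) (r X) Y) ≪⊗≫
      (X ◁ₜ f) ▷ₜ Y ◁ᵢ (mid X Y).symm ≪⊗≫
      as₂ X f Y ▷ᵢ (X ◁ₜ l Y) ≪⊗≫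
      a X (I E) Y ◁ᵢ ((wlComp X (f ▷ₜ Y) (l Y)).symm ≪≫ wlIso X (xi Y f).symm ≪≫
        wlComp X (l Y) (eps Y f))))
  have e' := congrArg Iso.hom (whiskerLeft_cancelLeft (as X (I E) Y).counit (isEquiv_a X (I E) Y)
    (Iso.refl (a X (I E) Y ≫ X ◁ₜ l Y ≫ eta X f ▷ₜ Y) ≪⊗≫
      mid X Y ▷ᵢ (eta X f ▷ₜ Y) ≪⊗≫
      ((wrComp (r X) (eta X f) Y).symm ≪≫ wrIso (zeta X f) Y ≪≫ wrComp (X ◁ₜ f) (r X) Y) ≪⊗≫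
      (X ◁ₜ f) ▷ₜ Y ◁ᵢ (mid X Y).symm ≪⊗≫
      as₂ X f Y ▷ᵢ (X ◁ₜ l Y) ≪⊗≫
      a X (I E) Y ◁ᵢ ((wlComp X (f ▷ₜ Y) (l Y)).symm ≪≫ wlIso X (xi Y f).symm ≪≫
        wlComp X (l Y) (eps Y f))))
  rw [SqRel.iff_hom]
  simp only [whiskerLeftIso_hom] at e e'
  rw [← etaEps] at e
  have hs : (wlComp X (f ▷ₜ Y) (l Y)).symm ≪≫ wlIso X (xi Y f).symm ≪≫ wlComp X (l Y) (eps Y f) =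
      (tSq (idSq (𝟙 X)) (xi Y f)).symm := by
    rw [wlSq_eq, Iso.trans_symm, Iso.trans_symm, Iso.trans_assoc]; rfl
  rw [← e, ← wrSq_eq, hs] at e'
  simp [vPaste_hom, bicategoricalIsoComp] at e' ⊢
  rw [show a X (I E) Y ◁ X ◁ₜ l Y ◁ (etaEps X Y f).hom = _ from e']
  simp

end
-- A third form of cubes, and pasting of trivial squares.
section
open Bicategory

/-- A third way to express the commutativity of a cube. -/
lemma SqRel.cube_iff' {B : Type u₁} [Bicategory.{w₁, v₁} B] {a₀ a₁ b₀ b₁ a₀' a₁' b₀' b₁' : B}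
    {f₀ : a₀ ⟶ b₀} {f₁ : a₁ ⟶ b₁} {p : a₀ ⟶ a₁} {q : b₀ ⟶ b₁}
    {f₀' : a₀' ⟶ b₀'} {f₁' : a₁' ⟶ b₁'} {p' : a₀' ⟶ a₁'} {q' : b₀' ⟶ b₁'}
    {x₀ : a₀ ⟶ a₀'} {x₁ : a₁ ⟶ a₁'} {y₀ : b₀ ⟶ b₀'} {y₁ : b₁ ⟶ b₁'}
    {σ : f₀ ≫ q ≅ p ≫ f₁} {σ' : f₀' ≫ q' ≅ p' ≫ f₁'} {l₀ : f₀ ≫ y₀ ≅ x₀ ≫ f₀'}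
    {l₁ : f₁ ≫ y₁ ≅ x₁ ≫ f₁'} {m : p ≫ x₁ ≅ x₀ ≫ p'} {n : q ≫ y₁ ≅ y₀ ≫ q'} :
    SqRel (Iso.refl _) (Iso.refl _) m n (MonBicat.hPaste σ l₁) (MonBicat.hPaste l₀ σ') ↔
      SqRel l₀ l₁ (Iso.refl _) (Iso.refl _) (MonBicat.vPaste σ n.symm)
        (MonBicat.vPaste m.symm σ') := by
  rw [SqRel.iff_hom, SqRel.iff_hom]
  simp only [vPaste_hom, hPaste_hom, Iso.refl_hom, whiskerLeft_id, id_whiskerRight,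
    Category.id_comp, Category.comp_id, Category.assoc, Iso.symm_hom]
  constructor
  · intro h
    have h' := congrArg (fun z => (α_ _ _ _).hom ≫ f₀ ◁ n.inv ≫ z ≫ m.inv ▷ f₁' ≫ (α_ _ _ _).hom) h
    simp only [Category.assoc, ← whiskerLeft_comp_assoc, ← comp_whiskerRight_assoc,
      Iso.inv_hom_id, whiskerLeft_id, Category.id_comp, Iso.hom_inv_id, id_whiskerRight] at h'
    simpa using h'
  · intro h
    have h' := congrArg (fun z => f₀ ◁ n.hom ≫ (α_ _ _ _).inv ≫ z ≫ (α_ _ _ _).inv ≫ m.hom ▷ f₁') h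
    simpa using h'

lemma idSq_symm_vPaste {B : Type u₁} [Bicategory.{w₁, v₁} B] {X Y : B} (f : X ⟶ Y) :
    SqRel (λ_ (𝟙 X)) (λ_ (𝟙 Y)) (Iso.refl _) (Iso.refl _) (vPaste (idSq f).symm (idSq f).symm)
      (idSq f).symm :=
  (SqRel.idSq_hPaste (idSq f)).transpose

end

/-! ### Naturality of `η` along 1-cells, and its compatibility with the tensor product. -/

section
open Bicategory
open scoped CategoryTheory.Prod
variable {E : Type u} [Bicategory.{w, v} E]

section
variable [PreMonoidalBicategory E]

@[simp] lemma tIso_comp {X X' Y Y' : E} {f f' f'' : X ⟶ X'} {g g' g'' : Y ⟶ Y'} (x : f ≅ f')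
    (x' : f' ≅ f'') (y : g ≅ g') (y' : g' ≅ g'') :
    tIso x y ≪≫ tIso x' y' = tIso (x ≪≫ x') (y ≪≫ y') := (tIso_trans _ _ _ _).symm

@[simp] lemma tIso_comp_assoc {X X' Y Y' : E} {f f' f'' : X ⟶ X'} {g g' g'' : Y ⟶ Y'}
    {h : X ⊠ Y ⟶ X' ⊠ Y'} (x : f ≅ f') (x' : f' ≅ f'') (y : g ≅ g') (y' : g' ≅ g'')
    (z : f'' ⊠₁ g'' ≅ h) :
    tIso x y ≪≫ tIso x' y' ≪≫ z = tIso (x ≪≫ x') (y ≪≫ y') ≪≫ z := by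
  rw [← tIso_comp, Iso.trans_assoc]

/-- The tensor product of two commutative cubes. -/
lemma SqRel.tSq_cube {X₀ X₁ X₀' X₁' X₀'' X₁'' X₀₁ X₁₁ Y₀ Y₁ Y₀' Y₁' Y₀'' Y₁'' Y₀₁ Y₁₁ : E}
    {f₀ : X₀ ⟶ X₀'} {f₁ : X₁ ⟶ X₁'} {g₀ : X₀' ⟶ X₀''} {g₁ : X₁' ⟶ X₁''} {p p₁ : X₀ ⟶ X₁}
    {q : X₀' ⟶ X₁'} {r r₁ : X₀'' ⟶ X₁''} {f₀' : X₀ ⟶ X₀₁} {f₁' : X₁ ⟶ X₁₁} {g₀' : X₀₁ ⟶ X₀''}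
    {g₁' : X₁₁ ⟶ X₁''} {q' : X₀₁ ⟶ X₁₁}
    {i : f₀ ≫ g₀ ≅ f₀' ≫ g₀'} {j : f₁ ≫ g₁ ≅ f₁' ≫ g₁'} {π : p ≅ p₁} {ρ : r ≅ r₁}
    {σ : f₀ ≫ q ≅ p ≫ f₁} {τ : g₀ ≫ r ≅ q ≫ g₁} {σ' : f₀' ≫ q' ≅ p₁ ≫ f₁'}
    {τ' : g₀' ≫ r₁ ≅ q' ≫ g₁'}
    {h₀ : Y₀ ⟶ Y₀'} {h₁ : Y₁ ⟶ Y₁'} {k₀ : Y₀' ⟶ Y₀''} {k₁ : Y₁' ⟶ Y₁''} {s s₁ : Y₀ ⟶ Y₁}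
    {t : Y₀' ⟶ Y₁'} {u u₁ : Y₀'' ⟶ Y₁''} {h₀' : Y₀ ⟶ Y₀₁} {h₁' : Y₁ ⟶ Y₁₁} {k₀' : Y₀₁ ⟶ Y₀''}
    {k₁' : Y₁₁ ⟶ Y₁''} {t' : Y₀₁ ⟶ Y₁₁}
    {i' : h₀ ≫ k₀ ≅ h₀' ≫ k₀'} {j' : h₁ ≫ k₁ ≅ h₁' ≫ k₁'} {π' : s ≅ s₁} {ρ' : u ≅ u₁}
    {κ : h₀ ≫ t ≅ s ≫ h₁} {μ : k₀ ≫ u ≅ t ≫ k₁} {κ' : h₀' ≫ t' ≅ s₁ ≫ h₁'}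
    {μ' : k₀' ≫ u₁ ≅ t' ≫ k₁'}
    (h : SqRel i j π ρ (MonBicat.vPaste σ τ) (MonBicat.vPaste σ' τ'))
    (h' : SqRel i' j' π' ρ' (MonBicat.vPaste κ μ) (MonBicat.vPaste κ' μ')) :
    SqRel (MonBicat.tSq i i') (MonBicat.tSq j j') (tIso π π') (tIso ρ ρ')
      (MonBicat.vPaste (MonBicat.tSq σ κ) (MonBicat.tSq τ μ)) (MonBicat.vPaste (MonBicat.tSq σ' κ') (MonBicat.tSq τ' μ')) := by
  refine ((tSq_vPaste σ τ κ μ).symm.trans ((h.tSq h').trans (tSq_vPaste σ' τ' κ' μ'))).congr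
    rfl rfl ?_ ?_ <;> simp

/-- Reassociation turns the interchange of `h ⊠₁ k` with `f` into that of `k` with `f`: this is
`asNat_sq` on three trivial squares, the last one transposed. -/
lemma asNat_idSq_lift {X X' Y Y' Z Z' : E} (h : X ⟶ X') (k : Y ⟶ Y') (f : Z ⟶ Z') :
    SqRel (asNat h k (𝟙 Z)) (asNat h k (𝟙 Z')) (Iso.refl _) (Iso.refl _)
      (vPaste (interchange (h ⊠₁ k) f) (as₃ X' Y' f).symm)
      (vPaste (as₃ X Y f).symm (tSq (idSq h) (interchange k f))) := by
  have main := SqRel.cube_iff'.1 (asNat_sq (idSq h) (idSq k) (idSq f).symm)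
  have e₁ := ((tSq_idSq h k).tSq (SqRel.refl (idSq f).symm)).vPaste
    (as₃_rel X' Y' f).transpose
  have e₂ := (as₃_rel X Y f).transpose.vPaste
    (SqRel.refl (tSq (idSq h) (tSq (idSq k) (idSq f).symm)))
  refine (e₁.symm.trans (main.trans e₂)).congr ?_ ?_ ?_ ?_ <;> simp

lemma interchange_comp {X Y Z V W : E} (h : X ⟶ Y) (k : Y ⟶ Z) (f : V ⟶ W) :
    SqRel (wrComp h k V) (wrComp h k W) (Iso.refl _) (Iso.refl _) (interchange (h ≫ k) f)
      (vPaste (interchange h f) (interchange k f)) := by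
  have e := ((SqRel.of_eq (vPaste_idSq h k).symm).tSq (idSq_symm_vPaste f).symm).trans
    (tSq_vPaste (idSq h) (idSq k) (idSq f).symm (idSq f).symm)
  refine e.congr rfl rfl ?_ ?_ <;> simp

/-- Both naturality squares fit below `zeta` in cubes whose outer faces agree, and the right unitor,
being an equivalence, can be cancelled. The same argument proves `etaNat_comp`. -/
lemma etaNat_map₂ {X Y : E} {h k : X ⟶ Y} (σ : h ≅ k) (f : I E ⟶ I E) :
    SqRel σ σ (Iso.refl _) (Iso.refl _) (etaNat h f) (etaNat k f) := by
  have e₁ : SqRel (wrIso σ (I E)) (wrIso σ (I E)) (Iso.refl _) (Iso.refl _) (interchange h f)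
      (interchange k f) :=
    ((SqRel.idSq σ).tSq (SqRel.refl (idSq f).symm)).congr rfl rfl (by simp) (by simp)
  have e := (etaNat_rel h f).symm.trans ((e₁.vPaste (SqRel.refl (zeta Y f))).trans (etaNat_rel k f))
  have hr : (ruNat h).symm ≪≫ hc (wrIso σ (I E)) (Iso.refl (r Y)) ≪≫ ruNat k =
      hc (Iso.refl (r X)) σ := by
    rw [← ruNat_map₂ σ, Iso.symm_self_id_assoc]
  exact (e.congr hr hr (by simp) (by simp)).vPaste_cancel_left (SqRel.refl _) (isEquiv_r X)

lemma etaNat_comp {X Y Z : E} (h : X ⟶ Y) (k : Y ⟶ Z) (f : I E ⟶ I E) :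
    etaNat (h ≫ k) f = vPaste (etaNat h f) (etaNat k f) := by
  have e := (etaNat_rel (h ≫ k) f).symm.trans
    (((interchange_comp h k f).vPaste (SqRel.refl (zeta Z f))).trans
    ((SqRel.vPaste_assoc _ _ _).trans
    (((SqRel.refl (interchange h f)).vPaste (etaNat_rel k f)).trans
    ((SqRel.vPaste_assoc _ _ _).symm.trans
    (((etaNat_rel h f).vPaste (SqRel.refl (etaNat k f))).trans
    (SqRel.vPaste_assoc _ _ _))))))
  have hr := ruNat_comp h k
  rw [SqRel, vPaste_eq, hc_refl, Iso.trans_refl] at hr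
  have hr' := congrArg (fun x => (ruNat (h ≫ k)).symm ≪≫ x) hr
  simp only [Iso.symm_self_id] at hr'
  refine ((e.congr ?_ ?_ (by simp) (by simp)).vPaste_cancel_left (i := Iso.refl (r X))
    (i' := Iso.refl (h ≫ k)) (j := Iso.refl (r X)) (j' := Iso.refl (h ≫ k)) (SqRel.refl _)
    (isEquiv_r X)).eq
  all_goals rw [hc_refl, hr', hc_refl_left, hc_refl_right (ruNat h)]

end

variable [MonoidalBicategory E]
open MonoidalBicategory

/-- The modification axiom `rho_natural` is what makes the ends of the cubes match. -/
lemma etaTensor_natural {X X' Y Y' : E} (h : X ⟶ X') (k : Y ⟶ Y') (f : I E ⟶ I E) :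
    SqRel (Iso.refl _) (Iso.refl _) (etaTensor X Y f) (etaTensor X' Y' f)
      (tSq (idSq h) (etaNat k f)) (etaNat (h ⊠₁ k) f) := by
  -- `N` is the square that completes the desired cube. It is shown to fit the cube of `etaNat_rel`
  -- for `h ⊠₁ k`, and is therefore `etaNat (h ⊠₁ k) f`.
  obtain ⟨N, hN⟩ := SqRel.exists_right (Iso.refl _) (Iso.refl _) (etaTensor X Y f)
    (etaTensor X' Y' f) (tSq (idSq h) (etaNat k f))
  have e₁ := (etaTensor_rel X Y f).vPaste hN
  have hh : SqRel (idSq h) (idSq h) (Iso.refl _) (Iso.refl _)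
      (vPaste (idSq h) (idSq (𝟙 X'))) (vPaste (idSq (𝟙 X)) (idSq h)) := by
    rw [vPaste_idSq, vPaste_idSq]
    exact SqRel.idSq _
  have e₂ := (asNat_idSq_lift h k f).vPaste (SqRel.refl (tSq (idSq (𝟙 X')) (zeta Y' f)))
  have e₃ := (SqRel.refl (as₃ X Y f).symm).vPaste
    ((hh.tSq_cube (etaNat_rel k f)).congr rfl rfl (tIso_refl _ _) (tIso_refl _ _))
  have e₄ := (SqRel.refl (interchange (h ⊠₁ k) f)).vPaste (etaTensor_rel X' Y' f)
  have e := e₁.symm.trans ((SqRel.vPaste_assoc _ _ _).trans (e₃.symm.trans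
    ((SqRel.vPaste_assoc _ _ _).symm.trans (e₂.symm.trans ((SqRel.vPaste_assoc _ _ _).trans
    (e₄.trans (etaNat_rel _ _)))))))
  have hr := rho_natural h k
  rw [hPaste_eq, ← hc_refl_left, ← hc_refl_right] at hr
  have hr' : (hc (rho X Y) (Iso.refl (h ⊠₁ k))).symm ≪≫ α_ _ _ _ ≪≫
      (hc (Iso.refl (a X Y (I E))) (tSq (idSq h) (ruNat k))).symm ≪≫ (α_ _ _ _).symm ≪≫
      (hc (asNat h k (𝟙 (I E))) (Iso.refl (X' ◁ₜ r Y'))).symm ≪≫ α_ _ _ _ ≪≫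
      hc (Iso.refl _) (rho X' Y') ≪≫ ruNat (h ⊠₁ k) = Iso.refl _ := by
    rw [hr]
    simp only [Iso.trans_assoc, Iso.self_symm_id_assoc, Iso.symm_self_id_assoc, Iso.symm_self_id]
  have e' := (e.congr (hr'.trans hc_refl.symm) (hr'.trans hc_refl.symm) (π₁ := Iso.refl _)
    (ρ₁ := Iso.refl _) (by simp) (by simp)).vPaste_cancel_left (SqRel.refl _) (isEquiv_r _)
  rw [← e'.eq]
  exact hN

end
-- Identity 1-cells, the middle comparison `etaEps`, and naturality of the trivialization.
section
open Bicategory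
open scoped CategoryTheory.Prod
variable {E : Type u} [Bicategory.{w, v} E]

lemma iso_cycle {C : Type u₁} [Category.{v₁} C] {w x y z : C} {A : x ≅ y} {t : y ≅ z}
    {R : x ≅ w} {M : w ≅ z} (h : A ≪≫ t = R ≪≫ M) :
    M ≪≫ t.symm ≪≫ A.symm ≪≫ R = Iso.refl w := by
  have : R = A ≪≫ t ≪≫ M.symm := by
    rw [← Iso.trans_assoc, h, Iso.trans_assoc, Iso.self_symm_id, Iso.trans_refl]
  subst this
  simp

section
variable [PreMonoidalBicategory E]

/-- By `etaNat_comp` and `𝟙 ≫ 𝟙 ≅ 𝟙`, the square `etaNat (𝟙 X) f` is idempotent for vertical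
pasting; it is also invertible there, so it is trivial. -/
lemma etaNat_id (X : E) (f : I E ⟶ I E) : etaNat (𝟙 X) f = (idSq (eta X f)).symm := by
  have h := etaNat_map₂ (λ_ (𝟙 X)) f
  rw [etaNat_comp] at h
  have h' := h.trans (SqRel.idSq_hPaste (etaNat (𝟙 X) f).symm).transpose.symm
  have h'' : SqRel (hc (Iso.refl _) (Iso.refl _)) (hc (Iso.refl _) (Iso.refl _)) (Iso.refl _)
      (Iso.refl _) (vPaste (etaNat (𝟙 X) f) (etaNat (𝟙 X) f))
      (vPaste (idSq (eta X f)).symm (etaNat (𝟙 X) f)) :=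
    h'.congr (by simp) (by simp) (by simp) (by simp)
  exact (h''.vPaste_cancel_right (SqRel.refl _) (IsEquiv.id X)).eq

/-- At an identity, the naturality 2-cell of the left unitor is a unit constraint, so the trivial
square satisfies the cube of `epsNat_rel`. -/
lemma epsNat_id (X : E) (f : I E ⟶ I E) : epsNat (𝟙 X) f = (idSq (eps X f)).symm := by
  have h₁ : SqRel (tId (I E) X) (tId (I E) X) (Iso.refl _) (Iso.refl _)
      (interchange f (𝟙 X)).symm (idSq (f ▷ₜ X)).symm := by
    have := (tSq_idSq f (𝟙 X)).transpose
    rw [interchange_eq, ← tSq_symm]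
    rw [← tSq_symm] at this
    rw [idSq_id] at this ⊢
    exact this
  have h₂ : SqRel (luNat (𝟙 X)) (luNat (𝟙 X)) (Iso.refl _) (Iso.refl _)
      (vPaste (interchange f (𝟙 X)).symm (xi X f)) (vPaste (xi X f) (idSq (eps X f)).symm) := by
    have := (h₁.vPaste (SqRel.refl (xi X f))).trans
      ((SqRel.idSq_hPaste (xi X f).symm).transpose.trans
        (SqRel.hPaste_idSq (xi X f).symm).symm.transpose)
    have hl := strongTrans_id PreMonoidalBicategory.leftUnit.toStrongTrans X
    have hm : (tensorLeft (I E)).mapId X = tId (I E) X :=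
      (congrArg (· ≪≫ tId (I E) X) (map₂Iso_refl TensorBicategory.tensor _)).trans
        (Iso.refl_trans _)
    have hl' : hc (tId (I E) X) (Iso.refl (l X)) ≪≫ λ_ (l X) ≪≫ (ρ_ (l X)).symm =
        luNat (𝟙 X) := by
      rw [SqRel, hm] at hl
      have h₁ := ((congrArg (luNat (𝟙 X) ≪≫ ·) (hc_refl (f := l X) (g := 𝟙 X))).trans
        (Iso.trans_refl _)).symm.trans hl
      rw [h₁, idSq, Iso.trans_symm, Iso.symm_symm_eq]
      rfl
    exact this.congr hl' hl' (by simp) (by simp)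
  refine (((epsNat_rel (𝟙 X) f).symm.trans h₂).congr (i₁ := hc (Iso.refl _) (Iso.refl _))
    (j₁ := hc (Iso.refl _) (Iso.refl _)) (by simp) (by simp) (by simp)
    (by simp)).vPaste_cancel_left (SqRel.refl _) (isEquiv_l X) |>.eq

end

variable [MonoidalBicategory E]
open MonoidalBicategory

lemma asNat_idSq_mid {X X' Y Y' Z Z' : E} (h : X ⟶ X') (f : Y ⟶ Y') (k : Z ⟶ Z') :
    SqRel (asNat h (𝟙 Y) k) (asNat h (𝟙 Y') k) (Iso.refl _) (Iso.refl _)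
      (vPaste (tSq (interchange h f) (idSq k)) (as₂ X' f Z').symm)
      (vPaste (as₂ X f Z).symm (tSq (idSq h) (interchange f k).symm)) := by
  rw [interchange_eq, interchange_eq, ← tSq_symm]
  exact SqRel.cube_iff'.1 (asNat_sq (idSq h) (idSq f).symm (idSq k))

lemma idSq_vPaste_idSq {B : Type u₁} [Bicategory.{w₁, v₁} B] {X Y : B} (h : X ⟶ Y) :
    SqRel (idSq h) (idSq h) (Iso.refl _) (Iso.refl _)
      (vPaste (idSq h) (idSq (𝟙 Y))) (vPaste (idSq (𝟙 X)) (idSq h)) := by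
  rw [vPaste_idSq, vPaste_idSq]
  exact SqRel.idSq _

/-- The argument of `etaTensor_natural`, with the 2-unitor `mid` and `mid_natural` in place of `rho`
and `rho_natural`. -/
lemma etaEps_natural {X X' Y Y' : E} (h : X ⟶ X') (k : Y ⟶ Y') (f : I E ⟶ I E) :
    SqRel (Iso.refl _) (Iso.refl _) (etaEps X Y f) (etaEps X' Y' f)
      (tSq (etaNat h f) (idSq k)) (tSq (idSq h) (epsNat k f)) := by
  obtain ⟨N, hN⟩ := SqRel.exists_right (Iso.refl _) (Iso.refl _) (etaEps X Y f)
    (etaEps X' Y' f) (tSq (etaNat h f) (idSq k))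
  have e₁ := (etaEps_rel X Y f).vPaste hN
  have e₂ := ((etaNat_rel h f).tSq_cube (idSq_vPaste_idSq k)).congr rfl rfl
    (tIso_refl _ _) (tIso_refl _ _)
  have e₃ := (SqRel.refl (tSq (interchange h f) (idSq k))).vPaste (etaEps_rel X' Y' f)
  have e₄ := (asNat_idSq_mid h f k).vPaste (SqRel.refl (tSq (idSq (𝟙 X')) (xi Y' f)))
  have e₅ := (SqRel.refl (as₂ X f Y).symm).vPaste
    (((idSq_vPaste_idSq h).tSq_cube (epsNat_rel k f)).congr rfl rfl
      (tIso_refl _ _) (tIso_refl _ _))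
  have e := e₁.symm.trans (e₂.symm.trans (e₃.trans ((SqRel.vPaste_assoc _ _ _).symm.trans
    (e₄.trans ((SqRel.vPaste_assoc _ _ _).trans
    (e₅.trans (SqRel.vPaste_assoc _ _ _).symm))))))
  have hr := mid_natural h k
  rw [hPaste_eq, ← hc_refl_left, ← hc_refl_right] at hr
  have hr' := iso_cycle hr
  have e' := (e.congr (i₁ := hc (Iso.refl _) (Iso.refl _)) (j₁ := hc (Iso.refl _) (Iso.refl _))
    (by simpa using hr') (by simpa using hr') (π₁ := Iso.refl _)
    (ρ₁ := Iso.refl _) (by simp) (by simp)).vPaste_cancel_left (SqRel.refl _)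
      ((isEquiv_a X (I E) Y).comp ((isEquiv_l Y).wl X))
  rw [← e'.eq]
  exact hN

/-- `TrivialAction.natural_obj` speaks of adjoint equivalences; this provides one with a prescribed
underlying 1-cell. -/
lemma exists_equivalence {B : Type u₁} [Bicategory.{w₁, v₁} B] {X Y : B} {f : X ⟶ Y}
    (hf : IsEquiv f) : ∃ e : X ≌ Y, e.hom = f := by
  obtain ⟨g, ⟨s⟩, ⟨t⟩⟩ := hf
  exact ⟨Equivalence.mkOfAdjointifyCounit s.symm t, rfl⟩

namespace TrivialAction
variable (τ : TrivialAction E)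

lemma iso_natural {X Y : E} {h : X ⟶ Y} (hh : IsEquiv h) (f : AutI E) :
    SqRel (Iso.refl _) (Iso.refl _) (τ.iso X f) (τ.iso Y f) (epsNat h f.hom) (etaNat h f.hom) := by
  obtain ⟨e, rfl⟩ := exists_equivalence hh
  rw [SqRel, hc_refl_left, hc_refl_right]
  exact (τ.natural_obj e f).symm

/-- `η_X Y = η_{XY}`. -/
def etaTensorLeft (X Y : E) (f : AutI E) : eta X f.hom ▷ₜ Y ≅ eta (X ⊠ Y) f.hom :=
  etaEps X Y f.hom ≪≫ wlIso X (τ.iso Y f) ≪≫ etaTensor X Y f.hom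

lemma etaTensorLeft_natural {X X' Y Y' : E} (h : X ⟶ X') {k : Y ⟶ Y'} (hk : IsEquiv k)
    (f : AutI E) :
    SqRel (Iso.refl _) (Iso.refl _) (τ.etaTensorLeft X Y f) (τ.etaTensorLeft X' Y' f)
      (tSq (etaNat h f.hom) (idSq k)) (etaNat (h ⊠₁ k) f.hom) := by
  refine ((etaEps_natural h k f.hom).trans ((((SqRel.refl (idSq h)).tSq
    (τ.iso_natural hk f)).congr (tIso_refl _ _) (tIso_refl _ _) rfl rfl).trans
      (etaTensor_natural h k f.hom))).congr (by simp) (by simp) ?_ ?_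
  · rfl
  · rfl

lemma enterLeft_eq {X Y N : E} (k : X ⊠ Y ⟶ N) (f : AutI E) :
    enterLeft τ k f = etaNat k f.hom ≪≫ (τ.etaTensorLeft X Y f).symm ▷ᵢ k := by
  apply Iso.ext
  simp [enterLeft, enterRight, etaTensorLeft, wlIso, ← comp_whiskerRight]

end TrivialAction

end
-- The pentagonator as a cube, with one variable moving at a time.
section
open Bicategory
open scoped CategoryTheory.Prod
variable {E : Type u} [Bicategory.{w, v} E]
lemma idSq_id_symm (X : E) : (idSq (𝟙 X)).symm = idSq (𝟙 X) := by
  rw [idSq_id]; rfl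

variable [MonoidalBicategory E]
open MonoidalBicategory

/-- The modification axiom, transposed so that the pentagonators become the two ends of a cube. The
special cases below replace `𝟙 ⊠₁ 𝟙` by an identity where needed. -/
lemma pent_rel {X X' Y Y' Z Z' W W' : E} (f : X ⟶ X') (g : Y ⟶ Y') (h : Z ⟶ Z') (k : W ⟶ W') :
    SqRel (pent X Y Z W) (pent X' Y' Z' W') (Iso.refl _) (Iso.refl _)
      (vPaste (tSq (asNat f g h).symm (idSq k).symm)
        (vPaste (asNat f (g ⊠₁ h) k).symm (tSq (idSq f).symm (asNat g h k).symm)))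
      (vPaste (asNat (f ⊠₁ g) h k).symm (asNat f g (h ⊠₁ k)).symm) := by
  have h' := pent_natural f g h k
  rw [← hc_refl_left, ← hc_refl_right] at h'
  have := SqRel.transpose (show SqRel _ _ _ _ _ _ from h'.symm)
  rw [tSq_symm, tSq_symm]
  exact this

lemma asNat_as₁ {X X' : E} (f : X ⟶ X') (Y Z : E) :
    SqRel (Iso.refl _) (Iso.refl _) (Iso.refl _) (tIso (Iso.refl f) (tId Y Z))
      (asNat f (𝟙 Y) (𝟙 Z)).symm (as₁ f Y Z).symm := (as₁_rel f Y Z).transpose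

lemma asNat_as₃ (X Y : E) {Z Z' : E} (h : Z ⟶ Z') :
    SqRel (Iso.refl _) (Iso.refl _) (tIso (tId X Y) (Iso.refl h)) (Iso.refl _)
      (asNat (𝟙 X) (𝟙 Y) h).symm (as₃ X Y h).symm := (as₃_rel X Y h).transpose

lemma pent_as₂ (X : E) {Y Y' : E} (g : Y ⟶ Y') (Z W : E) :
    SqRel (pent X Y Z W) (pent X Y' Z W) (Iso.refl _) (Iso.refl _)
      (vPaste (tSq (as₂ X g Z).symm (idSq (𝟙 W)))
        (vPaste (as₂ X (g ▷ₜ Z) W).symm (tSq (idSq (𝟙 X)) (as₁ g Z W).symm)))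
      (vPaste (as₁ (X ◁ₜ g) Z W).symm (as₂ X g (Z ⊠ W)).symm) := by
  have e := pent_rel (𝟙 X) g (𝟙 Z) (𝟙 W)
  rw [idSq_id_symm, idSq_id_symm] at e
  have e₁ := (SqRel.refl (tSq (as₂ X g Z).symm (idSq (𝟙 W)))).vPaste
    ((SqRel.refl (as₂ X (g ▷ₜ Z) W).symm).vPaste
      (((SqRel.refl (idSq (𝟙 X))).tSq (asNat_as₁ g Z W)).congr (tIso_refl _ _) (tIso_refl _ _)
        (tIso_refl _ _) rfl))
  have e₂ := (asNat_as₁ (X ◁ₜ g) Z W).vPaste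
    ((asNat_map₂ (Iso.refl (𝟙 X)) (Iso.refl g) (tId Z W)).transpose.congr rfl rfl
      (congrArg (tIso · (tId Z W)) (tIso_refl (𝟙 X) g)) rfl)
  refine (e₁.symm.trans (e.trans e₂)).congr (by simp) (by simp) (by simp) (by simp)

lemma pent_as₂' (X Y : E) {Z Z' : E} (h : Z ⟶ Z') (W : E) :
    SqRel (pent X Y Z W) (pent X Y Z' W) (Iso.refl _) (Iso.refl _)
      (vPaste (tSq (as₃ X Y h).symm (idSq (𝟙 W)))
        (vPaste (as₂ X (Y ◁ₜ h) W).symm (tSq (idSq (𝟙 X)) (as₂ Y h W).symm)))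
      (vPaste (as₂ (X ⊠ Y) h W).symm (as₃ X Y (h ▷ₜ W)).symm) := by
  have e := pent_rel (𝟙 X) (𝟙 Y) h (𝟙 W)
  rw [idSq_id_symm, idSq_id_symm] at e
  have e₁ := (((asNat_as₃ X Y h).tSq (SqRel.refl (idSq (𝟙 W)))).congr (tIso_refl _ _)
      (tIso_refl _ _) rfl (tIso_refl _ _)).vPaste
    (SqRel.refl (vPaste (as₂ X (Y ◁ₜ h) W).symm (tSq (idSq (𝟙 X)) (as₂ Y h W).symm)))
  have e₂ := (asNat_map₂ (tId X Y) (Iso.refl h) (Iso.refl (𝟙 W))).transpose.vPaste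
    ((asNat_as₃ X Y (h ▷ₜ W)).congr rfl rfl (congrArg (tIso (tId X Y)) (tIso_refl h (𝟙 W)).symm)
      rfl)
  refine (e₁.symm.trans (e.trans e₂)).congr (by simp) (by simp) (by simp) (by simp)

lemma pent_as₃ (X Y Z : E) {W W' : E} (k : W ⟶ W') :
    SqRel (pent X Y Z W) (pent X Y Z W') (Iso.refl _) (Iso.refl _)
      (vPaste (interchange (a X Y Z) k)
        (vPaste (as₃ X (Y ⊠ Z) k).symm (tSq (idSq (𝟙 X)) (as₃ Y Z k).symm)))
      (vPaste (as₃ (X ⊠ Y) Z k).symm (as₃ X Y (Z ◁ₜ k)).symm) := by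
  have e := pent_rel (𝟙 X) (𝟙 Y) (𝟙 Z) k
  rw [idSq_id_symm] at e
  have e₁ := (((asNat_id X Y Z).transpose.tSq (SqRel.refl (idSq k).symm)).congr (tIso_refl _ _)
      (tIso_refl _ _) rfl rfl).vPaste
    ((((asNat_map₂ (Iso.refl (𝟙 X)) (tId Y Z) (Iso.refl k)).transpose.trans
      (asNat_as₃ X (Y ⊠ Z) k)).congr rfl rfl
      (π₁ := tIso (tIso (Iso.refl (𝟙 X)) (tId Y Z) ≪≫ tId X (Y ⊠ Z)) (Iso.refl k)) (by simp)
      rfl).vPaste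
      (((SqRel.refl (idSq (𝟙 X))).tSq (asNat_as₃ Y Z k)).congr (tIso_refl _ _) (tIso_refl _ _)
        (Iso.trans_refl _).symm (tIso_refl _ _)))
  have e₂ := ((asNat_map₂ (tId X Y) (Iso.refl (𝟙 Z)) (Iso.refl k)).transpose.trans
      (asNat_as₃ (X ⊠ Y) Z k)).vPaste
    ((asNat_as₃ X Y (Z ◁ₜ k)).congr rfl rfl ((congrArg (tIso (tId X Y)) (tIso_refl (𝟙 Z) k).symm).trans
      (Iso.trans_refl _).symm) rfl)
  refine (e₁.symm.trans (e.trans e₂)).congr (by simp) (by simp) (by simp) (by simp)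

lemma as₃_sq (X Y : E) {a₀ a₁ b₀ b₁ : E} {f₀ : a₀ ⟶ b₀} {f₁ : a₁ ⟶ b₁} {p : a₀ ⟶ a₁}
    {q : b₀ ⟶ b₁} (σ : f₀ ≫ q ≅ p ≫ f₁) :
    SqRel (as₃ X Y f₀) (as₃ X Y f₁) (Iso.refl _) (Iso.refl _)
      (vPaste (tSq (idSq (𝟙 (X ⊠ Y))) σ) (as₃ X Y q).symm)
      (vPaste (as₃ X Y p).symm (tSq (idSq (𝟙 X)) (tSq (idSq (𝟙 Y)) σ))) := by
  have e := SqRel.cube_iff'.1 (asNat_sq (idSq (𝟙 X)) (idSq (𝟙 Y)) σ)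
  have e₁ := ((((tSq_idSq (𝟙 X) (𝟙 Y)).trans (SqRel.idSq (tId X Y))).congr (Iso.refl_trans _)
    (Iso.refl_trans _) (Iso.trans_refl _) (Iso.trans_refl _)).tSq (SqRel.refl σ)).vPaste (asNat_as₃ X Y q)
  have e₂ := (asNat_as₃ X Y p).vPaste (SqRel.refl (tSq (idSq (𝟙 X)) (tSq (idSq (𝟙 Y)) σ)))
  refine (e₁.symm.trans (e.trans e₂)).congr ?_ ?_ (by simp) (by simp) <;>
  · rw [as₃, ← hc_refl_right]
    simp

lemma as₂_sq (X Y : E) {a₀ a₁ b₀ b₁ : E} {f₀ : a₀ ⟶ b₀} {f₁ : a₁ ⟶ b₁} {p : a₀ ⟶ a₁}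
    {q : b₀ ⟶ b₁} (σ : f₀ ≫ q ≅ p ≫ f₁) :
    SqRel (as₂ X f₀ Y) (as₂ X f₁ Y) (Iso.refl _) (Iso.refl _)
      (vPaste (tSq (tSq (idSq (𝟙 X)) σ) (idSq (𝟙 Y))) (as₂ X q Y).symm)
      (vPaste (as₂ X p Y).symm (tSq (idSq (𝟙 X)) (tSq σ (idSq (𝟙 Y))))) :=
  SqRel.cube_iff'.1 (asNat_sq (idSq (𝟙 X)) σ (idSq (𝟙 Y)))

lemma as₂_map₂ (X : E) {Y Y' : E} {g g' : Y ⟶ Y'} (i : g ≅ g') (Z : E) :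
    SqRel (Iso.refl _) (Iso.refl _) (wrIso (wlIso X i) Z) (wlIso X (wrIso i Z))
      (as₂ X g Z).symm (as₂ X g' Z).symm :=
  (asNat_map₂ (Iso.refl (𝟙 X)) i (Iso.refl (𝟙 Z))).transpose

lemma as₃_map₂ (X Y : E) {Z Z' : E} {g g' : Z ⟶ Z'} (i : g ≅ g') :
    SqRel (Iso.refl _) (Iso.refl _) (wlIso (X ⊠ Y) i) (wlIso X (wlIso Y i))
      (as₃ X Y g).symm (as₃ X Y g').symm := by
  refine ((asNat_as₃ X Y g).symm.trans
    ((asNat_map₂ (Iso.refl (𝟙 X)) (Iso.refl (𝟙 Y)) i).transpose.trans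
      (asNat_as₃ X Y g'))).congr (by simp) (by simp) (by simp) (by simp)

end
-- The normalization axioms as compatibilities between `etaTensor`, `etaEps` and `epsTensor`.
section
open Bicategory
open scoped CategoryTheory.Prod
variable {E : Type u} [Bicategory.{w, v} E]

/-- Used to compare two ways of computing the same pentagonal cube, once a normalization axiom has
identified their ends. -/
lemma SqRel.compare {B : Type u₁} [Bicategory.{w₁, v₁} B] {a₀ a₁ b₀ b₁ : B}
    {f₀ f₀' : a₀ ⟶ b₀} {f₁ f₁' : a₁ ⟶ b₁} {p p' : a₀ ⟶ a₁} {q q' q'' : b₀ ⟶ b₁} {i i' : f₀ ≅ f₀'}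
    {j j' : f₁ ≅ f₁'} {π π' : p ≅ p'} {ρ : q ≅ q'} {ρ' : q ≅ q''} {σ : f₀ ≫ q ≅ p ≫ f₁}
    {τ : f₀' ≫ q' ≅ p' ≫ f₁'} {τ' : f₀' ≫ q'' ≅ p' ≫ f₁'} (h : SqRel i j π ρ σ τ)
    (h' : SqRel i' j' π' ρ' σ τ') (hi : i = i') (hj : j = j') (hπ : π = π') :
    SqRel (Iso.refl _) (Iso.refl _) (Iso.refl _) (ρ.symm ≪≫ ρ') τ τ' := by
  subst hi hj hπ
  exact (h.symm.trans h').congr (by simp) (by simp) (by simp) rfl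

section
variable [PreMonoidalBicategory E]

lemma wl_vPaste (X : E) {a₀ a₁ b₀ b₁ c₀ c₁ : E} {f₀ : a₀ ⟶ b₀} {f₁ : a₁ ⟶ b₁}
    {g₀ : b₀ ⟶ c₀} {g₁ : b₁ ⟶ c₁} {p : a₀ ⟶ a₁} {q : b₀ ⟶ b₁} {r : c₀ ⟶ c₁}
    (σ : f₀ ≫ q ≅ p ≫ f₁) (τ : g₀ ≫ r ≅ q ≫ g₁) :
    SqRel (wlComp X f₀ g₀) (wlComp X f₁ g₁) (Iso.refl _) (Iso.refl _)
      (tSq (idSq (𝟙 X)) (vPaste σ τ)) (vPaste (tSq (idSq (𝟙 X)) σ) (tSq (idSq (𝟙 X)) τ)) := by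
  have h := mapSq_vPaste (tensorLeft X) σ τ
  rwa [mapSq_tensorLeft, mapSq_tensorLeft, mapSq_tensorLeft] at h

lemma wr_vPaste (X : E) {a₀ a₁ b₀ b₁ c₀ c₁ : E} {f₀ : a₀ ⟶ b₀} {f₁ : a₁ ⟶ b₁}
    {g₀ : b₀ ⟶ c₀} {g₁ : b₁ ⟶ c₁} {p : a₀ ⟶ a₁} {q : b₀ ⟶ b₁} {r : c₀ ⟶ c₁}
    (σ : f₀ ≫ q ≅ p ≫ f₁) (τ : g₀ ≫ r ≅ q ≫ g₁) :
    SqRel (wrComp f₀ g₀ X) (wrComp f₁ g₁ X) (Iso.refl _) (Iso.refl _)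
      (tSq (vPaste σ τ) (idSq (𝟙 X))) (vPaste (tSq σ (idSq (𝟙 X))) (tSq τ (idSq (𝟙 X)))) := by
  have h := mapSq_vPaste (tensorRight X) σ τ
  rwa [mapSq_tensorRight, mapSq_tensorRight, mapSq_tensorRight] at h

lemma wl_hPaste (X : E) {a₀ a₁ a₂ b₀ b₁ b₂ : E} {f₀ : a₀ ⟶ b₀} {f₁ : a₁ ⟶ b₁} {f₂ : a₂ ⟶ b₂}
    {p : a₀ ⟶ a₁} {q : b₀ ⟶ b₁} {p' : a₁ ⟶ a₂} {q' : b₁ ⟶ b₂}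
    (σ : f₀ ≫ q ≅ p ≫ f₁) (τ : f₁ ≫ q' ≅ p' ≫ f₂) :
    SqRel (Iso.refl _) (Iso.refl _) (wlComp X p p') (wlComp X q q')
      (tSq (idSq (𝟙 X)) (hPaste σ τ)) (hPaste (tSq (idSq (𝟙 X)) σ) (tSq (idSq (𝟙 X)) τ)) := by
  have h := mapSq_hPaste (tensorLeft X) σ τ
  rwa [mapSq_tensorLeft, mapSq_tensorLeft, mapSq_tensorLeft] at h

lemma wr_hPaste (X : E) {a₀ a₁ a₂ b₀ b₁ b₂ : E} {f₀ : a₀ ⟶ b₀} {f₁ : a₁ ⟶ b₁} {f₂ : a₂ ⟶ b₂}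
    {p : a₀ ⟶ a₁} {q : b₀ ⟶ b₁} {p' : a₁ ⟶ a₂} {q' : b₁ ⟶ b₂}
    (σ : f₀ ≫ q ≅ p ≫ f₁) (τ : f₁ ≫ q' ≅ p' ≫ f₂) :
    SqRel (Iso.refl _) (Iso.refl _) (wrComp p p' X) (wrComp q q' X)
      (tSq (hPaste σ τ) (idSq (𝟙 X))) (hPaste (tSq σ (idSq (𝟙 X))) (tSq τ (idSq (𝟙 X)))) := by
  have h := mapSq_hPaste (tensorRight X) σ τ
  rwa [mapSq_tensorRight, mapSq_tensorRight, mapSq_tensorRight] at h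

lemma SqRel.wl {X₀ X₁ X₀' X₁' : E}
    {f f₁ : X₀ ⟶ X₀'} {f' f₁' : X₁ ⟶ X₁'} {p p₁ : X₀ ⟶ X₁} {q q₁ : X₀' ⟶ X₁'}
    {σ : f ≫ q ≅ p ≫ f'} {σ₁ : f₁ ≫ q₁ ≅ p₁ ≫ f₁'}
    {i : f ≅ f₁} {j : f' ≅ f₁'} {π : p ≅ p₁} {ρ : q ≅ q₁} (X : E) (h : SqRel i j π ρ σ σ₁) :
    SqRel (wlIso X i) (wlIso X j) (wlIso X π) (wlIso X ρ) (MonBicat.tSq (MonBicat.idSq (𝟙 X)) σ)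
      (MonBicat.tSq (MonBicat.idSq (𝟙 X)) σ₁) :=
  (SqRel.refl _).tSq h

lemma SqRel.wr {X₀ X₁ X₀' X₁' : E}
    {f f₁ : X₀ ⟶ X₀'} {f' f₁' : X₁ ⟶ X₁'} {p p₁ : X₀ ⟶ X₁} {q q₁ : X₀' ⟶ X₁'}
    {σ : f ≫ q ≅ p ≫ f'} {σ₁ : f₁ ≫ q₁ ≅ p₁ ≫ f₁'}
    {i : f ≅ f₁} {j : f' ≅ f₁'} {π : p ≅ p₁} {ρ : q ≅ q₁} (X : E) (h : SqRel i j π ρ σ σ₁) :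
    SqRel (wrIso i X) (wrIso j X) (wrIso π X) (wrIso ρ X) (MonBicat.tSq σ (MonBicat.idSq (𝟙 X)))
      (MonBicat.tSq σ₁ (MonBicat.idSq (𝟙 X))) :=
  h.tSq (SqRel.refl _)

end

variable [MonoidalBicategory E]
open MonoidalBicategory

lemma as₁_sq (X Y : E) {a₀ a₁ b₀ b₁ : E} {f₀ : a₀ ⟶ b₀} {f₁ : a₁ ⟶ b₁} {p : a₀ ⟶ a₁}
    {q : b₀ ⟶ b₁} (σ : f₀ ≫ q ≅ p ≫ f₁) :
    SqRel (as₁ f₀ X Y) (as₁ f₁ X Y) (Iso.refl _) (Iso.refl _)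
      (vPaste (tSq (tSq σ (idSq (𝟙 X))) (idSq (𝟙 Y))) (as₁ q X Y).symm)
      (vPaste (as₁ p X Y).symm (tSq σ (idSq (𝟙 (X ⊠ Y))))) := by
  have e := SqRel.cube_iff'.1 (asNat_sq σ (idSq (𝟙 X)) (idSq (𝟙 Y)))
  have e₁ := (SqRel.refl (tSq (tSq σ (idSq (𝟙 X))) (idSq (𝟙 Y)))).vPaste (asNat_as₁ q X Y)
  have e₂ := (asNat_as₁ p X Y).vPaste ((SqRel.refl σ).tSq
    (((tSq_idSq (𝟙 X) (𝟙 Y)).trans (SqRel.idSq (tId X Y))).congr (Iso.refl_trans _)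
    (Iso.refl_trans _) (Iso.trans_refl _) (Iso.trans_refl _)))
  refine (e₁.symm.trans (e.trans e₂)).congr ?_ ?_ (by simp) (by simp) <;>
  · rw [as₁, ← hc_refl_left]
    simp

/-- Expand `η` and `ε` in the pentagonator cube in which `f` moves in the third place. It can be
computed through `X ⊗ Y` as a whole (`eA`) or through the inner pair `Y`, `Z` (`eB`), and the right
normalization axiom identifies the ends. -/
lemma etaTensor_etaEps (X Y Z : E) (f : I E ⟶ I E) :
    SqRel (Iso.refl _) (Iso.refl _) (wrIso (etaTensor X Y f) Z ≪≫ etaEps (X ⊠ Y) Z f)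
      (wlIso X (etaEps Y Z f)) (as₂ X (eta Y f) Z).symm (as₃ X Y (eps Z f)).symm := by
  -- `N` and `M` are the two given squares, altered to start from `η_{XY}(f) ⊗ Z`; the claim becomes
  -- a relation between them.
  obtain ⟨N, hN⟩ := SqRel.exists_right (Iso.refl _) (Iso.refl _) (etaEps (X ⊠ Y) Z f).symm
    (Iso.refl _) (as₃ X Y (eps Z f)).symm
  obtain ⟨M, hM⟩ := SqRel.exists_right (Iso.refl _) (Iso.refl _) (wrIso (etaTensor X Y f) Z)
    (Iso.refl _) (as₂ X (eta Y f) Z).symm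
  have eA := ((pent_as₂' X Y f Z).vPaste
      (SqRel.refl (tSq (idSq (𝟙 X)) (tSq (idSq (𝟙 Y)) (xi Z f))))).trans
    ((SqRel.vPaste_assoc _ _ _).trans
    (((SqRel.refl _).vPaste (as₃_sq X Y (xi Z f)).symm).trans
    ((SqRel.vPaste_assoc _ _ _).symm.trans
    ((etaEps_rel (X ⊠ Y) Z f).symm.vPaste hN))))
  have eM := (wl_vPaste X (as₂ Y f Z).symm (tSq (idSq (𝟙 Y)) (xi Z f))).symm.trans
    ((etaEps_rel Y Z f).symm.wl X)
  have eT := (wr_vPaste Z (as₃ X Y f).symm (tSq (idSq (𝟙 X)) (zeta Y f))).symm.trans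
    ((etaTensor_rel X Y f).wr Z)
  have eB := (SqRel.vPaste_assoc (tSq (as₃ X Y f).symm (idSq (𝟙 Z)))
      (vPaste (as₂ X (Y ◁ₜ f) Z).symm (tSq (idSq (𝟙 X)) (as₂ Y f Z).symm))
      (tSq (idSq (𝟙 X)) (tSq (idSq (𝟙 Y)) (xi Z f)))).trans
    (((SqRel.refl _).vPaste (SqRel.vPaste_assoc _ _ _)).trans
    (((SqRel.refl _).vPaste ((SqRel.refl _).vPaste (eM.congr rfl rfl
      ((Iso.refl_trans _).trans (tIso_refl _ _)) rfl))).trans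
    (((SqRel.refl _).vPaste (as₂_sq X Z (zeta Y f)).symm).trans
    ((SqRel.vPaste_assoc _ _ _).symm.trans
    ((eT.congr rfl rfl rfl (Iso.refl_trans _)).vPaste hM)))))
  have hi := congrArg Iso.hom (right_normalization X Y Z)
  simp [bicategoricalIsoComp] at hi
  have hi' := congrArg (fun z => (α_ _ _ _).hom ≫ _ ◁ (α_ _ _ _).hom ≫ z) hi
  simp only [whiskerLeft_hom_inv_assoc, Iso.hom_inv_id_assoc] at hi'
  have e := eA.compare eB (Iso.ext (by simp; exact hi')) (Iso.ext (by simp; exact hi')) (by simp)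
  have e' := (e.congr (i₁ := hc (Iso.refl _) (Iso.refl _)) (j₁ := hc (Iso.refl _) (Iso.refl _))
    (by simp) (by simp) rfl rfl).vPaste_cancel_left (SqRel.refl _) ((isEquiv_r _).wr Z)
  refine (hM.trans (e'.symm.trans hN.symm)).congr (by simp) (by simp) (by simp) (by simp)

/-- As in `etaTensor_etaEps`, with `f` moving in the second place of the pentagonator and the left
normalization axiom. -/
lemma etaEps_epsTensor (X Y Z : E) (f : I E ⟶ I E) :
    SqRel (Iso.refl _) (Iso.refl _) (wrIso (etaEps X Y f) Z)
      (etaEps X (Y ⊠ Z) f ≪≫ wlIso X (epsTensor Y Z f).symm) (as₁ (eta X f) Y Z).symm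
      (as₂ X (eps Y f) Z).symm := by
  obtain ⟨M, hM⟩ := SqRel.exists_right (Iso.refl _) (Iso.refl _) (wrIso (etaEps X Y f).symm Z)
    (Iso.refl _) (as₂ X (eps Y f) Z).symm
  have eA := ((pent_as₂ X f Y Z).vPaste
      (SqRel.refl (tSq (idSq (𝟙 X)) (xi (Y ⊠ Z) f)))).trans
    ((SqRel.vPaste_assoc _ _ _).trans
    (((SqRel.refl _).vPaste (etaEps_rel X (Y ⊠ Z) f).symm).trans
    (as₁_sq Y Z (zeta X f)).symm))
  have eM := (wl_vPaste X (as₁ f Y Z).symm (xi (Y ⊠ Z) f)).symm.trans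
    ((epsTensor_rel Y Z f).symm.wl X)
  have eT := (wr_vPaste Z (as₂ X f Y).symm (tSq (idSq (𝟙 X)) (xi Y f))).symm.trans
    ((etaEps_rel X Y f).symm.wr Z)
  have eB := (SqRel.vPaste_assoc (tSq (as₂ X f Y).symm (idSq (𝟙 Z)))
      (vPaste (as₂ X (f ▷ₜ Y) Z).symm (tSq (idSq (𝟙 X)) (as₁ f Y Z).symm))
      (tSq (idSq (𝟙 X)) (xi (Y ⊠ Z) f))).trans
    (((SqRel.refl _).vPaste (SqRel.vPaste_assoc _ _ _)).trans
    (((SqRel.refl _).vPaste ((SqRel.refl _).vPaste (eM.congr rfl rfl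
      ((Iso.refl_trans _).trans (tIso_refl _ _)) rfl))).trans
    (((SqRel.refl _).vPaste (as₂_sq X Z (xi Y f)).symm).trans
    ((SqRel.vPaste_assoc _ _ _).symm.trans
    ((eT.congr rfl rfl rfl (Iso.refl_trans _)).vPaste hM)))))
  have hi := congrArg Iso.hom (left_normalization X Y Z)
  simp [bicategoricalIsoComp] at hi
  have hi' := congrArg (fun z => (α_ _ _ _).hom ≫ _ ◁ (α_ _ _ _).hom ≫ z ≫ (as₁ (r X) Y Z).inv) hi
  simp only [whiskerLeft_hom_inv_assoc, Iso.hom_inv_id_assoc, Category.assoc, Iso.hom_inv_id,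
    Category.comp_id] at hi'
  have e := eA.compare eB (Iso.ext (by simp; exact hi')) (Iso.ext (by simp; exact hi')) (by simp)
  have e' := (e.congr (i₁ := hc (Iso.refl _) (Iso.refl _)) (j₁ := hc (Iso.refl _) (Iso.refl _))
    (by simp) (by simp) rfl rfl).vPaste_cancel_left (SqRel.refl _) (((isEquiv_r _).wr Y).wr Z)
  refine (e'.trans hM.symm).congr (by simp) (by simp) (by simp) (by simp)

/-- The right unitor is a pseudonatural equivalence from `- ⊗ I` to the identity. -/
lemma wr_unit_injective {X X' Y Y' : E} {f₀ : X ⟶ X'} {f₁ : Y ⟶ Y'} {p : X ⟶ Y} {q : X' ⟶ Y'}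
    {σ σ' : f₀ ≫ q ≅ p ≫ f₁}
    (h : tSq σ (idSq (𝟙 (I E))) = tSq σ' (idSq (𝟙 (I E)))) : σ = σ' := by
  have e := ruNat_sq σ
  rw [h] at e
  have e' := e.symm.trans (ruNat_sq σ')
  exact ((e'.congr (π₁ := hc (Iso.refl _) (Iso.refl _)) (ρ₁ := hc (Iso.refl _) (Iso.refl _))
    (by simp) (by simp) (by simp) (by simp)).hPaste_cancel_left (SqRel.refl _) (isEquiv_r _)).eq

end
-- Moving an automorphism of the unit through an associator.
section
open Bicategory
open scoped CategoryTheory.Prod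
variable {E : Type u} [Bicategory.{w, v} E] [MonoidalBicategory E]
open MonoidalBicategory

/-- The compatibility of `rho` with the pentagon is not an axiom. As for ordinary monoidal
categories, it is deduced after tensoring with `I` on the right: there `etaTensor_etaEps` replaces
`η` by `ε` on the added unit, and the pentagonator cube can be used. -/
lemma etaTensor_as₃ (X Y Z : E) (f : I E ⟶ I E) :
    SqRel (Iso.refl _) (Iso.refl _) (etaTensor (X ⊠ Y) Z f)
      (wlIso X (etaTensor Y Z f) ≪≫ etaTensor X (Y ⊠ Z) f)
      (as₃ X Y (eta Z f)).symm (etaNat (a X Y Z) f) := by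
  obtain ⟨N, hN⟩ := SqRel.exists_right (Iso.refl _) (Iso.refl _) (etaTensor (X ⊠ Y) Z f)
    (wlIso X (etaTensor Y Z f) ≪≫ etaTensor X (Y ⊠ Z) f) (as₃ X Y (eta Z f)).symm
  have e := (pent_as₂' X Y (eta Z f) (I E)).trans
    (((etaTensor_etaEps (X ⊠ Y) Z (I E) f).vPaste (as₃_map₂ X Y (etaEps Z (I E) f))).trans
    (pent_as₃ X Y Z (eps (I E) f)).symm)
  -- `l₁` and `l₂` are the two factors of `e` where the statement is already known; cancelling them
  -- leaves the factor of interest, whiskered with `I`.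
  have l₁ := ((as₂_map₂ X (etaTensor Y Z f) (I E)).trans (etaTensor_etaEps X (Y ⊠ Z) (I E) f))
  have l₂ := ((etaTensor_etaEps Y Z (I E) f).wl X).congr (tIso_refl _ _) (tIso_refl _ _)
    (π₁ := wlIso X (wrIso (etaTensor Y Z f) (I E)) ≪≫ wlIso X (etaEps (Y ⊠ Z) (I E) f))
    (by simp) rfl
  have t := (e.congr (i₁ := hc (Iso.refl _) (hc (Iso.refl _ ≪≫ Iso.refl _) (Iso.refl _)))
    (j₁ := hc (Iso.refl _) (hc (Iso.refl _ ≪≫ Iso.refl _) (Iso.refl _)))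
    (π₁ := wrIso (etaTensor (X ⊠ Y) Z f) (I E) ≪≫ etaEps ((X ⊠ Y) ⊠ Z) (I E) f)
    (ρ₁ := wlIso X (wlIso Y (etaEps Z (I E) f)))
    (by simp) (by simp) (by simp) (by simp)).vPaste_cancel_right (l₁.vPaste l₂)
      ((isEquiv_a X (Y ⊠ Z) (I E)).comp ((isEquiv_a Y Z (I E)).wl X))
  have m := etaEps_natural (a X Y Z) (𝟙 (I E)) f
  rw [epsNat_id] at m
  have h := (t.trans m.symm).congr (i₁ := wrIso (Iso.refl _) (I E))
    (j₁ := wrIso (Iso.refl _) (I E))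
    (π₁ := wrIso (etaTensor (X ⊠ Y) Z f) (I E))
    (ρ₁ := wrIso (wlIso X (etaTensor Y Z f) ≪≫ etaTensor X (Y ⊠ Z) f) (I E))
    (by simp) (by simp) (by simp) (by simp)
  have hN' := hN.wr (I E)
  rw [← wr_unit_injective (hN'.right_unique h)]
  exact hN

namespace TrivialAction
variable (τ : TrivialAction E)

/-- The trivialization carries the middle factor to the right-hand one, where `etaTensor_as₃`
applies. -/
lemma etaTensor_as₂ (X Y Z : E) (f : AutI E) :
    SqRel (Iso.refl _) (Iso.refl _)
      (wrIso (etaTensor X Y f.hom) Z ≪≫ τ.etaTensorLeft (X ⊠ Y) Z f)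
      (wlIso X (τ.etaTensorLeft Y Z f) ≪≫ etaTensor X (Y ⊠ Z) f.hom)
      (as₂ X (eta Y f.hom) Z).symm (etaNat (a X Y Z) f.hom) := by
  refine ((etaTensor_etaEps X Y Z f.hom).trans ((as₃_map₂ X Y (τ.iso Z f)).trans
    (etaTensor_as₃ X Y Z f.hom))).congr (by simp) (by simp) ?_ ?_
  · rw [etaTensorLeft]; simp
  · rw [etaTensorLeft]; simp

/-- Pass from the first factor to the second by `etaEps_epsTensor` and the trivialization, then use
`etaTensor_as₂`. The two routes from `ε_{YZ}` to `η_{YZ}` agree by the compatibility of the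
trivialization with `⊗`. -/
lemma etaTensorLeft_as₁ (X Y Z : E) (f : AutI E) :
    SqRel (Iso.refl _) (Iso.refl _)
      (wrIso (τ.etaTensorLeft X Y f) Z ≪≫ τ.etaTensorLeft (X ⊠ Y) Z f)
      (τ.etaTensorLeft X (Y ⊠ Z) f)
      (as₁ (eta X f.hom) Y Z).symm (etaNat (a X Y Z) f.hom) := by
  refine ((etaEps_epsTensor X Y Z f.hom).trans ((as₂_map₂ X (τ.iso Y f) Z).trans
    (τ.etaTensor_as₂ X Y Z f))).congr (by simp) (by simp) ?_ ?_
  · rw [etaTensorLeft]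
    simp [etaTensorLeft]
  · have h := congrArg (fun x => wlIso X ((epsTensor Y Z f.hom).symm ≪≫ x)) (τ.tensor Y Z f)
    simp only [Iso.symm_self_id_assoc] at h
    conv_rhs => rw [etaTensorLeft, h]
    simp [etaTensorLeft]

end TrivialAction

end
-- Functoriality and monoidality of `η`, and of its naturality squares.
section
open Bicategory
open scoped CategoryTheory.Prod
variable {E : Type u} [Bicategory.{w, v} E]

section
variable [PreMonoidalBicategory E]

lemma tComp_natural {X X' X'' Y Y' Y'' : E} {f g : X ⟶ X'} {f' g' : X' ⟶ X''} {h k : Y ⟶ Y'}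
    {h' k' : Y' ⟶ Y''} (i : f ≅ g) (i' : f' ≅ g') (j : h ≅ k) (j' : h' ≅ k') :
    tIso (hc i i') (hc j j') ≪≫ tComp g g' k k' =
      tComp f f' h h' ≪≫ hc (tIso i j) (tIso i' j') := by
  have h₁ := map₂Iso_hc TensorBicategory.tensor (f := f ×ₘ h) (g := f' ×ₘ h') (f' := g ×ₘ k)
    (g' := g' ×ₘ k') (Iso.prod i j) (Iso.prod i' j')
  have h₂ := congrArg (· ≪≫ tComp g g' k k') h₁
  simp only [Iso.trans_assoc, Iso.symm_self_id, Iso.trans_refl] at h₂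
  exact h₂

lemma tComp_tId (X Y : E) :
    tIso (ρ_ (𝟙 X)).symm (ρ_ (𝟙 Y)).symm ≪≫ tComp (𝟙 X) (𝟙 X) (𝟙 Y) (𝟙 Y) ≪≫
      hc (tId X Y) (tId X Y) = tId X Y ≪≫ (ρ_ _).symm := by
  have h₁ := map₂Iso_rightUnitor TensorBicategory.tensor (𝟙 X ×ₘ 𝟙 Y)
  have h₂ : tIso (ρ_ (𝟙 X)) (ρ_ (𝟙 Y)) = tComp (𝟙 X) (𝟙 X) (𝟙 Y) (𝟙 Y) ≪≫
    hc (Iso.refl _) (tId X Y) ≪≫ ρ_ _ := h₁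
  have h₃ : hc (tId X Y) (tId X Y) = hc (Iso.refl _) (tId X Y) ≪≫ hc (tId X Y) (Iso.refl _) := by
    rw [← hc_trans, Iso.refl_trans, Iso.trans_refl]
  have h₄ : hc (tId X Y) (Iso.refl _) = ρ_ _ ≪≫ tId X Y ≪≫ (ρ_ _).symm := by
    rw [hc_refl_right]; ext; simp
  rw [h₃, h₄, ← tIso_symm, h₂]
  simp only [Iso.trans_symm, Iso.trans_assoc, Iso.symm_self_id_assoc]

lemma etaIso_refl (X : E) (f : I E ⟶ I E) : etaIso X (Iso.refl f) = Iso.refl _ := by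
  have h : wlIso X (Iso.refl f) = Iso.refl _ := tIso_refl _ _
  rw [etaIso, h]
  ext; simp; rfl

lemma etaIso_trans (X : E) {f g h : I E ⟶ I E} (σ : f ≅ g) (τ : g ≅ h) :
    etaIso X (σ ≪≫ τ) = etaIso X σ ≪≫ etaIso X τ := by
  refine (((etaIso_rel X (σ ≪≫ τ)).congr rfl rfl rfl rfl).ρ_unique
    (((etaIso_rel X σ).trans (etaIso_rel X τ)).congr (by simp) (by simp) ?_ rfl) (isEquiv_r X))
  simp

lemma wlComp_natural (X : E) {Y Y' Y'' : E} {f g : Y ⟶ Y'} {f' g' : Y' ⟶ Y''}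
    (i : f ≅ g) (i' : f' ≅ g') :
    wlIso X (hc i i') ≪≫ wlComp X g g' = wlComp X f f' ≪≫ hc (wlIso X i) (wlIso X i') := by
  rw [wlComp_eq, wlComp_eq, Iso.trans_assoc, ← tComp_natural]
  simp

lemma etaComp_natural (X : E) {f g f' g' : I E ⟶ I E} (σ : f ≅ f') (τ : g ≅ g') :
    etaIso X (hc σ τ) ≪≫ etaComp X f' g' = etaComp X f g ≪≫ hc (etaIso X σ) (etaIso X τ) := by
  have e₁ := (etaIso_rel X (hc σ τ)).trans (etaComp_rel X f' g')
  have e₂ := (etaComp_rel X f g).trans ((etaIso_rel X σ).hPaste (etaIso_rel X τ))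
  exact e₁.ρ_unique (e₂.congr rfl rfl (wlComp_natural X σ τ).symm rfl) (isEquiv_r X)

lemma mapComp_assoc {B : Type u₁} [Bicategory.{w₁, v₁} B] {C : Type u₂} [Bicategory.{w₂, v₂} C]
    (F : B ⥤ᵖ C) {a b c d : B} (f : a ⟶ b) (g : b ⟶ c) (h : c ⟶ d) :
    F.map₂Iso (α_ f g h) ≪≫ F.mapComp f (g ≫ h) ≪≫ hc (Iso.refl _) (F.mapComp g h) =
      F.mapComp (f ≫ g) h ≪≫ hc (F.mapComp f g) (Iso.refl _) ≪≫ α_ _ _ _ := by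
  ext; simp

lemma wlComp_assoc (X : E) {Y₀ Y₁ Y₂ Y₃ : E} (f : Y₀ ⟶ Y₁) (g : Y₁ ⟶ Y₂) (h : Y₂ ⟶ Y₃) :
    wlIso X (α_ f g h) ≪≫ wlComp X f (g ≫ h) ≪≫ hc (Iso.refl _) (wlComp X g h) =
      wlComp X (f ≫ g) h ≪≫ hc (wlComp X f g) (Iso.refl _) ≪≫ α_ _ _ _ :=
  mapComp_assoc (tensorLeft X) f g h

lemma etaComp_assoc (X : E) (f g h : I E ⟶ I E) :
    etaIso X (α_ f g h) ≪≫ etaComp X f (g ≫ h) ≪≫ hc (Iso.refl _) (etaComp X g h) =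
      etaComp X (f ≫ g) h ≪≫ hc (etaComp X f g) (Iso.refl _) ≪≫ α_ _ _ _ := by
  have e₁ := (etaIso_rel X (α_ f g h)).trans ((etaComp_rel X f (g ≫ h)).trans
    ((SqRel.refl _).hPaste (etaComp_rel X g h)))
  have e₂ := (etaComp_rel X (f ≫ g) h).trans (((etaComp_rel X f g).hPaste (SqRel.refl _)).trans
    (SqRel.hPaste_assoc _ _ _))
  exact e₁.ρ_unique (e₂.congr rfl rfl (wlComp_assoc X f g h).symm rfl) (isEquiv_r X)

lemma interchange_natural_right {X X' : E} (h : X ⟶ X') {Y Y' : E} {f g : Y ⟶ Y'} (σ : f ≅ g) :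
    SqRel (Iso.refl _) (Iso.refl _) (wlIso X σ) (wlIso X' σ) (interchange h f)
      (interchange h g) := by
  refine ((SqRel.refl (idSq h)).tSq (SqRel.idSq σ).transpose).congr ?_ ?_ rfl rfl <;> simp

lemma interchange_comp_right {X X' : E} (h : X ⟶ X') {Y Y' Y'' : E} (f : Y ⟶ Y') (g : Y' ⟶ Y'') :
    SqRel (Iso.refl _) (Iso.refl _) (wlComp X f g) (wlComp X' f g) (interchange h (f ≫ g))
      (hPaste (interchange h f) (interchange h g)) := by
  have e := ((SqRel.idSq_hPaste (idSq h)).symm.tSq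
    (SqRel.of_eq (vPaste_idSq f g)).symm.transpose).trans
      (tSq_hPaste (idSq h) (idSq h) (idSq f).symm (idSq g).symm)
  have hu (Z : E) : λ_ (𝟙 Z) = ρ_ (𝟙 Z) := Iso.ext (by simp [unitors_equal])
  refine e.congr (by simp) (by simp) ?_ ?_ <;> rw [wlComp_eq] <;> congr 1 <;> rw [hu] <;> rfl

/-- The square `N` that completes the cube satisfies the characterization of `etaNat h g`, after `r
X` is cancelled. The proof of `etaNat_etaComp` is the same. -/
lemma etaNat_etaIso {X Y : E} (h : X ⟶ Y) {f g : I E ⟶ I E} (σ : f ≅ g) :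
    SqRel (Iso.refl _) (Iso.refl _) (etaIso X σ) (etaIso Y σ) (etaNat h f) (etaNat h g) := by
  obtain ⟨N, hN⟩ := SqRel.exists_right (Iso.refl _) (Iso.refl _) (etaIso X σ) (etaIso Y σ)
    (etaNat h f)
  have e₁ := (etaNat_rel h f).trans ((etaIso_rel X σ).vPaste hN)
  have e₂ := ((interchange_natural_right h σ).vPaste (etaIso_rel Y σ)).trans (etaNat_rel h g)
  have e := (e₁.symm.trans e₂).congr (i₁ := hc (Iso.refl _) (Iso.refl _))
    (j₁ := hc (Iso.refl _) (Iso.refl _)) (π₁ := Iso.refl _) (ρ₁ := Iso.refl _) (by simp) (by simp)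
    (by simp) (by simp)
  rw [← (e.vPaste_cancel_left (SqRel.refl _) (isEquiv_r X)).eq]
  exact hN

lemma etaNat_etaComp {X Y : E} (h : X ⟶ Y) (f g : I E ⟶ I E) :
    SqRel (Iso.refl _) (Iso.refl _) (etaComp X f g) (etaComp Y f g) (etaNat h (f ≫ g))
      (hPaste (etaNat h f) (etaNat h g)) := by
  obtain ⟨N, hN⟩ := SqRel.exists_right (Iso.refl _) (Iso.refl _) (etaComp X f g) (etaComp Y f g)
    (etaNat h (f ≫ g))
  have e₁ := (etaNat_rel h (f ≫ g)).trans ((etaComp_rel X f g).vPaste hN)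
  have e₂ := ((interchange_comp_right h f g).vPaste (etaComp_rel Y f g)).trans
    ((SqRel.of_eq (hPaste_vPaste _ _ _ _).symm).trans
    (((etaNat_rel h f).hPaste (etaNat_rel h g)).trans (SqRel.of_eq (hPaste_vPaste _ _ _ _))))
  have e := (e₁.symm.trans e₂).congr (i₁ := hc (Iso.refl _) (Iso.refl _))
    (j₁ := hc (Iso.refl _) (Iso.refl _)) (π₁ := Iso.refl _) (ρ₁ := Iso.refl _) (by simp) (by simp)
    (by simp only [Iso.refl_trans, Iso.trans_refl, Iso.symm_self_id_assoc]; exact hc_refl)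
    (by simp)
  rw [← (e.vPaste_cancel_left (SqRel.refl _) (isEquiv_r X)).eq]
  exact hN

end

end
-- Functoriality and monoidality of the comparisons with the tensor product.
section
open Bicategory
open scoped CategoryTheory.Prod
variable {E : Type u} [Bicategory.{w, v} E]

lemma SqRel.ρ_unique_of_eq {B : Type u₁} [Bicategory.{w₁, v₁} B] {a₀ a₁ b₀ b₁ : B}
    {f₀ f₀' : a₀ ⟶ b₀} {f₁ f₁' : a₁ ⟶ b₁} {p p' : a₀ ⟶ a₁} {q q' : b₀ ⟶ b₁} {i i' : f₀ ≅ f₀'}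
    {j j' : f₁ ≅ f₁'} {π π' : p ≅ p'} {ρ ρ' : q ≅ q'} {σ : f₀ ≫ q ≅ p ≫ f₁}
    {τ : f₀' ≫ q' ≅ p' ≫ f₁'} (h : SqRel i j π ρ σ τ) (h' : SqRel i' j' π' ρ' σ τ)
    (hf : IsEquiv f₀) (hi : i = i') (hj : j = j') (hπ : π = π') : ρ = ρ' := by
  subst hi hj hπ
  exact h.ρ_unique h' hf

lemma leftUnitor_id {B : Type u₁} [Bicategory.{w₁, v₁} B] (X : B) : λ_ (𝟙 X) = ρ_ (𝟙 X) :=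
  Iso.ext (by simp [unitors_equal])

section
variable [PreMonoidalBicategory E]

lemma as₂_comp (X : E) {Y Y' Y'' : E} (f : Y ⟶ Y') (g : Y' ⟶ Y'') (Z : E) :
    SqRel (wrIso (wlComp X f g) Z ≪≫ wrComp (X ◁ₜ f) (X ◁ₜ g) Z)
      (wlIso X (wrComp f g Z) ≪≫ wlComp X (f ▷ₜ Z) (g ▷ₜ Z)) (Iso.refl _) (Iso.refl _)
      (as₂ X (f ≫ g) Z) (vPaste (as₂ X f Z) (as₂ X g Z)) := by
  have e := (asNat_map₂ (ρ_ (𝟙 X)).symm (Iso.refl (f ≫ g)) (ρ_ (𝟙 Z)).symm).trans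
    (asNat_comp (𝟙 X) (𝟙 X) f g (𝟙 Z) (𝟙 Z))
  refine e.congr ?_ ?_ (by simp) (by simp)
  · simp only [wlComp_eq, wrComp_eq, tIso_comp_assoc, Iso.refl_trans, Iso.trans_refl,
      leftUnitor_id]
  · simp only [wlComp_eq, wrComp_eq, tIso_comp_assoc, Iso.refl_trans, Iso.trans_refl,
      leftUnitor_id]

lemma as₃_comp (X Y : E) {Z Z' Z'' : E} (f : Z ⟶ Z') (g : Z' ⟶ Z'') :
    SqRel (wlComp (X ⊠ Y) f g) (wlIso X (wlComp Y f g) ≪≫ wlComp X (Y ◁ₜ f) (Y ◁ₜ g))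
      (Iso.refl _) (Iso.refl _) (as₃ X Y (f ≫ g)) (vPaste (as₃ X Y f) (as₃ X Y g)) := by
  have e := (as₃_rel X Y (f ≫ g)).symm.trans
    ((asNat_map₂ (ρ_ (𝟙 X)).symm (ρ_ (𝟙 Y)).symm (Iso.refl (f ≫ g))).trans
    ((asNat_comp (𝟙 X) (𝟙 X) (𝟙 Y) (𝟙 Y) f g).trans ((as₃_rel X Y f).vPaste (as₃_rel X Y g))))
  refine e.congr ?_ ?_ (by simp) (by simp)
  · have h := tComp_natural (tId X Y) (tId X Y) (Iso.refl f) (Iso.refl g)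
    simp only [Iso.trans_assoc]
    rw [← h, tIso_symm, hc_refl, wlComp_eq]
    simp only [tIso_comp_assoc, Iso.trans_refl, Iso.refl_symm]
    rw [tComp_tId, Iso.symm_self_id_assoc]
  · simp only [wlComp_eq, tIso_comp_assoc, Iso.refl_trans, Iso.trans_refl, hc_refl,
      Iso.refl_symm]

end

variable [MonoidalBicategory E]
open MonoidalBicategory

/-- This and the next three lemmas are equalities of bigons: both sides complete cubes with the same
remaining faces, and one of these faces has an equivalence as edge. -/
lemma etaTensor_etaIso (X Y : E) {f g : I E ⟶ I E} (σ : f ≅ g) :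
    wlIso X (etaIso Y σ) ≪≫ etaTensor X Y g = etaTensor X Y f ≪≫ etaIso (X ⊠ Y) σ := by
  have e₁ := (etaTensor_rel X Y f).trans (etaIso_rel (X ⊠ Y) σ)
  have e₂ := ((as₃_map₂ X Y σ).vPaste ((etaIso_rel Y σ).wl X)).trans (etaTensor_rel X Y g)
  exact e₂.ρ_unique_of_eq e₁ ((isEquiv_a _ _ _).comp ((isEquiv_r Y).wl X)) (by simp) (by simp)
    (by simp)

lemma etaTensor_etaComp (X Y : E) (f g : I E ⟶ I E) :
    wlIso X (etaComp Y f g) ≪≫ wlComp X (eta Y f) (eta Y g) ≪≫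
        hc (etaTensor X Y f) (etaTensor X Y g) =
      etaTensor X Y (f ≫ g) ≪≫ etaComp (X ⊠ Y) f g := by
  have e₁ := (etaTensor_rel X Y (f ≫ g)).trans (etaComp_rel (X ⊠ Y) f g)
  have e₂ := ((as₃_comp X Y f g).transpose.vPaste
    (((etaComp_rel Y f g).wl X).trans (wl_hPaste X (zeta Y f) (zeta Y g)))).trans
    ((SqRel.of_eq (hPaste_vPaste (as₃ X Y f).symm (as₃ X Y g).symm _ _).symm).trans
    ((etaTensor_rel X Y f).hPaste (etaTensor_rel X Y g)))
  have e := e₂.ρ_unique_of_eq e₁ ((isEquiv_a _ _ _).comp ((isEquiv_r Y).wl X)) (by simp) (by simp)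
    (by simp only [Iso.trans_refl, Iso.refl_trans, hc_refl])
  simpa only [Iso.trans_assoc, Iso.refl_trans] using e

lemma etaEps_etaIso (X Y : E) {f g : I E ⟶ I E} (σ : f ≅ g) :
    wrIso (etaIso X σ) Y ≪≫ etaEps X Y g = etaEps X Y f ≪≫ wlIso X (epsIso Y σ) := by
  have e₁ := ((etaIso_rel X σ).wr Y).trans (etaEps_rel X Y g)
  have e₂ := (etaEps_rel X Y f).trans ((as₂_map₂ X σ Y).vPaste ((epsIso_rel Y σ).wl X))
  exact e₁.ρ_unique_of_eq e₂ ((isEquiv_r X).wr Y) (by simp) (by simp) (by simp)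

lemma etaEps_etaComp (X Y : E) (f g : I E ⟶ I E) :
    wrIso (etaComp X f g) Y ≪≫ wrComp (eta X f) (eta X g) Y ≪≫
        hc (etaEps X Y f) (etaEps X Y g) =
      etaEps X Y (f ≫ g) ≪≫ wlIso X (epsComp Y f g) ≪≫ wlComp X (eps Y f) (eps Y g) := by
  have e₁ := (((etaComp_rel X f g).wr Y).trans (wr_hPaste Y (zeta X f) (zeta X g))).trans
    ((etaEps_rel X Y f).hPaste (etaEps_rel X Y g))
  have e₂ := (etaEps_rel X Y (f ≫ g)).trans (((as₂_comp X f g Y).transpose.vPaste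
    (((epsComp_rel Y f g).wl X).trans (wl_hPaste X (xi Y f) (xi Y g)))).trans
    (SqRel.of_eq (hPaste_vPaste (as₂ X f Y).symm (as₂ X g Y).symm _ _).symm))
  have e := e₁.ρ_unique_of_eq e₂ ((isEquiv_r X).wr Y) (by simp) (by simp)
    (by simp only [Iso.trans_refl, Iso.refl_trans, hc_refl])
  simpa only [Iso.trans_assoc, Iso.trans_refl] using e

namespace TrivialAction
variable (τ : TrivialAction E)

lemma etaTensorLeft_etaIso (X Y : E) {f g : AutI E} (σ : f ⟶ g) :
    wrIso (etaIso X σ) Y ≪≫ τ.etaTensorLeft X Y g =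
      τ.etaTensorLeft X Y f ≪≫ etaIso (X ⊠ Y) σ := by
  have h := congrArg (wlIso X) (τ.natural Y σ)
  have h' : wlIso X (epsIso Y σ) ≪≫ wlIso X (τ.iso Y g) =
    wlIso X (τ.iso Y f) ≪≫ wlIso X (etaIso Y σ) := by simpa using h
  simp only [etaTensorLeft]
  rw [← Iso.trans_assoc, etaEps_etaIso, Iso.trans_assoc, ← Iso.trans_assoc (wlIso X (epsIso Y σ)),
    h', Iso.trans_assoc, etaTensor_etaIso]
  simp only [Iso.trans_assoc]

/-- The middle part of the left-hand comparison is the trivialization, so its monoidality in `f`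
enters here, as its naturality does in `etaTensorLeft_etaIso`. -/
lemma etaTensorLeft_etaComp (X Y : E) (f g : AutI E) :
    wrIso (etaComp X f.hom g.hom) Y ≪≫ wrComp (eta X f.hom) (eta X g.hom) Y ≪≫
        hc (τ.etaTensorLeft X Y f) (τ.etaTensorLeft X Y g) =
      τ.etaTensorLeft X Y ⟨f.hom ≫ g.hom, f.isEquiv.comp g.isEquiv⟩ ≪≫
        etaComp (X ⊠ Y) f.hom g.hom := by
  have h := congrArg (wlIso X) (τ.monoidal Y f g)
  have h' : wlIso X (epsComp Y f.hom g.hom) ≪≫ wlIso X (hc (τ.iso Y f) (τ.iso Y g)) =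
      wlIso X (τ.iso Y ⟨f.hom ≫ g.hom, f.isEquiv.comp g.isEquiv⟩) ≪≫
      wlIso X (etaComp Y f.hom g.hom) := by
    have : hc (τ.iso Y f) (τ.iso Y g) = τ.iso Y f ▷ᵢ eps Y g.hom ≪≫ eta Y f.hom ◁ᵢ τ.iso Y g := rfl
    rw [this]
    simpa using h.symm
  simp only [etaTensorLeft]
  rw [hc_trans, hc_trans]
  have k := congrArg (· ≪≫ hc (wlIso X (τ.iso Y f)) (wlIso X (τ.iso Y g)) ≪≫
    hc (etaTensor X Y f.hom) (etaTensor X Y g.hom)) (etaEps_etaComp X Y f.hom g.hom)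
  simp only [Iso.trans_assoc] at k
  rw [k, ← Iso.trans_assoc (wlComp X _ _), ← wlComp_natural, Iso.trans_assoc,
    ← Iso.trans_assoc (wlIso X (epsComp Y f.hom g.hom)), h', Iso.trans_assoc, etaTensor_etaComp]
  simp only [Iso.trans_assoc]

end TrivialAction

end
-- Squares graded by automorphisms of the unit, and their products with 1-cells.
section
open Bicategory
open scoped CategoryTheory.Prod
variable {E : Type u} [Bicategory.{w, v} E]

section
variable [PreMonoidalBicategory E]

section
variable {N X X' X'' X''' : E} {u : X ⟶ N} {u' : X' ⟶ N} {u'' : X'' ⟶ N} {u''' : X''' ⟶ N}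
  {p q : X ⟶ X'} {p' q' : X' ⟶ X''} {p'' : X'' ⟶ X'''} {f f' f'' g g' h : I E ⟶ I E}

/-- The composite of two squares whose right-hand sides are automorphisms coming from the unit. -/
def gradedComp (α : u ≫ eta N f ≅ p ≫ u') (β : u' ≫ eta N g ≅ p' ≫ u'') :
    u ≫ eta N (f ≫ g) ≅ (p ≫ p') ≫ u'' :=
  u ◁ᵢ etaComp N f g ≪≫ hPaste α β

lemma gradedComp_rel (α : u ≫ eta N f ≅ p ≫ u') (β : u' ≫ eta N g ≅ p' ≫ u'') :
    SqRel (Iso.refl _) (Iso.refl _) (Iso.refl _) (etaComp N f g) (gradedComp α β)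
      (hPaste α β) := by
  rw [SqRel, hc_refl, Iso.trans_refl, hc_refl_left, gradedComp]

/-- Two squares over automorphisms coming from the unit agree up to an isomorphism of left-hand
sides and an isomorphism of automorphisms of the unit. -/
abbrev GradedRel (π : p ≅ q) (θ : f ≅ g) (α : u ≫ eta N f ≅ p ≫ u') (β : u ≫ eta N g ≅ q ≫ u') :
    Prop :=
  SqRel (Iso.refl u) (Iso.refl u') π (etaIso N θ) α β

namespace GradedRel

lemma of_sqRel {π : p ≅ q} {α : u ≫ eta N f ≅ p ≫ u'} {β : u ≫ eta N f ≅ q ≫ u'}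
    (e : SqRel (Iso.refl u) (Iso.refl u') π (Iso.refl _) α β) : GradedRel π (Iso.refl f) α β :=
  e.congr rfl rfl rfl (etaIso_refl N f).symm

lemma refl (α : u ≫ eta N f ≅ p ≫ u') : GradedRel (Iso.refl p) (Iso.refl f) α α :=
  of_sqRel (SqRel.refl α)

lemma symm {π : p ≅ q} {θ : f ≅ g} {α : u ≫ eta N f ≅ p ≫ u'} {β : u ≫ eta N g ≅ q ≫ u'}
    (e : GradedRel π θ α β) : GradedRel π.symm θ.symm β α :=
  SqRel.symm e

lemma trans {π : p ≅ q} {r : X ⟶ X'} {π' : q ≅ r} {θ : f ≅ f'} {θ' : f' ≅ f''}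
    {α : u ≫ eta N f ≅ p ≫ u'} {β : u ≫ eta N f' ≅ q ≫ u'} {γ : u ≫ eta N f'' ≅ r ≫ u'}
    (e : GradedRel π θ α β) (e' : GradedRel π' θ' β γ) :
    GradedRel (π ≪≫ π') (θ ≪≫ θ') α γ :=
  (SqRel.trans e e').congr (Iso.refl_trans _) (Iso.refl_trans _) rfl (etaIso_trans N θ θ').symm

lemma comp {π : p ≅ q} {π' : p' ≅ q'} {θ : f ≅ f'} {θ' : g ≅ g'}
    {α : u ≫ eta N f ≅ p ≫ u'} {α' : u ≫ eta N f' ≅ q ≫ u'}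
    {β : u' ≫ eta N g ≅ p' ≫ u''} {β' : u' ≫ eta N g' ≅ q' ≫ u''}
    (e : GradedRel π θ α α') (e' : GradedRel π' θ' β β') :
    GradedRel (hc π π') (hc θ θ') (gradedComp α β) (gradedComp α' β') := by
  refine ((gradedComp_rel α β).trans ((SqRel.hPaste e e').trans
    (gradedComp_rel α' β').symm)).congr (by simp) (by simp) ?_ ?_
  · simp only [Iso.refl_trans, Iso.trans_refl, Iso.refl_symm]
  · rw [← Iso.trans_assoc, ← etaComp_natural, Iso.trans_assoc, Iso.self_symm_id, Iso.trans_refl]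

lemma comp_assoc (α : u ≫ eta N f ≅ p ≫ u') (β : u' ≫ eta N g ≅ p' ≫ u'')
    (γ : u'' ≫ eta N h ≅ p'' ≫ u''') :
    GradedRel (α_ p p' p'') (α_ f g h) (gradedComp (gradedComp α β) γ)
      (gradedComp α (gradedComp β γ)) := by
  have e := ((gradedComp_rel (gradedComp α β) γ).trans
    (((gradedComp_rel α β).hPaste (SqRel.refl γ)).trans ((SqRel.hPaste_assoc α β γ).trans
    (((SqRel.refl α).hPaste (gradedComp_rel β γ).symm).trans
    (gradedComp_rel α (gradedComp β γ)).symm))))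
  refine e.congr (by simp) (by simp) (by simp) ?_
  have k := congrArg (· ≪≫ hc (Iso.refl _) (etaComp N g h).symm ≪≫ (etaComp N f (g ≫ h)).symm)
    (etaComp_assoc N f g h)
  simp only [Iso.trans_assoc] at k
  rw [← k, ← Iso.trans_assoc (hc (Iso.refl _) (etaComp N g h)), ← hc_trans]
  simp

/-- This turns identities between 2-cells of paths into identities between morphisms of `Aut(I)`:
the path 2-cell of a relation leaves no choice for its grade when the source 1-cell is an
equivalence. -/
lemma unique (hu : IsEquiv u) {π π' : p ≅ q} {θ θ' : f ≅ g}
    {α : u ≫ eta N f ≅ p ≫ u'} {β : u ≫ eta N g ≅ q ≫ u'} (e : GradedRel π θ α β)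
    (e' : GradedRel π' θ' α β) (hπ : π = π') : etaIso N θ = etaIso N θ' := by
  subst hπ
  exact SqRel.ρ_unique e e' hu

end GradedRel
end

lemma tSq_hPaste_idSq {a₀ a₁ a₂ b₀ b₁ b₂ Y Y' : E} {f₀ : a₀ ⟶ b₀} {f₁ : a₁ ⟶ b₁} {f₂ : a₂ ⟶ b₂}
    {p : a₀ ⟶ a₁} {q : b₀ ⟶ b₁} {p' : a₁ ⟶ a₂} {q' : b₁ ⟶ b₂}
    (σ : f₀ ≫ q ≅ p ≫ f₁) (σ' : f₁ ≫ q' ≅ p' ≫ f₂) (v : Y ⟶ Y') :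
    SqRel (Iso.refl _) (Iso.refl _) (wrComp p p' Y) (wrComp q q' Y')
      (tSq (hPaste σ σ') (idSq v)) (hPaste (tSq σ (idSq v)) (tSq σ' (idSq v))) := by
  have e := ((SqRel.refl (hPaste σ σ')).tSq (SqRel.idSq_hPaste (idSq v)).symm).trans
      (tSq_hPaste σ σ' (idSq v) (idSq v))
  refine e.congr (by simp) (by simp) ?_ ?_ <;> rw [wrComp_eq]

lemma tSq_idSq_hPaste {a₀ a₁ a₂ b₀ b₁ b₂ Y Y' : E} {f₀ : a₀ ⟶ b₀} {f₁ : a₁ ⟶ b₁} {f₂ : a₂ ⟶ b₂}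
    {p : a₀ ⟶ a₁} {q : b₀ ⟶ b₁} {p' : a₁ ⟶ a₂} {q' : b₁ ⟶ b₂}
    (σ : f₀ ≫ q ≅ p ≫ f₁) (σ' : f₁ ≫ q' ≅ p' ≫ f₂) (v : Y ⟶ Y') :
    SqRel (Iso.refl _) (Iso.refl _) (wlComp Y p p') (wlComp Y' q q')
      (tSq (idSq v) (hPaste σ σ')) (hPaste (tSq (idSq v) σ) (tSq (idSq v) σ')) := by
  have e := ((SqRel.idSq_hPaste (idSq v)).symm.tSq (SqRel.refl (hPaste σ σ'))).trans
      (tSq_hPaste (idSq v) (idSq v) σ σ')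
  refine e.congr (by simp) (by simp) ?_ ?_ <;> rw [wlComp_eq, ← leftUnitor_id]

end

variable [MonoidalBicategory E]
open MonoidalBicategory

section enterRight
variable {X Y N : E} (k : X ⊠ Y ⟶ N)

lemma enterRight_rel (f : AutI E) :
    SqRel (Iso.refl _) (Iso.refl _) (etaTensor X Y f.hom).symm (Iso.refl _) (etaNat k f.hom)
      (enterRight k f) := by
  rw [SqRel, hc_refl, Iso.refl_trans, hc_refl_right, enterRight]

lemma enterRight_natural {f g : AutI E} (σ : f ⟶ g) :
    SqRel (Iso.refl _) (Iso.refl _) (wlIso X (etaIso Y σ)) (etaIso N σ) (enterRight k f)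
      (enterRight k g) := by
  refine ((enterRight_rel k f).symm.trans ((etaNat_etaIso k σ).trans (enterRight_rel k g))).congr
    (by simp) (by simp) ?_ (by simp)
  rw [Iso.symm_symm_eq, ← Iso.trans_assoc, ← etaTensor_etaIso, Iso.trans_assoc, Iso.self_symm_id,
    Iso.trans_refl]

lemma enterRight_comp (f g : AutI E) :
    SqRel (Iso.refl _) (Iso.refl _) (wlIso X (etaComp Y f.hom g.hom) ≪≫ wlComp X _ _)
      (etaComp N f.hom g.hom) (enterRight k ⟨f.hom ≫ g.hom, f.isEquiv.comp g.isEquiv⟩)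
      (hPaste (enterRight k f) (enterRight k g)) := by
  refine ((enterRight_rel k _).symm.trans ((etaNat_etaComp k f.hom g.hom).trans
    ((enterRight_rel k f).hPaste (enterRight_rel k g)))).congr (by simp) (by simp) ?_ (by simp)
  rw [Iso.symm_symm_eq, ← Iso.trans_assoc, ← etaTensor_etaComp, Iso.trans_assoc, Iso.trans_assoc,
    ← hc_trans, Iso.self_symm_id, Iso.self_symm_id, hc_refl, Iso.trans_refl]

variable (τ : TrivialAction E)

lemma enterLeft_rel (f : AutI E) :
    SqRel (Iso.refl _) (Iso.refl _) (τ.etaTensorLeft X Y f).symm (Iso.refl _) (etaNat k f.hom)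
      (enterLeft τ k f) := by
  rw [SqRel, hc_refl, Iso.refl_trans, hc_refl_right, τ.enterLeft_eq]

lemma enterLeft_natural {f g : AutI E} (σ : f ⟶ g) :
    SqRel (Iso.refl _) (Iso.refl _) (wrIso (etaIso X σ) Y) (etaIso N σ) (enterLeft τ k f)
      (enterLeft τ k g) := by
  refine ((enterLeft_rel k τ f).symm.trans ((etaNat_etaIso k σ).trans
    (enterLeft_rel k τ g))).congr (by simp) (by simp) ?_ (by simp)
  rw [Iso.symm_symm_eq, ← Iso.trans_assoc, ← τ.etaTensorLeft_etaIso, Iso.trans_assoc,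
    Iso.self_symm_id, Iso.trans_refl]

lemma enterLeft_comp (f g : AutI E) :
    SqRel (Iso.refl _) (Iso.refl _) (wrIso (etaComp X f.hom g.hom) Y ≪≫ wrComp _ _ Y)
      (etaComp N f.hom g.hom) (enterLeft τ k ⟨f.hom ≫ g.hom, f.isEquiv.comp g.isEquiv⟩)
      (hPaste (enterLeft τ k f) (enterLeft τ k g)) := by
  refine ((enterLeft_rel k τ _).symm.trans ((etaNat_etaComp k f.hom g.hom).trans
    ((enterLeft_rel k τ f).hPaste (enterLeft_rel k τ g)))).congr (by simp) (by simp) ?_ (by simp)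
  rw [Iso.symm_symm_eq, ← Iso.trans_assoc, ← τ.etaTensorLeft_etaComp, Iso.trans_assoc,
    Iso.trans_assoc, ← hc_trans, Iso.self_symm_id, Iso.self_symm_id, hc_refl, Iso.trans_refl]

end enterRight

section
variable {X X' X'' Y Y' Y'' U V N : E} (c : U ⊠ V ⟶ N)

/-- A square tensored on the left with a 1-cell `u`, and continued along `c`. -/
def leftMul (u : X ⟶ U) {v : Y ⟶ V} {v' : Y' ⟶ V} {p : Y ⟶ Y'} {f : AutI E}
    (α : v ≫ eta V f.hom ≅ p ≫ v') : ((u ⊠₁ v) ≫ c) ≫ eta N f.hom ≅ X ◁ₜ p ≫ (u ⊠₁ v') ≫ c :=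
  vPaste (tSq (idSq u) α) (enterRight c f)

lemma leftMul_rel (u : X ⟶ U) {v : Y ⟶ V} {v' : Y' ⟶ V} {p q : Y ⟶ Y'} {f g : AutI E}
    {α : v ≫ eta V f.hom ≅ p ≫ v'} {β : v ≫ eta V g.hom ≅ q ≫ v'} {π : p ≅ q} {θ : f ⟶ g}
    (h : GradedRel π θ α β) : GradedRel (wlIso X π) θ (leftMul c u α) (leftMul c u β) :=
  (((SqRel.refl (idSq u)).tSq h).vPaste (enterRight_natural c θ)).congr (by simp) (by simp) rfl rfl

/-- Multiplication respects composition of graded squares because `enterRight` is monoidal in the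
automorphism; likewise for `rightMul_comp` and `enterLeft`. -/
lemma leftMul_comp (u : X ⟶ U) {v : Y ⟶ V} {v' : Y' ⟶ V} {v'' : Y'' ⟶ V} {p : Y ⟶ Y'}
    {q : Y' ⟶ Y''} {f g : AutI E} (α : v ≫ eta V f.hom ≅ p ≫ v')
    (β : v' ≫ eta V g.hom ≅ q ≫ v'') :
    GradedRel (wlComp X p q) (Iso.refl _)
      (leftMul c u (f := ⟨f.hom ≫ g.hom, f.isEquiv.comp g.isEquiv⟩) (gradedComp α β))
      (gradedComp (leftMul c u α) (leftMul c u β)) := by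
  have e := ((((SqRel.refl (idSq u)).tSq (gradedComp_rel α β)).trans
    (tSq_idSq_hPaste α β u)).vPaste (enterRight_comp c f g)).trans
    ((SqRel.of_eq (hPaste_vPaste _ _ _ _).symm).trans (gradedComp_rel _ _).symm)
  refine GradedRel.of_sqRel (e.congr (by simp) (by simp) ?_ ?_)
  · simp only [tIso_refl, Iso.refl_trans, Iso.trans_refl, Iso.refl_symm]
  · simp only [Iso.refl_trans, Iso.self_symm_id]

variable (τ : TrivialAction E)

/-- A square tensored on the right with a 1-cell `v`, and continued along `c`. -/
def rightMul {u : X ⟶ U} {u' : X' ⟶ U} {p : X ⟶ X'} {f : AutI E}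
    (α : u ≫ eta U f.hom ≅ p ≫ u') (v : Y ⟶ V) :
    ((u ⊠₁ v) ≫ c) ≫ eta N f.hom ≅ p ▷ₜ Y ≫ (u' ⊠₁ v) ≫ c :=
  vPaste (tSq α (idSq v)) (enterLeft τ c f)

lemma rightMul_rel {u : X ⟶ U} {u' : X' ⟶ U} {p q : X ⟶ X'} {f g : AutI E}
    {α : u ≫ eta U f.hom ≅ p ≫ u'} {β : u ≫ eta U g.hom ≅ q ≫ u'} {π : p ≅ q} {θ : f ⟶ g}
    (h : GradedRel π θ α β) (v : Y ⟶ V) :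
    GradedRel (wrIso π Y) θ (rightMul c τ α v) (rightMul c τ β v) :=
  ((SqRel.tSq h (SqRel.refl (idSq v))).vPaste (enterLeft_natural c τ θ)).congr
    (by simp) (by simp) rfl rfl

lemma rightMul_comp {u : X ⟶ U} {u' : X' ⟶ U} {u'' : X'' ⟶ U} {p : X ⟶ X'}
    {q : X' ⟶ X''} {f g : AutI E} (α : u ≫ eta U f.hom ≅ p ≫ u')
    (β : u' ≫ eta U g.hom ≅ q ≫ u'') (v : Y ⟶ V) :
    GradedRel (wrComp p q Y) (Iso.refl _)
      (rightMul c τ (f := ⟨f.hom ≫ g.hom, f.isEquiv.comp g.isEquiv⟩) (gradedComp α β) v)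
      (gradedComp (rightMul c τ α v) (rightMul c τ β v)) := by
  have e := ((((gradedComp_rel α β).tSq (SqRel.refl (idSq v))).trans
    (tSq_hPaste_idSq α β v)).vPaste (enterLeft_comp c τ f g)).trans
    ((SqRel.of_eq (hPaste_vPaste _ _ _ _).symm).trans (gradedComp_rel _ _).symm)
  refine GradedRel.of_sqRel (e.congr (by simp) (by simp) ?_ ?_)
  · simp only [tIso_refl, Iso.refl_trans, Iso.trans_refl, Iso.refl_symm]
  · simp only [Iso.refl_trans, Iso.self_symm_id]

end

end
-- Splitting tensor products of composite 1-cells.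
section
open Bicategory
open scoped CategoryTheory.Prod
variable {E : Type u} [Bicategory.{w, v} E]

section
variable [PreMonoidalBicategory E]
variable {X₀ X₁ X₂ X₃ Y₀ Y₁ Y₂ Y₃ : E}

lemma tComp_assoc (f : X₀ ⟶ X₁) (f' : X₁ ⟶ X₂) (f'' : X₂ ⟶ X₃) (g : Y₀ ⟶ Y₁) (g' : Y₁ ⟶ Y₂)
    (g'' : Y₂ ⟶ Y₃) :
    tIso (α_ f f' f'') (α_ g g' g'') ≪≫ tComp f (f' ≫ f'') g (g' ≫ g'') ≪≫
        hc (Iso.refl _) (tComp f' f'' g' g'') =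
      tComp (f ≫ f') f'' (g ≫ g') g'' ≪≫ hc (tComp f f' g g') (Iso.refl _) ≪≫ α_ _ _ _ :=
  mapComp_assoc TensorBicategory.tensor (f ×ₘ g) (f' ×ₘ g') (f'' ×ₘ g'')

/-- `(m ≫ c) ⊠ n` splits off `c ⊠ 1`. -/
def splitRight (m : X₀ ⟶ X₁) (c : X₁ ⟶ X₂) (n : Y₀ ⟶ Y₁) :
    (m ≫ c) ⊠₁ n ≅ (m ⊠₁ n) ≫ c ▷ₜ Y₁ :=
  tIso (Iso.refl _) (ρ_ n).symm ≪≫ tComp m c n (𝟙 Y₁)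

/-- `n ⊠ (m ≫ c)` splits off `1 ⊠ c`. -/
def splitLeft (n : Y₀ ⟶ Y₁) (m : X₀ ⟶ X₁) (c : X₁ ⟶ X₂) :
    n ⊠₁ (m ≫ c) ≅ (n ⊠₁ m) ≫ Y₁ ◁ₜ c :=
  tIso (ρ_ n).symm (Iso.refl _) ≪≫ tComp n (𝟙 Y₁) m c

lemma splitRight_natural {m m' : X₀ ⟶ X₁} {c c' : X₁ ⟶ X₂} (i : m ≅ m') (j : c ≅ c')
    (n : Y₀ ⟶ Y₁) :
    tIso (hc i j) (Iso.refl n) ≪≫ splitRight m' c' n =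
      splitRight m c n ≪≫ hc (tIso i (Iso.refl n)) (wrIso j Y₁) := by
  have h := tComp_natural i j (Iso.refl n) (Iso.refl (𝟙 Y₁))
  simp only [splitRight, Iso.trans_assoc]
  rw [← h, hc_refl]
  simp

lemma splitLeft_natural {m m' : X₀ ⟶ X₁} {c c' : X₁ ⟶ X₂} (i : m ≅ m') (j : c ≅ c')
    (n : Y₀ ⟶ Y₁) :
    tIso (Iso.refl n) (hc i j) ≪≫ splitLeft n m' c' =
      splitLeft n m c ≪≫ hc (tIso (Iso.refl n) i) (wlIso Y₁ j) := by
  have h := tComp_natural (Iso.refl n) (Iso.refl (𝟙 Y₁)) i j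
  simp only [splitLeft, Iso.trans_assoc]
  rw [← h, hc_refl]
  simp

lemma splitRight_comp (m : X₀ ⟶ X₁) (c : X₁ ⟶ X₂) (c' : X₂ ⟶ X₃) (n : Y₀ ⟶ Y₁) :
    tIso (α_ m c c') (Iso.refl n) ≪≫ splitRight m (c ≫ c') n ≪≫
        hc (Iso.refl _) (wrComp c c' Y₁) =
      splitRight (m ≫ c) c' n ≪≫ hc (splitRight m c n) (Iso.refl _) ≪≫ α_ _ _ _ := by
  have h := tComp_assoc m c c' n (𝟙 Y₁) (𝟙 Y₁)
  have h₁ := tComp_natural (Iso.refl m) (Iso.refl (c ≫ c')) (Iso.refl n) (λ_ (𝟙 Y₁)).symm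
  have h₂ := tComp_natural (Iso.refl (m ≫ c)) (Iso.refl c') (ρ_ n).symm (Iso.refl (𝟙 Y₁))
  have e₁ : hc (Iso.refl (m ⊠₁ n)) (wrComp c c' Y₁) =
      hc (tIso (Iso.refl m) (Iso.refl n)) (tIso (Iso.refl (c ≫ c')) (λ_ (𝟙 Y₁)).symm) ≪≫
        hc (Iso.refl _) (tComp c c' (𝟙 Y₁) (𝟙 Y₁)) := by
    rw [← hc_trans, wrComp_eq, tIso_refl, Iso.refl_trans]
  have e₂ : hc (splitRight m c n) (Iso.refl (c' ▷ₜ Y₁)) =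
      hc (tIso (Iso.refl (m ≫ c)) (ρ_ n).symm) (tIso (Iso.refl c') (Iso.refl (𝟙 Y₁))) ≪≫
        hc (tComp m c n (𝟙 Y₁)) (Iso.refl _) := by
    rw [← hc_trans, tIso_refl, Iso.refl_trans]; rfl
  rw [e₁, e₂]
  simp only [splitRight, Iso.trans_assoc]
  rw [← Iso.trans_assoc (tComp m (c ≫ c') n (𝟙 Y₁)), ← h₁,
    ← Iso.trans_assoc (tComp (m ≫ c) c' n (𝟙 Y₁)), ← h₂, Iso.trans_assoc, Iso.trans_assoc, ← h]
  simp only [hc_refl, tIso_comp_assoc, Iso.refl_trans, Iso.trans_refl]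
  congr 2
  ext; simp

lemma splitLeft_comp (n : Y₀ ⟶ Y₁) (m : X₀ ⟶ X₁) (c : X₁ ⟶ X₂) (c' : X₂ ⟶ X₃) :
    tIso (Iso.refl n) (α_ m c c') ≪≫ splitLeft n m (c ≫ c') ≪≫
        hc (Iso.refl _) (wlComp Y₁ c c') =
      splitLeft n (m ≫ c) c' ≪≫ hc (splitLeft n m c) (Iso.refl _) ≪≫ α_ _ _ _ := by
  have h := tComp_assoc n (𝟙 Y₁) (𝟙 Y₁) m c c'
  have h₁ := tComp_natural (Iso.refl n) (λ_ (𝟙 Y₁)).symm (Iso.refl m) (Iso.refl (c ≫ c'))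
  have h₂ := tComp_natural (ρ_ n).symm (Iso.refl (𝟙 Y₁)) (Iso.refl (m ≫ c)) (Iso.refl c')
  have e₁ : hc (Iso.refl (n ⊠₁ m)) (wlComp Y₁ c c') =
      hc (tIso (Iso.refl n) (Iso.refl m)) (tIso (λ_ (𝟙 Y₁)).symm (Iso.refl (c ≫ c'))) ≪≫
        hc (Iso.refl _) (tComp (𝟙 Y₁) (𝟙 Y₁) c c') := by
    rw [← hc_trans, wlComp_eq, tIso_refl, Iso.refl_trans, leftUnitor_id]
  have e₂ : hc (splitLeft n m c) (Iso.refl (Y₁ ◁ₜ c')) =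
      hc (tIso (ρ_ n).symm (Iso.refl (m ≫ c))) (tIso (Iso.refl (𝟙 Y₁)) (Iso.refl c')) ≪≫
        hc (tComp n (𝟙 Y₁) m c) (Iso.refl _) := by
    rw [← hc_trans, tIso_refl, Iso.refl_trans]; rfl
  rw [e₁, e₂]
  simp only [splitLeft, Iso.trans_assoc]
  rw [← Iso.trans_assoc (tComp n (𝟙 Y₁) m (c ≫ c')), ← h₁,
    ← Iso.trans_assoc (tComp n (𝟙 Y₁) (m ≫ c) c'), ← h₂, Iso.trans_assoc, Iso.trans_assoc, ← h]
  simp only [hc_refl, tIso_comp_assoc, Iso.refl_trans, Iso.trans_refl]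
  congr 2
  ext; simp

/-- Splitting off `c'` before `c`, or `c` before `c'`, are the two bracketings of a threefold
composite under the tensor product; the unit constraints between them make up the interchange
2-cell. -/
lemma splitLeft_splitRight (m : X₀ ⟶ X₁) (c : X₁ ⟶ X₂) (n : Y₀ ⟶ Y₁) (c' : Y₁ ⟶ Y₂) :
    splitLeft (m ≫ c) n c' ≪≫ hc (splitRight m c n) (Iso.refl _) ≪≫ α_ _ _ _ ≪≫
        hc (Iso.refl _) (interchange c c') =
      splitRight m c (n ≫ c') ≪≫ hc (splitLeft m n c') (Iso.refl _) ≪≫ α_ _ _ _ := by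
  have h := tComp_assoc m c (𝟙 X₂) n (𝟙 Y₁) c'
  have h' := tComp_assoc m (𝟙 X₁) c n c' (𝟙 Y₂)
  have h₁ := tComp_natural (Iso.refl (m ≫ c)) (Iso.refl (𝟙 X₂)) (ρ_ n).symm (Iso.refl c')
  have h₂ := tComp_natural (ρ_ m).symm (Iso.refl c) (Iso.refl (n ≫ c')) (Iso.refl (𝟙 Y₂))
  have h₃ := tComp_natural (Iso.refl m) (ρ_ c ≪≫ (λ_ c).symm) (Iso.refl n) (λ_ c' ≪≫ (ρ_ c').symm)
  have e₁ : hc (Iso.refl (m ⊠₁ n)) (interchange c c') =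
      hc (Iso.refl (m ⊠₁ n)) (tComp c (𝟙 X₂) (𝟙 Y₁) c').symm ≪≫
        hc (tIso (Iso.refl m) (Iso.refl n)) (tIso (ρ_ c ≪≫ (λ_ c).symm) (λ_ c' ≪≫ (ρ_ c').symm)) ≪≫
        hc (Iso.refl _) (tComp (𝟙 X₁) c c' (𝟙 Y₂)) := by
    simp only [← hc_trans, tIso_refl, Iso.refl_trans]; rfl
  have e₂ : hc (splitRight m c n) (Iso.refl (X₂ ◁ₜ c')) =
      hc (tIso (Iso.refl (m ≫ c)) (ρ_ n).symm) (tIso (Iso.refl (𝟙 X₂)) (Iso.refl c')) ≪≫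
        hc (tComp m c n (𝟙 Y₁)) (Iso.refl _) := by
    rw [← hc_trans, tIso_refl, Iso.refl_trans]; rfl
  have e₃ : hc (splitLeft m n c') (Iso.refl (c ▷ₜ Y₂)) =
      hc (tIso (ρ_ m).symm (Iso.refl (n ≫ c'))) (tIso (Iso.refl c) (Iso.refl (𝟙 Y₂))) ≪≫
        hc (tComp m (𝟙 X₁) n c') (Iso.refl _) := by
    rw [← hc_trans, tIso_refl, Iso.refl_trans]; rfl
  have k : tComp (m ≫ c) (𝟙 X₂) (n ≫ 𝟙 Y₁) c' ≪≫ hc (tComp m c n (𝟙 Y₁)) (Iso.refl _) ≪≫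
      α_ _ _ _ ≪≫ hc (Iso.refl (m ⊠₁ n)) (tComp c (𝟙 X₂) (𝟙 Y₁) c').symm =
      tIso (α_ m c (𝟙 X₂)) (α_ n (𝟙 Y₁) c') ≪≫ tComp m (c ≫ 𝟙 X₂) n (𝟙 Y₁ ≫ c') := by
    have := congrArg (· ≪≫ hc (Iso.refl (m ⊠₁ n)) (tComp c (𝟙 X₂) (𝟙 Y₁) c').symm) h
    simp only [Iso.trans_assoc] at this
    rw [← this, ← hc_trans, Iso.self_symm_id, Iso.trans_refl, hc_refl, Iso.trans_refl]
  rw [e₁, e₂, e₃]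
  replace h₁ := congrArg Iso.hom h₁
  replace h₂ := congrArg Iso.hom h₂
  replace h₃ := congrArg Iso.hom h₃
  replace h' := congrArg Iso.hom h'
  replace k := congrArg Iso.hom k
  ext
  simp only [Iso.trans_hom] at h₁ h₂ h₃ h' k
  simp only [splitRight, splitLeft, Iso.trans_hom, Category.assoc]
  rw [← reassoc_of% h₁, reassoc_of% k, ← reassoc_of% h₃, ← reassoc_of% h₂, ← h']
  simp only [← Category.assoc]
  congr 2
  simp only [← Iso.trans_hom, ← tIso_trans]
  congr 2 <;> ext <;> simp

end
end
-- Associativity cells transported along 1-cells.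
section
open Bicategory
open scoped CategoryTheory.Prod

/-- Replace the vertical sides of a square by isomorphic ones. -/
def conjSq {B : Type u₁} [Bicategory.{w₁, v₁} B] {a₀ a₁ b₀ b₁ : B} {f₀ g₀ : a₀ ⟶ b₀}
    {f₁ g₁ : a₁ ⟶ b₁} {p : a₀ ⟶ a₁} {q : b₀ ⟶ b₁} (i : f₀ ≅ g₀) (j : f₁ ≅ g₁)
    (σ : f₀ ≫ q ≅ p ≫ f₁) : g₀ ≫ q ≅ p ≫ g₁ :=
  (hc i (Iso.refl q)).symm ≪≫ σ ≪≫ hc (Iso.refl p) j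

lemma conjSq_rel {B : Type u₁} [Bicategory.{w₁, v₁} B] {a₀ a₁ b₀ b₁ : B} {f₀ g₀ : a₀ ⟶ b₀}
    {f₁ g₁ : a₁ ⟶ b₁} {p : a₀ ⟶ a₁} {q : b₀ ⟶ b₁} (i : f₀ ≅ g₀) (j : f₁ ≅ g₁)
    (σ : f₀ ≫ q ≅ p ≫ f₁) : SqRel i j (Iso.refl p) (Iso.refl q) σ (conjSq i j σ) := by
  rw [SqRel, conjSq, Iso.self_symm_id_assoc]

variable {E : Type u} [Bicategory.{w, v} E]

section
variable [PreMonoidalBicategory E]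

section
variable {X X' X'' Y Y' Y'' Z Z' Z'' : E}

/-- Peels the last 1-cell `c` of one variable off the naturality square of the associator; this is
what produces the naturality 2-cells of `a` in the pentagons. `asNat_comp_as₂` and `asNat_comp_as₃`
do it for the other variables. -/
lemma asNat_comp_as₁ (m : X ⟶ X') (c : X' ⟶ X'') (v : Y ⟶ Y') (w : Z ⟶ Z') :
    SqRel (tIso (splitRight m c v) (Iso.refl w) ≪≫ splitRight (m ⊠₁ v) (c ▷ₜ Y') w)
      (splitRight m c (v ⊠₁ w)) (Iso.refl _) (Iso.refl _) (asNat (m ≫ c) v w)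
      (vPaste (asNat m v w) (as₁ c Y' Z')) := by
  have e := (asNat_map₂ (Iso.refl (m ≫ c)) (ρ_ v).symm (ρ_ w).symm).trans
    ((asNat_comp m c v (𝟙 _) w (𝟙 _)).trans
    ((SqRel.refl (asNat m v w)).vPaste (as₁_rel c Y' Z')))
  refine e.congr ?_ ?_ (by simp) (by simp)
  · simp only [splitRight, tIso_comp_assoc, Iso.refl_trans, Iso.trans_refl, hc_refl]
  · have h := tComp_natural (Iso.refl m) (Iso.refl c) (Iso.refl (v ⊠₁ w)) (tId Y' Z')
    have h' := map₂Iso_rightUnitor TensorBicategory.tensor (v ×ₘ w)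
    replace h' : tIso (ρ_ v) (ρ_ w) = tComp v (𝟙 Y') w (𝟙 Z') ≪≫ hc (Iso.refl _) (tId Y' Z') ≪≫
      ρ_ _ := h'
    simp only [splitRight, Iso.trans_assoc, tIso_comp_assoc, Iso.trans_refl]
    rw [← tIso_refl m (v ⊠₁ w), ← h]
    simp only [hc_refl, tIso_comp_assoc, Iso.trans_refl]
    congr 2
    rw [← tIso_symm, h']
    simp only [Iso.trans_symm, Iso.trans_assoc, hc_symm, Iso.refl_symm, Iso.symm_self_id_assoc]
    rw [← hc_trans]
    simp

lemma asNat_comp_as₂ (u : X ⟶ X') (m : Y ⟶ Y') (c : Y' ⟶ Y'') (w : Z ⟶ Z') :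
    SqRel (tIso (splitLeft u m c) (Iso.refl w) ≪≫ splitRight (u ⊠₁ m) (X' ◁ₜ c) w)
      (tIso (Iso.refl u) (splitRight m c w) ≪≫ splitLeft u (m ⊠₁ w) (c ▷ₜ Z'))
      (Iso.refl _) (Iso.refl _) (asNat u (m ≫ c) w)
      (vPaste (asNat u m w) (as₂ X' c Z')) := by
  have e := (asNat_map₂ (ρ_ u).symm (Iso.refl (m ≫ c)) (ρ_ w).symm).trans
    (asNat_comp u (𝟙 _) m c w (𝟙 _))
  refine e.congr ?_ ?_ (by simp) (by simp)
  · simp only [splitRight, splitLeft, tIso_comp_assoc, Iso.refl_trans, Iso.trans_refl]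
  · simp only [splitRight, splitLeft, tIso_comp_assoc, Iso.refl_trans, Iso.trans_refl]

lemma asNat_comp_as₃ (u : X ⟶ X') (v : Y ⟶ Y') (m : Z ⟶ Z') (c : Z' ⟶ Z'') :
    SqRel (splitLeft (u ⊠₁ v) m c)
      (tIso (Iso.refl u) (splitLeft v m c) ≪≫ splitLeft u (v ⊠₁ m) (Y' ◁ₜ c))
      (Iso.refl _) (Iso.refl _) (asNat u v (m ≫ c))
      (vPaste (asNat u v m) (as₃ X' Y' c)) := by
  have e := (asNat_map₂ (ρ_ u).symm (ρ_ v).symm (Iso.refl (m ≫ c))).trans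
    ((asNat_comp u (𝟙 _) v (𝟙 _) m c).trans
    ((SqRel.refl (asNat u v m)).vPaste (as₃_rel X' Y' c)))
  refine e.congr ?_ ?_ (by simp) (by simp)
  · have h := tComp_natural (Iso.refl (u ⊠₁ v)) (tId X' Y') (Iso.refl m) (Iso.refl c)
    have h' := map₂Iso_rightUnitor TensorBicategory.tensor (u ×ₘ v)
    replace h' : tIso (ρ_ u) (ρ_ v) = tComp u (𝟙 X') v (𝟙 Y') ≪≫ hc (Iso.refl _) (tId X' Y') ≪≫
      ρ_ _ := h'
    simp only [splitLeft, Iso.trans_assoc, tIso_comp_assoc, Iso.trans_refl]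
    rw [← tIso_refl (u ⊠₁ v) m, ← h]
    simp only [hc_refl, tIso_comp_assoc, Iso.trans_refl]
    congr 2
    rw [← tIso_symm, h']
    simp only [Iso.trans_symm, Iso.trans_assoc, hc_symm, Iso.refl_symm, Iso.symm_self_id_assoc]
    rw [← hc_trans]
    simp
  · simp only [splitLeft, tIso_comp_assoc, Iso.refl_trans, Iso.trans_refl, hc_refl]

lemma splitRight_split {m' : X ⟶ X''} {m : X ⟶ X'} {d : X' ⟶ X''} (K : m' ≅ m ≫ d) {X₃ : E}
    (c : X'' ⟶ X₃) (n : Y ⟶ Y') :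
    tIso (hc K (Iso.refl c) ≪≫ α_ m d c) (Iso.refl n) ≪≫ splitRight m (d ≫ c) n ≪≫
        hc (Iso.refl _) (wrComp d c Y') =
      splitRight m' c n ≪≫ hc (tIso K (Iso.refl n) ≪≫ splitRight m d n) (Iso.refl _) ≪≫
        α_ _ _ _ := by
  have h := congrArg (tIso (hc K (Iso.refl c)) (Iso.refl n) ≪≫ ·) (splitRight_comp m d c n)
  rw [← Iso.trans_assoc, tIso_comp, Iso.refl_trans] at h
  refine h.trans ?_
  rw [← Iso.trans_assoc, splitRight_natural, Iso.trans_assoc, ← Iso.trans_assoc (hc _ _), ← hc_trans]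
  simp

lemma splitLeft_split {m' : X ⟶ X''} {m : X ⟶ X'} {d : X' ⟶ X''} (K : m' ≅ m ≫ d) {X₃ : E}
    (c : X'' ⟶ X₃) (n : Y ⟶ Y') :
    tIso (Iso.refl n) (hc K (Iso.refl c) ≪≫ α_ m d c) ≪≫ splitLeft n m (d ≫ c) ≪≫
        hc (Iso.refl _) (wlComp Y' d c) =
      splitLeft n m' c ≪≫ hc (tIso (Iso.refl n) K ≪≫ splitLeft n m d) (Iso.refl _) ≪≫
        α_ _ _ _ := by
  have h := congrArg (tIso (Iso.refl n) (hc K (Iso.refl c)) ≪≫ ·) (splitLeft_comp n m d c)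
  rw [← Iso.trans_assoc, tIso_comp, Iso.refl_trans] at h
  refine h.trans ?_
  rw [← Iso.trans_assoc, splitLeft_natural, Iso.trans_assoc, ← Iso.trans_assoc (hc _ _), ← hc_trans]
  simp

lemma tSq_vPaste_idSq {a₀ a₁ b₀ b₁ c₀ c₁ : E} {f₀ : a₀ ⟶ b₀} {f₁ : a₁ ⟶ b₁} {g₀ : b₀ ⟶ c₀}
    {g₁ : b₁ ⟶ c₁} {p : a₀ ⟶ a₁} {q : b₀ ⟶ b₁} {r : c₀ ⟶ c₁} (σ : f₀ ≫ q ≅ p ≫ f₁)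
    (σ' : g₀ ≫ r ≅ q ≫ g₁) (v : Y ⟶ Y') :
    SqRel (splitRight f₀ g₀ v) (splitRight f₁ g₁ v) (Iso.refl _) (Iso.refl _)
      (tSq (vPaste σ σ') (idSq v)) (vPaste (tSq σ (idSq v)) (tSq σ' (idSq (𝟙 Y')))) := by
  have e := ((SqRel.refl (vPaste σ σ')).tSq (((SqRel.idSq (ρ_ v).symm).trans
    (SqRel.of_eq (vPaste_idSq v (𝟙 Y')).symm)).congr (Iso.trans_refl _) (Iso.trans_refl _)
    (Iso.trans_refl _) (Iso.trans_refl _))).trans (tSq_vPaste σ σ' (idSq v) (idSq (𝟙 Y')))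
  exact e.congr rfl rfl (by simp) (by simp)

lemma tSq_idSq_vPaste {a₀ a₁ b₀ b₁ c₀ c₁ : E} {f₀ : a₀ ⟶ b₀} {f₁ : a₁ ⟶ b₁} {g₀ : b₀ ⟶ c₀}
    {g₁ : b₁ ⟶ c₁} {p : a₀ ⟶ a₁} {q : b₀ ⟶ b₁} {r : c₀ ⟶ c₁} (σ : f₀ ≫ q ≅ p ≫ f₁)
    (σ' : g₀ ≫ r ≅ q ≫ g₁) (v : Y ⟶ Y') :
    SqRel (splitLeft v f₀ g₀) (splitLeft v f₁ g₁) (Iso.refl _) (Iso.refl _)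
      (tSq (idSq v) (vPaste σ σ')) (vPaste (tSq (idSq v) σ) (tSq (idSq (𝟙 Y')) σ')) := by
  have e := ((((SqRel.idSq (ρ_ v).symm).trans
    (SqRel.of_eq (vPaste_idSq v (𝟙 Y')).symm)).congr (Iso.trans_refl _) (Iso.trans_refl _)
    (Iso.trans_refl _) (Iso.trans_refl _)).tSq (SqRel.refl (vPaste σ σ'))).trans
    (tSq_vPaste (idSq v) (idSq (𝟙 Y')) σ σ')
  exact e.congr rfl rfl (by simp) (by simp)

end

section
variable {A B C P Q N X Y Z : E} {cxy : A ⊠ B ⟶ P} {cpz : P ⊠ C ⟶ N} {cyz : B ⊠ C ⟶ Q}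
  {cxq : A ⊠ Q ⟶ N} {f : I E ⟶ I E}

/-- Splitting an iterated product, associated to the left, of 1-cells. -/
def splitProdRight (cxy : A ⊠ B ⟶ P) (cpz : P ⊠ C ⟶ N) (u : X ⟶ A) (v : Y ⟶ B) (w : Z ⟶ C) :
    (((u ⊠₁ v) ≫ cxy) ⊠₁ w) ≫ cpz ≅ ((u ⊠₁ v) ⊠₁ w) ≫ cxy ▷ₜ C ≫ cpz :=
  hc (splitRight (u ⊠₁ v) cxy w) (Iso.refl cpz) ≪≫ α_ _ _ _

/-- Splitting an iterated product, associated to the right, of 1-cells. -/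
def splitProdLeft (cyz : B ⊠ C ⟶ Q) (cxq : A ⊠ Q ⟶ N) (u : X ⟶ A) (v : Y ⟶ B) (w : Z ⟶ C) :
    (u ⊠₁ ((v ⊠₁ w) ≫ cyz)) ≫ cxq ≅ (u ⊠₁ (v ⊠₁ w)) ≫ A ◁ₜ cyz ≫ cxq :=
  hc (splitLeft u (v ⊠₁ w) cyz) (Iso.refl cxq) ≪≫ α_ _ _ _

/-- An associativity 2-cell transported along `u`, `v`, `w`. -/
def assocCell (φ : cxy ▷ₜ C ≫ cpz ≫ eta N f ≅ a A B C ≫ A ◁ₜ cyz ≫ cxq) (u : X ⟶ A) (v : Y ⟶ B)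
    (w : Z ⟶ C) : ((((u ⊠₁ v) ≫ cxy) ⊠₁ w) ≫ cpz) ≫ eta N f ≅
      a X Y Z ≫ (u ⊠₁ ((v ⊠₁ w) ≫ cyz)) ≫ cxq :=
  conjSq (splitProdRight cxy cpz u v w).symm (splitProdLeft cyz cxq u v w).symm
    (vPaste (asNat u v w) (α_ _ _ _ ≪≫ φ))

lemma assocCell_rel (φ : cxy ▷ₜ C ≫ cpz ≫ eta N f ≅ a A B C ≫ A ◁ₜ cyz ≫ cxq) (u : X ⟶ A)
    (v : Y ⟶ B) (w : Z ⟶ C) :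
    SqRel (splitProdRight cxy cpz u v w) (splitProdLeft cyz cxq u v w) (Iso.refl _) (Iso.refl _)
      (assocCell φ u v w) (vPaste (asNat u v w) (α_ _ _ _ ≪≫ φ)) :=
  (conjSq_rel _ _ _).symm

end

end

end
-- The edges of a pentagon, and transport of a filled pentagon.
section
open Bicategory
open scoped CategoryTheory.Prod

lemma hc_reassoc {B : Type u₁} [Bicategory.{w₁, v₁} B] {a₀ a₁ a₂ a₃ a₄ : B} {p : a₀ ⟶ a₃}
    {m : a₀ ⟶ a₁} {m' : a₀ ⟶ a₂} {d : a₁ ⟶ a₂} {c : a₂ ⟶ a₃} {e : a₁ ⟶ a₃} (k : a₃ ⟶ a₄)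
    {x : p ≅ m ≫ e} {r : e ≅ d ≫ c} {y : p ≅ m' ≫ c} {z : m' ≅ m ≫ d}
    (h : x ≪≫ hc (Iso.refl m) r = y ≪≫ hc z (Iso.refl c) ≪≫ α_ m d c) :
    hc x (Iso.refl k) ≪≫ α_ m e k ≪≫ hc (Iso.refl m) (hc r (Iso.refl k) ≪≫ α_ d c k) =
      hc y (Iso.refl k) ≪≫ α_ m' c k ≪≫ hc z (Iso.refl (c ≫ k)) ≪≫ α_ m d (c ≫ k) := by
  have h' : x = (y ≪≫ hc z (Iso.refl c) ≪≫ α_ m d c) ≪≫ (hc (Iso.refl m) r).symm := by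
    rw [← h, Iso.trans_assoc, Iso.self_symm_id, Iso.trans_refl]
  subst h'
  ext
  simp

lemma hc_reassoc' {B : Type u₁} [Bicategory.{w₁, v₁} B] {a₀ a₁ a₂ a₂' a₃ a₄ : B} {p : a₀ ⟶ a₃}
    {m : a₀ ⟶ a₁} {m' : a₀ ⟶ a₂} {m'' : a₀ ⟶ a₂'} {d : a₁ ⟶ a₂} {c : a₂ ⟶ a₃} {d' : a₁ ⟶ a₂'}
    {c' : a₂' ⟶ a₃} (k : a₃ ⟶ a₄) {s : p ≅ m' ≫ c} {r : m' ≅ m ≫ d} {s' : p ≅ m'' ≫ c'}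
    {r' : m'' ≅ m ≫ d'} {i : d ≫ c ≅ d' ≫ c'}
    (h : s ≪≫ hc r (Iso.refl c) ≪≫ α_ m d c ≪≫ hc (Iso.refl m) i =
      s' ≪≫ hc r' (Iso.refl c') ≪≫ α_ m d' c') :
    hc s' (Iso.refl k) ≪≫ α_ m'' c' k ≪≫ hc r' (Iso.refl (c' ≫ k)) ≪≫ α_ m d' (c' ≫ k) ≪≫
      hc (Iso.refl m) ((α_ d c k).symm ≪≫ hc i (Iso.refl k) ≪≫ α_ d' c' k).symm =
      hc s (Iso.refl k) ≪≫ α_ m' c k ≪≫ hc r (Iso.refl (c ≫ k)) ≪≫ α_ m d (c ≫ k) := by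
  have h' : s' = (s ≪≫ hc r (Iso.refl c) ≪≫ α_ m d c ≪≫ hc (Iso.refl m) i) ≪≫
      (hc r' (Iso.refl c') ≪≫ α_ m d' c').symm := by
    rw [h, Iso.trans_assoc, Iso.self_symm_id, Iso.trans_refl]
  subst h'
  ext
  simp

variable {E : Type u} [Bicategory.{w, v} E] [MonoidalBicategory E]
open MonoidalBicategory

section
variable {A B C T P Q R U V N X Y Z W : E} {cxy : A ⊠ B ⟶ P} {cyz : B ⊠ C ⟶ Q}
  {czt : C ⊠ T ⟶ R} {cpz : P ⊠ C ⟶ U} {cxq : A ⊠ Q ⟶ U} {cyr : B ⊠ R ⟶ V} {cqt : Q ⊠ T ⟶ V}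
  {cut : U ⊠ T ⟶ N} {cpr : P ⊠ R ⟶ N} {cxv : A ⊠ V ⟶ N} (u : X ⟶ A) (v : Y ⟶ B) (w' : Z ⟶ C)
  (t : W ⟶ T)

/-- Splitting a product of four 1-cells, associated to the left. -/
def splitProd₀ (cxy : A ⊠ B ⟶ P) (cpz : P ⊠ C ⟶ U) (cut : U ⊠ T ⟶ N) (u : X ⟶ A) (v : Y ⟶ B)
    (w : Z ⟶ C) (t : W ⟶ T) :
    (((((u ⊠₁ v) ≫ cxy) ⊠₁ w) ≫ cpz) ⊠₁ t) ≫ cut ≅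
      (((u ⊠₁ v) ⊠₁ w) ⊠₁ t) ≫ cxy ▷ₜ C ▷ₜ T ≫ cpz ▷ₜ T ≫ cut :=
  hc (splitRight (((u ⊠₁ v) ≫ cxy) ⊠₁ w) cpz t) (Iso.refl cut) ≪≫ α_ _ _ _ ≪≫
    hc (tIso (splitRight (u ⊠₁ v) cxy w) (Iso.refl t) ≪≫
      splitRight ((u ⊠₁ v) ⊠₁ w) (cxy ▷ₜ C) t) (Iso.refl _) ≪≫ α_ _ _ _

/-- Splitting a product of four 1-cells, associated as `(XY)(ZT)`. -/
def splitProd₁ (cxy : A ⊠ B ⟶ P) (czt : C ⊠ T ⟶ R) (cpr : P ⊠ R ⟶ N) (u : X ⟶ A) (v : Y ⟶ B)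
    (w : Z ⟶ C) (t : W ⟶ T) :
    (((u ⊠₁ v) ≫ cxy) ⊠₁ ((w ⊠₁ t) ≫ czt)) ≫ cpr ≅
      ((u ⊠₁ v) ⊠₁ (w ⊠₁ t)) ≫ cxy ▷ₜ (C ⊠ T) ≫ P ◁ₜ czt ≫ cpr :=
  hc (splitLeft ((u ⊠₁ v) ≫ cxy) (w ⊠₁ t) czt) (Iso.refl cpr) ≪≫ α_ _ _ _ ≪≫
    hc (splitRight (u ⊠₁ v) cxy (w ⊠₁ t)) (Iso.refl _) ≪≫ α_ _ _ _

/-- Splitting a product of four 1-cells, associated to the right. -/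
def splitProd₂ (czt : C ⊠ T ⟶ R) (cyr : B ⊠ R ⟶ V) (cxv : A ⊠ V ⟶ N) (u : X ⟶ A) (v : Y ⟶ B)
    (w : Z ⟶ C) (t : W ⟶ T) :
    (u ⊠₁ ((v ⊠₁ ((w ⊠₁ t) ≫ czt)) ≫ cyr)) ≫ cxv ≅
      (u ⊠₁ (v ⊠₁ (w ⊠₁ t))) ≫ A ◁ₜ (B ◁ₜ czt) ≫ A ◁ₜ cyr ≫ cxv :=
  hc (splitLeft u (v ⊠₁ ((w ⊠₁ t) ≫ czt)) cyr) (Iso.refl cxv) ≪≫ α_ _ _ _ ≪≫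
    hc (tIso (Iso.refl u) (splitLeft v (w ⊠₁ t) czt) ≪≫ splitLeft u (v ⊠₁ (w ⊠₁ t)) (B ◁ₜ czt))
      (Iso.refl _) ≪≫ α_ _ _ _

/-- Splitting a product of four 1-cells, associated as `(X(YZ))T`. -/
def splitProd₃ (cyz : B ⊠ C ⟶ Q) (cxq : A ⊠ Q ⟶ U) (cut : U ⊠ T ⟶ N) (u : X ⟶ A) (v : Y ⟶ B)
    (w : Z ⟶ C) (t : W ⟶ T) :
    (((u ⊠₁ ((v ⊠₁ w) ≫ cyz)) ≫ cxq) ⊠₁ t) ≫ cut ≅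
      ((u ⊠₁ (v ⊠₁ w)) ⊠₁ t) ≫ (A ◁ₜ cyz) ▷ₜ T ≫ cxq ▷ₜ T ≫ cut :=
  hc (splitRight (u ⊠₁ ((v ⊠₁ w) ≫ cyz)) cxq t) (Iso.refl cut) ≪≫ α_ _ _ _ ≪≫
    hc (tIso (splitLeft u (v ⊠₁ w) cyz) (Iso.refl t) ≪≫
      splitRight (u ⊠₁ (v ⊠₁ w)) (A ◁ₜ cyz) t) (Iso.refl _) ≪≫ α_ _ _ _

/-- Splitting a product of four 1-cells, associated as `X((YZ)T)`. -/
def splitProd₄ (cyz : B ⊠ C ⟶ Q) (cqt : Q ⊠ T ⟶ V) (cxv : A ⊠ V ⟶ N) (u : X ⟶ A) (v : Y ⟶ B)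
    (w : Z ⟶ C) (t : W ⟶ T) :
    (u ⊠₁ ((((v ⊠₁ w) ≫ cyz) ⊠₁ t) ≫ cqt)) ≫ cxv ≅
      (u ⊠₁ ((v ⊠₁ w) ⊠₁ t)) ≫ A ◁ₜ (cyz ▷ₜ T) ≫ A ◁ₜ cqt ≫ cxv :=
  hc (splitLeft u (((v ⊠₁ w) ≫ cyz) ⊠₁ t) cqt) (Iso.refl cxv) ≪≫ α_ _ _ _ ≪≫
    hc (tIso (Iso.refl u) (splitRight (v ⊠₁ w) cyz t) ≪≫
      splitLeft u ((v ⊠₁ w) ⊠₁ t) (cyz ▷ₜ T)) (Iso.refl _) ≪≫ α_ _ _ _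

/-- The upper right edge of a pentagon, moved past `cxy`. -/
def pentagonEdge₁ {f : I E ⟶ I E} (cxy : A ⊠ B ⟶ P)
    (φ : cpz ▷ₜ T ≫ cut ≫ eta N f ≅ a P C T ≫ P ◁ₜ czt ≫ cpr) :
    (cxy ▷ₜ C ▷ₜ T ≫ cpz ▷ₜ T ≫ cut) ≫ eta N f ≅
      a (A ⊠ B) C T ≫ cxy ▷ₜ (C ⊠ T) ≫ P ◁ₜ czt ≫ cpr :=
  vPaste (as₁ cxy C T) (α_ _ _ _ ≪≫ φ)

/-- The upper left edge of a pentagon, moved past `czt`. -/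
def pentagonEdge₂ {f : I E ⟶ I E} (czt : C ⊠ T ⟶ R)
    (φ : cxy ▷ₜ R ≫ cpr ≫ eta N f ≅ a A B R ≫ A ◁ₜ cyr ≫ cxv) :
    (cxy ▷ₜ (C ⊠ T) ≫ P ◁ₜ czt ≫ cpr) ≫ eta N f ≅
      a A B (C ⊠ T) ≫ A ◁ₜ (B ◁ₜ czt) ≫ A ◁ₜ cyr ≫ cxv :=
  conjSq ((α_ _ _ _).symm ≪≫ hc (interchange cxy czt) (Iso.refl cpr) ≪≫ α_ _ _ _).symm
    (Iso.refl _) (vPaste (as₃ A B czt) (α_ _ _ _ ≪≫ φ))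

/-- The first lower edge of a pentagon. -/
def pentagonEdge₃ (τ : TrivialAction E) {f : AutI E} (cut : U ⊠ T ⟶ N)
    (φ : cxy ▷ₜ C ≫ cpz ≫ eta U f.hom ≅ a A B C ≫ A ◁ₜ cyz ≫ cxq) :
    (cxy ▷ₜ C ▷ₜ T ≫ cpz ▷ₜ T ≫ cut) ≫ eta N f.hom ≅
      a A B C ▷ₜ T ≫ (A ◁ₜ cyz) ▷ₜ T ≫ cxq ▷ₜ T ≫ cut :=
  conjSq (hc (wrComp _ _ T) (Iso.refl cut) ≪≫ α_ _ _ _) (hc (wrComp _ _ T) (Iso.refl cut) ≪≫ α_ _ _ _)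
    (vPaste (tSq (α_ _ _ _ ≪≫ φ) (idSq (𝟙 T))) (enterLeft τ cut f))

/-- The second lower edge of a pentagon, moved past `cyz`. -/
def pentagonEdge₄ {f : I E ⟶ I E} (cyz : B ⊠ C ⟶ Q)
    (φ : cxq ▷ₜ T ≫ cut ≫ eta N f ≅ a A Q T ≫ A ◁ₜ cqt ≫ cxv) :
    ((A ◁ₜ cyz) ▷ₜ T ≫ cxq ▷ₜ T ≫ cut) ≫ eta N f ≅
      a A (B ⊠ C) T ≫ A ◁ₜ (cyz ▷ₜ T) ≫ A ◁ₜ cqt ≫ cxv :=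
  vPaste (as₂ A cyz T) (α_ _ _ _ ≪≫ φ)

/-- The third lower edge of a pentagon. -/
def pentagonEdge₅ {f : AutI E} (cxv : A ⊠ V ⟶ N)
    (φ : cyz ▷ₜ T ≫ cqt ≫ eta V f.hom ≅ a B C T ≫ B ◁ₜ czt ≫ cyr) :
    (A ◁ₜ (cyz ▷ₜ T) ≫ A ◁ₜ cqt ≫ cxv) ≫ eta N f.hom ≅
      A ◁ₜ a B C T ≫ A ◁ₜ (B ◁ₜ czt) ≫ A ◁ₜ cyr ≫ cxv :=
  conjSq (hc (wlComp A _ _) (Iso.refl cxv) ≪≫ α_ _ _ _) (hc (wlComp A _ _) (Iso.refl cxv) ≪≫ α_ _ _ _)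
    (vPaste (tSq (idSq (𝟙 A)) (α_ _ _ _ ≪≫ φ)) (enterRight cxv f))

/-- A transported edge is the naturality of the associator at `u`, `v`, `w'`, `t`, pasted onto the
edge of the pentagon of `A`, `B`, `C`, `T`. The splittings at both ends are chosen so that
consecutive edges match; the other four edges follow the same pattern. -/
lemma pentagonEdge₁_rel {f : I E ⟶ I E}
    (φ : cpz ▷ₜ T ≫ cut ≫ eta N f ≅ a P C T ≫ P ◁ₜ czt ≫ cpr) :
    SqRel (splitProd₀ cxy cpz cut u v w' t) (splitProd₁ cxy czt cpr u v w' t) (Iso.refl _)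
      (Iso.refl _) (assocCell φ ((u ⊠₁ v) ≫ cxy) w' t)
      (vPaste (asNat (u ⊠₁ v) w' t) (pentagonEdge₁ cxy φ)) := by
  have e := (assocCell_rel φ ((u ⊠₁ v) ≫ cxy) w' t).trans
    (((asNat_comp_as₁ (u ⊠₁ v) cxy w' t).vPaste (SqRel.refl (α_ _ _ _ ≪≫ φ))).trans
    (SqRel.vPaste_assoc (asNat (u ⊠₁ v) w' t) (as₁ cxy C T) (α_ _ _ _ ≪≫ φ)))
  refine e.congr ?_ ?_ (by simp) (by simp)
  · simp only [splitProdRight, splitProd₀, Iso.trans_assoc]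
  · simp only [splitProdLeft, splitProd₁, Iso.trans_assoc]

lemma pentagonEdge₂_rel {f : I E ⟶ I E}
    (φ : cxy ▷ₜ R ≫ cpr ≫ eta N f ≅ a A B R ≫ A ◁ₜ cyr ≫ cxv) :
    SqRel (splitProd₁ cxy czt cpr u v w' t) (splitProd₂ czt cyr cxv u v w' t) (Iso.refl _)
      (Iso.refl _) (assocCell φ u v ((w' ⊠₁ t) ≫ czt))
      (vPaste (asNat u v (w' ⊠₁ t)) (pentagonEdge₂ czt φ)) := by
  have e := (assocCell_rel φ u v ((w' ⊠₁ t) ≫ czt)).trans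
    (((asNat_comp_as₃ u v (w' ⊠₁ t) czt).vPaste (SqRel.refl (α_ _ _ _ ≪≫ φ))).trans
    ((SqRel.vPaste_assoc (asNat u v (w' ⊠₁ t)) (as₃ A B czt) (α_ _ _ _ ≪≫ φ)).trans
    ((SqRel.refl (asNat u v (w' ⊠₁ t))).vPaste (conjSq_rel
      ((α_ _ _ _).symm ≪≫ hc (interchange cxy czt) (Iso.refl cpr) ≪≫ α_ _ _ _).symm
      (Iso.refl _) _))))
  refine e.congr ?_ ?_ (by simp) (by simp)
  · simp only [splitProdRight, Iso.trans_assoc]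
    -- The common vertex of the first two edges is split with `cxy` pulled out first, while this
    -- edge needs `czt` first; the interchange 2-cell in `pentagonEdge₂` mediates.
    exact hc_reassoc' cpr (splitLeft_splitRight (u ⊠₁ v) cxy (w' ⊠₁ t) czt)
  · simp only [splitProdLeft, splitProd₂, Iso.trans_assoc, hc_refl, Iso.trans_refl]

lemma pentagonEdge₃_rel (τ : TrivialAction E) {f : AutI E}
    (φ : cxy ▷ₜ C ≫ cpz ≫ eta U f.hom ≅ a A B C ≫ A ◁ₜ cyz ≫ cxq) :
    SqRel (splitProd₀ cxy cpz cut u v w' t) (splitProd₃ cyz cxq cut u v w' t) (Iso.refl _)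
      (Iso.refl _) (rightMul cut τ (assocCell φ u v w') t)
      (vPaste (tSq (asNat u v w') (idSq t)) (pentagonEdge₃ τ cut φ)) := by
  have e₀ := (((assocCell_rel φ u v w').tSq (SqRel.refl (idSq t))).trans
    (tSq_vPaste_idSq (asNat u v w') (α_ _ _ _ ≪≫ φ) t)).congr rfl rfl rfl
      ((Iso.trans_refl _).trans (tIso_refl _ _))
  have e := (e₀.vPaste (SqRel.refl (enterLeft τ cut f))).trans
    ((SqRel.vPaste_assoc _ _ _).trans ((SqRel.refl (tSq (asNat u v w') (idSq t))).vPaste (conjSq_rel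
    (hc (wrComp _ _ T) (Iso.refl cut) ≪≫ α_ _ _ _) (hc (wrComp _ _ T) (Iso.refl cut) ≪≫ α_ _ _ _)
    (vPaste (tSq (α_ _ _ _ ≪≫ φ) (idSq (𝟙 T))) (enterLeft τ cut f)))))
  refine e.congr ?_ ?_ (by simp) (by simp)
  · refine hc_reassoc cut ?_
    rw [Iso.trans_assoc]
    exact splitRight_split (splitRight (u ⊠₁ v) cxy w') cpz t
  · refine hc_reassoc cut ?_
    rw [Iso.trans_assoc]
    exact splitRight_split (splitLeft u (v ⊠₁ w') cyz) cxq t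

lemma pentagonEdge₄_rel {f : I E ⟶ I E}
    (φ : cxq ▷ₜ T ≫ cut ≫ eta N f ≅ a A Q T ≫ A ◁ₜ cqt ≫ cxv) :
    SqRel (splitProd₃ cyz cxq cut u v w' t) (splitProd₄ cyz cqt cxv u v w' t) (Iso.refl _)
      (Iso.refl _) (assocCell φ u ((v ⊠₁ w') ≫ cyz) t)
      (vPaste (asNat u (v ⊠₁ w') t) (pentagonEdge₄ cyz φ)) := by
  have e := (assocCell_rel φ u ((v ⊠₁ w') ≫ cyz) t).trans
    (((asNat_comp_as₂ u (v ⊠₁ w') cyz t).vPaste (SqRel.refl (α_ _ _ _ ≪≫ φ))).trans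
    (SqRel.vPaste_assoc (asNat u (v ⊠₁ w') t) (as₂ A cyz T) (α_ _ _ _ ≪≫ φ)))
  refine e.congr ?_ ?_ (by simp) (by simp)
  · simp only [splitProdRight, splitProd₃, Iso.trans_assoc]
  · simp only [splitProdLeft, splitProd₄, Iso.trans_assoc]

lemma pentagonEdge₅_rel {f : AutI E}
    (φ : cyz ▷ₜ T ≫ cqt ≫ eta V f.hom ≅ a B C T ≫ B ◁ₜ czt ≫ cyr) :
    SqRel (splitProd₄ cyz cqt cxv u v w' t) (splitProd₂ czt cyr cxv u v w' t) (Iso.refl _)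
      (Iso.refl _) (leftMul cxv u (assocCell φ v w' t))
      (vPaste (tSq (idSq u) (asNat v w' t)) (pentagonEdge₅ cxv φ)) := by
  have e₀ := (((SqRel.refl (idSq u)).tSq (assocCell_rel φ v w' t)).trans
    (tSq_idSq_vPaste (asNat v w' t) (α_ _ _ _ ≪≫ φ) u)).congr rfl rfl rfl
      ((Iso.trans_refl _).trans (tIso_refl _ _))
  have e := (e₀.vPaste (SqRel.refl (enterRight cxv f))).trans
    ((SqRel.vPaste_assoc _ _ _).trans ((SqRel.refl (tSq (idSq u) (asNat v w' t))).vPaste (conjSq_rel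
    (hc (wlComp A _ _) (Iso.refl cxv) ≪≫ α_ _ _ _) (hc (wlComp A _ _) (Iso.refl cxv) ≪≫ α_ _ _ _)
    (vPaste (tSq (idSq (𝟙 A)) (α_ _ _ _ ≪≫ φ)) (enterRight cxv f)))))
  refine e.congr ?_ ?_ (by simp) (by simp)
  · refine hc_reassoc cxv ?_
    rw [Iso.trans_assoc]
    exact splitLeft_split (splitRight (v ⊠₁ w') cyz t) cqt u
  · refine hc_reassoc cxv ?_
    rw [Iso.trans_assoc]
    exact splitLeft_split (splitLeft v (w' ⊠₁ t) czt) cyr u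

/-- A pentagon filled with `θ` remains so after transport along `u`, `v`, `w'`, `t`. -/
lemma pentagon_transport (τ : TrivialAction E) {f₁ f₂ g₁ g₂ g₃ : AutI E}
    (φpzt : cpz ▷ₜ T ≫ cut ≫ eta N f₁.hom ≅ a P C T ≫ P ◁ₜ czt ≫ cpr)
    (φxyr : cxy ▷ₜ R ≫ cpr ≫ eta N f₂.hom ≅ a A B R ≫ A ◁ₜ cyr ≫ cxv)
    (φxyz : cxy ▷ₜ C ≫ cpz ≫ eta U g₁.hom ≅ a A B C ≫ A ◁ₜ cyz ≫ cxq)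
    (φxqt : cxq ▷ₜ T ≫ cut ≫ eta N g₂.hom ≅ a A Q T ≫ A ◁ₜ cqt ≫ cxv)
    (φyzt : cyz ▷ₜ T ≫ cqt ≫ eta V g₃.hom ≅ a B C T ≫ B ◁ₜ czt ≫ cyr)
    (θ : f₁.hom ≫ f₂.hom ≅ g₁.hom ≫ g₂.hom ≫ g₃.hom)
    (H : SqRel (Iso.refl _) (Iso.refl _) (pent A B C T).symm
      (AssociativityData.pentagonCell N θ)
      (hPaste (pentagonEdge₁ cxy φpzt) (pentagonEdge₂ czt φxyr))
      (hPaste (pentagonEdge₃ τ cut φxyz)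
        (hPaste (pentagonEdge₄ cyz φxqt) (pentagonEdge₅ cxv φyzt)))) :
    GradedRel (pent X Y Z W).symm θ
      (gradedComp (assocCell φpzt ((u ⊠₁ v) ≫ cxy) w' t) (assocCell φxyr u v ((w' ⊠₁ t) ≫ czt)))
      (gradedComp (rightMul cut τ (assocCell φxyz u v w') t)
        (gradedComp (assocCell φxqt u ((v ⊠₁ w') ≫ cyz) t)
          (leftMul cxv u (assocCell φyzt v w' t)))) := by
  have e₁ := (pentagonEdge₁_rel u v w' t φpzt).hPaste (pentagonEdge₂_rel u v w' t φxyr)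
  have e₂ := (pentagonEdge₃_rel u v w' t τ φxyz).hPaste
    ((pentagonEdge₄_rel u v w' t φxqt).hPaste (pentagonEdge₅_rel u v w' t φyzt))
  -- The modification axiom moves the pentagonator of `A`, `B`, `C`, `T` back to that of `X`, `Y`,
  -- `Z`, `W`.
  have p : SqRel (Iso.refl _) (Iso.refl _) (pent X Y Z W) (pent A B C T)
      (hPaste (tSq (asNat u v w') (idSq t)) (hPaste (asNat u (v ⊠₁ w') t)
        (tSq (idSq u) (asNat v w' t))))
      (hPaste (asNat (u ⊠₁ v) w' t) (asNat u v (w' ⊠₁ t))) := by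
    have h := (pent_rel u v w' t).transpose
    simpa only [vPaste, tSq_symm, Iso.symm_symm_eq] using h
  have e := e₁.trans ((SqRel.of_eq (hPaste_vPaste _ _ _ _)).trans
    ((p.symm.vPaste H).trans
    ((SqRel.of_eq ((congrArg _ (hPaste_vPaste _ _ _ _)).trans (hPaste_vPaste _ _ _ _)).symm).trans
      e₂.symm)))
  refine ((gradedComp_rel _ _).trans (e.trans (((SqRel.refl _).hPaste
    (gradedComp_rel _ _).symm).trans (gradedComp_rel _ _).symm))).congr ?_ ?_ ?_ ?_
  · simp
  · simp
  · simp
  · rw [AssociativityData.pentagonCell, ← hc_refl_left]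
    simp only [Iso.refl_trans, Iso.trans_refl, Iso.trans_assoc, hc_refl, Iso.refl_symm,
      Iso.self_symm_id_assoc]
    rw [← Iso.trans_assoc (hc _ _), ← hc_trans]
    simp

end

end
-- From the whiskered composites of `upperSide` and `lowerSide` to pastings of squares.
section
open Bicategory
open scoped CategoryTheory.Prod

section
variable {B : Type u₁} [Bicategory.{w₁, v₁} B]

lemma conj_whiskerLeft {a b c d c' : B} {l k : a ⟶ b} (W : l ≅ k) {g : b ⟶ c} {e : c ⟶ d}
    {e' : b ⟶ c'} {g' : c' ⟶ d} (L : g ≫ e ⟶ e' ≫ g') :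
    W.inv ▷ g ▷ e ≫ (α_ l g e).hom ≫ l ◁ L ≫ (α_ l e' g').inv ≫ W.hom ▷ e' ▷ g' =
      (α_ k g e).hom ≫ k ◁ L ≫ (α_ k e' g').inv := by
  rw [← associator_inv_naturality_left, whisker_exchange_assoc, associator_naturality_left_assoc,
    ← comp_whiskerRight_assoc]
  simp

/-- A formal identity in an arbitrary bicategory, where the tensor product plays no role. Up to
coherence the two sides differ only by sliding `L₃` past `S`. -/
lemma hPaste_hPaste_eq {o₀ o₁ o₂ x₁ x₂ y₁ y₂ z q n : B} {k₁ : o₀ ⟶ o₁} {k₂ : o₁ ⟶ o₂} {k₃ : o₂ ⟶ n}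
    {e₁ e₂ e₃ : n ⟶ n} {e₁' : o₂ ⟶ o₂} {e₃' : z ⟶ z} {p₁ : o₀ ⟶ x₁} {p₂ : x₁ ⟶ x₂} {p₂' : y₁ ⟶ y₂}
    {p₃ : x₂ ⟶ q} {x₃ : B} {p : o₀ ⟶ x₃} {p' : x₃ ⟶ q} {m₁ : x₁ ⟶ y₁} {m₂ : y₁ ⟶ o₂} {m₁' : x₂ ⟶ y₂} {n₁ : y₂ ⟶ z}
    {n₂ : z ⟶ n} {y₃ : B} {r₁ : q ⟶ y₃} {r₂ : y₃ ⟶ z} {l₁ : o₀ ⟶ o₂} {l₂ : x₁ ⟶ o₂} {l₃ : x₂ ⟶ z}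
    {l₄ : q ⟶ z} (L₁ : k₃ ≫ e₁ ≅ e₁' ≫ k₃) (M₃ : k₁ ≫ k₂ ≫ e₁' ≅ p₁ ≫ m₁ ≫ m₂)
    (φ : m₂ ≫ k₃ ≫ e₂ ≅ p₂' ≫ n₁ ≫ n₂) (L₃ : n₂ ≫ e₃ ≅ e₃' ≫ n₂) (S : m₁ ≫ p₂' ≅ p₂ ≫ m₁')
    (M₅ : m₁' ≫ n₁ ≫ e₃' ≅ p₃ ≫ r₁ ≫ r₂) (W₁ : l₁ ≅ k₁ ≫ k₂) (W₂ : l₂ ≅ m₁ ≫ m₂)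
    (W₃ : l₃ ≅ m₁' ≫ n₁) (W₄ : l₄ ≅ r₁ ≫ r₂) (P : p₁ ≫ p₂ ≫ p₃ ≅ p ≫ p') :
    Iso.refl (k₁ ≫ k₂ ≫ k₃ ≫ e₁ ≫ e₂ ≫ e₃) ≪⊗≫ (k₁ ≫ k₂) ◁ᵢ (L₁ ▷ᵢ (e₂ ≫ e₃)) ≪⊗≫
      M₃ ▷ᵢ (k₃ ≫ e₂ ≫ e₃) ≪⊗≫ (p₁ ≫ m₁) ◁ᵢ (φ ▷ᵢ e₃) ≪⊗≫ (p₁ ≫ m₁ ≫ p₂' ≫ n₁) ◁ᵢ L₃ ≪⊗≫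
      p₁ ◁ᵢ (S ▷ᵢ (n₁ ≫ e₃' ≫ n₂)) ≪⊗≫ (p₁ ≫ p₂) ◁ᵢ (M₅ ▷ᵢ n₂) ≪⊗≫ P ▷ᵢ (r₁ ≫ r₂ ≫ n₂) ≪⊗≫
      Iso.refl (p ≫ p' ≫ r₁ ≫ r₂ ≫ n₂) =
    Iso.refl _ ≪⊗≫ (hPaste
      (conjSq (hc W₁ (Iso.refl k₃) ≪≫ α_ _ _ _) (hc W₂ (Iso.refl k₃) ≪≫ α_ _ _ _)
        (vPaste (hc W₁ (Iso.refl _) ≪≫ α_ _ _ _ ≪≫ M₃ ≪≫ (hc (Iso.refl _) W₂).symm) L₁))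
      (hPaste (vPaste S (α_ _ _ _ ≪≫ φ))
      (conjSq (hc W₃ (Iso.refl n₂) ≪≫ α_ _ _ _) (hc W₄ (Iso.refl n₂) ≪≫ α_ _ _ _)
        (vPaste (hc W₃ (Iso.refl _) ≪≫ α_ _ _ _ ≪≫ M₅ ≪≫ (hc (Iso.refl _) W₄).symm) L₃))) ≪≫
      hc P (Iso.refl _)) ≪⊗≫ Iso.refl _ := by
  have h₁ : conjSq (hc W₁ (Iso.refl k₃) ≪≫ α_ _ _ _) (hc W₂ (Iso.refl k₃) ≪≫ α_ _ _ _)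
        (vPaste (hc W₁ (Iso.refl _) ≪≫ α_ _ _ _ ≪≫ M₃ ≪≫ (hc (Iso.refl _) W₂).symm) L₁) =
      Iso.refl _ ≪⊗≫ (k₁ ≫ k₂) ◁ᵢ L₁ ≪⊗≫ M₃ ▷ᵢ k₃ ≪⊗≫ Iso.refl _ := by
    ext
    simp [bicategoricalIsoComp, conjSq, vPaste_hom]
    rw [reassoc_of% conj_whiskerLeft]
    simp
  have h₃ : conjSq (hc W₃ (Iso.refl n₂) ≪≫ α_ _ _ _) (hc W₄ (Iso.refl n₂) ≪≫ α_ _ _ _)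
        (vPaste (hc W₃ (Iso.refl _) ≪≫ α_ _ _ _ ≪≫ M₅ ≪≫ (hc (Iso.refl _) W₄).symm) L₃) =
      Iso.refl _ ≪⊗≫ (m₁' ≫ n₁) ◁ᵢ L₃ ≪⊗≫ M₅ ▷ᵢ n₂ ≪⊗≫ Iso.refl _ := by
    ext
    simp [bicategoricalIsoComp, conjSq, vPaste_hom]
    rw [reassoc_of% conj_whiskerLeft]
    simp
  rw [h₁, h₃]
  ext
  simp only [bicategoricalIsoComp, hPaste_hom, vPaste_hom, Iso.trans_hom, hc_hom, Iso.refl_hom,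
    whiskerLeftIso_hom, whiskerRightIso_hom]
  calc _ = 𝟙 (k₁ ≫ k₂ ≫ k₃ ≫ e₁ ≫ e₂ ≫ e₃) ⊗≫ (k₁ ≫ k₂) ◁ (L₁.hom ▷ (e₂ ≫ e₃)) ⊗≫
      M₃.hom ▷ (k₃ ≫ e₂ ≫ e₃) ⊗≫ (p₁ ≫ m₁) ◁ (φ.hom ▷ e₃) ⊗≫
      p₁ ◁ ((m₁ ≫ p₂') ◁ (n₁ ◁ L₃.hom) ≫ S.hom ▷ (n₁ ≫ e₃' ≫ n₂)) ⊗≫ (p₁ ≫ p₂) ◁ (M₅.hom ▷ n₂) ⊗≫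
      P.hom ▷ (r₁ ≫ r₂ ≫ n₂) ⊗≫ 𝟙 (p ≫ p' ≫ r₁ ≫ r₂ ≫ n₂) := by bicategory
    _ = _ := by
      rw [whisker_exchange]
      bicategory

lemma mapComp₃_conj {B' : Type u₂} [Bicategory.{w₂, v₂} B'] (F : B ⥤ᵖ B') {x₀ x₁ x₂ x₃ y₁ y₂ : B}
    {f : x₀ ⟶ x₁} {g : x₁ ⟶ x₂} {h : x₂ ⟶ x₃} {p : x₀ ⟶ y₁} {m : y₁ ⟶ y₂} {n : y₂ ⟶ x₃}
    (φ : f ≫ g ≫ h ≅ p ≫ m ≫ n) :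
    (F.mapComp (f ≫ g) h).symm ≪≫ F.map₂Iso (α_ f g h ≪≫ φ) ≪≫ F.mapComp p (m ≫ n) =
      hc (F.mapComp f g) (Iso.refl _) ≪≫ α_ _ _ _ ≪≫
        ((mapComp₃ F f g h).symm ≪≫ F.map₂Iso φ ≪≫ mapComp₃ F p m n) ≪≫
        (hc (Iso.refl _) (F.mapComp m n)).symm := by
  ext
  change (F.mapComp (f ≫ g) h).inv ≫ F.map₂ ((α_ f g h).hom ≫ φ.hom) ≫
    (F.mapComp p (m ≫ n)).hom = _
  simp [mapComp₃]

/-- The associators hidden in `⊗≫` are the same on both sides and cancel, leaving the cube with `P`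
moved to the other side. -/
lemma coherence_eq_iff {o₀ o₁ o₂ n n' n'' x₁ x₂ y₁ y₂ : B} {k₁ : o₀ ⟶ o₁} {k₂ : o₁ ⟶ o₂}
    {k₃ : o₂ ⟶ n} {e₁ : n ⟶ n'} {e₂ : n' ⟶ n''} {d₁ : n ⟶ y₁} {d₂ : y₁ ⟶ y₂} {d₃ : y₂ ⟶ n''}
    {p : o₀ ⟶ x₁} {p' : x₁ ⟶ x₂} {q : o₀ ⟶ x₂} {y₃ y₄ : B} {r₁ : x₂ ⟶ y₃} {r₂ : y₃ ⟶ y₄}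
    {r₃ : y₄ ⟶ n''}
    (σ : (k₁ ≫ k₂ ≫ k₃) ≫ e₁ ≫ e₂ ≅ (p ≫ p') ≫ r₁ ≫ r₂ ≫ r₃)
    (σ' : (k₁ ≫ k₂ ≫ k₃) ≫ d₁ ≫ d₂ ≫ d₃ ≅ q ≫ r₁ ≫ r₂ ≫ r₃) (P : q ≅ p ≫ p')
    (ψ : e₁ ≫ e₂ ≅ d₁ ≫ d₂ ≫ d₃) :
    (Iso.refl (k₁ ≫ k₂ ≫ k₃ ≫ e₁ ≫ e₂) ≪⊗≫ σ ≪⊗≫ Iso.refl (p ≫ p' ≫ r₁ ≫ r₂ ≫ r₃) =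
      Iso.refl _ ≪⊗≫ (k₁ ≫ k₂ ≫ k₃) ◁ᵢ ψ ≪⊗≫ (Iso.refl (k₁ ≫ k₂ ≫ k₃ ≫ d₁ ≫ d₂ ≫ d₃) ≪⊗≫
        (σ' ≪≫ hc P (Iso.refl _)) ≪⊗≫ Iso.refl _)) ↔
    SqRel (Iso.refl _) (Iso.refl _) P.symm ψ σ σ' := by
  have h₁ : Iso.refl (k₁ ≫ k₂ ≫ k₃ ≫ e₁ ≫ e₂) ≪⊗≫ σ ≪⊗≫ Iso.refl (p ≫ p' ≫ r₁ ≫ r₂ ≫ r₃) =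
      k₁ ◁ᵢ (α_ k₂ k₃ (e₁ ≫ e₂)).symm ≪≫ (α_ k₁ (k₂ ≫ k₃) (e₁ ≫ e₂)).symm ≪≫ σ ≪≫ α_ p p' _ := by
    ext
    simp [bicategoricalIsoComp]
  have h₂ : Iso.refl _ ≪⊗≫ (k₁ ≫ k₂ ≫ k₃) ◁ᵢ ψ ≪⊗≫ (Iso.refl (k₁ ≫ k₂ ≫ k₃ ≫ d₁ ≫ d₂ ≫ d₃) ≪⊗≫
        (σ' ≪≫ hc P (Iso.refl _)) ≪⊗≫ Iso.refl (p ≫ p' ≫ r₁ ≫ r₂ ≫ r₃)) =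
      k₁ ◁ᵢ (α_ k₂ k₃ (e₁ ≫ e₂)).symm ≪≫ (α_ k₁ (k₂ ≫ k₃) (e₁ ≫ e₂)).symm ≪≫
        (hc (Iso.refl _) ψ ≪≫ σ' ≪≫ hc P (Iso.refl _)) ≪≫ α_ p p' _ := by
    ext
    simp [bicategoricalIsoComp]
  rw [h₁, h₂, SqRel]
  constructor
  · intro h
    have h' := congrArg (fun z => (k₁ ◁ᵢ (α_ k₂ k₃ (e₁ ≫ e₂)).symm ≪≫
      (α_ k₁ (k₂ ≫ k₃) (e₁ ≫ e₂)).symm).symm ≪≫ z ≪≫ (α_ p p' _).symm) h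
    simp only [Iso.trans_symm, Iso.trans_assoc, Iso.symm_self_id_assoc, Iso.self_symm_id,
      Iso.trans_refl] at h'
    rw [h', Iso.trans_assoc, Iso.trans_assoc, ← hc_trans]
    simp
  · intro h
    have h' : σ = hc (Iso.refl _) ψ ≪≫ σ' ≪≫ hc P (Iso.refl _) := by
      rw [← Iso.trans_assoc, ← h, Iso.trans_assoc, ← hc_trans]
      simp
    rw [h']

end

variable {E : Type u} [Bicategory.{w, v} E] [MonoidalBicategory E]
open MonoidalBicategory

section
variable {A B C T P Q R U V N : E} {cxy : A ⊠ B ⟶ P} {cyz : B ⊠ C ⟶ Q}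
  {czt : C ⊠ T ⟶ R} {cpz : P ⊠ C ⟶ U} {cxq : A ⊠ Q ⟶ U} {cyr : B ⊠ R ⟶ V} {cqt : Q ⊠ T ⟶ V}
  {cut : U ⊠ T ⟶ N} {cpr : P ⊠ R ⟶ N} {cxv : A ⊠ V ⟶ N}

lemma pentagon_upper {f g : I E ⟶ I E}
    (φ : cpz ▷ₜ T ≫ cut ≫ eta N f ≅ a P C T ≫ P ◁ₜ czt ≫ cpr)
    (φ' : cxy ▷ₜ R ≫ cpr ≫ eta N g ≅ a A B R ≫ A ◁ₜ cyr ≫ cxv) :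
    Iso.refl (cxy ▷ₜ C ▷ₜ T ≫ cpz ▷ₜ T ≫ cut ≫ eta N f ≫ eta N g) ≪⊗≫
      cxy ▷ₜ C ▷ₜ T ◁ᵢ (φ ▷ᵢ eta N g) ≪⊗≫ as₁ cxy C T ▷ᵢ (P ◁ₜ czt ≫ cpr ≫ eta N g) ≪⊗≫
      a (A ⊠ B) C T ◁ᵢ (interchange cxy czt ▷ᵢ (cpr ≫ eta N g)) ≪⊗≫
      (a (A ⊠ B) C T ≫ (A ⊠ B) ◁ₜ czt) ◁ᵢ φ' ≪⊗≫
      a (A ⊠ B) C T ◁ᵢ (as₃ A B czt ▷ᵢ (A ◁ₜ cyr ≫ cxv)) ≪⊗≫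
      Iso.refl (a (A ⊠ B) C T ≫ a A B (C ⊠ T) ≫ A ◁ₜ (B ◁ₜ czt) ≫ A ◁ₜ cyr ≫ cxv) =
    Iso.refl _ ≪⊗≫ hPaste (pentagonEdge₁ cxy φ) (pentagonEdge₂ czt φ') ≪⊗≫ Iso.refl _ := by
  ext
  simp [bicategoricalIsoComp, hPaste_hom, pentagonEdge₁, pentagonEdge₂, conjSq, vPaste_hom]
  bicategory

lemma pentagon_lower (τ : TrivialAction E) {g₁ g₂ g₃ : AutI E}
    (φxyz : cxy ▷ₜ C ≫ cpz ≫ eta U g₁.hom ≅ a A B C ≫ A ◁ₜ cyz ≫ cxq)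
    (φxqt : cxq ▷ₜ T ≫ cut ≫ eta N g₂.hom ≅ a A Q T ≫ A ◁ₜ cqt ≫ cxv)
    (φyzt : cyz ▷ₜ T ≫ cqt ≫ eta V g₃.hom ≅ a B C T ≫ B ◁ₜ czt ≫ cyr) :
    Iso.refl (cxy ▷ₜ C ▷ₜ T ≫ cpz ▷ₜ T ≫ cut ≫ eta N g₁.hom ≫ eta N g₂.hom ≫ eta N g₃.hom) ≪⊗≫
      (cxy ▷ₜ C ▷ₜ T ≫ cpz ▷ₜ T) ◁ᵢ (enterLeft τ cut g₁ ▷ᵢ (eta N g₂.hom ≫ eta N g₃.hom)) ≪⊗≫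
      ((wrComp₃ (cxy ▷ₜ C) cpz (eta U g₁.hom) T).symm ≪≫ wrIso φxyz T ≪≫
        wrComp₃ (a A B C) (A ◁ₜ cyz) cxq T) ▷ᵢ (cut ≫ eta N g₂.hom ≫ eta N g₃.hom) ≪⊗≫
      (a A B C ▷ₜ T ≫ (A ◁ₜ cyz) ▷ₜ T) ◁ᵢ (φxqt ▷ᵢ eta N g₃.hom) ≪⊗≫
      (a A B C ▷ₜ T ≫ (A ◁ₜ cyz) ▷ₜ T ≫ a A Q T ≫ A ◁ₜ cqt) ◁ᵢ enterRight cxv g₃ ≪⊗≫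
      a A B C ▷ₜ T ◁ᵢ (as₂ A cyz T ▷ᵢ (A ◁ₜ cqt ≫ A ◁ₜ eta V g₃.hom ≫ cxv)) ≪⊗≫
      (a A B C ▷ₜ T ≫ a A (B ⊠ C) T) ◁ᵢ
        (((wlComp₃ A (cyz ▷ₜ T) cqt (eta V g₃.hom)).symm ≪≫ wlIso A φyzt ≪≫
          wlComp₃ A (a B C T) (B ◁ₜ czt) cyr) ▷ᵢ cxv) ≪⊗≫
      pent A B C T ▷ᵢ (A ◁ₜ (B ◁ₜ czt) ≫ A ◁ₜ cyr ≫ cxv) ≪⊗≫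
      Iso.refl (a (A ⊠ B) C T ≫ a A B (C ⊠ T) ≫ A ◁ₜ (B ◁ₜ czt) ≫ A ◁ₜ cyr ≫ cxv) =
    Iso.refl _ ≪⊗≫ (hPaste (pentagonEdge₃ τ cut φxyz) (hPaste (pentagonEdge₄ cyz φxqt)
      (pentagonEdge₅ cxv φyzt)) ≪≫ hc (pent A B C T) (Iso.refl _)) ≪⊗≫ Iso.refl _ := by
  have h₃ : tSq (α_ _ _ _ ≪≫ φxyz) (idSq (𝟙 T)) = hc (wrComp (cxy ▷ₜ C) cpz T) (Iso.refl _) ≪≫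
      α_ _ _ _ ≪≫ ((wrComp₃ (cxy ▷ₜ C) cpz (eta U g₁.hom) T).symm ≪≫ wrIso φxyz T ≪≫
        wrComp₃ (a A B C) (A ◁ₜ cyz) cxq T) ≪≫ (hc (Iso.refl _) (wrComp (A ◁ₜ cyz) cxq T)).symm := by
    rw [wrSq_eq]
    exact mapComp₃_conj (tensorRight T) φxyz
  have h₅ : tSq (idSq (𝟙 A)) (α_ _ _ _ ≪≫ φyzt) = hc (wlComp A (cyz ▷ₜ T) cqt) (Iso.refl _) ≪≫
      α_ _ _ _ ≪≫ ((wlComp₃ A (cyz ▷ₜ T) cqt (eta V g₃.hom)).symm ≪≫ wlIso A φyzt ≪≫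
          wlComp₃ A (a B C T) (B ◁ₜ czt) cyr) ≪≫ (hc (Iso.refl _) (wlComp A (B ◁ₜ czt) cyr)).symm := by
    rw [wlSq_eq]
    exact mapComp₃_conj (tensorLeft A) φyzt
  rw [pentagonEdge₃, pentagonEdge₅, h₃, h₅]
  exact hPaste_hPaste_eq (enterLeft τ cut g₁) ((wrComp₃ (cxy ▷ₜ C) cpz (eta U g₁.hom) T).symm ≪≫
    wrIso φxyz T ≪≫ wrComp₃ (a A B C) (A ◁ₜ cyz) cxq T) φxqt (enterRight cxv g₃) (as₂ A cyz T)
    ((wlComp₃ A (cyz ▷ₜ T) cqt (eta V g₃.hom)).symm ≪≫ wlIso A φyzt ≪≫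
      wlComp₃ A (a B C T) (B ◁ₜ czt) cyr) (wrComp (cxy ▷ₜ C) cpz T) (wrComp (A ◁ₜ cyz) cxq T)
    (wlComp A (cyz ▷ₜ T) cqt) (wlComp A (B ◁ₜ czt) cyr) (pent A B C T)

end

namespace AssociativityData
variable {s : PiZeroSection E} (D : AssociativityData s) (τ : TrivialAction E)
  {x y z t p q r' u' v' n : PiZero E} (hp : x * y = p) (hq : y * z = q) (hr : z * t = r')
  (hu : p * z = u') (hu' : x * q = u') (hv : y * r' = v') (hv' : q * t = v') (hn : u' * t = n)
  (hn₁ : p * r' = n) (hn₂ : x * v' = n)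

/-- The bridge between the pasting equation that defines `θ` and the cube calculus. -/
lemma upperSide_eq_iff (ψ : eta (s.obj n) (D.f p z t).hom ≫ eta (s.obj n) (D.f x y r').hom ≅
    eta (s.obj n) (D.f x y z).hom ≫ eta (s.obj n) (D.f x q t).hom ≫
      eta (s.obj n) (D.f y z t).hom) :
    D.upperSide hp hr hu hv hn hn₁ hn₂ = Iso.refl _ ≪⊗≫
        ((D.c hp).hom ▷ₜ s.obj z ▷ₜ s.obj t ≫ (D.c hu).hom ▷ₜ s.obj t ≫ (D.c hn).hom) ◁ᵢ ψ ≪⊗≫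
        D.lowerSide τ hp hq hr hu hu' hv hv' hn hn₂ ↔
      SqRel (Iso.refl _) (Iso.refl _) (pent (s.obj x) (s.obj y) (s.obj z) (s.obj t)).symm ψ
        (hPaste (pentagonEdge₁ (D.c hp).hom (D.φ hu hr hn hn₁))
          (pentagonEdge₂ (D.c hr).hom (D.φ hp hv hn₁ hn₂)))
        (hPaste (pentagonEdge₃ τ (D.c hn).hom (D.φ hp hq hu hu'))
          (hPaste (pentagonEdge₄ (D.c hq).hom (D.φ hu' hv' hn hn₂))
            (pentagonEdge₅ (D.c hn₂).hom (D.φ hq hr hv' hv)))) := by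
  have h₁ := pentagon_upper (D.φ hu hr hn hn₁) (D.φ hp hv hn₁ hn₂)
  have h₂ := pentagon_lower τ (D.φ hp hq hu hu') (D.φ hu' hv' hn hn₂) (D.φ hq hr hv' hv)
  rw [upperSide, lowerSide, h₁, h₂]
  exact coherence_eq_iff _ _ _ ψ

end AssociativityData

end
-- Moving an automorphism past an associativity cell: the naturality faces of the associahedron.
section
open Bicategory
open scoped CategoryTheory.Prod
variable {E : Type u} [Bicategory.{w, v} E]

section
variable [PreMonoidalBicategory E]

/-- Each pasting is `etaNat` along one of the two composites that `F` compares, and `etaNat` is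
natural in the 1-cell. -/
lemma etaNat_square {X Y N N' : E} {m₀ : X ⟶ N} {k : X ⟶ Y} {m₁ : Y ⟶ N'} {e : N ⟶ N'}
    (F : m₀ ≫ e ≅ k ≫ m₁) (g : I E ⟶ I E) :
    SqRel (Iso.refl _) (Iso.refl _) (etaNat k g) (etaNat e g) (hPaste F (etaNat m₁ g))
      (hPaste (etaNat m₀ g) F) :=
  SqRel.cube_iff.1 (by rw [← etaNat_comp, ← etaNat_comp]; exact etaNat_map₂ F g)

section
variable {X X' U Y Y' Y'' : E} {u : X ⟶ U} {u' : X' ⟶ U} {p : X ⟶ X'} {e : U ⟶ U}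

lemma tSq_idSq_comp (α : u ≫ e ≅ p ≫ u') (n : Y ⟶ Y') (k : Y' ⟶ Y'') :
    SqRel (splitLeft u n k) (splitLeft u' n k) (Iso.refl _) (Iso.refl _) (tSq α (idSq (n ≫ k)))
      (vPaste (tSq α (idSq n)) (tSq (idSq e).symm (idSq k))) := by
  have h : SqRel (ρ_ u).symm (ρ_ u').symm (Iso.refl _) (Iso.refl _) α (vPaste α (idSq e).symm) :=
    (SqRel.hPaste_idSq α.symm).transpose.symm
  have e' := (h.tSq (SqRel.of_eq (vPaste_idSq n k).symm)).trans
    (tSq_vPaste α (idSq e).symm (idSq n) (idSq k))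
  exact e'.congr rfl rfl (by simp) (by simp)

lemma idSq_comp_tSq (α : u ≫ e ≅ p ≫ u') (n : Y ⟶ Y') (k : Y' ⟶ Y'') :
    SqRel (splitRight n k u) (splitRight n k u') (Iso.refl _) (Iso.refl _) (tSq (idSq (n ≫ k)) α)
      (vPaste (tSq (idSq n) α) (tSq (idSq k) (idSq e).symm)) := by
  have h : SqRel (ρ_ u).symm (ρ_ u').symm (Iso.refl _) (Iso.refl _) α (vPaste α (idSq e).symm) :=
    (SqRel.hPaste_idSq α.symm).transpose.symm
  have e' := (SqRel.tSq (SqRel.of_eq (vPaste_idSq n k).symm) h).trans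
    (tSq_vPaste (idSq n) (idSq k) α (idSq e).symm)
  exact e'.congr rfl rfl (by simp) (by simp)

end
end

variable [MonoidalBicategory E]
open MonoidalBicategory

section
variable {U V V' N : E}

lemma enterRight_wr_comp (k : V' ⟶ V) (c : V ⊠ U ⟶ N) (g : AutI E) :
    vPaste (tSq (idSq k) (idSq (eta U g.hom)).symm) (enterRight c g) =
      enterRight (k ▷ₜ U ≫ c) g := by
  have h := (etaTensor_natural k (𝟙 U) g.hom).symm.vPaste (enterRight_rel c g)
  rw [← etaNat_comp, etaNat_id] at h
  exact (h.symm.trans (enterRight_rel _ g)).congr (by simp) (by simp) (by simp) (by simp) |>.eq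

variable (τ : TrivialAction E)

/-- Entering on the left uses the trivialization on the right-hand object, which is natural only
along equivalences; `enterRight_wr_comp` needs no such condition. -/
lemma enterLeft_wl_comp {k : V' ⟶ V} (hk : IsEquiv k) (c : U ⊠ V ⟶ N) (g : AutI E) :
    vPaste (tSq (idSq (eta U g.hom)).symm (idSq k)) (enterLeft τ c g) =
      enterLeft τ (U ◁ₜ k ≫ c) g := by
  have h := (τ.etaTensorLeft_natural (𝟙 U) hk g).symm.vPaste (enterLeft_rel c τ g)
  rw [← etaNat_comp, etaNat_id] at h
  exact (h.symm.trans (enterLeft_rel _ τ g)).congr (by simp) (by simp) (by simp) (by simp) |>.eq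

end

section
variable {A B C P N : E} (g : AutI E)

lemma enterRight_enterRight (c' : B ⊠ C ⟶ P) (c : A ⊠ P ⟶ N) :
    SqRel (Iso.refl _) (Iso.refl _)
      (wlIso A (etaTensor B C g.hom) ≪≫ etaTensor A (B ⊠ C) g.hom).symm (Iso.refl _)
      (etaNat (A ◁ₜ c' ≫ c) g.hom)
      (vPaste (tSq (idSq (𝟙 A)) (enterRight c' g)) (enterRight c g)) := by
  have h := (((etaTensor_natural (𝟙 A) c' g.hom).symm.trans
    ((SqRel.refl (idSq (𝟙 A))).tSq (enterRight_rel c' g))).congr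
    (i₁ := Iso.refl _) (j₁ := Iso.refl _) (by simp) (by simp)
    (π₁ := (wlIso A (etaTensor B C g.hom) ≪≫ etaTensor A (B ⊠ C) g.hom).symm)
    (ρ₁ := (etaTensor A P g.hom).symm) (by simp) (by simp)).vPaste (enterRight_rel c g)
  rw [← etaNat_comp] at h
  exact h.congr hc_refl hc_refl rfl rfl

variable (τ : TrivialAction E)

lemma enterLeft_enterLeft (c' : A ⊠ B ⟶ P) (c : P ⊠ C ⟶ N) :
    SqRel (Iso.refl _) (Iso.refl _)
      (wrIso (τ.etaTensorLeft A B g) C ≪≫ τ.etaTensorLeft (A ⊠ B) C g).symm (Iso.refl _)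
      (etaNat (c' ▷ₜ C ≫ c) g.hom)
      (vPaste (tSq (enterLeft τ c' g) (idSq (𝟙 C))) (enterLeft τ c g)) := by
  have h := (((τ.etaTensorLeft_natural c' (IsEquiv.id C) g).symm.trans
    ((enterLeft_rel c' τ g).tSq (SqRel.refl (idSq (𝟙 C))))).congr
    (i₁ := Iso.refl _) (j₁ := Iso.refl _) (by simp) (by simp)
    (π₁ := (wrIso (τ.etaTensorLeft A B g) C ≪≫ τ.etaTensorLeft (A ⊠ B) C g).symm)
    (ρ₁ := (τ.etaTensorLeft P C g).symm) (by simp) (by simp)).vPaste (enterLeft_rel c τ g)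
  rw [← etaNat_comp] at h
  exact h.congr hc_refl hc_refl rfl rfl

lemma enterRight_enterLeft (c' : A ⊠ B ⟶ P) (c : P ⊠ C ⟶ N) :
    SqRel (Iso.refl _) (Iso.refl _)
      (wrIso (etaTensor A B g.hom) C ≪≫ τ.etaTensorLeft (A ⊠ B) C g).symm (Iso.refl _)
      (etaNat (c' ▷ₜ C ≫ c) g.hom)
      (vPaste (tSq (enterRight c' g) (idSq (𝟙 C))) (enterLeft τ c g)) := by
  have h := (((τ.etaTensorLeft_natural c' (IsEquiv.id C) g).symm.trans
    ((enterRight_rel c' g).tSq (SqRel.refl (idSq (𝟙 C))))).congr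
    (i₁ := Iso.refl _) (j₁ := Iso.refl _) (by simp) (by simp)
    (π₁ := (wrIso (etaTensor A B g.hom) C ≪≫ τ.etaTensorLeft (A ⊠ B) C g).symm)
    (ρ₁ := (τ.etaTensorLeft P C g).symm) (by simp) (by simp)).vPaste (enterLeft_rel c τ g)
  rw [← etaNat_comp] at h
  exact h.congr hc_refl hc_refl rfl rfl

lemma enterLeft_enterRight (c' : B ⊠ C ⟶ P) (c : A ⊠ P ⟶ N) :
    SqRel (Iso.refl _) (Iso.refl _)
      (wlIso A (τ.etaTensorLeft B C g) ≪≫ etaTensor A (B ⊠ C) g.hom).symm (Iso.refl _)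
      (etaNat (A ◁ₜ c' ≫ c) g.hom)
      (vPaste (tSq (idSq (𝟙 A)) (enterLeft τ c' g)) (enterRight c g)) := by
  have h := (((etaTensor_natural (𝟙 A) c' g.hom).symm.trans
    ((SqRel.refl (idSq (𝟙 A))).tSq (enterLeft_rel c' τ g))).congr
    (i₁ := Iso.refl _) (j₁ := Iso.refl _) (by simp) (by simp)
    (π₁ := (wlIso A (τ.etaTensorLeft B C g) ≪≫ etaTensor A (B ⊠ C) g.hom).symm)
    (ρ₁ := (etaTensor A P g.hom).symm) (by simp) (by simp)).vPaste (enterRight_rel c g)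
  rw [← etaNat_comp] at h
  exact h.congr hc_refl hc_refl rfl rfl

end

section
variable {A B C P Q N X Y Z X' Y' Z' : E} {cxy : A ⊠ B ⟶ P} {cpz : P ⊠ C ⟶ N} {cyz : B ⊠ C ⟶ Q}
  {cxq : A ⊠ Q ⟶ N} {f : I E ⟶ I E}

/-- The automorphism `g` is multiplied in either before or after reassociation, by the squares `R`
and `L`. These split into a part over the naturality of `a`, governed by `hU`, and a part over `φ`,
governed by `etaNat_square`; `hK` says that the parts fit. The latter leaves `g` exchanged with `f`
by naturality of `η(g)` along `η(f)`. -/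
lemma assocCell_move (φ : cxy ▷ₜ C ≫ cpz ≫ eta N f ≅ a A B C ≫ A ◁ₜ cyz ≫ cxq) {g : I E ⟶ I E}
    {u : X ⟶ A} {v : Y ⟶ B} {w : Z ⟶ C} {u' : X' ⟶ A} {v' : Y' ⟶ B} {w' : Z' ⟶ C}
    {p₀ : (X ⊠ Y) ⊠ Z ⟶ (X' ⊠ Y') ⊠ Z'} {p₁ : X ⊠ (Y ⊠ Z) ⟶ X' ⊠ (Y' ⊠ Z')}
    {e₀ : (A ⊠ B) ⊠ C ⟶ (A ⊠ B) ⊠ C} {e₁ : A ⊠ (B ⊠ C) ⟶ A ⊠ (B ⊠ C)}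
    {L : ((u ⊠₁ ((v ⊠₁ w) ≫ cyz)) ≫ cxq) ≫ eta N g ≅ p₁ ≫ (u' ⊠₁ ((v' ⊠₁ w') ≫ cyz)) ≫ cxq}
    {R : ((((u ⊠₁ v) ≫ cxy) ⊠₁ w) ≫ cpz) ≫ eta N g ≅ p₀ ≫ (((u' ⊠₁ v') ≫ cxy) ⊠₁ w') ≫ cpz}
    {L' : (u ⊠₁ (v ⊠₁ w)) ≫ e₁ ≅ p₁ ≫ (u' ⊠₁ (v' ⊠₁ w'))}
    {R' : ((u ⊠₁ v) ⊠₁ w) ≫ e₀ ≅ p₀ ≫ ((u' ⊠₁ v') ⊠₁ w')}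
    {M₁ : (A ◁ₜ cyz ≫ cxq) ≫ eta N g ≅ e₁ ≫ A ◁ₜ cyz ≫ cxq}
    {M₀ : (cxy ▷ₜ C ≫ cpz) ≫ eta N g ≅ e₀ ≫ cxy ▷ₜ C ≫ cpz}
    {i₀ : eta _ g ≅ e₀} {i₁ : eta _ g ≅ e₁} {π : a X Y Z ≫ p₁ ≅ p₀ ≫ a X' Y' Z'}
    {κ : a A B C ≫ e₁ ≅ e₀ ≫ a A B C}
    (hL : SqRel (splitProdLeft cyz cxq u v w) (splitProdLeft cyz cxq u' v' w') (Iso.refl _)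
      (Iso.refl _) L (vPaste L' M₁))
    (hR : SqRel (splitProdRight cxy cpz u v w) (splitProdRight cxy cpz u' v' w') (Iso.refl _)
      (Iso.refl _) R (vPaste R' M₀))
    (hM₁ : SqRel (Iso.refl _) (Iso.refl _) i₁ (Iso.refl _) (etaNat _ g) M₁)
    (hM₀ : SqRel (Iso.refl _) (Iso.refl _) i₀ (Iso.refl _) (etaNat _ g) M₀)
    (hU : SqRel (Iso.refl _) (Iso.refl _) π κ (hPaste (asNat u v w) L')
      (hPaste R' (asNat u' v' w')))
    (hK : SqRel (Iso.refl _) (Iso.refl _) i₀ i₁ (etaNat (a A B C) g) κ) :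
    SqRel (Iso.refl _) (Iso.refl _) π (etaNat (eta N f) g) (hPaste (assocCell φ u v w) L)
      (hPaste R (assocCell φ u' v' w')) := by
  have e := (((SqRel.refl ((α_ _ _ _) ≪≫ φ)).hPaste hM₁).symm.trans
    ((etaNat_square (α_ _ _ _ ≪≫ φ) g).trans (hM₀.hPaste (SqRel.refl ((α_ _ _ _) ≪≫ φ))))).congr
    (i₁ := Iso.refl _) (j₁ := Iso.refl _) (π₁ := κ) (ρ₁ := etaNat (eta N f) g)
    (by simp) (by simp) (by rw [hK]; rw [← Iso.trans_assoc, hc_symm, ← hc_trans]; simp) (by simp)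
  have h₁ := ((assocCell_rel φ u v w).hPaste hL).trans (SqRel.of_eq (hPaste_vPaste _ _ _ _))
  have h₂ := (hR.hPaste (assocCell_rel φ u' v' w')).trans (SqRel.of_eq (hPaste_vPaste _ _ _ _))
  exact (h₁.trans ((hU.vPaste e).trans h₂.symm)).congr (by simp) (by simp) (by simp) (by simp)

end

section
variable {X X' Y Y' Z Z' U V W : E}

lemma asNat_hPaste_as₁ {u : X ⟶ U} {u' : X' ⟶ U} {p : X ⟶ X'} {e : U ⟶ U} (α : u ≫ e ≅ p ≫ u')
    (v : Y ⟶ V) (w : Z ⟶ W) :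
    SqRel (Iso.refl _) (Iso.refl _) (as₁ p Y Z).symm (as₁ e V W).symm
      (hPaste (asNat u v w) (tSq α (idSq (v ⊠₁ w))))
      (hPaste (tSq (tSq α (idSq v)) (idSq w)) (asNat u' v w)) := by
  refine ((asNat_sq α (idSq v) (idSq w)).trans ((SqRel.refl (asNat u v w)).hPaste
    (((SqRel.refl α).tSq (tSq_idSq v w)).congr (tIso_refl _ _) (tIso_refl _ _) rfl rfl))).symm.congr (by simp) (by simp) ?_ ?_ <;>
  rw [as₁, hc_refl_left]

lemma asNat_hPaste_as₂ (u : X ⟶ U) {v : Y ⟶ V} {v' : Y' ⟶ V} {p : Y ⟶ Y'} {e : V ⟶ V}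
    (α : v ≫ e ≅ p ≫ v') (w : Z ⟶ W) :
    SqRel (Iso.refl _) (Iso.refl _) (as₂ X p Z).symm (as₂ U e W).symm
      (hPaste (asNat u v w) (tSq (idSq u) (tSq α (idSq w))))
      (hPaste (tSq (tSq (idSq u) α) (idSq w)) (asNat u v' w)) :=
  (asNat_sq (idSq u) α (idSq w)).symm

lemma asNat_hPaste_as₃ (u : X ⟶ U) (v : Y ⟶ V) {w : Z ⟶ W} {w' : Z' ⟶ W} {p : Z ⟶ Z'}
    {e : W ⟶ W} (α : w ≫ e ≅ p ≫ w') :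
    SqRel (Iso.refl _) (Iso.refl _) (as₃ X Y p).symm (as₃ U V e).symm
      (hPaste (asNat u v w) (tSq (idSq u) (tSq (idSq v) α)))
      (hPaste (tSq (idSq (u ⊠₁ v)) α) (asNat u v w')) := by
  refine (((((tSq_idSq u v).symm.tSq (SqRel.refl α)).congr (tIso_refl _ _) (tIso_refl _ _)
    rfl rfl).hPaste (SqRel.refl (asNat u v w'))).trans
    (asNat_sq (idSq u) (idSq v) α)).symm.congr (by simp) (by simp) ?_ ?_ <;>
  rw [as₃, hc_refl_right]

end

section
variable {A B C P Q N X Y Z X' Y' Z' : E} {cxy : A ⊠ B ⟶ P} {cpz : P ⊠ C ⟶ N} {cyz : B ⊠ C ⟶ Q}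
  {cxq : A ⊠ Q ⟶ N} {f : I E ⟶ I E}

/-- The face where the first factor is a product moves: `g` enters on the left in both bracketings,
and `etaTensorLeft_as₁` supplies `hK`. For the second and third factors below this role is played by
`etaTensor_as₂` and `etaTensor_as₃`. -/
lemma assocCell_as₁ (τ : TrivialAction E) (hyz : IsEquiv cyz)
    (φ : cxy ▷ₜ C ≫ cpz ≫ eta N f ≅ a A B C ≫ A ◁ₜ cyz ≫ cxq) {g : AutI E} {u : X ⟶ A}
    {u' : X' ⟶ A} {p : X ⟶ X'} (α : u ≫ eta A g.hom ≅ p ≫ u') (v : Y ⟶ B) (w : Z ⟶ C) :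
    SqRel (Iso.refl _) (Iso.refl _) (as₁ p Y Z).symm (etaNat (eta N f) g.hom)
      (hPaste (assocCell φ u v w) (rightMul cxq τ α ((v ⊠₁ w) ≫ cyz)))
      (hPaste (rightMul cpz τ (rightMul cxy τ α v) w) (assocCell φ u' v w)) := by
  refine assocCell_move φ ?_ ?_ (enterLeft_rel _ τ g) (enterLeft_enterLeft g τ cxy cpz)
    (asNat_hPaste_as₁ α v w) ((τ.etaTensorLeft_as₁ A B C g).symm.congr rfl rfl rfl rfl)
  · rw [← enterLeft_wl_comp τ hyz]
    exact (((tSq_idSq_comp α _ cyz).vPaste (SqRel.refl _)).trans (SqRel.vPaste_assoc _ _ _)).congr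
      rfl rfl (Iso.trans_refl _) (Iso.trans_refl _)
  · exact (((tSq_vPaste_idSq _ _ w).vPaste (SqRel.refl _)).trans (SqRel.vPaste_assoc _ _ _)).congr
      rfl rfl (Iso.trans_refl _) (Iso.trans_refl _)

lemma assocCell_as₂ (τ : TrivialAction E)
    (φ : cxy ▷ₜ C ≫ cpz ≫ eta N f ≅ a A B C ≫ A ◁ₜ cyz ≫ cxq) {g : AutI E} (u : X ⟶ A)
    {v : Y ⟶ B} {v' : Y' ⟶ B} {p : Y ⟶ Y'} (α : v ≫ eta B g.hom ≅ p ≫ v') (w : Z ⟶ C) :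
    SqRel (Iso.refl _) (Iso.refl _) (as₂ X p Z).symm (etaNat (eta N f) g.hom)
      (hPaste (assocCell φ u v w) (leftMul cxq u (rightMul cyz τ α w)))
      (hPaste (rightMul cpz τ (leftMul cxy u α) w) (assocCell φ u v' w)) := by
  refine assocCell_move φ ?_ ?_ (enterLeft_enterRight g τ cyz cxq)
    (enterRight_enterLeft g τ cxy cpz)
    (asNat_hPaste_as₂ u α w) ((τ.etaTensor_as₂ A B C g).symm.congr rfl rfl rfl rfl)
  · exact (((tSq_idSq_vPaste _ _ u).vPaste (SqRel.refl _)).trans (SqRel.vPaste_assoc _ _ _)).congr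
      rfl rfl (Iso.trans_refl _) (Iso.trans_refl _)
  · exact (((tSq_vPaste_idSq _ _ w).vPaste (SqRel.refl _)).trans (SqRel.vPaste_assoc _ _ _)).congr
      rfl rfl (Iso.trans_refl _) (Iso.trans_refl _)

lemma assocCell_as₃
    (φ : cxy ▷ₜ C ≫ cpz ≫ eta N f ≅ a A B C ≫ A ◁ₜ cyz ≫ cxq) {g : AutI E} (u : X ⟶ A)
    (v : Y ⟶ B) {w : Z ⟶ C} {w' : Z' ⟶ C} {p : Z ⟶ Z'} (α : w ≫ eta C g.hom ≅ p ≫ w') :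
    SqRel (Iso.refl _) (Iso.refl _) (as₃ X Y p).symm (etaNat (eta N f) g.hom)
      (hPaste (assocCell φ u v w) (leftMul cxq u (leftMul cyz v α)))
      (hPaste (leftMul cpz ((u ⊠₁ v) ≫ cxy) α) (assocCell φ u v w')) := by
  refine assocCell_move φ ?_ ?_ (enterRight_enterRight g cyz cxq) (enterRight_rel _ g)
    (asNat_hPaste_as₃ u v α) ((etaTensor_as₃ A B C g.hom).symm.congr rfl rfl rfl rfl)
  · exact (((tSq_idSq_vPaste _ _ u).vPaste (SqRel.refl _)).trans (SqRel.vPaste_assoc _ _ _)).congr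
      rfl rfl (Iso.trans_refl _) (Iso.trans_refl _)
  · rw [← enterRight_wr_comp]
    exact (((idSq_comp_tSq α _ cxy).vPaste (SqRel.refl _)).trans (SqRel.vPaste_assoc _ _ _)).congr
      rfl rfl (Iso.trans_refl _) (Iso.trans_refl _)

end

end
-- Tensoring with an invertible object; `η_X` is an equivalence.
section
open Bicategory
open scoped CategoryTheory.Prod

section
variable {B : Type u₁} [Bicategory.{w₁, v₁} B]

lemma IsEquiv.symm_exists {a b : B} {f : a ⟶ b} (hf : IsEquiv f) :
    ∃ g : b ⟶ a, IsEquiv g ∧ Nonempty (f ≫ g ≅ 𝟙 a) ∧ Nonempty (g ≫ f ≅ 𝟙 b) := by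
  obtain ⟨g, h, h'⟩ := hf
  exact ⟨g, ⟨f, h', h⟩, h, h'⟩

lemma IsEquiv.whiskerLeft_surjective {a b c : B} {p : a ⟶ b} (hp : IsEquiv p) {m m' : b ⟶ c}
    (σ : p ≫ m ≅ p ≫ m') : ∃ α : m ≅ m', p ◁ᵢ α = σ := by
  obtain ⟨q, -, -, ⟨e⟩⟩ := hp.symm_exists
  exact ⟨cancelLeft e σ, whiskerLeft_cancelLeft e hp σ⟩

lemma IsEquiv.whiskerRight_surjective {a b c : B} {p : b ⟶ c} (hp : IsEquiv p) {m m' : a ⟶ b}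
    (σ : m ≫ p ≅ m' ≫ p) : ∃ α : m ≅ m', α ▷ᵢ p = σ := by
  obtain ⟨q, hq, ⟨e⟩, -⟩ := hp.symm_exists
  have key (γ : m ≅ m') : γ = (ρ_ m).symm ≪≫ m ◁ᵢ e.symm ≪≫ (α_ m p q).symm ≪≫
      (γ ▷ᵢ p) ▷ᵢ q ≪≫ α_ m' p q ≪≫ m' ◁ᵢ e ≪≫ ρ_ m' := by
    ext
    have h : (γ.hom ▷ p) ▷ q = (α_ m p q).hom ≫ γ.hom ▷ (p ≫ q) ≫ (α_ m' p q).inv := by simp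
    simp only [Iso.trans_hom, whiskerRightIso_hom, whiskerLeftIso_hom, Iso.symm_hom, h,
      Category.assoc, Iso.inv_hom_id_assoc]
    rw [whisker_exchange_assoc, ← whiskerLeft_comp_assoc]
    simp
  -- The formula of `key` dictates the only possible preimage. Comparing it with `key α` gives `σ ▷
  -- q = (α ▷ p) ▷ q`, and whiskering with `q` is faithful.
  obtain ⟨α, hα⟩ : ∃ α : m ≅ m', (ρ_ m).symm ≪≫ m ◁ᵢ e.symm ≪≫ (α_ m p q).symm ≪≫ σ ▷ᵢ q ≪≫
    α_ m' p q ≪≫ m' ◁ᵢ e ≪≫ ρ_ m' = α := ⟨_, rfl⟩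
  refine ⟨α, hq.whiskerRight_injective ?_⟩
  ext
  simpa only [Iso.trans_hom, cancel_epi, cancel_mono] using
    (congrArg Iso.hom (hα.trans (key α))).symm

end

namespace SqRel
variable {B : Type u₁} [Bicategory.{w₁, v₁} B] {a₀ a₁ b₀ b₁ : B} {f₀ f₀' : a₀ ⟶ b₀}
  {f₁ f₁' : a₁ ⟶ b₁} {p p' : a₀ ⟶ a₁} {q q' : b₀ ⟶ b₁}

lemma exists_i (hq : IsEquiv q') (j : f₁ ≅ f₁') (π : p ≅ p') (ρ : q ≅ q') (σ : f₀ ≫ q ≅ p ≫ f₁)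
    (σ' : f₀' ≫ q' ≅ p' ≫ f₁') : ∃ i : f₀ ≅ f₀', SqRel i j π ρ σ σ' := by
  obtain ⟨i, hi⟩ := hq.whiskerRight_surjective
    ((hc (Iso.refl f₀) ρ).symm ≪≫ σ ≪≫ hc π j ≪≫ σ'.symm)
  refine ⟨i, ?_⟩
  have h : hc i ρ = hc (Iso.refl f₀) ρ ≪≫ i ▷ᵢ q' := by
    rw [← hc_refl_right, ← hc_trans]; simp
  rw [SqRel, h, hi]
  simp only [Iso.trans_assoc, Iso.symm_self_id, Iso.self_symm_id_assoc, Iso.trans_refl]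

lemma exists_j (hp : IsEquiv p') (i : f₀ ≅ f₀') (π : p ≅ p') (ρ : q ≅ q') (σ : f₀ ≫ q ≅ p ≫ f₁)
    (σ' : f₀' ≫ q' ≅ p' ≫ f₁') : ∃ j : f₁ ≅ f₁', SqRel i j π ρ σ σ' := by
  obtain ⟨j, hj⟩ := hp.whiskerLeft_surjective
    ((hc π (Iso.refl f₁)).symm ≪≫ σ.symm ≪≫ hc i ρ ≪≫ σ')
  refine ⟨j, ?_⟩
  have h : hc π j = hc π (Iso.refl f₁) ≪≫ p' ◁ᵢ j := by
    rw [← hc_refl_left, ← hc_trans]; simp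
  rw [SqRel, h, hj]
  simp only [Iso.self_symm_id_assoc]

end SqRel

section
variable {B : Type u₁} [Bicategory.{w₁, v₁} B] {a₀ a₁ b₀ b₁ : B}

lemma IsEquiv.exists_left_side {p : a₀ ⟶ a₁} {q : b₀ ⟶ b₁} (hq : IsEquiv q) (f₁ : a₁ ⟶ b₁) :
    ∃ f₀ : a₀ ⟶ b₀, Nonempty (f₀ ≫ q ≅ p ≫ f₁) ∧ (IsEquiv p → IsEquiv f₁ → IsEquiv f₀) := by
  obtain ⟨q', hq', -, ⟨e⟩⟩ := hq.symm_exists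
  exact ⟨(p ≫ f₁) ≫ q', ⟨α_ _ _ _ ≪≫ (p ≫ f₁) ◁ᵢ e ≪≫ ρ_ _⟩, fun h h' => (h.comp h').comp hq'⟩

lemma IsEquiv.exists_right_side {p : a₀ ⟶ a₁} {q : b₀ ⟶ b₁} (hp : IsEquiv p) (f₀ : a₀ ⟶ b₀) :
    ∃ f₁ : a₁ ⟶ b₁, Nonempty (f₀ ≫ q ≅ p ≫ f₁) ∧ (IsEquiv q → IsEquiv f₀ → IsEquiv f₁) := by
  obtain ⟨p', hp', ⟨e⟩, -⟩ := hp.symm_exists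
  exact ⟨p' ≫ f₀ ≫ q, ⟨(λ_ _).symm ≪≫ e.symm ▷ᵢ (f₀ ≫ q) ≪≫ α_ _ _ _⟩,
    fun h h' => hp'.comp (h'.comp h)⟩

end

variable {E : Type u} [Bicategory.{w, v} E] [MonoidalBicategory E]
open MonoidalBicategory

section
variable {X Z : E} {k : I E ⟶ Z ⊠ X} {Y Y' : E}

/-- If `Z ⊠ X` is equivalent to the unit object, then `Z ⊠ (X ⊠ f)` is equivalent to `I ⊠ f`. -/
def unitSquare (k : I E ⟶ Z ⊠ X) (f : Y ⟶ Y') :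
    I E ◁ₜ f ≫ k ▷ₜ Y' ≫ a Z X Y' ≅ (k ▷ₜ Y ≫ a Z X Y) ≫ Z ◁ₜ (X ◁ₜ f) :=
  hPaste (interchange k f).symm (as₃ Z X f)

lemma unitSquare_map₂ (k : I E ⟶ Z ⊠ X) {f g : Y ⟶ Y'} (σ : f ≅ g) :
    SqRel (wlIso (I E) σ) (wlIso Z (wlIso X σ)) (Iso.refl _) (Iso.refl _) (unitSquare k f)
      (unitSquare k g) :=
  ((interchange_natural_right k σ).transpose.hPaste (as₃_map₂ Z X σ).transpose).congr rfl rfl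
    hc_refl hc_refl

lemma isEquiv_unitSquare_side {k : I E ⟶ Z ⊠ X} (hk : IsEquiv k) (Y : E) :
    IsEquiv (k ▷ₜ Y ≫ a Z X Y) := (hk.wr Y).comp (isEquiv_a Z X Y)

/-- A 2-cell is determined by `I ◁ₜ σ`, hence by `Z ◁ₜ (X ◁ₜ σ)`. -/
lemma wlIso_injective_of_isEquiv {k : I E ⟶ Z ⊠ X} (hk : IsEquiv k) {f g : Y ⟶ Y'}
    {σ σ' : f ≅ g} (h : wlIso X σ = wlIso X σ') : σ = σ' := by
  have e := unitSquare_map₂ k σ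
  rw [h] at e
  have e' := e.i_unique (unitSquare_map₂ k σ') (isEquiv_unitSquare_side hk _)
  have e₂ := luNat_map₂ σ
  rw [e'] at e₂
  exact e₂.j_unique (luNat_map₂ σ') (isEquiv_l _)

/-- The 2-cell `Z ◁ₜ ρ` comes from some `σ` through `Z ⊗ (X ⊗ -) ≃ I ⊗ - ≃ id`; then `X ◁ₜ σ = ρ`
because `Z ⊗ -` is faithful as well, by `k'`. -/
lemma wlIso_surjective_of_isEquiv {k : I E ⟶ Z ⊠ X} (hk : IsEquiv k) {k' : I E ⟶ X ⊠ Z}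
    (hk' : IsEquiv k') {f g : Y ⟶ Y'} (ρ : X ◁ₜ f ≅ X ◁ₜ g) : ∃ σ : f ≅ g, wlIso X σ = ρ := by
  obtain ⟨i, hi⟩ := SqRel.exists_i (isEquiv_unitSquare_side hk _) (wlIso Z ρ) (Iso.refl _)
    (Iso.refl _) (unitSquare k f) (unitSquare k g)
  obtain ⟨j, hj⟩ := SqRel.exists_j (isEquiv_l _) i (Iso.refl _) (Iso.refl _) (luNat f) (luNat g)
  refine ⟨j, wlIso_injective_of_isEquiv hk' ?_⟩
  have e := (luNat_map₂ j).i_unique hj (isEquiv_l _)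
  have e' := unitSquare_map₂ k j
  rw [e] at e'
  exact e'.j_unique hi (isEquiv_unitSquare_side hk _)

/-- The 1-cell is `Z ◁ₜ h` transported along `Z ⊗ (X ⊗ -) ≃ id`. This gives an isomorphism after
applying `Z ⊗ -`, and `Z ⊗ -` is full on invertible 2-cells. -/
lemma exists_wl_of_isEquiv {k : I E ⟶ Z ⊠ X} (hk : IsEquiv k) {k' : I E ⟶ X ⊠ Z}
    (hk' : IsEquiv k') (h : X ⊠ Y ⟶ X ⊠ Y') :
    ∃ f : Y ⟶ Y', Nonempty (X ◁ₜ f ≅ h) ∧ (IsEquiv h → IsEquiv f) := by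
  obtain ⟨m, ⟨σ⟩, hm⟩ := (isEquiv_unitSquare_side hk Y').exists_left_side
    (p := k ▷ₜ Y ≫ a Z X Y) (Z ◁ₜ h)
  obtain ⟨f, ⟨κ⟩, hf⟩ := (isEquiv_l Y).exists_right_side (q := l Y') m
  obtain ⟨i, -⟩ := SqRel.exists_i (isEquiv_l _) (Iso.refl f) (Iso.refl _) (Iso.refl _) (luNat f) κ
  obtain ⟨j, -⟩ := SqRel.exists_j (isEquiv_unitSquare_side hk _) i (Iso.refl _) (Iso.refl _)
    (unitSquare k f) σ
  obtain ⟨ρ, -⟩ := wlIso_surjective_of_isEquiv hk' hk j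
  exact ⟨f, ⟨ρ⟩, fun hh => hf (isEquiv_l _) (hm (isEquiv_unitSquare_side hk _) (hh.wl Z))⟩

end

section
variable [IsGroupLike E]

lemma exists_isEquiv_inverse (X : E) :
    ∃ (Z : E) (k : I E ⟶ Z ⊠ X) (k' : I E ⟶ X ⊠ Z), IsEquiv k ∧ IsEquiv k' := by
  obtain ⟨Z, ⟨e⟩, ⟨e'⟩⟩ := IsGroupLike.exists_inverse X
  exact ⟨Z, e.inv, e'.inv, ⟨e.hom, ⟨e.counit⟩, ⟨e.unit.symm⟩⟩, ⟨e'.hom, ⟨e'.counit⟩, ⟨e'.unit.symm⟩⟩⟩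

lemma wlIso_injective (X : E) {Y Y' : E} {f g : Y ⟶ Y'} {σ σ' : f ≅ g}
    (h : wlIso X σ = wlIso X σ') : σ = σ' := by
  obtain ⟨Z, k, k', hk, hk'⟩ := exists_isEquiv_inverse X
  exact wlIso_injective_of_isEquiv hk h

lemma etaIso_injective (X : E) {f g : I E ⟶ I E} {σ σ' : f ≅ g}
    (h : etaIso X σ = etaIso X σ') : σ = σ' := by
  have e := etaIso_rel X σ
  rw [h] at e
  exact wlIso_injective X (e.π_unique (etaIso_rel X σ') (isEquiv_r X))

lemma etaIso_surjective (X : E) {f g : I E ⟶ I E} (ρ : eta X f ≅ eta X g) :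
    ∃ σ : f ≅ g, etaIso X σ = ρ := by
  obtain ⟨Z, k, k', hk, hk'⟩ := exists_isEquiv_inverse X
  obtain ⟨i, hi⟩ := SqRel.exists_i (isEquiv_r X) ρ (Iso.refl _) (Iso.refl _) (zeta X f).symm
    (zeta X g).symm
  obtain ⟨σ, rfl⟩ := wlIso_surjective_of_isEquiv hk hk' i
  exact ⟨σ, (etaIso_rel X σ).transpose.j_unique hi (isEquiv_r X)⟩

/-- Conjugate `h` by the right unitor to a self-equivalence of `X ⊗ I`; it comes from a
self-equivalence of `I` because `X` is invertible. -/
lemma exists_eta {X : E} {h : X ⟶ X} (hh : IsEquiv h) :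
    ∃ f : AutI E, Nonempty (eta X f.hom ≅ h) := by
  obtain ⟨Z, k, k', hk, hk'⟩ := exists_isEquiv_inverse X
  obtain ⟨m, ⟨σ⟩, hm⟩ := (isEquiv_r X).exists_left_side (p := r X) h
  obtain ⟨f, ⟨ρ⟩, hf⟩ := exists_wl_of_isEquiv hk hk' m
  obtain ⟨j, -⟩ := SqRel.exists_j (isEquiv_r X) ρ (Iso.refl _) (Iso.refl _) (zeta X f).symm σ
  exact ⟨⟨f, hf (hm (isEquiv_r X) hh)⟩, ⟨j⟩⟩

end

end
-- The canonical symmetry and the Picard structure on `Aut(I)`.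
section
open Bicategory
open scoped CategoryTheory.Prod
variable {E : Type u} [Bicategory.{w, v} E] [MonoidalBicategory E]
open MonoidalBicategory

lemma isEquiv_eta (X : E) {f : I E ⟶ I E} (hf : IsEquiv f) : IsEquiv (eta X f) :=
  IsEquiv.comp ⟨r X, ⟨(ru X).counit⟩, ⟨(ru X).unit.symm⟩⟩ ((hf.wl X).comp (isEquiv_r X))

/-- The trivialization lets `f` act on `A`, while `g` acts on `B` by `etaTensor`. Both naturality
squares are then tensor products of trivial squares, transposes of each other. This is why the
braiding is a symmetry. -/
lemma etaNat_eta_symm (τ : TrivialAction E) (A B : E) (f g : AutI E) :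
    etaNat (eta (A ⊠ B) f.hom) g.hom = (etaNat (eta (A ⊠ B) g.hom) f.hom).symm := by
  have e₁ := ((etaTensor_natural (eta A f.hom) (𝟙 B) g.hom).trans
    (etaNat_map₂ (τ.etaTensorLeft A B f) g.hom)).congr (Iso.refl_trans _) (Iso.refl_trans _)
    (Iso.trans_refl _) (Iso.trans_refl _)
  have e₂ := ((τ.etaTensorLeft_natural (𝟙 A) (isEquiv_eta B g.isEquiv) f).trans
    (etaNat_map₂ (etaTensor A B g.hom) f.hom)).congr (Iso.refl_trans _) (Iso.refl_trans _)
    (Iso.trans_refl _) (Iso.trans_refl _)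
  rw [etaNat_id] at e₁ e₂
  have h : tSq (idSq (eta A f.hom)).symm (idSq (eta B g.hom)) =
      (tSq (idSq (eta A f.hom)) (idSq (eta B g.hom)).symm).symm := by
    rw [← tSq_symm]; rfl
  rw [h] at e₂
  exact e₁.right_unique e₂.transpose

/-- Moving one automorphism of the unit through another one, on an object `X`. -/
def braidCell (X : E) (f g : I E ⟶ I E) : eta X (f ≫ g) ≅ eta X (g ≫ f) :=
  etaComp X f g ≪≫ etaNat (eta X f) g ≪≫ (etaComp X g f).symm

lemma braidCell_rel {X Y : E} (h : X ⟶ Y) (f g : I E ⟶ I E) :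
    SqRel (Iso.refl _) (Iso.refl _) (braidCell X f g) (braidCell Y f g) (etaNat h (f ≫ g))
      (etaNat h (g ≫ f)) :=
  ((etaNat_etaComp h f g).trans ((etaNat_square (etaNat h f) g).trans
    (etaNat_etaComp h g f).symm)).congr (by simp) (by simp) rfl rfl

lemma iso_conj {C : Type u₁} [Category.{v₁} C] {a₁ a₂ b₁ b₂ c₁ c₂ d₁ d₂ e₁ e₂ : C}
    {A₁ : a₁ ≅ b₁} {A₂ : a₂ ≅ b₂} {C₁ : b₁ ≅ c₁} {C₂ : b₂ ≅ c₂} {H₁ : c₁ ≅ d₁} {H₂ : c₂ ≅ d₂}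
    {T₁ : a₁ ≅ e₁} {T₂ : a₂ ≅ e₂} {K₁ : e₁ ≅ d₁} {K₂ : e₂ ≅ d₂} {W : b₁ ≅ b₂} {N : d₁ ≅ d₂}
    (h₁ : A₁ ≪≫ C₁ ≪≫ H₁ = T₁ ≪≫ K₁) (h₂ : A₂ ≪≫ C₂ ≪≫ H₂ = T₂ ≪≫ K₂)
    (h : (C₁.symm ≪≫ W ≪≫ C₂) ≪≫ H₂ = H₁ ≪≫ N) :
    (A₁ ≪≫ W ≪≫ A₂.symm) ≪≫ T₂ = T₁ ≪≫ K₁ ≪≫ N ≪≫ K₂.symm := by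
  have k₁ : T₁ = (A₁ ≪≫ C₁ ≪≫ H₁) ≪≫ K₁.symm := by rw [h₁]; simp
  have k₂ : T₂ = (A₂ ≪≫ C₂ ≪≫ H₂) ≪≫ K₂.symm := by rw [h₂]; simp
  have k₃ : N = H₁.symm ≪≫ (C₁.symm ≪≫ W ≪≫ C₂) ≪≫ H₂ := by rw [h]; simp
  rw [k₁, k₂, k₃]
  simp

lemma braidCell_tensor (X Y : E) (f g : I E ⟶ I E) :
    wlIso X (braidCell Y f g) ≪≫ etaTensor X Y (g ≫ f) =
      etaTensor X Y (f ≫ g) ≪≫ braidCell (X ⊠ Y) f g := by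
  have e := ((etaTensor_natural (𝟙 X) (eta Y f) g).trans
      (etaNat_map₂ (etaTensor X Y f) g)).congr (Iso.refl_trans _) (Iso.refl_trans _)
      (Iso.trans_refl _) (Iso.trans_refl _)
  rw [wlSq_eq] at e
  have h := iso_conj (etaTensor_etaComp X Y f g) (etaTensor_etaComp X Y g f) e
  rw [braidCell, braidCell, ← h]
  simp

/-- An isomorphism `f + g ≅ g + f` is the canonical one on `X`. -/
def IsBraidOn (X : E) {f g : I E ⟶ I E} (β : f ≫ g ≅ g ≫ f) : Prop :=
  etaIso X β = braidCell X f g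

namespace IsBraidOn
variable {f g : I E ⟶ I E} {β : f ≫ g ≅ g ≫ f}

lemma tensor {Y : E} (h : IsBraidOn Y β) (X : E) : IsBraidOn (X ⊠ Y) β := by
  have e := etaTensor_etaIso X Y β
  rw [show etaIso Y β = _ from h, braidCell_tensor] at e
  rw [IsBraidOn]
  simpa using (congrArg (fun x => (etaTensor X Y (f ≫ g)).symm ≪≫ x) e).symm

lemma of_isEquiv {X Y : E} {h : X ⟶ Y} (hh : IsEquiv h) (hX : IsBraidOn X β) : IsBraidOn Y β := by
  have e := etaNat_etaIso h β
  rw [show etaIso X β = _ from hX] at e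
  exact e.ρ_unique (braidCell_rel h f g) hh

/-- `X` is equivalent to `X ⊗ I` by the right unitor, so the choice made on the unit object is
canonical on every object. -/
lemma of_unit (h : IsBraidOn (I E) β) (X : E) : IsBraidOn X β :=
  (h.tensor X).of_isEquiv (isEquiv_r X)

end IsBraidOn

section
variable [IsGroupLike E]

/-- The canonical symmetry of `Aut_E(I)`. -/
noncomputable def braid (f g : I E ⟶ I E) : f ≫ g ≅ g ≫ f :=
  (etaIso_surjective (I E) (braidCell (I E) f g)).choose

lemma etaIso_braid (X : E) (f g : I E ⟶ I E) : etaIso X (braid f g) = braidCell X f g :=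
  IsBraidOn.of_unit (etaIso_surjective (I E) (braidCell (I E) f g)).choose_spec X

lemma etaIso_braid_etaComp (X : E) (f g : I E ⟶ I E) :
    etaIso X (braid f g) ≪≫ etaComp X g f = etaComp X f g ≪≫ etaNat (eta X f) g := by
  rw [etaIso_braid, braidCell]; simp

lemma braid_natural_right (f : I E ⟶ I E) {g g' : I E ⟶ I E} (σ : g ≅ g') :
    hc (Iso.refl f) σ ≪≫ braid f g' = braid f g ≪≫ hc σ (Iso.refl f) := by
  apply etaIso_injective (I E)
  have h := congrArg Iso.hom (etaNat_etaIso (eta (I E) f) σ)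
  have b := congrArg Iso.hom (etaIso_braid_etaComp (I E) f g)
  have b' := congrArg Iso.hom (etaIso_braid_etaComp (I E) f g')
  have c := congrArg Iso.hom (etaComp_natural (I E) σ (Iso.refl f))
  have c' := congrArg Iso.hom (etaComp_natural (I E) (Iso.refl f) σ)
  rw [etaIso_refl] at c c'
  simp only [Iso.trans_hom] at h b b' c c'
  ext
  rw [etaIso_trans, etaIso_trans, ← cancel_mono (etaComp (I E) g' f).hom]
  simp only [Iso.trans_hom, Category.assoc]
  rw [b', c, reassoc_of% c', reassoc_of% b, h]

lemma braid_braid (τ : TrivialAction E) (f g : AutI E) :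
    braid f.hom g.hom ≪≫ braid g.hom f.hom = Iso.refl _ := by
  -- Tested on `I ⊗ I` because `etaNat_eta_symm` needs a tensor product.
  apply etaIso_injective (I E ⊠ I E)
  rw [etaIso_trans, etaIso_braid, etaIso_braid, braidCell, braidCell, etaNat_eta_symm τ,
    etaIso_refl]
  simp

lemma braid_symm (τ : TrivialAction E) (f g : AutI E) :
    (braid f.hom g.hom).symm = braid g.hom f.hom := by
  simpa using congrArg ((braid f.hom g.hom).symm ≪≫ ·) (braid_braid τ f g).symm

lemma braid_natural_left (τ : TrivialAction E) {f f' : AutI E} (σ : f ⟶ f') (g : AutI E) :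
    hc σ (Iso.refl g.hom) ≪≫ braid f'.hom g.hom =
      braid f.hom g.hom ≪≫ hc (Iso.refl g.hom) σ := by
  have h := congrArg Iso.symm (braid_natural_right g.hom (Iso.symm σ))
  simp only [Iso.trans_symm, hc_symm, Iso.refl_symm, Iso.symm_symm_eq, braid_symm τ] at h
  exact h.symm

/-- The hexagon is the monoidality of `η(-)`-naturality along the fixed 1-cell `η(f)`, that is,
`etaNat_etaComp`; the remaining rewrites carry `etaComp` through the associators. -/
lemma braid_comp_right (f g h : I E ⟶ I E) :
    α_ f g h ≪≫ braid f (g ≫ h) ≪≫ α_ g h f =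
      hc (braid f g) (Iso.refl h) ≪≫ α_ g f h ≪≫ hc (Iso.refl g) (braid f h) := by
  apply etaIso_injective (I E)
  have n := congrArg Iso.hom (etaNat_etaComp (eta (I E) f) g h)
  have b₁ := congrArg Iso.hom (etaIso_braid_etaComp (I E) f (g ≫ h))
  have b₂ := congrArg (fun x => (hc x (Iso.refl (eta (I E) h))).hom)
    (etaIso_braid_etaComp (I E) f g)
  have b₃ := congrArg (fun x => (hc (Iso.refl (eta (I E) g)) x).hom)
    (etaIso_braid_etaComp (I E) f h)
  have c₁ := congrArg Iso.hom (etaComp_natural (I E) (braid f g) (Iso.refl h))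
  have c₂ := congrArg Iso.hom (etaComp_natural (I E) (Iso.refl g) (braid f h))
  have a₁ := congrArg Iso.hom (etaComp_assoc (I E) f g h)
  have a₂ := congrArg Iso.hom (etaComp_assoc (I E) g f h)
  have a₃ := congrArg Iso.hom (etaComp_assoc (I E) g h f)
  rw [etaIso_refl] at c₁ c₂
  simp only [Iso.trans_hom, hc_hom, Iso.refl_hom, id_whiskerRight, Bicategory.whiskerLeft_id,
    Category.comp_id, Category.id_comp, comp_whiskerRight, Bicategory.whiskerLeft_comp,
    hPaste_hom] at n b₁ b₂ b₃ c₁ c₂ a₁ a₂ a₃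
  ext
  simp only [etaIso_trans]
  rw [← cancel_mono (etaComp (I E) g (h ≫ f)).hom,
    ← cancel_mono (eta (I E) g ◁ (etaComp (I E) h f).hom)]
  simp only [Iso.trans_hom, Category.assoc]
  rw [a₃, reassoc_of% b₁, reassoc_of% n, reassoc_of% a₁, reassoc_of% c₂, b₃, reassoc_of% a₂,
    reassoc_of% c₁, reassoc_of% b₂]
  simp

lemma braid_comp_left (τ : TrivialAction E) (f g h : AutI E) :
    (α_ f.hom g.hom h.hom).symm ≪≫ braid (f.hom ≫ g.hom) h.hom ≪≫ (α_ h.hom f.hom g.hom).symm =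
      hc (Iso.refl f.hom) (braid g.hom h.hom) ≪≫ (α_ f.hom h.hom g.hom).symm ≪≫
        hc (braid f.hom h.hom) (Iso.refl g.hom) := by
  have e := congrArg Iso.symm (braid_comp_right h.hom f.hom g.hom)
  have s := braid_symm τ h ⟨f.hom ≫ g.hom, f.isEquiv.comp g.isEquiv⟩
  simp only [Iso.trans_symm, hc_symm, Iso.refl_symm, braid_symm τ] at e
  rw [s] at e
  simpa only [Iso.trans_assoc] using e

/-- `Aut_E(I)` is a Picard groupoid. -/
noncomputable abbrev picardGroupoid (τ : TrivialAction E) : PicardGroupoid (AutI E) where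
  braiding f g :=
    { hom := braid f.hom g.hom
      inv := (braid f.hom g.hom).symm
      hom_inv_id := Iso.self_symm_id _
      inv_hom_id := Iso.symm_self_id _ }
  braiding_naturality_right f _ _ σ :=
    (congrArg (· ≪≫ braid _ _) (hc_refl_left σ).symm).trans ((braid_natural_right f.hom σ).trans
      (congrArg (braid _ _ ≪≫ ·) (hc_refl_right σ)))
  braiding_naturality_left σ g :=
    (congrArg (· ≪≫ braid _ _) (hc_refl_right σ).symm).trans ((braid_natural_left τ σ g).trans
      (congrArg (braid _ _ ≪≫ ·) (hc_refl_left σ)))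
  hexagon_forward f g h := by
    have e := braid_comp_right f.hom g.hom h.hom
    rw [hc_refl_left, hc_refl_right] at e
    exact e
  hexagon_reverse f g h := by
    have e := braid_comp_left τ f g h
    rw [hc_refl_left, hc_refl_right] at e
    exact e
  symmetry f g := braid_braid τ f g
  isIso σ := ⟨σ.symm, Iso.self_symm_id _, Iso.symm_self_id _⟩
  exists_inverse f := by
    obtain ⟨g, hg, ⟨σ⟩, -⟩ := f.isEquiv.symm_exists
    exact ⟨⟨g, hg⟩, ⟨⟨σ, σ.symm, Iso.self_symm_id _, Iso.symm_self_id _⟩⟩⟩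

lemma isCanonicalSymmetry_picardGroupoid (τ : TrivialAction E) :
    IsCanonicalSymmetry (picardGroupoid τ) :=
  fun X f g => etaIso_braid X f.hom g.hom

end

end
-- The two halves of the associahedron as chains of graded relations.
section
open MonoidalCategory
variable {C : Type u₁} [Category.{v₁} C] [MonoidalCategory C]

/-- The composite of the faces of odd index. -/
abbrev oddGrade {e₁ e₂ e₃ o₁ o₂ o₃ q₁ q₂ l₁ l₂ l₃ l₄ l₅ l₆ : C}
    (θ₁ : e₁ ⊗ e₂ ⟶ o₁ ⊗ o₂ ⊗ o₃) (θ₂ : o₃ ⊗ e₃ ⟶ q₂ ⊗ l₆) (θ₃ : o₂ ⊗ q₂ ⟶ q₁ ⊗ l₄ ⊗ l₅)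
    (θ₄ : o₁ ⊗ q₁ ⟶ l₁ ⊗ l₂ ⊗ l₃) : e₁ ⊗ e₂ ⊗ e₃ ⟶ l₁ ⊗ l₂ ⊗ l₃ ⊗ l₄ ⊗ l₅ ⊗ l₆ :=
  𝟙 (e₁ ⊗ e₂ ⊗ e₃) ⊗≫ θ₁ ▷ e₃ ⊗≫ (o₁ ⊗ o₂) ◁ θ₂ ⊗≫ o₁ ◁ θ₃ ▷ l₆ ⊗≫ θ₄ ▷ (l₄ ⊗ l₅ ⊗ l₆) ⊗≫
    𝟙 (l₁ ⊗ l₂ ⊗ l₃ ⊗ l₄ ⊗ l₅ ⊗ l₆)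

/-- The composite of the faces of even index. -/
abbrev evenGrade {e₁ e₂ e₃ m₂ m₃ d k₂ k₃ n₁ l₁ l₂ l₃ l₄ l₅ l₆ : C}
    (θ₁ : e₂ ⊗ e₃ ⟶ l₁ ⊗ m₂ ⊗ m₃) (θ₂ : e₁ ⊗ l₁ ⟶ l₁ ⊗ d) (θ₃ : d ⊗ m₂ ⟶ l₂ ⊗ k₂ ⊗ k₃)
    (θ₄ : k₃ ⊗ m₃ ⟶ n₁ ⊗ l₅ ⊗ l₆) (θ₅ : k₂ ⊗ n₁ ⟶ l₃ ⊗ l₄) :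
    e₁ ⊗ e₂ ⊗ e₃ ⟶ l₁ ⊗ l₂ ⊗ l₃ ⊗ l₄ ⊗ l₅ ⊗ l₆ :=
  e₁ ◁ θ₁ ⊗≫ θ₂ ▷ (m₂ ⊗ m₃) ⊗≫ l₁ ◁ θ₃ ▷ m₃ ⊗≫ (l₁ ⊗ l₂ ⊗ k₂) ◁ θ₄ ⊗≫
    (l₁ ⊗ l₂) ◁ θ₅ ▷ (l₅ ⊗ l₆) ⊗≫ 𝟙 (l₁ ⊗ l₂ ⊗ l₃ ⊗ l₄ ⊗ l₅ ⊗ l₆)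

lemma oddFaces_chain {e₁ e₂ e₃ o₁ o₂ o₃ q₁ q₂ l₁ l₂ l₃ l₄ l₅ l₆ : C}
    (θ₁ : e₁ ⊗ e₂ ⟶ o₁ ⊗ o₂ ⊗ o₃) (θ₂ : o₃ ⊗ e₃ ⟶ q₂ ⊗ l₆) (θ₃ : o₂ ⊗ q₂ ⟶ q₁ ⊗ l₄ ⊗ l₅)
    (θ₄ : o₁ ⊗ q₁ ⟶ l₁ ⊗ l₂ ⊗ l₃) :
    (α_ e₁ e₂ e₃).inv ≫ (θ₁ ⊗ₘ 𝟙 e₃) ≫ (α_ o₁ (o₂ ⊗ o₃) e₃).hom ≫ (𝟙 o₁ ⊗ₘ (α_ o₂ o₃ e₃).hom) ≫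
      (𝟙 o₁ ⊗ₘ (𝟙 o₂ ⊗ₘ θ₂)) ≫ (𝟙 o₁ ⊗ₘ (α_ o₂ q₂ l₆).inv) ≫ (𝟙 o₁ ⊗ₘ (θ₃ ⊗ₘ 𝟙 l₆)) ≫
      (𝟙 o₁ ⊗ₘ (α_ q₁ (l₄ ⊗ l₅) l₆).hom) ≫ (𝟙 o₁ ⊗ₘ (𝟙 q₁ ⊗ₘ (α_ l₄ l₅ l₆).hom)) ≫
      (α_ o₁ q₁ (l₄ ⊗ l₅ ⊗ l₆)).inv ≫ (θ₄ ⊗ₘ 𝟙 (l₄ ⊗ l₅ ⊗ l₆)) ≫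
      (α_ l₁ (l₂ ⊗ l₃) (l₄ ⊗ l₅ ⊗ l₆)).hom ≫ (𝟙 l₁ ⊗ₘ (α_ l₂ l₃ (l₄ ⊗ l₅ ⊗ l₆)).hom) =
    oddGrade θ₁ θ₂ θ₃ θ₄ := by
  monoidal

lemma evenFaces_chain {e₁ e₂ e₃ m₂ m₃ d k₂ k₃ n₁ l₁ l₂ l₃ l₄ l₅ l₆ : C}
    (θ₁ : e₂ ⊗ e₃ ⟶ l₁ ⊗ m₂ ⊗ m₃) (θ₂ : e₁ ⊗ l₁ ⟶ l₁ ⊗ d) (θ₃ : d ⊗ m₂ ⟶ l₂ ⊗ k₂ ⊗ k₃)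
    (θ₄ : k₃ ⊗ m₃ ⟶ n₁ ⊗ l₅ ⊗ l₆) (θ₅ : k₂ ⊗ n₁ ⟶ l₃ ⊗ l₄) :
    (𝟙 e₁ ⊗ₘ θ₁) ≫ (α_ e₁ l₁ (m₂ ⊗ m₃)).inv ≫ (θ₂ ⊗ₘ 𝟙 (m₂ ⊗ m₃)) ≫ (α_ l₁ d (m₂ ⊗ m₃)).hom ≫
      (𝟙 l₁ ⊗ₘ (α_ d m₂ m₃).inv) ≫ (𝟙 l₁ ⊗ₘ (θ₃ ⊗ₘ 𝟙 m₃)) ≫ (𝟙 l₁ ⊗ₘ (α_ l₂ (k₂ ⊗ k₃) m₃).hom) ≫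
      (𝟙 l₁ ⊗ₘ (𝟙 l₂ ⊗ₘ (α_ k₂ k₃ m₃).hom)) ≫ (𝟙 l₁ ⊗ₘ (𝟙 l₂ ⊗ₘ (𝟙 k₂ ⊗ₘ θ₄))) ≫
      (𝟙 l₁ ⊗ₘ (𝟙 l₂ ⊗ₘ (α_ k₂ n₁ (l₅ ⊗ l₆)).inv)) ≫
      (𝟙 l₁ ⊗ₘ (𝟙 l₂ ⊗ₘ (θ₅ ⊗ₘ 𝟙 (l₅ ⊗ l₆)))) ≫
      (𝟙 l₁ ⊗ₘ (𝟙 l₂ ⊗ₘ (α_ l₃ l₄ (l₅ ⊗ l₆)).hom)) =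
    evenGrade θ₁ θ₂ θ₃ θ₄ θ₅ := by
  monoidal

end

section
open Bicategory

section
variable {B : Type u₁} [Bicategory.{w₁, v₁} B]

/-- The composite of the 2-cells of the first side of the associahedron. -/
abbrev oddPath {x₀ x₁ x₂ x₃ y₁ y₂ y₃ z₁ z₂ z₃ z₄ : B} {e₁ : x₀ ⟶ x₁} {e₂ : x₁ ⟶ x₂}
    {e₃ : x₂ ⟶ x₃} {o₁ : x₀ ⟶ y₁} {o₂ : y₁ ⟶ y₂} {o₃ : y₂ ⟶ x₂} {q₂ : y₂ ⟶ y₃} {l₆ : y₃ ⟶ x₃}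
    {q₁ : y₁ ⟶ z₁} {l₄ : z₁ ⟶ z₂} {l₅ : z₂ ⟶ y₃} {l₁ : x₀ ⟶ z₃} {l₂ : z₃ ⟶ z₄} {l₃ : z₄ ⟶ z₁}
    (π₁ : o₁ ≫ o₂ ≫ o₃ ≅ e₁ ≫ e₂) (π₂ : q₂ ≫ l₆ ≅ o₃ ≫ e₃) (π₃ : q₁ ≫ l₄ ≫ l₅ ≅ o₂ ≫ q₂)
    (π₄ : l₁ ≫ l₂ ≫ l₃ ≅ o₁ ≫ q₁) : l₁ ≫ l₂ ≫ l₃ ≫ l₄ ≫ l₅ ≫ l₆ ≅ e₁ ≫ e₂ ≫ e₃ :=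
  Iso.refl (l₁ ≫ l₂ ≫ l₃ ≫ l₄ ≫ l₅ ≫ l₆) ≪⊗≫ π₄ ▷ᵢ (l₄ ≫ l₅ ≫ l₆) ≪⊗≫ o₁ ◁ᵢ (π₃ ▷ᵢ l₆) ≪⊗≫
    (o₁ ≫ o₂) ◁ᵢ π₂ ≪⊗≫ π₁ ▷ᵢ e₃ ≪⊗≫ Iso.refl (e₁ ≫ e₂ ≫ e₃)

lemma odd_path_chain {x₀ x₁ x₂ x₃ y₁ y₂ y₃ z₁ z₂ z₃ z₄ : B} {e₁ : x₀ ⟶ x₁} {e₂ : x₁ ⟶ x₂}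
    {e₃ : x₂ ⟶ x₃} {o₁ : x₀ ⟶ y₁} {o₂ : y₁ ⟶ y₂} {o₃ : y₂ ⟶ x₂} {q₂ : y₂ ⟶ y₃} {l₆ : y₃ ⟶ x₃}
    {q₁ : y₁ ⟶ z₁} {l₄ : z₁ ⟶ z₂} {l₅ : z₂ ⟶ y₃} {l₁ : x₀ ⟶ z₃} {l₂ : z₃ ⟶ z₄} {l₃ : z₄ ⟶ z₁}
    (π₁ : o₁ ≫ o₂ ≫ o₃ ≅ e₁ ≫ e₂) (π₂ : q₂ ≫ l₆ ≅ o₃ ≫ e₃) (π₃ : q₁ ≫ l₄ ≫ l₅ ≅ o₂ ≫ q₂)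
    (π₄ : l₁ ≫ l₂ ≫ l₃ ≅ o₁ ≫ q₁) :
    (α_ e₁ e₂ e₃).symm ≪≫ hc π₁.symm (Iso.refl e₃) ≪≫ α_ o₁ (o₂ ≫ o₃) e₃ ≪≫
      hc (Iso.refl o₁) (α_ o₂ o₃ e₃) ≪≫ hc (Iso.refl o₁) (hc (Iso.refl o₂) π₂.symm) ≪≫
      hc (Iso.refl o₁) (α_ o₂ q₂ l₆).symm ≪≫ hc (Iso.refl o₁) (hc π₃.symm (Iso.refl l₆)) ≪≫
      hc (Iso.refl o₁) (α_ q₁ (l₄ ≫ l₅) l₆) ≪≫ hc (Iso.refl o₁) (hc (Iso.refl q₁) (α_ l₄ l₅ l₆)) ≪≫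
      (α_ o₁ q₁ (l₄ ≫ l₅ ≫ l₆)).symm ≪≫ hc π₄.symm (Iso.refl (l₄ ≫ l₅ ≫ l₆)) ≪≫
      α_ l₁ (l₂ ≫ l₃) (l₄ ≫ l₅ ≫ l₆) ≪≫ hc (Iso.refl l₁) (α_ l₂ l₃ (l₄ ≫ l₅ ≫ l₆)) =
    (oddPath π₁ π₂ π₃ π₄).symm := by
  ext
  simp [bicategoricalIsoComp]

/-- The composite of the 2-cells of the second side of the associahedron. -/
abbrev evenPath {x₀ x₁ x₂ x₃ y₁ y₂ y₃ y₄ y₅ z₁ z₂ z₃ : B} {e₁ : x₀ ⟶ x₁} {e₂ : x₁ ⟶ x₂}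
    {e₃ : x₂ ⟶ x₃} {m₁ : x₁ ⟶ y₁} {m₂ : y₁ ⟶ y₂} {m₃ : y₂ ⟶ x₃} {l₁ : x₀ ⟶ y₃} {d : y₃ ⟶ y₁}
    {l₂ : y₃ ⟶ y₄} {k₂ : y₄ ⟶ y₅} {k₃ : y₅ ⟶ y₂} {n₁ : y₅ ⟶ z₁} {l₅ : z₁ ⟶ z₂} {l₆ : z₂ ⟶ x₃}
    {l₃ : y₄ ⟶ z₃} {l₄ : z₃ ⟶ z₁}
    (π₁ : m₁ ≫ m₂ ≫ m₃ ≅ e₂ ≫ e₃) (π₂ : l₁ ≫ d ≅ e₁ ≫ m₁) (π₃ : l₂ ≫ k₂ ≫ k₃ ≅ d ≫ m₂)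
    (π₄ : n₁ ≫ l₅ ≫ l₆ ≅ k₃ ≫ m₃) (π₅ : l₃ ≫ l₄ ≅ k₂ ≫ n₁) :
    l₁ ≫ l₂ ≫ l₃ ≫ l₄ ≫ l₅ ≫ l₆ ≅ e₁ ≫ e₂ ≫ e₃ :=
  Iso.refl (l₁ ≫ l₂ ≫ l₃ ≫ l₄ ≫ l₅ ≫ l₆) ≪⊗≫ (l₁ ≫ l₂) ◁ᵢ (π₅ ▷ᵢ (l₅ ≫ l₆)) ≪⊗≫
    (l₁ ≫ l₂ ≫ k₂) ◁ᵢ π₄ ≪⊗≫ l₁ ◁ᵢ (π₃ ▷ᵢ m₃) ≪⊗≫ π₂ ▷ᵢ (m₂ ≫ m₃) ≪⊗≫ e₁ ◁ᵢ π₁ ≪⊗≫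
    Iso.refl (e₁ ≫ e₂ ≫ e₃)

lemma even_path_chain {x₀ x₁ x₂ x₃ y₁ y₂ y₃ y₄ y₅ z₁ z₂ z₃ : B} {e₁ : x₀ ⟶ x₁} {e₂ : x₁ ⟶ x₂}
    {e₃ : x₂ ⟶ x₃} {m₁ : x₁ ⟶ y₁} {m₂ : y₁ ⟶ y₂} {m₃ : y₂ ⟶ x₃} {l₁ : x₀ ⟶ y₃} {d : y₃ ⟶ y₁}
    {l₂ : y₃ ⟶ y₄} {k₂ : y₄ ⟶ y₅} {k₃ : y₅ ⟶ y₂} {n₁ : y₅ ⟶ z₁} {l₅ : z₁ ⟶ z₂} {l₆ : z₂ ⟶ x₃}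
    {l₃ : y₄ ⟶ z₃} {l₄ : z₃ ⟶ z₁}
    (π₁ : m₁ ≫ m₂ ≫ m₃ ≅ e₂ ≫ e₃) (π₂ : l₁ ≫ d ≅ e₁ ≫ m₁) (π₃ : l₂ ≫ k₂ ≫ k₃ ≅ d ≫ m₂)
    (π₄ : n₁ ≫ l₅ ≫ l₆ ≅ k₃ ≫ m₃) (π₅ : l₃ ≫ l₄ ≅ k₂ ≫ n₁) :
    hc (Iso.refl e₁) π₁.symm ≪≫ (α_ e₁ m₁ (m₂ ≫ m₃)).symm ≪≫ hc π₂.symm (Iso.refl (m₂ ≫ m₃)) ≪≫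
      α_ l₁ d (m₂ ≫ m₃) ≪≫ hc (Iso.refl l₁) (α_ d m₂ m₃).symm ≪≫
      hc (Iso.refl l₁) (hc π₃.symm (Iso.refl m₃)) ≪≫ hc (Iso.refl l₁) (α_ l₂ (k₂ ≫ k₃) m₃) ≪≫
      hc (Iso.refl l₁) (hc (Iso.refl l₂) (α_ k₂ k₃ m₃)) ≪≫
      hc (Iso.refl l₁) (hc (Iso.refl l₂) (hc (Iso.refl k₂) π₄.symm)) ≪≫
      hc (Iso.refl l₁) (hc (Iso.refl l₂) (α_ k₂ n₁ (l₅ ≫ l₆)).symm) ≪≫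
      hc (Iso.refl l₁) (hc (Iso.refl l₂) (hc π₅.symm (Iso.refl (l₅ ≫ l₆)))) ≪≫
      hc (Iso.refl l₁) (hc (Iso.refl l₂) (α_ l₃ l₄ (l₅ ≫ l₆))) =
    (evenPath π₁ π₂ π₃ π₄ π₅).symm := by
  ext
  simp [bicategoricalIsoComp]
  bicategory

end

variable {E : Type u} [Bicategory.{w, v} E] [MonoidalBicategory E]
open MonoidalBicategory

namespace GradedRel

-- The chain meets three pentagons (`H₁`, `H₃`, `H₄`) and one naturality face (`H₂`). The path
-- 2-cells are inverted because the associahedron is stated from the longest path to the shortest,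
-- while the `θ` go from fewer summands to more.
open scoped MonoidalCategory in
lemma odd_chain {N x₀ x₁ x₂ x₃ y₁ y₂ y₃ z₁ z₂ z₃ z₄ : E} {b₀ : x₀ ⟶ N} {b₁ : x₁ ⟶ N} {b₂ : x₂ ⟶ N}
    {b₃ : x₃ ⟶ N} {c₁ : y₁ ⟶ N} {c₂ : y₂ ⟶ N} {c₃ : y₃ ⟶ N} {d₁ : z₁ ⟶ N} {d₂ : z₂ ⟶ N}
    {d₃ : z₃ ⟶ N} {d₄ : z₄ ⟶ N} {e₁ : x₀ ⟶ x₁} {e₂ : x₁ ⟶ x₂}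
    {e₃ : x₂ ⟶ x₃} {o₁ : x₀ ⟶ y₁} {o₂ : y₁ ⟶ y₂} {o₃ : y₂ ⟶ x₂} {q₂ : y₂ ⟶ y₃} {l₆ : y₃ ⟶ x₃}
    {q₁ : y₁ ⟶ z₁} {l₄ : z₁ ⟶ z₂} {l₅ : z₂ ⟶ y₃} {l₁ : x₀ ⟶ z₃} {l₂ : z₃ ⟶ z₄} {l₃ : z₄ ⟶ z₁}
    {e₁' e₂' e₃' o₁' o₂' o₃' q₁' q₂' l₁' l₂' l₃' l₄' l₅' l₆' : AutI E}
    {E₁ : b₀ ≫ eta N e₁'.hom ≅ e₁ ≫ b₁} {E₂ : b₁ ≫ eta N e₂'.hom ≅ e₂ ≫ b₂}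
    {E₃ : b₂ ≫ eta N e₃'.hom ≅ e₃ ≫ b₃} {O₁ : b₀ ≫ eta N o₁'.hom ≅ o₁ ≫ c₁}
    {O₂ : c₁ ≫ eta N o₂'.hom ≅ o₂ ≫ c₂} {O₃ : c₂ ≫ eta N o₃'.hom ≅ o₃ ≫ b₂}
    {Q₁ : c₁ ≫ eta N q₁'.hom ≅ q₁ ≫ d₁} {Q₂ : c₂ ≫ eta N q₂'.hom ≅ q₂ ≫ c₃}
    {L₁ : b₀ ≫ eta N l₁'.hom ≅ l₁ ≫ d₃} {L₂ : d₃ ≫ eta N l₂'.hom ≅ l₂ ≫ d₄}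
    {L₃ : d₄ ≫ eta N l₃'.hom ≅ l₃ ≫ d₁} {L₄ : d₁ ≫ eta N l₄'.hom ≅ l₄ ≫ d₂}
    {L₅ : d₂ ≫ eta N l₅'.hom ≅ l₅ ≫ c₃} {L₆ : c₃ ≫ eta N l₆'.hom ≅ l₆ ≫ b₃}
    {π₁ : o₁ ≫ o₂ ≫ o₃ ≅ e₁ ≫ e₂} {π₂ : q₂ ≫ l₆ ≅ o₃ ≫ e₃} {π₃ : q₁ ≫ l₄ ≫ l₅ ≅ o₂ ≫ q₂}
    {π₄ : l₁ ≫ l₂ ≫ l₃ ≅ o₁ ≫ q₁}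
    {θ₁ : e₁' ⊗ e₂' ⟶ o₁' ⊗ o₂' ⊗ o₃'} {θ₂ : o₃' ⊗ e₃' ⟶ q₂' ⊗ l₆'}
    {θ₃ : o₂' ⊗ q₂' ⟶ q₁' ⊗ l₄' ⊗ l₅'} {θ₄ : o₁' ⊗ q₁' ⟶ l₁' ⊗ l₂' ⊗ l₃'}
    (H₁ : GradedRel π₁.symm θ₁ (gradedComp E₁ E₂) (gradedComp O₁ (gradedComp O₂ O₃)))
    (H₂ : GradedRel π₂.symm θ₂ (gradedComp O₃ E₃) (gradedComp Q₂ L₆))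
    (H₃ : GradedRel π₃.symm θ₃ (gradedComp O₂ Q₂) (gradedComp Q₁ (gradedComp L₄ L₅)))
    (H₄ : GradedRel π₄.symm θ₄ (gradedComp O₁ Q₁) (gradedComp L₁ (gradedComp L₂ L₃))) :
    GradedRel (oddPath π₁ π₂ π₃ π₄).symm (oddGrade θ₁ θ₂ θ₃ θ₄)
      (gradedComp E₁ (gradedComp E₂ E₃))
      (gradedComp L₁ (gradedComp L₂ (gradedComp L₃ (gradedComp L₄ (gradedComp L₅ L₆))))) := by
  have h := (comp_assoc E₁ E₂ E₃).symm.trans <| (H₁.comp (refl E₃)).trans <|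
    (comp_assoc O₁ _ E₃).trans <| ((refl O₁).comp (comp_assoc O₂ O₃ E₃)).trans <|
    ((refl O₁).comp ((refl O₂).comp H₂)).trans <|
    ((refl O₁).comp (comp_assoc O₂ Q₂ L₆).symm).trans <|
    ((refl O₁).comp (H₃.comp (refl L₆))).trans <| ((refl O₁).comp (comp_assoc Q₁ _ L₆)).trans <|
    ((refl O₁).comp ((refl Q₁).comp (comp_assoc L₄ L₅ L₆))).trans <|
    (comp_assoc O₁ Q₁ _).symm.trans <| (H₄.comp (refl _)).trans <|
    (comp_assoc L₁ _ _).trans <| (refl L₁).comp (comp_assoc L₂ L₃ _)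
  exact h.congr rfl rfl (odd_path_chain π₁ π₂ π₃ π₄)
    (congrArg (etaIso N) (oddFaces_chain θ₁ θ₂ θ₃ θ₄))

-- Here the three pentagons are `H₁`, `H₃`, `H₄`, and the two naturality faces are `H₂` and `H₅`.
open scoped MonoidalCategory in
lemma even_chain {N x₀ x₁ x₂ x₃ y₁ y₂ y₃ y₄ y₅ z₁ z₂ z₃ : E} {b₀ : x₀ ⟶ N} {b₁ : x₁ ⟶ N}
    {b₂ : x₂ ⟶ N} {b₃ : x₃ ⟶ N} {c₁ : y₁ ⟶ N} {c₂ : y₂ ⟶ N} {c₃ : y₃ ⟶ N} {c₄ : y₄ ⟶ N}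
    {c₅ : y₅ ⟶ N} {d₁ : z₁ ⟶ N} {d₂ : z₂ ⟶ N} {d₃ : z₃ ⟶ N} {e₁ : x₀ ⟶ x₁} {e₂ : x₁ ⟶ x₂}
    {e₃ : x₂ ⟶ x₃} {m₁ : x₁ ⟶ y₁} {m₂ : y₁ ⟶ y₂} {m₃ : y₂ ⟶ x₃} {l₁ : x₀ ⟶ y₃} {d : y₃ ⟶ y₁}
    {l₂ : y₃ ⟶ y₄} {k₂ : y₄ ⟶ y₅} {k₃ : y₅ ⟶ y₂} {n₁ : y₅ ⟶ z₁} {l₅ : z₁ ⟶ z₂} {l₆ : z₂ ⟶ x₃}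
    {l₃ : y₄ ⟶ z₃} {l₄ : z₃ ⟶ z₁}
    {e₁' e₂' e₃' m₂' m₃' d' k₂' k₃' n₁' l₁' l₂' l₃' l₄' l₅' l₆' : AutI E}
    {E₁ : b₀ ≫ eta N e₁'.hom ≅ e₁ ≫ b₁} {E₂ : b₁ ≫ eta N e₂'.hom ≅ e₂ ≫ b₂}
    {E₃ : b₂ ≫ eta N e₃'.hom ≅ e₃ ≫ b₃} {M₁ : b₁ ≫ eta N l₁'.hom ≅ m₁ ≫ c₁}
    {M₂ : c₁ ≫ eta N m₂'.hom ≅ m₂ ≫ c₂} {M₃ : c₂ ≫ eta N m₃'.hom ≅ m₃ ≫ b₃}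
    {L₁ : b₀ ≫ eta N l₁'.hom ≅ l₁ ≫ c₃} {D : c₃ ≫ eta N d'.hom ≅ d ≫ c₁}
    {L₂ : c₃ ≫ eta N l₂'.hom ≅ l₂ ≫ c₄} {K₂ : c₄ ≫ eta N k₂'.hom ≅ k₂ ≫ c₅}
    {K₃ : c₅ ≫ eta N k₃'.hom ≅ k₃ ≫ c₂} {N₁ : c₅ ≫ eta N n₁'.hom ≅ n₁ ≫ d₁}
    {L₅ : d₁ ≫ eta N l₅'.hom ≅ l₅ ≫ d₂} {L₆ : d₂ ≫ eta N l₆'.hom ≅ l₆ ≫ b₃}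
    {L₃ : c₄ ≫ eta N l₃'.hom ≅ l₃ ≫ d₃} {L₄ : d₃ ≫ eta N l₄'.hom ≅ l₄ ≫ d₁}
    {π₁ : m₁ ≫ m₂ ≫ m₃ ≅ e₂ ≫ e₃} {π₂ : l₁ ≫ d ≅ e₁ ≫ m₁} {π₃ : l₂ ≫ k₂ ≫ k₃ ≅ d ≫ m₂}
    {π₄ : n₁ ≫ l₅ ≫ l₆ ≅ k₃ ≫ m₃} {π₅ : l₃ ≫ l₄ ≅ k₂ ≫ n₁}
    {θ₁ : e₂' ⊗ e₃' ⟶ l₁' ⊗ m₂' ⊗ m₃'} {θ₂ : e₁' ⊗ l₁' ⟶ l₁' ⊗ d'}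
    {θ₃ : d' ⊗ m₂' ⟶ l₂' ⊗ k₂' ⊗ k₃'} {θ₄ : k₃' ⊗ m₃' ⟶ n₁' ⊗ l₅' ⊗ l₆'}
    {θ₅ : k₂' ⊗ n₁' ⟶ l₃' ⊗ l₄'}
    (H₁ : GradedRel π₁.symm θ₁ (gradedComp E₂ E₃) (gradedComp M₁ (gradedComp M₂ M₃)))
    (H₂ : GradedRel π₂.symm θ₂ (gradedComp E₁ M₁) (gradedComp L₁ D))
    (H₃ : GradedRel π₃.symm θ₃ (gradedComp D M₂) (gradedComp L₂ (gradedComp K₂ K₃)))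
    (H₄ : GradedRel π₄.symm θ₄ (gradedComp K₃ M₃) (gradedComp N₁ (gradedComp L₅ L₆)))
    (H₅ : GradedRel π₅.symm θ₅ (gradedComp K₂ N₁) (gradedComp L₃ L₄)) :
    GradedRel (evenPath π₁ π₂ π₃ π₄ π₅).symm (evenGrade θ₁ θ₂ θ₃ θ₄ θ₅)
      (gradedComp E₁ (gradedComp E₂ E₃))
      (gradedComp L₁ (gradedComp L₂ (gradedComp L₃ (gradedComp L₄ (gradedComp L₅ L₆))))) := by
  have h := ((refl E₁).comp H₁).trans <| (comp_assoc E₁ M₁ _).symm.trans <|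
    (H₂.comp (refl _)).trans <| (comp_assoc L₁ D _).trans <|
    ((refl L₁).comp (comp_assoc D M₂ M₃).symm).trans <|
    ((refl L₁).comp (H₃.comp (refl M₃))).trans <| ((refl L₁).comp (comp_assoc L₂ _ M₃)).trans <|
    ((refl L₁).comp ((refl L₂).comp (comp_assoc K₂ K₃ M₃))).trans <|
    ((refl L₁).comp ((refl L₂).comp ((refl K₂).comp H₄))).trans <|
    ((refl L₁).comp ((refl L₂).comp (comp_assoc K₂ N₁ _).symm)).trans <|
    ((refl L₁).comp ((refl L₂).comp (H₅.comp (refl _)))).trans <|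
    (refl L₁).comp ((refl L₂).comp (comp_assoc L₃ L₄ _))
  exact h.congr rfl rfl (even_path_chain π₁ π₂ π₃ π₄ π₅)
    (congrArg (etaIso N) (evenFaces_chain θ₁ θ₂ θ₃ θ₄ θ₅))

end GradedRel

end
-- Pentagon cells with named products, and their graded relations.
namespace PseudoCocycle₃
open MonoidalCategory
variable {G : Type u} [Group G] {A : Type u₁} [Category.{v₁} A] [MonoidalCategory A]
  (P : PseudoCocycle₃ G A)

/-- The morphism `θ_{x,y,z,t}`, with given names for the products. -/
def cell {x y z t p q r : G} (hp : x * y = p) (hq : y * z = q) (hr : z * t = r) :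
    P.f p z t ⊗ P.f x y r ⟶ P.f x y z ⊗ P.f x q t ⊗ P.f y z t :=
  eqToHom (by subst hp hr; rfl) ≫ P.θ x y z t ≫ eqToHom (by subst hq; rfl)

lemma cell_rfl (x y z t : G) : P.cell (x := x) (y := y) (z := z) (t := t) rfl rfl rfl =
    P.θ x y z t :=
  (Category.id_comp _).trans (Category.comp_id _)

end PseudoCocycle₃

section
open Bicategory
variable {E : Type u} [Bicategory.{w, v} E] [MonoidalBicategory E]
open MonoidalBicategory

section
variable {X₀ X₁ X₂ X₃ Z₁ U Y V N : E} (c : U ⊠ V ⟶ N) (τ : TrivialAction E)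

lemma GradedRel.rightMul {u₀ : X₀ ⟶ U} {u₁ : X₁ ⟶ U} {u₂ : X₂ ⟶ U} {u₃ : X₃ ⟶ U} {u₄ : Z₁ ⟶ U}
    {p₁ : X₀ ⟶ X₁} {p₂ : X₁ ⟶ X₂} {p₃ : X₂ ⟶ X₃} {q₁ : X₀ ⟶ Z₁} {q₂ : Z₁ ⟶ X₃}
    {f₁ f₂ g₁ g₂ g₃ : AutI E} {α : u₀ ≫ eta U f₁.hom ≅ q₁ ≫ u₄} {β : u₄ ≫ eta U f₂.hom ≅ q₂ ≫ u₃}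
    {γ : u₀ ≫ eta U g₁.hom ≅ p₁ ≫ u₁} {δ : u₁ ≫ eta U g₂.hom ≅ p₂ ≫ u₂}
    {κ : u₂ ≫ eta U g₃.hom ≅ p₃ ≫ u₃} {π : p₁ ≫ p₂ ≫ p₃ ≅ q₁ ≫ q₂}
    {θ : f₁.hom ≫ f₂.hom ≅ g₁.hom ≫ g₂.hom ≫ g₃.hom}
    (h : GradedRel π.symm θ (gradedComp α β) (gradedComp γ (gradedComp δ κ))) (v : Y ⟶ V) :
    GradedRel ((wrComp₃ p₁ p₂ p₃ Y).symm ≪≫ wrIso π Y ≪≫ wrComp q₁ q₂ Y).symm θ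
      (gradedComp (MonBicat.rightMul c τ α v) (MonBicat.rightMul c τ β v))
      (gradedComp (MonBicat.rightMul c τ γ v)
        (gradedComp (MonBicat.rightMul c τ δ v) (MonBicat.rightMul c τ κ v))) := by
  have e := (rightMul_comp c τ α β v).symm.trans
    ((rightMul_rel c τ (f := ⟨_, f₁.isEquiv.comp f₂.isEquiv⟩)
      (g := ⟨_, g₁.isEquiv.comp (g₂.isEquiv.comp g₃.isEquiv)⟩) h v).trans
    ((rightMul_comp c τ γ (g := ⟨_, g₂.isEquiv.comp g₃.isEquiv⟩) (gradedComp δ κ) v).trans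
    ((GradedRel.refl _).comp (rightMul_comp c τ δ κ v))))
  refine e.congr rfl rfl ?_ (congrArg (etaIso N) ?_)
  · simp only [wrComp₃, mapComp₃, Iso.trans_symm, Iso.trans_assoc]
    rw [hc_refl_left]
    rfl
  · simp

lemma GradedRel.leftMul {u₀ : X₀ ⟶ V} {u₁ : X₁ ⟶ V} {u₂ : X₂ ⟶ V} {u₃ : X₃ ⟶ V} {u₄ : Z₁ ⟶ V}
    {p₁ : X₀ ⟶ X₁} {p₂ : X₁ ⟶ X₂} {p₃ : X₂ ⟶ X₃} {q₁ : X₀ ⟶ Z₁} {q₂ : Z₁ ⟶ X₃}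
    {f₁ f₂ g₁ g₂ g₃ : AutI E} {α : u₀ ≫ eta V f₁.hom ≅ q₁ ≫ u₄} {β : u₄ ≫ eta V f₂.hom ≅ q₂ ≫ u₃}
    {γ : u₀ ≫ eta V g₁.hom ≅ p₁ ≫ u₁} {δ : u₁ ≫ eta V g₂.hom ≅ p₂ ≫ u₂}
    {κ : u₂ ≫ eta V g₃.hom ≅ p₃ ≫ u₃} {π : p₁ ≫ p₂ ≫ p₃ ≅ q₁ ≫ q₂}
    {θ : f₁.hom ≫ f₂.hom ≅ g₁.hom ≫ g₂.hom ≫ g₃.hom}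
    (h : GradedRel π.symm θ (gradedComp α β) (gradedComp γ (gradedComp δ κ))) (u : Y ⟶ U) :
    GradedRel ((wlComp₃ Y p₁ p₂ p₃).symm ≪≫ wlIso Y π ≪≫ wlComp Y q₁ q₂).symm θ
      (gradedComp (MonBicat.leftMul c u α) (MonBicat.leftMul c u β))
      (gradedComp (MonBicat.leftMul c u γ)
        (gradedComp (MonBicat.leftMul c u δ) (MonBicat.leftMul c u κ))) := by
  have e := (leftMul_comp c u α β).symm.trans
    ((leftMul_rel c u (f := ⟨_, f₁.isEquiv.comp f₂.isEquiv⟩)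
      (g := ⟨_, g₁.isEquiv.comp (g₂.isEquiv.comp g₃.isEquiv)⟩) h).trans
    ((leftMul_comp c u γ (g := ⟨_, g₂.isEquiv.comp g₃.isEquiv⟩) (gradedComp δ κ)).trans
    ((GradedRel.refl _).comp (leftMul_comp c u δ κ))))
  refine e.congr rfl rfl ?_ (congrArg (etaIso N) ?_)
  · simp only [wlComp₃, mapComp₃, Iso.trans_symm, Iso.trans_assoc]
    rw [hc_refl_left]
    rfl
  · simp

end

/-- Through `etaComp`, the naturality of `η_N(g)` along `η_N(f)` is the image of the symmetry; a
naturality face thus contributes a permutation of summands. -/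
lemma GradedRel.of_etaNat [IsGroupLike E] {N X₀ X₁ X₂ X₃ : E} {u₀ : X₀ ⟶ N} {u₁ : X₁ ⟶ N}
    {u₂ : X₂ ⟶ N} {u₃ : X₃ ⟶ N} {p : X₀ ⟶ X₁} {q : X₁ ⟶ X₂} {p' : X₀ ⟶ X₃} {q' : X₃ ⟶ X₂}
    {f g : I E ⟶ I E} {α : u₀ ≫ eta N f ≅ p ≫ u₁} {β : u₁ ≫ eta N g ≅ q ≫ u₂}
    {γ : u₀ ≫ eta N g ≅ p' ≫ u₃} {δ : u₃ ≫ eta N f ≅ q' ≫ u₂} {π : p ≫ q ≅ p' ≫ q'}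
    (h : SqRel (Iso.refl _) (Iso.refl _) π (etaNat (eta N f) g) (hPaste α β) (hPaste γ δ)) :
    GradedRel π (braid f g) (gradedComp α β) (gradedComp γ δ) :=
  ((gradedComp_rel α β).trans (h.trans (gradedComp_rel γ δ).symm)).congr (by simp) (by simp)
    (by simp) (etaIso_braid N f g).symm

namespace AssociativityData
open scoped MonoidalCategory
variable {s : PiZeroSection E} (D : AssociativityData s) (τ : TrivialAction E) [IsGroupLike E]

/-- The 2-cell `θ_{x,y,z,t}`, with given names for the products. -/
noncomputable abbrev cellOf (θ : D.PentagonCells) {x y z t p q r : PiZero E} (hp : x * y = p) (hq : y * z = q)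
    (hr : z * t = r) : D.f p z t ⊗ D.f x y r ⟶ D.f x y z ⊗ D.f x q t ⊗ D.f y z t :=
  (PseudoCocycle₃.mk D.f θ).cell hp hq hr

variable {D τ} in
lemma IsPentagon.sqRel {θ : D.PentagonCells} (hθ : D.IsPentagon τ θ)
    {x y z t p q r' u' v' n : PiZero E} (hp : x * y = p) (hq : y * z = q) (hr : z * t = r')
    (hu : p * z = u') (hu' : x * q = u') (hv : y * r' = v') (hv' : q * t = v') (hn : u' * t = n)
    (hn₁ : p * r' = n) (hn₂ : x * v' = n) :
    SqRel (Iso.refl _) (Iso.refl _) (pent (s.obj x) (s.obj y) (s.obj z) (s.obj t)).symm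
      (pentagonCell (s.obj n) (D.cellOf θ hp hq hr))
      (hPaste (pentagonEdge₁ (D.c hp).hom (D.φ hu hr hn hn₁))
        (pentagonEdge₂ (D.c hr).hom (D.φ hp hv hn₁ hn₂)))
      (hPaste (pentagonEdge₃ τ (D.c hn).hom (D.φ hp hq hu hu'))
        (hPaste (pentagonEdge₄ (D.c hq).hom (D.φ hu' hv' hn hn₂))
          (pentagonEdge₅ (D.c hn₂).hom (D.φ hq hr hv' hv)))) := by
  subst hp hq hr hu hv hn
  rw [← upperSide_eq_iff, cellOf, PseudoCocycle₃.cell_rfl]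
  exact hθ x y z t

end AssociativityData

end
-- The cocycle identity from the associahedron.
section
open Bicategory
variable {E : Type u} [Bicategory.{w, v} E] [MonoidalBicategory E]
open MonoidalBicategory

namespace AssociativityData
variable {s : PiZeroSection E} {D : AssociativityData s} {τ : TrivialAction E} [IsGroupLike E]

lemma IsPentagon.gradedRel {θ : D.PentagonCells} (hθ : D.IsPentagon τ θ)
    {x y z t p q r' u' v' n : PiZero E} (hp : x * y = p) (hq : y * z = q) (hr : z * t = r')
    (hu : p * z = u') (hu' : x * q = u') (hv : y * r' = v') (hv' : q * t = v') (hn : u' * t = n)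
    (hn₁ : p * r' = n) (hn₂ : x * v' = n) {A B C F : E} (b₁ : A ⟶ s.obj x) (b₂ : B ⟶ s.obj y)
    (b₃ : C ⟶ s.obj z) (b₄ : F ⟶ s.obj t) :
    GradedRel (pent A B C F).symm (D.cellOf θ hp hq hr)
      (gradedComp (assocCell (D.φ hu hr hn hn₁) ((b₁ ⊠₁ b₂) ≫ (D.c hp).hom) b₃ b₄)
        (assocCell (D.φ hp hv hn₁ hn₂) b₁ b₂ ((b₃ ⊠₁ b₄) ≫ (D.c hr).hom)))
      (gradedComp (rightMul (D.c hn).hom τ (assocCell (D.φ hp hq hu hu') b₁ b₂ b₃) b₄)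
        (gradedComp (assocCell (D.φ hu' hv' hn hn₂) b₁ ((b₂ ⊠₁ b₃) ≫ (D.c hq).hom) b₄)
          (leftMul (D.c hn₂).hom b₁ (assocCell (D.φ hq hr hv' hv) b₂ b₃ b₄)))) :=
  pentagon_transport b₁ b₂ b₃ b₄ τ _ _ _ _ _ _
    (hθ.sqRel hp hq hr hu hu' hv hv' hn hn₁ hn₂)

/-- The cocycle condition, with given names for the products. -/
lemma IsPentagon.oddGrade_eq_evenGrade {θ : D.PentagonCells} (hθ : D.IsPentagon τ θ)
    {x y z t w xy yz zt tw xyz yzt ztw m k n : PiZero E} (h₁₂ : x * y = xy) (h₂₃ : y * z = yz)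
    (h₃₄ : z * t = zt) (h₄₅ : t * w = tw) (h₁₂_₃ : xy * z = xyz) (h₁_₂₃ : x * yz = xyz)
    (h₂₃_₄ : yz * t = yzt) (h₂_₃₄ : y * zt = yzt) (h₃₄_₅ : zt * w = ztw) (h₃_₄₅ : z * tw = ztw)
    (h₁₂₃_₄ : xyz * t = m) (h₁₂_₃₄ : xy * zt = m) (h₁_₂₃₄ : x * yzt = m) (h₂₃₄_₅ : yzt * w = k)
    (h₂₃_₄₅ : yz * tw = k) (h₂_₃₄₅ : y * ztw = k) (h₁₂₃₄_₅ : m * w = n) (h₁₂₃_₄₅ : xyz * tw = n)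
    (h₁₂_₃₄₅ : xy * ztw = n) (h₁_₂₃₄₅ : x * k = n) :
    oddGrade (D.cellOf θ h₁₂_₃ h₃₄ h₄₅) (braid (D.f x y ztw).hom (D.f z t w).hom).symm
        (D.cellOf θ h₁₂ h₂_₃₄ h₃₄_₅) (D.cellOf θ h₁₂ h₂₃ h₃₄) =
      evenGrade (D.cellOf θ h₁₂ h₂₃ h₃_₄₅) (braid (D.f xyz t w).hom (D.f x y z).hom)
        (D.cellOf θ h₁_₂₃ h₂₃_₄ h₄₅) (D.cellOf θ h₂₃ h₃₄ h₄₅)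
        (braid (D.f x yzt w).hom (D.f y z t).hom) := by
  -- The faces are, in order: the pentagon of `XY, Z, T, W`, the naturality of `a` in its third
  -- variable, the pentagon of `X, Y, ZT, W`, and the pentagon of `X, Y, Z, T` multiplied by `W`.
  -- Identities are taken as 1-cells, a product such as `XY` being sent to `s(xy)` by `c`.
  have odd := GradedRel.odd_chain
    (hθ.gradedRel h₁₂_₃ h₃₄ h₄₅ h₁₂₃_₄ h₁₂_₃₄ h₃_₄₅ h₃₄_₅ h₁₂₃₄_₅ h₁₂₃_₄₅ h₁₂_₃₄₅
      ((𝟙 (s.obj x) ⊠₁ 𝟙 (s.obj y)) ≫ (D.c h₁₂).hom) (𝟙 _) (𝟙 _) (𝟙 _))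
    (GradedRel.of_etaNat (assocCell_as₃ (D.φ h₁₂ h₂_₃₄₅ h₁₂_₃₄₅ h₁_₂₃₄₅) (𝟙 _) (𝟙 _)
      (assocCell (D.φ h₃₄ h₄₅ h₃₄_₅ h₃_₄₅) (𝟙 _) (𝟙 _) (𝟙 _)))).symm
    (hθ.gradedRel h₁₂ h₂_₃₄ h₃₄_₅ h₁₂_₃₄ h₁_₂₃₄ h₂_₃₄₅ h₂₃₄_₅ h₁₂₃₄_₅ h₁₂_₃₄₅ h₁_₂₃₄₅
      (𝟙 _) (𝟙 _) ((𝟙 (s.obj z) ⊠₁ 𝟙 (s.obj t)) ≫ (D.c h₃₄).hom) (𝟙 _))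
    (GradedRel.rightMul (D.c h₁₂₃₄_₅).hom τ
      (hθ.gradedRel h₁₂ h₂₃ h₃₄ h₁₂_₃ h₁_₂₃ h₂_₃₄ h₂₃_₄ h₁₂₃_₄ h₁₂_₃₄ h₁_₂₃₄
        (𝟙 _) (𝟙 _) (𝟙 _) (𝟙 _)) (𝟙 (s.obj w)))
  -- The faces are, in order: the pentagon of `X, Y, Z, TW`, the naturality of `a` in its first
  -- variable, the pentagon of `X, YZ, T, W`, the pentagon of `Y, Z, T, W` multiplied by `X`, and
  -- the naturality of `a` in its second variable.
  have even := GradedRel.even_chain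
    (hθ.gradedRel h₁₂ h₂₃ h₃_₄₅ h₁₂_₃ h₁_₂₃ h₂_₃₄₅ h₂₃_₄₅ h₁₂₃_₄₅ h₁₂_₃₄₅ h₁_₂₃₄₅
      (𝟙 _) (𝟙 _) (𝟙 _) ((𝟙 (s.obj t) ⊠₁ 𝟙 (s.obj w)) ≫ (D.c h₄₅).hom))
    (GradedRel.of_etaNat (assocCell_as₁ τ (isEquiv_hom (D.c h₄₅))
      (D.φ h₁₂₃_₄ h₄₅ h₁₂₃₄_₅ h₁₂₃_₄₅)
      (assocCell (D.φ h₁₂ h₂₃ h₁₂_₃ h₁_₂₃) (𝟙 _) (𝟙 _) (𝟙 _)) (𝟙 _) (𝟙 _)))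
    (hθ.gradedRel h₁_₂₃ h₂₃_₄ h₄₅ h₁₂₃_₄ h₁_₂₃₄ h₂₃_₄₅ h₂₃₄_₅ h₁₂₃₄_₅ h₁₂₃_₄₅ h₁_₂₃₄₅
      (𝟙 _) ((𝟙 (s.obj y) ⊠₁ 𝟙 (s.obj z)) ≫ (D.c h₂₃).hom) (𝟙 _) (𝟙 _))
    (GradedRel.leftMul (D.c h₁_₂₃₄₅).hom
      (hθ.gradedRel h₂₃ h₃₄ h₄₅ h₂₃_₄ h₂_₃₄ h₃_₄₅ h₃₄_₅ h₂₃₄_₅ h₂₃_₄₅ h₂_₃₄₅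
        (𝟙 _) (𝟙 _) (𝟙 _) (𝟙 _)) (𝟙 (s.obj x)))
    (GradedRel.of_etaNat (assocCell_as₂ τ (D.φ h₁_₂₃₄ h₂₃₄_₅ h₁₂₃₄_₅ h₁_₂₃₄₅) (𝟙 _)
      (assocCell (D.φ h₂₃ h₃₄ h₂₃_₄ h₂_₃₄) (𝟙 _) (𝟙 _) (𝟙 _)) (𝟙 _)))
  -- Both chains join the same graded squares, and the axiom `K₅` is the equality of their path
  -- 2-cells. The open goal is that the source, an iterated product of equivalences, is an
  -- equivalence.
  refine etaIso_injective (s.obj n) (odd.unique ?_ even (congrArg Iso.symm (associahedron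
    (s.obj x) (s.obj y) (s.obj z) (s.obj t) (s.obj w))))
  exact (IsEquiv.tHom ((IsEquiv.tHom ((IsEquiv.tHom ((IsEquiv.tHom (.id _) (.id _)).comp
    (isEquiv_hom _)) (.id _)).comp (isEquiv_hom _)) (.id _)).comp (isEquiv_hom _)) (.id _)).comp
    (isEquiv_hom _)

end AssociativityData

end
-- Comparison with `oddFaces` and `evenFaces`.
section
open MonoidalCategory
variable {C : Type u₁} [Category.{v₁} C] [MonoidalCategory C]

lemma oddGrade_eq {e₁ e₂ e₃ o₁ o₂ o₃ q₁ q₂ l₁ l₂ l₃ l₄ l₅ l₆ : C}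
    (θ₁ : e₁ ⊗ e₂ ⟶ o₁ ⊗ o₂ ⊗ o₃) (θ₂ : o₃ ⊗ e₃ ⟶ q₂ ⊗ l₆) (θ₃ : o₂ ⊗ q₂ ⟶ q₁ ⊗ l₄ ⊗ l₅)
    (θ₄ : o₁ ⊗ q₁ ⟶ l₁ ⊗ l₂ ⊗ l₃) :
    𝟙 (e₁ ⊗ e₂ ⊗ e₃) ⊗≫ θ₁ ▷ e₃ ⊗≫ (o₁ ⊗ o₂) ◁ θ₂ ⊗≫ (o₁ ⊗ o₂) ◁ 𝟙 q₂ ▷ l₆ ⊗≫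
      o₁ ◁ θ₃ ▷ l₆ ⊗≫ θ₄ ▷ (l₄ ⊗ l₅ ⊗ l₆) ⊗≫ 𝟙 (l₁ ⊗ l₂ ⊗ l₃ ⊗ l₄ ⊗ l₅ ⊗ l₆) =
    oddGrade θ₁ θ₂ θ₃ θ₄ := by
  monoidal

lemma evenGrade_eq {e₁ e₂ e₃ m₂ m₃ d k₂ k₃ n₁ l₁ l₂ l₃ l₄ l₅ l₆ : C}
    (θ₁ : e₂ ⊗ e₃ ⟶ l₁ ⊗ m₂ ⊗ m₃) (θ₂ : e₁ ⊗ l₁ ⟶ l₁ ⊗ d) (θ₃ : d ⊗ m₂ ⟶ l₂ ⊗ k₂ ⊗ k₃)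
    (θ₄ : k₃ ⊗ m₃ ⟶ n₁ ⊗ l₅ ⊗ l₆) (θ₅ : k₂ ⊗ n₁ ⟶ l₃ ⊗ l₄) :
    e₁ ◁ θ₁ ⊗≫ θ₂ ▷ (m₂ ⊗ m₃) ⊗≫ l₁ ◁ 𝟙 d ▷ (m₂ ⊗ m₃) ⊗≫ l₁ ◁ θ₃ ▷ m₃ ⊗≫
      (l₁ ⊗ l₂ ⊗ k₂) ◁ θ₄ ⊗≫ (l₁ ⊗ l₂) ◁ θ₅ ▷ (l₅ ⊗ l₆) ⊗≫
      (l₁ ⊗ l₂ ⊗ l₃) ◁ 𝟙 l₄ ▷ (l₅ ⊗ l₆) ⊗≫ 𝟙 (l₁ ⊗ l₂ ⊗ l₃ ⊗ l₄ ⊗ l₅ ⊗ l₆) =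
    evenGrade θ₁ θ₂ θ₃ θ₄ θ₅ := by
  monoidal

end

namespace PseudoCocycle₃
open MonoidalCategory
variable {G : Type u} [Group G] {A : Type u₁} [Category.{v₁} A] [MonoidalCategory A]
  [PicardGroupoid A] (P : PseudoCocycle₃ G A)

/-- The product `ztw` is a free variable so that substituting it turns the transport `eqToHom` into
an identity; `evenGrade_cell` does the same with `xyz` and `yzt`. -/
lemma oddGrade_cell (x y z t w : G) {ztw : G} (h : z * t * w = ztw) :
    oddGrade (P.cell (x := x * y) (y := z) (z := t) (t := w) rfl rfl rfl)
        (β_ (P.f z t w) (P.f x y ztw)).hom (P.cell (x := x) (y := y) rfl rfl h)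
        (P.cell (x := x) (y := y) (z := z) (t := t) rfl rfl rfl) =
      𝟙 (P.f (x * y * z) t w ⊗ P.f (x * y) z (t * w) ⊗ P.f x y ztw) ⊗≫
        P.th (x * y) z t w ▷ P.f x y ztw ⊗≫
        (P.f (x * y) z t ⊗ P.f (x * y) (z * t) w) ◁ (β_ (P.f z t w) (P.f x y ztw)).hom ⊗≫
        (P.f (x * y) z t ⊗ P.f (x * y) (z * t) w) ◁
          eqToHom (congrArg (P.f x y ·) h.symm) ▷ P.f z t w ⊗≫
        P.f (x * y) z t ◁ P.th x y (z * t) w ▷ P.f z t w ⊗≫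
        P.th x y z t ▷ (P.f x (y * (z * t)) w ⊗ P.f y (z * t) w ⊗ P.f z t w) ⊗≫
        𝟙 (P.f x y z ⊗ P.f x (y * z) t ⊗ P.f y z t ⊗ P.f x (y * (z * t)) w ⊗
            P.f y (z * t) w ⊗ P.f z t w) := by
  subst h
  simp only [cell_rfl]
  exact (oddGrade_eq _ _ _ _).symm

lemma evenGrade_cell (x y z t w : G) {xyz yzt : G} (h : x * (y * z) = xyz)
    (h' : y * z * t = yzt) :
    evenGrade (P.cell (x := x) (y := y) (z := z) (t := t * w) rfl rfl rfl)
        (β_ (P.f xyz t w) (P.f x y z)).hom (P.cell h h' rfl)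
        (P.cell (x := y) (y := z) (z := t) (t := w) rfl rfl rfl)
        (β_ (P.f x yzt w) (P.f y z t)).hom =
      P.f xyz t w ◁ P.th x y z (t * w) ⊗≫
        (β_ (P.f xyz t w) (P.f x y z)).hom ▷ (P.f x (y * z) (t * w) ⊗ P.f y z (t * w)) ⊗≫
        P.f x y z ◁ eqToHom (congrArg (P.f · t w) h.symm) ▷
          (P.f x (y * z) (t * w) ⊗ P.f y z (t * w)) ⊗≫
        P.f x y z ◁ P.th x (y * z) t w ▷ P.f y z (t * w) ⊗≫
        (P.f x y z ⊗ P.f x (y * z) t ⊗ P.f x (y * z * t) w) ◁ P.th y z t w ⊗≫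
        (P.f x y z ⊗ P.f x (y * z) t) ◁ (β_ (P.f x (y * z * t) w) (P.f y z t)).hom ▷
          (P.f y (z * t) w ⊗ P.f z t w) ⊗≫
        (P.f x y z ⊗ P.f x (y * z) t ⊗ P.f y z t) ◁
          eqToHom (congrArg (P.f x · w) h') ▷ (P.f y (z * t) w ⊗ P.f z t w) ⊗≫
        𝟙 (P.f x y z ⊗ P.f x (y * z) t ⊗ P.f y z t ⊗ P.f x yzt w ⊗
            P.f y (z * t) w ⊗ P.f z t w) := by
  subst h h'
  simp only [cell_rfl]
  exact (evenGrade_eq _ _ _ _ _).symm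

end PseudoCocycle₃

section
open Bicategory
variable {E : Type u} [Bicategory.{w, v} E] [MonoidalBicategory E]
open MonoidalBicategory

namespace AssociativityData
variable {s : PiZeroSection E} {D : AssociativityData s} {τ : TrivialAction E} [IsGroupLike E]

lemma IsPentagon.isCocycle {θ : D.PentagonCells} (hθ : D.IsPentagon τ θ) :
    @PseudoCocycle₃.IsCocycle _ _ _ _ _ (picardGroupoid τ) (PseudoCocycle₃.mk D.f θ) := by
  intro x y z t w
  have e := hθ.oddGrade_eq_evenGrade (x := x) (y := y) (z := z) (t := t) (w := w) rfl rfl rfl rfl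
    rfl (mul_assoc x y z).symm (mul_assoc y z t) rfl (mul_assoc z t w) rfl rfl
    (mul_assoc (x * y) z t).symm (by simp only [mul_assoc]) (by simp only [mul_assoc])
    (by simp only [mul_assoc]) rfl rfl (by simp only [mul_assoc]) (by simp only [mul_assoc])
    (by simp only [mul_assoc])
  -- The naturality face among the odd faces is traversed backwards; by symmetry its inverse
  -- braiding is the braiding in the other order.
  rw [braid_symm τ] at e
  let _ := picardGroupoid τ
  exact ((PseudoCocycle₃.mk D.f θ).oddGrade_cell x y z t w
    (mul_assoc z t w)).symm.trans (e.trans ((PseudoCocycle₃.mk D.f θ).evenGrade_cell x y z t w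
    (mul_assoc x y z).symm (mul_assoc y z t)))

end AssociativityData

end
-- Existence of the choices; existence and uniqueness of the pentagon cells.
section
open Bicategory

lemma SqRel.exists_ρ {B : Type u₁} [Bicategory.{w₁, v₁} B] {a₀ a₁ b₀ b₁ : B} {f₀ f₀' : a₀ ⟶ b₀}
    {f₁ f₁' : a₁ ⟶ b₁} {p p' : a₀ ⟶ a₁} {q q' : b₀ ⟶ b₁} (hf : IsEquiv f₀') (i : f₀ ≅ f₀')
    (j : f₁ ≅ f₁') (π : p ≅ p') (σ : f₀ ≫ q ≅ p ≫ f₁) (σ' : f₀' ≫ q' ≅ p' ≫ f₁') :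
    ∃ ρ : q ≅ q', SqRel i j π ρ σ σ' := by
  obtain ⟨ρ, h⟩ := SqRel.exists_j hf π i j σ.symm σ'.symm
  exact ⟨ρ, h.transpose⟩

variable {E : Type u} [Bicategory.{w, v} E] [MonoidalBicategory E]
open MonoidalBicategory

namespace AssociativityData
variable {s : PiZeroSection E}

lemma exists_equivalence (s : PiZeroSection E) {x y p : PiZero E} (h : x * y = p) :
    Nonempty (s.obj x ⊠ s.obj y ≌ s.obj p) := by
  refine Quotient.exact (s := equivalenceSetoid E) ?_
  have e : PiZero.mk (s.obj x ⊠ s.obj y) = PiZero.mk (s.obj x) * PiZero.mk (s.obj y) := rfl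
  refine e.trans ?_
  rw [s.mk_obj, s.mk_obj, h]
  exact (s.mk_obj p).symm

variable [IsGroupLike E]

/-- The left-hand equivalence into `N` extends the right-hand one by a self-equivalence of `N`,
which is some `η_N(f)` by `exists_eta`. -/
lemma exists_associator {A B C P Q N : E} {cxy : A ⊠ B ⟶ P} {cpz : P ⊠ C ⟶ N} {cyz : B ⊠ C ⟶ Q}
    {cxq : A ⊠ Q ⟶ N} (hxy : IsEquiv cxy) (hpz : IsEquiv cpz) (hyz : IsEquiv cyz)
    (hxq : IsEquiv cxq) :
    ∃ f : AutI E, Nonempty (cxy ▷ₜ C ≫ cpz ≫ eta N f.hom ≅ a A B C ≫ A ◁ₜ cyz ≫ cxq) := by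
  obtain ⟨h, ⟨σ⟩, hh⟩ := ((hxy.wr C).comp hpz).exists_right_side (q := cxq)
    (a A B C ≫ A ◁ₜ cyz)
  obtain ⟨f, ⟨κ⟩⟩ := exists_eta (hh hxq ((isEquiv_a A B C).comp (hyz.wl A)))
  exact ⟨f, ⟨(α_ _ _ _).symm ≪≫ hc (Iso.refl _) κ ≪≫ σ.symm ≪≫ α_ _ _ _⟩⟩

lemma nonempty (s : PiZeroSection E) : Nonempty (AssociativityData s) := by
  let c {x y p : PiZero E} (h : x * y = p) : s.obj x ⊠ s.obj y ≌ s.obj p :=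
    (exists_equivalence s h).some
  have key (x y z : PiZero E) := exists_associator (isEquiv_hom (c (x := x) (y := y) rfl))
    (isEquiv_hom (c (x := x * y) (y := z) rfl)) (isEquiv_hom (c (x := y) (y := z) rfl))
    (isEquiv_hom (c (mul_assoc x y z).symm))
  choose f hf using key
  -- After substitution of the named products, `hn'` is a proof of associativity and so agrees with
  -- the one used in `key`.
  refine ⟨c, f, fun {x y z p q n} hp hq hn hn' => Nonempty.some ?_⟩
  subst hp hq hn
  exact hf x y z

lemma pentagonCell_injective (N : E) {f₁ f₂ g₁ g₂ g₃ : AutI E}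
    {θ θ' : f₁.hom ≫ f₂.hom ≅ g₁.hom ≫ g₂.hom ≫ g₃.hom}
    (h : pentagonCell N θ = pentagonCell N θ') : θ = θ' := by
  refine etaIso_injective N ?_
  have e := congrArg (fun ψ => etaComp N f₁.hom f₂.hom ≪≫ ψ ≪≫
    (eta N g₁.hom ◁ᵢ etaComp N g₂.hom g₃.hom).symm ≪≫
      (etaComp N g₁.hom (g₂.hom ≫ g₃.hom)).symm) h
  simpa only [pentagonCell, Iso.trans_assoc, Iso.self_symm_id_assoc, Iso.self_symm_id,
    Iso.trans_refl] using e

lemma pentagonCell_surjective (N : E) {f₁ f₂ g₁ g₂ g₃ : AutI E}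
    (ψ : eta N f₁.hom ≫ eta N f₂.hom ≅ eta N g₁.hom ≫ eta N g₂.hom ≫ eta N g₃.hom) :
    ∃ θ : f₁.hom ≫ f₂.hom ≅ g₁.hom ≫ g₂.hom ≫ g₃.hom, pentagonCell N θ = ψ := by
  obtain ⟨θ, h⟩ := etaIso_surjective N (etaComp N f₁.hom f₂.hom ≪≫ ψ ≪≫
    (eta N g₁.hom ◁ᵢ etaComp N g₂.hom g₃.hom).symm ≪≫
      (etaComp N g₁.hom (g₂.hom ≫ g₃.hom)).symm)
  refine ⟨θ, ?_⟩
  rw [pentagonCell, h]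
  simp only [Iso.trans_assoc, Iso.symm_self_id_assoc, Iso.symm_self_id, Iso.trans_refl]

lemma exists_pentagonCell {N X X₁ : E} {f₁ f₂ g₁ g₂ g₃ : AutI E} {u u' : X ⟶ N} {v v' : X₁ ⟶ N}
    {p p' : X ⟶ X₁} (hu : IsEquiv u') (i : u ≅ u') (j : v ≅ v') (π : p ≅ p')
    (σ : u ≫ eta N f₁.hom ≫ eta N f₂.hom ≅ p ≫ v)
    (σ' : u' ≫ eta N g₁.hom ≫ eta N g₂.hom ≫ eta N g₃.hom ≅ p' ≫ v') :
    ∃ θ : f₁.hom ≫ f₂.hom ≅ g₁.hom ≫ g₂.hom ≫ g₃.hom,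
      SqRel i j π (pentagonCell N θ) σ σ' := by
  obtain ⟨ψ, h⟩ := SqRel.exists_ρ hu i j π σ σ'
  obtain ⟨θ, rfl⟩ := pentagonCell_surjective N ψ
  exact ⟨θ, h⟩

/-- In the cube form of the pentagon, only the bigon on the automorphisms of `s(xyzt)` is unknown.
It exists and is unique because the common source is an equivalence, and it lifts uniquely along
`η`. -/
lemma existsUnique_isPentagon (D : AssociativityData s) (τ : TrivialAction E) :
    ∃! θ : D.PentagonCells, D.IsPentagon τ θ := by
  have hc {x y z t p u n : PiZero E} (hp : x * y = p) (hu : p * z = u) (hn : u * t = n) :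
      IsEquiv ((D.c hp).hom ▷ₜ s.obj z ▷ₜ s.obj t ≫ (D.c hu).hom ▷ₜ s.obj t ≫ (D.c hn).hom) :=
    (((isEquiv_hom _).wr _).wr _).comp (((isEquiv_hom _).wr _).comp (isEquiv_hom _))
  have key (x y z t : PiZero E) : ∃ θ : dNeg D.f x y z t ⟶ dPos D.f x y z t,
      D.upperSide (p := x * y) (r' := z * t) (u' := x * y * z) (v' := y * (z * t))
        (n := x * y * z * t) rfl rfl rfl rfl rfl (mul_assoc (x * y) z t).symm
        (by simp only [mul_assoc]) =
      Iso.refl _ ≪⊗≫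
        ((D.c (p := x * y) rfl).hom ▷ₜ s.obj z ▷ₜ s.obj t ≫
          (D.c (p := x * y * z) rfl).hom ▷ₜ s.obj t ≫ (D.c (p := x * y * z * t) rfl).hom) ◁ᵢ
          pentagonCell (s.obj (x * y * z * t)) θ ≪⊗≫
        D.lowerSide τ (p := x * y) (q := y * z) (r' := z * t) (u' := x * y * z)
          (v' := y * (z * t)) (n := x * y * z * t) rfl rfl rfl rfl (mul_assoc x y z).symm rfl
          (mul_assoc y z t) rfl (by simp only [mul_assoc]) := by
    simp only [upperSide_eq_iff]
    exact exists_pentagonCell (hc rfl rfl rfl) _ _ _ _ _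
  choose θ hθ using key
  refine ⟨θ, hθ, fun θ' hθ' => ?_⟩
  funext x y z t
  have h := hθ x y z t
  have h' := hθ' x y z t
  rw [upperSide_eq_iff] at h h'
  exact pentagonCell_injective _ (h'.ρ_unique h (hc rfl rfl rfl))

end AssociativityData

end
end MonBicat

theorem theorem3p1 {E : Type u} [Bicategory.{w, v} E]
    [MonBicat.MonoidalBicategory E] [MonBicat.IsGroupLike E] (τ : MonBicat.TrivialAction E) :
    ∃ P : MonBicat.PicardGroupoid (MonBicat.AutI E),
      MonBicat.IsCanonicalSymmetry P ∧
      ∀ s : MonBicat.PiZeroSection E,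
        Nonempty (MonBicat.AssociativityData s) ∧
        ∀ D : MonBicat.AssociativityData s,
          (∃! θ : D.PentagonCells, D.IsPentagon τ θ) ∧
          ∀ θ : D.PentagonCells, D.IsPentagon τ θ →
            (MonBicat.PseudoCocycle₃.mk D.f θ).IsCocycle ∧
            ∃! k : MonBicat.H3 (MonBicat.PiZero E) (MonBicat.AutI E),
              k.IsClassOf (MonBicat.PseudoCocycle₃.mk D.f θ) := by
  refine ⟨MonBicat.picardGroupoid τ, MonBicat.isCanonicalSymmetry_picardGroupoid τ, fun s =>
    ⟨MonBicat.AssociativityData.nonempty s, fun D => ⟨D.existsUnique_isPentagon τ, fun θ hθ =>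
      ⟨hθ.isCocycle, _, ⟨hθ.isCocycle, rfl⟩, ?_⟩⟩⟩⟩
  -- A class of `(f, θ)` depends on a proof of the cocycle condition only, and two such proofs are
  -- equal.
  rintro k ⟨h, rfl⟩
  rfl
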